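/- **Setting.** Let $\mathscr A$ be a unital $C^*$-algebra, $\alpha$ a point-norm continuous action of $\mathbb R^n$ on $\mathscr A$ by $*$-automorphisms, and $B=(B_{kj})$ a skew-symmetric real $n\times n$ matrix. Let $\mathscr A^\infty$ be the algebra of all $a$ such that $t\mapsto\alpha_t(a)$ is smooth, $\delta^\gamma a=i^{-|\gamma|}\partial_t^\gamma|_{t=0}\alpha_t(a)$, with the Fréchet topology of the seminorms $\|\delta^\gamma a\|$. Let $\Gamma=\{re^{i\theta}:r>0,\ a<\theta<b\}$ with $a<b\le a+2\pi$ be an open sector. *Symbols.* $S^m$ is the space of smooth $f:\mathbb R^n\to\mathscr A^\infty$ with $\|\delta^\beta\partial_\xi^\gamma f(\xi)\|\le C_{\beta\gamma}(1+|\xi|^2)^{(m-|\gamma|)/2}$ for all $\beta,\gamma$. A polyhomogeneous $f\in S^m$, $f\sim\sum_{j\ge0}f_{m-j}$, is one with $f-\sum_{j<N}f_{m-j}\in S^{m-N}$ for all $N$, where $f_{m-j}:\mathbb R^n\to\mathscr A^\infty$ is smooth and $f_{m-j}(t\xi)=t^{m-j}f_{m-j}(\xi)$ for $t\ge1$, $|\xi|\ge1$.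 It is elliptic with parameter if, for $|\xi|=1$, $f_m(\xi)$ and all $f_m(\xi)-\mu^m$, $\mu\in\Gamma$, are invertible in $\mathscr A^\infty$. *Weakly parametric symbols.* For $m\in\mathbb R$, $d\in\mathbb Z$, $S^{m,d}$ is the space of smooth $g:\mathbb R^n\times\Gamma\to\mathscr A^\infty$, holomorphic in $\mu\in\Gamma$, such that for all $j\ge0$ one has $\partial_z^j\big(z^dg(\cdot,1/z)\big)\in S^{m+j}$ for $1/z\in\Gamma$, with uniform estimates for $|z|\le1$ and $1/z$ in closed subsectors of $\Gamma$; $S^{-\infty,d}=\bigcap_mS^{m,d}$. For $g\in S^{m,d}$ and $g_j\in S^{m-j,d}$ we say that $g\sim\sum_{j\ge 0} g_j$ in $S^{m,d}$ if $g-\sum_{j<N}g_j\in S^{m-N,d}$ for all $N$. It is a weakly polyhomogeneous expansion if $g_j(t\xi,t\mu)=t^{m+d-j}g_j(\xi,\mu)$ for $t\ge1$, $|\xi|\ge1$, $\mu\in\Gamma$. *Composition and twisted derivatives.* $f\sharp g(\xi)=(2\pi)^{-n}\iint e^{-i\langle y,\eta\rangle}f(\eta+\xi)\,\alpha_{-y}(g(\xi+By))\,dy\,d\eta$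 as an oscillatory integral, i.e. the limit as $\varepsilon\to0^+$ of the integrals with an extra factor $\chi(\varepsilon y,\varepsilon\eta)$, for every Schwartz function $\chi$ with $\chi(0)=1$. With $\partial_{B,\xi_j}=\sum_kB_{kj}\partial_{\xi_k}$, the homogeneous parts of $g^{B,\sigma}(\xi,\mu)=\partial_x^\sigma|_{x=0}\,\alpha_{-x}(g(\xi+Bx,\mu))$ for $g\sim\sum_jg_{-m-j}$ are $$g_{-m-l}^{B,\sigma}=\sum_{\gamma\le\sigma,\ |\gamma|\le l}\binom\sigma\gamma(-i)^{|\sigma-\gamma|}\,\delta^{\sigma-\gamma}\,\partial_{B,\xi}^\gamma\, g_{-m-l+|\gamma|}.$$ **Theorem.** Let $m$ be a positive integer and let $f\in S^m$, $f\sim\sum_{j\ge0}f_{m-j}$, be a polyhomogeneous symbol that is elliptic with parameter. Then there are a symbol $g\in S^{-m,0}\cap S^{0,-m}$ and symbols $g_{-m-j}$, $j\ge0$, such that: 1. $g$ is weakly polyhomogeneous with $g\sim\sum_{j\ge0}g_{-m-j}$ both in $S^{-m,0}$ and in $S^{0,-m}$, where $g_{-m-j}$ is homogeneous of degree $-m-j$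 in $(\xi,\mu)$ for $|\xi|\ge1$; moreover $g-g_{-m}\sim\sum_{j\ge1}g_{-m-j}$ both in $S^{-m-1,0}$ and in $S^{m-1,-2m}$. In particular $g_{-m}\in S^{-m,0}\cap S^{0,-m}$ and $g_{-m-j}\in S^{-m-j,0}\cap S^{m-j,-2m}$ for $j\ge1$. The parts are given by $$g_{-m}(\xi,\mu)=(f_m(\xi)-\mu^m)^{-1}\qquad(|\xi|\ge1,\ \mu\in\Gamma),$$ $$g_{-m-j}(\xi,\mu)=-\sum_{\substack{k+l+|\sigma|=j\\ l<j}}\frac{(-i)^{|\sigma|}}{\sigma!}\,g_{-m}(\xi,\mu)\,\partial_\xi^\sigma f_{m-k}(\xi)\,g_{-m-l}^{B,\sigma}(\xi,\mu)\qquad(j\ge1,\ \xi\in\mathbb R^n,\ \mu\in\Gamma).$$ 2. For every $\mu\in\Gamma$ the composition product $(f-\mu^m)\sharp g$ exists, and $(f-\mu^m)\sharp g-1\in S^{-\infty,-m}$. -/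

import Mathlib

open scoped ContDiff Topology SchwartzMap

noncomputable section

namespace TwistedCalculus

/-- `ℝⁿ` with its Euclidean structure. -/
abbrev E (n : ℕ) : Type := EuclideanSpace ℝ (Fin n)

/-- A point-norm continuous action of `ℝⁿ` on `A` by `*`-automorphisms. -/
structure CStarAction (n : ℕ) (A : Type*) [CStarAlgebra A] where
  /-- The automorphism `α_t`. -/
  act : E n → (A ≃⋆ₐ[ℂ] A)
  act_zero : ∀ a, act 0 a = a
  act_add : ∀ s t a, act (s + t) a = act s (act t a)
  continuous_act : ∀ a, Continuous fun t => act t a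

/-! ### Multi-indices and partial derivatives -/

/-- The length `|α|` of a multi-index. -/
def len {n : ℕ} (α : Fin n → ℕ) : ℕ := ∑ i, α i

/-- `α! = α₁! ⋯ αₙ!`. -/
def multiFactorial {n : ℕ} (α : Fin n → ℕ) : ℕ := ∏ i, (α i).factorial

/-- The binomial coefficient `∏ᵢ (αᵢ choose βᵢ)`. -/
def multiChoose {n : ℕ} (α β : Fin n → ℕ) : ℕ := ∏ i, (α i).choose (β i)

/-- The vectors `e₁, …, eₙ` of the standard basis of `ℝⁿ`. -/
def stdVec (n : ℕ) (j : Fin n) : E n := EuclideanSpace.single j 1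

/-- The matrix `B` as a map `x ↦ B x` on `ℝⁿ`. -/
def matApply {n : ℕ} (B : Matrix (Fin n) (Fin n) ℝ) (x : E n) : E n :=
  WithLp.toLp 2 (B.mulVec x.ofLp)

section Derivatives

variable {n : ℕ} {A : Type*} [CStarAlgebra A]

/-- The directional derivative `∂_v F`. -/
def dirDeriv (v : E n) (F : E n → A) : E n → A := fun x => fderiv ℝ F x v

/-- `∂_{v₁}^{α₁} ⋯ ∂_{vₙ}^{αₙ} F` for vectors `v₁, …, vₙ`. -/
def multiDeriv (v : Fin n → E n) (α : Fin n → ℕ) (F : E n → A) : E n → A :=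
  (List.finRange n).foldr (fun j G => (dirDeriv (v j))^[α j] G) F

/-- The partial derivative `∂_ξ^α F`. -/
def pderiv (α : Fin n → ℕ) (F : E n → A) : E n → A := multiDeriv (stdVec n) α F

/-- The partial derivative `∂_{B,ξ}^α F`, where
`∂_{B,ξ_j} F (ξ) = ∂_{x_j}|_{x=0} F (ξ + B x) = ∑ₖ B_{kj} ∂_{ξ_k} F (ξ)`
is the derivative in the direction of `B e_j`. -/
def pderivB (B : Matrix (Fin n) (Fin n) ℝ) (α : Fin n → ℕ) (F : E n → A) : E n → A :=
  multiDeriv (fun j => matApply B (stdVec n j)) α F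

end Derivatives

/-! ### The smooth subalgebra and smooth maps into it -/

section Smooth

variable {n : ℕ} {A : Type*} [CStarAlgebra A] (α : CStarAction n A)

/-- The set `A^∞` of the `a` for which `t ↦ α_t(a)` is smooth. -/
def smoothElements : Set A := {a | ContDiff ℝ ∞ fun t => α.act t a}

/-- `δ^γ a = i^{-|γ|} ∂_t^γ|_{t=0} α_t(a)`, meaningful for `a ∈ A^∞`. -/
def delta (γ : Fin n → ℕ) (a : A) : A :=
  (Complex.I ^ len γ)⁻¹ • pderiv γ (fun t => α.act t a) 0

/-- `a` is invertible in `A^∞`. -/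
def InvertibleInSmooth (a : A) : Prop :=
  ∃ b ∈ smoothElements α, a * b = 1 ∧ b * a = 1

/-- Smooth maps `ℝⁿ → A^∞`. The Fréchet topology of `A^∞` is given by the seminorms `‖δ^γ a‖`; it
is the topology induced by the family of maps `δ^γ : A^∞ → A`, which embeds `A^∞` as a closed
subspace in a product of copies of `A`. So a map into `A^∞` is smooth if and only if its composition
with each `δ^γ` is smooth as a map into `A`. -/
def SmoothMap (F : E n → A) : Prop :=
  (∀ ξ, F ξ ∈ smoothElements α) ∧ ∀ γ, ContDiff ℝ ∞ fun ξ => delta α γ (F ξ)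

/-- Smooth maps `ℝⁿ × Γ → A^∞` that are holomorphic in the second variable, `Γ ⊆ ℂ` open. -/
def SmoothHolomorphic (Γ : Set ℂ) (F : E n → ℂ → A) : Prop :=
  (∀ ξ, ∀ μ ∈ Γ, F ξ μ ∈ smoothElements α) ∧
  ∀ γ, ContDiffOn ℝ ∞ (fun p : E n × ℂ => delta α γ (F p.1 p.2)) (Set.univ ×ˢ Γ) ∧
    ∀ ξ, DifferentiableOn ℂ (fun μ => delta α γ (F ξ μ)) Γ

end Smooth

/-! ### Symbols -/

/-- `⟨ξ⟩ = (1 + |ξ|²)^{1/2}`. -/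
def bracket {n : ℕ} (ξ : E n) : ℝ := Real.sqrt (1 + ‖ξ‖ ^ 2)

section Symbols

variable {n : ℕ} {A : Type*} [CStarAlgebra A] (α : CStarAction n A)

/-- The symbol space `S^m(ℝⁿ, A^∞)`. -/
def IsSymbol (m : ℝ) (F : E n → A) : Prop :=
  SmoothMap α F ∧
  ∀ β γ : Fin n → ℕ, ∃ C : ℝ, ∀ ξ,
    ‖delta α β (pderiv γ F ξ)‖ ≤ C * bracket ξ ^ (m - len γ)

/-- `F` is homogeneous of degree `d` for `|ξ| ≥ 1`. -/
def IsHomogeneous (d : ℝ) (F : E n → A) : Prop :=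
  ∀ t : ℝ, 1 ≤ t → ∀ ξ : E n, 1 ≤ ‖ξ‖ → F (t • ξ) = (t ^ d) • F ξ

/-- `F` is a (1-step) polyhomogeneous symbol of order `m` with expansion
`F ∼ ∑_{j ≥ 0} F_{m-j}`; here `P j` stands for the homogeneous part `F_{m-j}`. -/
def IsPolyhomogeneous (m : ℝ) (F : E n → A) (P : ℕ → E n → A) : Prop :=
  IsSymbol α m F ∧
  (∀ j, SmoothMap α (P j) ∧ IsHomogeneous (m - j) (P j)) ∧
  ∀ N : ℕ, IsSymbol α (m - N) fun ξ => F ξ - ∑ j ∈ Finset.range N, P j ξ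

/-- The open sector of the `r e^{iθ}` with `r > 0` and `a < θ < b`. -/
def openSector (a b : ℝ) : Set ℂ :=
  {μ | ∃ r θ : ℝ, 0 < r ∧ θ ∈ Set.Ioo a b ∧ μ = r * Complex.exp (θ * Complex.I)}

/-- The closed sector (in `ℂ \ {0}`) of the `r e^{iθ}` with `r > 0` and `a ≤ θ ≤ b`. -/
def closedSector (a b : ℝ) : Set ℂ :=
  {μ | ∃ r θ : ℝ, 0 < r ∧ θ ∈ Set.Icc a b ∧ μ = r * Complex.exp (θ * Complex.I)}

/-- `∂_z^j (z^d F(ξ, 1/z))`. -/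
def zDeriv (d : ℤ) (j : ℕ) (F : E n → ℂ → A) (z : ℂ) (ξ : E n) : A :=
  iteratedDeriv j (fun w : ℂ => w ^ d • F ξ w⁻¹) z

/-- The space `S^{m,d}(ℝⁿ × Γ, A^∞)` of weakly parametric symbols, for an integer `d`. -/
def IsWeakSymbol (Γ : Set ℂ) (m : ℝ) (d : ℤ) (F : E n → ℂ → A) : Prop :=
  SmoothHolomorphic α Γ F ∧
  (∀ j : ℕ, ∀ z : ℂ, z⁻¹ ∈ Γ → IsSymbol α (m + j) (zDeriv d j F z)) ∧
  ∀ (j : ℕ) (β γ : Fin n → ℕ) (a b : ℝ), closedSector a b ⊆ Γ →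
    ∃ C : ℝ, ∀ z : ℂ, z⁻¹ ∈ closedSector a b → ‖z‖ ≤ 1 → ∀ ξ,
      ‖delta α β (pderiv γ (zDeriv d j F z) ξ)‖ ≤ C * bracket ξ ^ (m + j - len γ)

/-- `F ∼ ∑_{j ≥ 0} P j` with `F ∈ S^{m,d}`, `P j ∈ S^{m-j,d}` and remainders
`F - ∑_{j < N} P j ∈ S^{m-N,d}`. -/
def HasWeakExpansion (Γ : Set ℂ) (m : ℝ) (d : ℤ) (F : E n → ℂ → A)
    (P : ℕ → E n → ℂ → A) : Prop :=
  IsWeakSymbol α Γ m d F ∧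
  (∀ j : ℕ, IsWeakSymbol α Γ (m - j) d (P j)) ∧
  ∀ N : ℕ, IsWeakSymbol α Γ (m - N) d fun ξ μ => F ξ μ - ∑ j ∈ Finset.range N, P j ξ μ

/-- `F` is homogeneous of degree `k` in `(ξ, μ)` for `|ξ| ≥ 1`. -/
def IsWeakHomogeneous (Γ : Set ℂ) (k : ℝ) (F : E n → ℂ → A) : Prop :=
  ∀ t : ℝ, 1 ≤ t → ∀ ξ : E n, 1 ≤ ‖ξ‖ → ∀ μ ∈ Γ, F (t • ξ) (t * μ) = (t ^ k) • F ξ μ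

/-- `F ∈ S^{∞,d}` is weakly polyhomogeneous with homogeneous parts `P j` of degree `k - j`,
which lie in `S^{k-j-d,d}`. -/
def IsWeaklyPolyhomogeneous (Γ : Set ℂ) (k : ℝ) (d : ℤ) (F : E n → ℂ → A)
    (P : ℕ → E n → ℂ → A) : Prop :=
  HasWeakExpansion α Γ (k - d) d F P ∧ ∀ j : ℕ, IsWeakHomogeneous Γ (k - j) (P j)

/-- The symbol with principal part `F` of order `m` is elliptic with parameter `μ ∈ Γ`: it is
elliptic, and `F ξ - μ^m` is invertible in `A^∞` for `μ ∈ Γ`, `|ξ| = 1`. -/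
def IsEllipticWithParameter (Γ : Set ℂ) (m : ℕ) (F : E n → A) : Prop :=
  (∀ ξ : E n, ‖ξ‖ = 1 → InvertibleInSmooth α (F ξ)) ∧
  ∀ ξ : E n, ‖ξ‖ = 1 → ∀ μ ∈ Γ, InvertibleInSmooth α (F ξ - algebraMap ℂ A (μ ^ m))

/-- The homogeneous part `F_{m-l}^{B,σ}` of `F^{B,σ}(ξ) = ∂_x^σ|_{x=0} α_{-x}(F(ξ + B x))`, for
`F ∼ ∑_j F_{m-j}` with `P j = F_{m-j}`. Since `∂_x^β|_{x=0} α_{-x}(a) = (-i)^{|β|} δ^β a`, it is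
`∑ (σ choose γ) (-iδ)^{σ-γ} ∂_{B,ξ}^γ F_{m-l+|γ|}`, the sum over `γ ≤ σ` with `|γ| ≤ l`. -/
def twistedPart (B : Matrix (Fin n) (Fin n) ℝ) (σ : Fin n → ℕ) (P : ℕ → E n → A) (l : ℕ)
    (ξ : E n) : A :=
  ∑ γ ∈ (Finset.Iic σ).filter (fun γ => len γ ≤ l),
    ((multiChoose σ γ : ℂ) * (-Complex.I) ^ len (σ - γ)) •
      delta α (σ - γ) (pderivB B γ (P (l - len γ)) ξ)

/-! ### Oscillatory integrals and the composition product -/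

/-- The oscillatory integral `∫∫ e^{-i⟨y,η⟩} a(y,η) dy (2π)^{-n} dη` exists and equals `v`: for every
Schwartz function `χ` with `χ(0) = 1`, the regularized integrals converge absolutely and tend to `v`
as the regularization is removed. -/
def HasOscIntegral (a : E n → E n → A) (v : A) : Prop :=
  ∀ χ : 𝓢(E n × E n, ℂ), χ 0 = 1 →
    (∀ ε : ℝ, 0 < ε → MeasureTheory.Integrable fun p : E n × E n =>
      (χ (ε • p) * Complex.exp (-(Complex.I * (inner ℝ p.1 p.2 : ℝ)))) • a p.1 p.2) ∧
    Filter.Tendsto (fun ε : ℝ => (((2 * Real.pi) ^ n)⁻¹ : ℝ) • ∫ p : E n × E n,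
      (χ (ε • p) * Complex.exp (-(Complex.I * (inner ℝ p.1 p.2 : ℝ)))) • a p.1 p.2)
      (𝓝[>] 0) (𝓝 v)

/-- `H = F ♯ G`, i.e. `H(ξ) = ∫∫ e^{-i⟨y,η⟩} F(η + ξ) α_{-y}(G(ξ + B y)) dy (2π)^{-n} dη` for all
`ξ`, as an oscillatory integral. -/
def IsComposition (B : Matrix (Fin n) (Fin n) ℝ) (F G H : E n → A) : Prop :=
  ∀ ξ, HasOscIntegral (fun y η => F (η + ξ) * α.act (-y) (G (ξ + matApply B y))) (H ξ)

end Symbols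

end TwistedCalculus

end

open TwistedCalculus

/-! Put z = 1/μ and attach to a symbol F the function u(t,ξ,z) = α_t(F(ξ,1/z)). Then δ^γ becomes a
t-derivative at t = 0 up to a power of i, holomorphy in μ becomes the Cauchy–Riemann equation in z,
and the twisted translate α_{-y}(F(ξ+By)) becomes u(-y, ξ+By, z). Membership of F in S^{M,d} follows
once z^d u lies in the class `Good` of order M: equivariant holomorphic functions with symbol
estimates in which a t-derivative is neutral, a ξ-derivative lowers the order by one and a
z-derivative raises it by one, uniformly for bounded z in closed subcones. `IsSymbol.good` and
`Good.isWeakSymbol` translate in the two directions.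

Composition. Let `comp` at the parameter s be the oscillatory integral of f(t, ξ+sη, z) G(t-y, ξ+By,
z). For s = 1 it is the composition product; for s = 0 Fourier inversion reduces it to the pointwise
product (`comp_zero`). Differentiation in s produces η_j ∂_{ξ_j} f, and integration by parts in y
turns η_j into -i∂_{y_j} acting on G (`dd_sdir_comp`). Each s-derivative therefore lowers the order
by one, and Taylor's formula on [0,1] is the asymptotic expansion (`s0_comp_sub_compTerm`). The
analytic input is that an oscillatory integral inherits the symbol estimates of its amplitude in the
parameters (`PAmp.sym_osc`): integration by parts lowers the growth in (y,η) until the integral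
converges absolutely, without touching the parameter weight. Expanding ∂_y^σ = (-∂_t + ∂_B)^σ
binomially and sorting by total order gives `s0_comp_sub_lowerTerm`.

Principal part. By homogeneity f_m(ξ) - μ^m is invertible for |ξ| ≥ 1. Near the origin f_m is
replaced by `principal`, which is zero or of the form s^m f_m(θ) with |θ| = 1, so that invertibility
persists for every ξ because Γ is a cone. With R = (z^m p - 1)⁻¹ the functions z^k R, 0 ≤ k ≤ m,
have order -k: they are bounded accordingly by compactness (`exists_bound_resolvent`), and they are
closed under differentiation up to products with p and its derivatives (`dd_res`, `cls_res`). For k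
= m this is g_{-m} in S^{-m,0}, for k = 0 it is z^{-m}g_{-m}, that is, g_{-m} in S^{0,-m}.

Recursion and summation. The terms of order j in the expansion of (f - μ^m)♯g cancel if g_{-m-j} is
-g_{-m} times an expression in the earlier parts (`parts`). That expression is linear in the earlier
parts and involves no z-derivative, so powers of z pass through it (`lowerTerm_smul`). Hence
z^{-m}g_{-m-j} and, for j ≥ 1, z^{-2m}g_{-m-j} arise by replacing one or two factors z^m R by R,
which gives the orders -j and m-j. The three sequences are summed with the same excision functions
(`exists_borelSum`), so that a single g has all the required expansions.

Remainder. In the expansion of f♯(z^{-m}g) the recursion leaves z^{-2m} times the partial sums of g,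
plus z^{-m}. Since z^{-2m}(g - g_{-m} - ∑) has arbitrarily low order, z^{-m}((f - μ^m)♯g - 1) is of
order -∞ (`IsParametrix.good_comp`). This is where the expansion in S^{m-1,-2m} is used. -/

open scoped ContDiff Topology SchwartzMap

noncomputable section

namespace TwistedCalculus

/-! ### Directional derivatives -/

section DirectionalDerivative

variable {V F : Type*} [NormedAddCommGroup V] [NormedSpace ℝ V]
  [NormedAddCommGroup F] [NormedSpace ℝ F]

/-- The directional derivative of `u` in the direction `v`. -/
def dd (v : V) (u : V → F) : V → F := fun x => fderiv ℝ u x v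

theorem dd_eqOn {Ω : Set V} (hΩ : IsOpen Ω) {u w : V → F} (h : Set.EqOn u w Ω) (v : V) :
    Set.EqOn (dd v u) (dd v w) Ω := fun x hx => by
  have : u =ᶠ[𝓝 x] w := Filter.eventuallyEq_of_mem (hΩ.mem_nhds hx) h
  simp only [dd, this.fderiv_eq]

theorem contDiffOn_dd {Ω : Set V} (hΩ : IsOpen Ω) {u : V → F} (hu : ContDiffOn ℝ ∞ u Ω) (v : V) :
    ContDiffOn ℝ ∞ (dd v u) Ω :=
  (hu.fderiv_of_isOpen hΩ (m := ∞) (by simp)).clm_apply contDiffOn_const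

theorem differentiableAt_of_contDiffOn {Ω : Set V} (hΩ : IsOpen Ω) {u : V → F}
    (hu : ContDiffOn ℝ ∞ u Ω) {x : V} (hx : x ∈ Ω) : DifferentiableAt ℝ u x :=
  (hu.contDiffAt (hΩ.mem_nhds hx)).differentiableAt (by simp)

theorem dd_comm {Ω : Set V} (hΩ : IsOpen Ω) {u : V → F} (hu : ContDiffOn ℝ ∞ u Ω) (v w : V) :
    Set.EqOn (dd v (dd w u)) (dd w (dd v u)) Ω := fun x hx => by
  have hs := ((hu.contDiffAt (hΩ.mem_nhds hx)).isSymmSndFDerivAt (by simp [minSmoothness_of_isRCLikeNormedField]; exact WithTop.coe_le_coe.2 (le_top : (2 : ℕ∞) ≤ ⊤))) v w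
  have hd : DifferentiableAt ℝ (fderiv ℝ u) x :=
    differentiableAt_of_contDiffOn hΩ (hu.fderiv_of_isOpen hΩ (m := ∞) (by simp)) hx
  have key : ∀ a b : V, dd a (dd b u) x = fderiv ℝ (fderiv ℝ u) x a b := fun a b => by
    have : HasFDerivAt (dd b u) _ x := hd.hasFDerivAt.clm_apply (hasFDerivAt_const b x)
    simp [dd, this.fderiv]
  rw [key, key, hs]

theorem dd_add {Ω : Set V} (hΩ : IsOpen Ω) {u w : V → F} (hu : ContDiffOn ℝ ∞ u Ω)
    (hw : ContDiffOn ℝ ∞ w Ω) (v : V) :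
    Set.EqOn (dd v fun x => u x + w x) (fun x => dd v u x + dd v w x) Ω := fun x hx => by
  simp [dd, fderiv_fun_add (differentiableAt_of_contDiffOn hΩ hu hx)
    (differentiableAt_of_contDiffOn hΩ hw hx)]

theorem dd_sum {κ : Type*} {Ω : Set V} (hΩ : IsOpen Ω) (s : Finset κ) {u : κ → V → F}
    (hu : ∀ j ∈ s, ContDiffOn ℝ ∞ (u j) Ω) (v : V) :
    Set.EqOn (dd v fun x => ∑ j ∈ s, u j x) (fun x => ∑ j ∈ s, dd v (u j) x) Ω := fun x hx => by
  simp only [dd]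
  rw [fderiv_fun_sum fun j hj => differentiableAt_of_contDiffOn hΩ (hu j hj) hx]
  simp

theorem dd_clm {F' : Type*} [NormedAddCommGroup F'] [NormedSpace ℝ F'] (L : F →L[ℝ] F')
    {Ω : Set V} (hΩ : IsOpen Ω) {u : V → F} (hu : ContDiffOn ℝ ∞ u Ω) (v : V) :
    Set.EqOn (dd v fun x => L (u x)) (fun x => L (dd v u x)) Ω := fun x hx => by
  have := (L.hasFDerivAt (x := u x)).comp x
    (differentiableAt_of_contDiffOn hΩ hu hx).hasFDerivAt
  have h2 : HasFDerivAt (fun x => L (u x)) _ x := this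
  simp [dd, h2.fderiv]

theorem dd_bilin {F₁ F₂ F₃ : Type*} [NormedAddCommGroup F₁] [NormedSpace ℝ F₁]
    [NormedAddCommGroup F₂] [NormedSpace ℝ F₂] [NormedAddCommGroup F₃] [NormedSpace ℝ F₃]
    (L : F₁ →L[ℝ] F₂ →L[ℝ] F₃) {Ω : Set V} (hΩ : IsOpen Ω) {u : V → F₁} {w : V → F₂}
    (hu : ContDiffOn ℝ ∞ u Ω) (hw : ContDiffOn ℝ ∞ w Ω) (v : V) :
    Set.EqOn (dd v fun x => L (u x) (w x)) (fun x => L (dd v u x) (w x) + L (u x) (dd v w x)) Ω :=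
  fun x hx => by
  have := L.hasFDerivAt_of_bilinear (differentiableAt_of_contDiffOn hΩ hu hx).hasFDerivAt
    (differentiableAt_of_contDiffOn hΩ hw hx).hasFDerivAt
  simp [dd, this.fderiv, add_comm]

theorem dd_comp {V' : Type*} [NormedAddCommGroup V'] [NormedSpace ℝ V'] {Ω : Set V} {Ω' : Set V'}
    (hΩ : IsOpen Ω) (hΩ' : IsOpen Ω') {u : V → F} (hu : ContDiffOn ℝ ∞ u Ω) {T : V' → V}
    (hT : ContDiffOn ℝ ∞ T Ω') (hm : Set.MapsTo T Ω' Ω) (v : V') {x : V'} (hx : x ∈ Ω') :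
    dd v (fun y => u (T y)) x = dd (dd v T x) u (T x) := by
  have h := (differentiableAt_of_contDiffOn hΩ hu (hm hx)).hasFDerivAt.comp x
    (differentiableAt_of_contDiffOn hΩ' hT hx).hasFDerivAt
  have h2 : HasFDerivAt (fun y => u (T y)) _ x := h
  simp [dd, h2.fderiv]

theorem dd_dir_sum {κ : Type*} (s : Finset κ) (c : κ → ℝ) (v : κ → V) (u : V → F) (x : V) :
    dd (∑ j ∈ s, c j • v j) u x = ∑ j ∈ s, c j • dd (v j) u x := by
  simp [dd]

theorem dd_const (v : V) (a : F) : dd v (fun _ : V => a) = fun _ => 0 := by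
  ext x; simp [dd]

theorem hasDerivAt_line {Ω : Set V} (hΩ : IsOpen Ω) {u : V → F} (hu : ContDiffOn ℝ ∞ u Ω) (v : V)
    (x : V) (τ : ℝ) (hx : x + τ • v ∈ Ω) :
    HasDerivAt (fun τ : ℝ => u (x + τ • v)) (dd v u (x + τ • v)) τ := by
  have h1 : HasDerivAt (fun τ : ℝ => x + τ • v) v τ := by
    simpa using ((hasDerivAt_id τ).smul_const v).const_add x
  exact (differentiableAt_of_contDiffOn hΩ hu hx).hasFDerivAt.comp_hasDerivAt τ h1

/-- A family of continuous functions that is closed under directional derivatives along a basis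
consists of smooth functions. -/
theorem hasFDerivAt_of_continuous_lineDeriv {ι : Type*} [Fintype ι]
    (b : Module.Basis ι ℝ V) {Ω : Set V} (hΩ : IsOpen Ω) {u : V → F} {u' : ι → V → F}
    (hc : ∀ i, ContinuousOn (u' i) Ω)
    (hd : ∀ i, ∀ x ∈ Ω, HasLineDerivAt ℝ u (u' i x) x (b i)) [FiniteDimensional ℝ V]
    {x₀ : V} (hx₀ : x₀ ∈ Ω) :
    HasFDerivAt u (∑ i, ((b.coord i).toContinuousLinearMap).smulRight (u' i x₀)) x₀ := by
  classical
  obtain ⟨K, hK⟩ : ∃ K : ℝ, 0 < K ∧ ∀ h : V, ∑ i, |b.repr h i| ≤ K * ‖h‖ := by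
    refine ⟨∑ i, ‖(b.coord i).toContinuousLinearMap‖ + 1, by positivity, fun h => ?_⟩
    have : ∑ i, |b.repr h i| ≤ ∑ i, ‖(b.coord i).toContinuousLinearMap‖ * ‖h‖ :=
      Finset.sum_le_sum fun i _ => ((b.coord i).toContinuousLinearMap).le_opNorm h
    rw [← Finset.sum_mul] at this
    nlinarith [norm_nonneg h]
  obtain ⟨M, hM0, hM⟩ : ∃ M : ℝ, 0 < M ∧ ∀ i, ‖b i‖ ≤ M :=
    ⟨∑ i, ‖b i‖ + 1, by positivity, fun i =>
      (Finset.single_le_sum (f := fun i => ‖b i‖) (fun i _ => norm_nonneg _)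
        (Finset.mem_univ i)).trans (by linarith)⟩
  rw [hasFDerivAt_iff_isLittleO_nhds_zero, Asymptotics.isLittleO_iff]
  intro ε hε
  have hev : ∀ᶠ x in 𝓝 x₀, x ∈ Ω ∧ ∀ i, ‖u' i x - u' i x₀‖ ≤ ε / K := by
    refine Filter.Eventually.and (hΩ.mem_nhds hx₀) (Filter.eventually_all.2 fun i => ?_)
    have := ((hc i).continuousAt (hΩ.mem_nhds hx₀))
    have := Metric.tendsto_nhds.1 this (ε / K) (by have := hK.1; positivity)
    filter_upwards [this] with x hx
    rw [← dist_eq_norm]; exact hx.le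
  obtain ⟨R, hR, hball⟩ := Metric.eventually_nhds_iff.1 hev
  -- Move away from x₀ along one coordinate at a time. On each leg the mean value inequality
  -- compares u with its linearization at x₀, at the cost of ε/K times the coordinate increment.
  have main : ∀ (c : ι → ℝ), (∑ i, |c i|) * M < R → ∀ s : Finset ι,
      ‖u (x₀ + ∑ i ∈ s, c i • b i) - u x₀ - ∑ i ∈ s, c i • u' i x₀‖ ≤ (ε / K) * ∑ i ∈ s, |c i| := by
    intro c hcR s
    induction s using Finset.induction_on with
    | empty => simp
    | insert i s his ih =>
      have hle : ∀ τ ∈ Set.Icc (0 : ℝ) 1, dist ((x₀ + ∑ j ∈ s, c j • b j) + τ • (c i • b i)) x₀ < R := by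
        intro τ hτ
        rw [dist_eq_norm, add_assoc, add_sub_cancel_left]
        refine lt_of_le_of_lt ?_ hcR
        calc _ ≤ ‖∑ j ∈ s, c j • b j‖ + ‖τ • (c i • b i)‖ := norm_add_le _ _
          _ ≤ ∑ j ∈ s, |c j| * M + |c i| * M := by
            gcongr
            · refine (norm_sum_le _ _).trans (Finset.sum_le_sum fun j _ => ?_)
              rw [norm_smul, Real.norm_eq_abs]
              exact mul_le_mul_of_nonneg_left (hM j) (abs_nonneg _)
            · rw [norm_smul, norm_smul, Real.norm_eq_abs, Real.norm_eq_abs, abs_of_nonneg hτ.1]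
              have : |c i| * ‖b i‖ ≤ |c i| * M := mul_le_mul_of_nonneg_left (hM i) (abs_nonneg _)
              have h0 : 0 ≤ |c i| * ‖b i‖ := by positivity
              nlinarith [hτ.2]
          _ = (∑ j ∈ insert i s, |c j|) * M := by
            rw [Finset.sum_insert his, ← Finset.sum_mul]; ring
          _ ≤ (∑ j, |c j|) * M := by
            gcongr
            exact Finset.subset_univ _
      have hder : ∀ τ ∈ Set.Icc (0 : ℝ) 1, HasDerivWithinAt
          (fun τ : ℝ => u ((x₀ + ∑ j ∈ s, c j • b j) + τ • (c i • b i)) - τ • (c i • u' i x₀))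
          (c i • u' i ((x₀ + ∑ j ∈ s, c j • b j) + τ • (c i • b i)) - c i • u' i x₀)
          (Set.Icc 0 1) τ := by
        intro τ hτ
        have h1 := (hd i _ (hball (hle τ hτ)).1)
        have h2 : HasLineDerivAt ℝ u (c i • u' i ((x₀ + ∑ j ∈ s, c j • b j) + τ • (c i • b i)))
          ((x₀ + ∑ j ∈ s, c j • b j) + τ • (c i • b i)) (c i • b i) := h1.smul (c i)
        have h3 : HasDerivAt (fun τ : ℝ => u ((x₀ + ∑ j ∈ s, c j • b j) + τ • (c i • b i)))
            (c i • u' i ((x₀ + ∑ j ∈ s, c j • b j) + τ • (c i • b i))) τ := by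
          have h4 : HasDerivAt (fun σ : ℝ => σ - τ) 1 τ := (hasDerivAt_id τ).sub_const τ
          have h5 := HasDerivAt.scomp (g₁ := fun r : ℝ => u (((x₀ + ∑ j ∈ s, c j • b j) + τ • (c i • b i)) + r • (c i • b i)))
            τ (by simpa [HasLineDerivAt] using h2) h4
          simp only [one_smul] at h5
          refine h5.congr_of_eventuallyEq (Filter.Eventually.of_forall fun σ => ?_)
          simp only [Function.comp, sub_smul]
          congr 1
          abel
        have h6 : HasDerivAt (fun τ : ℝ => τ • (c i • u' i x₀)) (c i • u' i x₀) τ := by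
          simpa using (hasDerivAt_id τ).smul_const (c i • u' i x₀)
        exact (h3.sub h6).hasDerivWithinAt
      have hmv := (convex_Icc (0 : ℝ) 1).norm_image_sub_le_of_norm_hasDerivWithin_le
        (C := |c i| * (ε / K)) hder (fun τ hτ => by
          rw [← smul_sub, norm_smul, Real.norm_eq_abs]
          exact mul_le_mul_of_nonneg_left ((hball (hle τ hτ)).2 i) (abs_nonneg _))
        (Set.left_mem_Icc.2 zero_le_one) (Set.right_mem_Icc.2 zero_le_one)
      simp only [one_smul, zero_smul, add_zero, sub_zero, norm_one, mul_one] at hmv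
      rw [Finset.sum_insert his, Finset.sum_insert his, Finset.sum_insert his, mul_add]
      calc _ = ‖(u ((x₀ + ∑ j ∈ s, c j • b j) + c i • b i) - c i • u' i x₀
              - u (x₀ + ∑ j ∈ s, c j • b j)) +
              (u (x₀ + ∑ i ∈ s, c i • b i) - u x₀ - ∑ i ∈ s, c i • u' i x₀)‖ := by
            congr 1
            rw [add_comm (c i • b i), ← add_assoc]
            abel
        _ ≤ _ := (norm_add_le _ _).trans (by linarith)
  have hsmall : ∀ᶠ h : V in 𝓝 0, ‖h‖ < R / (K * M) := by
    have := Metric.ball_mem_nhds (0 : V) (ε := R / (K * M)) (by have := hK.1; positivity)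
    filter_upwards [this] with h hh
    simpa using hh
  filter_upwards [hsmall] with h hh
  have hKh := hK.2 h
  have h1 : (∑ i, |b.repr h i|) * M < R := by
    have : ‖h‖ * (K * M) < R := (lt_div_iff₀ (by have := hK.1; positivity)).1 hh
    nlinarith
  have h2 := main (fun i => b.repr h i) h1 Finset.univ
  rw [b.sum_repr] at h2
  have h3 : (∑ i, ((b.coord i).toContinuousLinearMap).smulRight (u' i x₀)) h
      = ∑ i, b.repr h i • u' i x₀ := by
    simp
  rw [h3]
  refine h2.trans ?_
  calc ε / K * ∑ i, |b.repr h i| ≤ ε / K * (K * ‖h‖) := by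
        have := hK.1; gcongr
    _ = ε * ‖h‖ := by have := hK.1; field_simp

/-- Continuous partial derivatives along a basis give differentiability, and the total derivative is
assembled from members of the family; induction on the order k then applies to those members. This
replaces joint differentiation arguments wherever only one-parameter derivatives are accessible. -/
theorem contDiffOn_of_lineDeriv_family {ι : Type*} [Fintype ι] [FiniteDimensional ℝ V]
    (b : Module.Basis ι ℝ V) {Ω : Set V} (hΩ : IsOpen Ω) (𝓕 : Set (V → F))
    (hc : ∀ u ∈ 𝓕, ContinuousOn u Ω)
    (hd : ∀ u ∈ 𝓕, ∀ i, ∃ u' ∈ 𝓕, ∀ x ∈ Ω, HasLineDerivAt ℝ u (u' x) x (b i)) :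
    ∀ u ∈ 𝓕, ContDiffOn ℝ ∞ u Ω := by
  suffices h : ∀ k : ℕ, ∀ u ∈ 𝓕, ContDiffOn ℝ k u Ω from
    fun u hu => contDiffOn_infty.2 fun k => h k u hu
  intro k
  induction k with
  | zero => intro u hu; simpa using (contDiffOn_zero (𝕜 := ℝ)).2 (hc u hu)
  | succ k ih =>
    intro u hu
    choose u' hu' hd' using hd u hu
    have hfd : ∀ x ∈ Ω, HasFDerivAt u
        (∑ i, ((b.coord i).toContinuousLinearMap).smulRight (u' i x)) x := fun x hx =>
      hasFDerivAt_of_continuous_lineDeriv b hΩ (fun i => hc _ (hu' i)) hd' hx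
    push_cast
    rw [contDiffOn_succ_iff_fderiv_of_isOpen hΩ]
    refine ⟨fun x hx => (hfd x hx).differentiableAt.differentiableWithinAt, by simp, ?_⟩
    refine ContDiffOn.congr (f := fun x =>
      ∑ i, ((b.coord i).toContinuousLinearMap).smulRight (u' i x)) ?_ fun x hx => (hfd x hx).fderiv
    refine ContDiffOn.sum fun i _ => ?_
    exact (ContinuousLinearMap.smulRightL ℝ V F
      ((b.coord i).toContinuousLinearMap)).contDiff.comp_contDiffOn (ih _ (hu' i))

end DirectionalDerivative

/-! ### Weighted symbol classes -/

/-- An open set with finitely many directions, each with a weight, and a family of subsets on which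
estimates are required to be uniform. -/
structure Grading (V : Type*) [NormedAddCommGroup V] [NormedSpace ℝ V] where
  /-- The domain. -/
  dom : Set V
  isOpen_dom : IsOpen dom
  /-- The index set of the directions. -/
  ι : Type
  [fintype_ι : Fintype ι]
  /-- The directions. -/
  dir : ι → V
  /-- The factor that an estimate gains under differentiation. -/
  wt : ι → V → ℝ
  wt_nonneg : ∀ i x, 0 ≤ wt i x
  /-- The sets on which the estimates are uniform. -/
  bdd : ℕ → Set V
  bdd_subset : ∀ r, bdd r ⊆ dom

attribute [instance] Grading.fintype_ι

section Classes

variable {V F : Type*} [NormedAddCommGroup V] [NormedSpace ℝ V]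
  [NormedAddCommGroup F] [NormedSpace ℝ F] (𝒢 : Grading V)

/-- `‖u‖ ≲ W`, uniformly on the sets `𝒢.bdd r`. -/
def BoundedBy (W : V → ℝ) (u : V → F) : Prop :=
  ∀ r, ∃ C : ℝ, ∀ x ∈ 𝒢.bdd r, ‖u x‖ ≤ C * W x

/-- Smooth functions whose derivatives of order at most `k` satisfy the weighted estimates. -/
def Cls : ℕ → (V → ℝ) → (V → F) → Prop
  | 0, W, u => ContDiffOn ℝ ∞ u 𝒢.dom ∧ BoundedBy 𝒢 W u
  | k + 1, W, u => (ContDiffOn ℝ ∞ u 𝒢.dom ∧ BoundedBy 𝒢 W u) ∧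
      ∀ i, Cls k (fun x => W x * 𝒢.wt i x) (dd (𝒢.dir i) u)

/-- Smooth functions all of whose derivatives satisfy the weighted estimates. -/
def Sym (W : V → ℝ) (u : V → F) : Prop := ∀ k, Cls 𝒢 k W u

/-- Comparison of weights. -/
def WLE (W W' : V → ℝ) : Prop := ∀ r, ∃ c : ℝ, ∀ x ∈ 𝒢.bdd r, |W x| ≤ c * W' x

variable {𝒢}

theorem Cls.contDiffOn {k : ℕ} {W : V → ℝ} {u : V → F} (h : Cls 𝒢 k W u) :
    ContDiffOn ℝ ∞ u 𝒢.dom := by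
  cases k with
  | zero => exact h.1
  | succ k => exact h.1.1

theorem Cls.boundedBy {k : ℕ} {W : V → ℝ} {u : V → F} (h : Cls 𝒢 k W u) : BoundedBy 𝒢 W u := by
  cases k with
  | zero => exact h.2
  | succ k => exact h.1.2

theorem Sym.contDiffOn {W : V → ℝ} {u : V → F} (h : Sym 𝒢 W u) : ContDiffOn ℝ ∞ u 𝒢.dom :=
  (h 0).contDiffOn

theorem Sym.boundedBy {W : V → ℝ} {u : V → F} (h : Sym 𝒢 W u) : BoundedBy 𝒢 W u :=
  (h 0).boundedBy

theorem BoundedBy.mono {W W' : V → ℝ} (hW : WLE 𝒢 W W') {u : V → F} (h : BoundedBy 𝒢 W u) :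
    BoundedBy 𝒢 W' u := fun r => by
  obtain ⟨C, hC⟩ := h r
  obtain ⟨c, hc⟩ := hW r
  refine ⟨|C| * c, fun x hx => (hC x hx).trans ?_⟩
  calc C * W x ≤ |C * W x| := le_abs_self _
    _ = |C| * |W x| := abs_mul _ _
    _ ≤ |C| * (c * W' x) := mul_le_mul_of_nonneg_left (hc x hx) (abs_nonneg _)
    _ = _ := by ring

theorem WLE.refl {W : V → ℝ} (hW : ∀ x, 0 ≤ W x) : WLE 𝒢 W W :=
  fun _ => ⟨1, fun x _ => by rw [one_mul, abs_of_nonneg (hW x)]⟩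

theorem WLE.of_le {W W' : V → ℝ} (hW : ∀ x, 0 ≤ W x) (h : ∀ x, W x ≤ W' x) : WLE 𝒢 W W' :=
  fun _ => ⟨1, fun x _ => by rw [one_mul, abs_of_nonneg (hW x)]; exact h x⟩

theorem WLE.mul_wt {W W' : V → ℝ} (hW : WLE 𝒢 W W') (i : 𝒢.ι) :
    WLE 𝒢 (fun x => W x * 𝒢.wt i x) (fun x => W' x * 𝒢.wt i x) := fun r => by
  obtain ⟨c, hc⟩ := hW r
  refine ⟨c, fun x hx => ?_⟩
  rw [abs_mul, abs_of_nonneg (𝒢.wt_nonneg i x), ← mul_assoc]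
  exact mul_le_mul_of_nonneg_right (hc x hx) (𝒢.wt_nonneg i x)

theorem WLE.mul {W₁ W₂ W₁' W₂' : V → ℝ} (h₁ : WLE 𝒢 W₁ W₁') (h₂ : WLE 𝒢 W₂ W₂') :
    WLE 𝒢 (fun x => W₁ x * W₂ x) (fun x => W₁' x * W₂' x) := fun r => by
  obtain ⟨c, hc⟩ := h₁ r
  obtain ⟨d, hd⟩ := h₂ r
  refine ⟨c * d, fun x hx => ?_⟩
  rw [abs_mul, mul_mul_mul_comm]
  exact mul_le_mul (hc x hx) (hd x hx) (abs_nonneg _) ((abs_nonneg _).trans (hc x hx))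

theorem Cls.mono {k : ℕ} {W W' : V → ℝ} {u : V → F} (h : Cls 𝒢 k W u) (hW : WLE 𝒢 W W') :
    Cls 𝒢 k W' u := by
  induction k generalizing W W' u with
  | zero => exact ⟨h.1, h.2.mono hW⟩
  | succ k ih => exact ⟨⟨h.1.1, h.1.2.mono hW⟩, fun i => ih (h.2 i) (hW.mul_wt i)⟩

theorem Sym.mono {W W' : V → ℝ} {u : V → F} (h : Sym 𝒢 W u) (hW : WLE 𝒢 W W') : Sym 𝒢 W' u :=
  fun k => (h k).mono hW

theorem Cls.congr {k : ℕ} {W : V → ℝ} {u w : V → F} (h : Cls 𝒢 k W u)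
    (huw : Set.EqOn w u 𝒢.dom) : Cls 𝒢 k W w := by
  induction k generalizing W u w with
  | zero =>
    refine ⟨h.1.congr huw, fun r => ?_⟩
    obtain ⟨C, hC⟩ := h.2 r
    exact ⟨C, fun x hx => by rw [huw (𝒢.bdd_subset r hx)]; exact hC x hx⟩
  | succ k ih =>
    refine ⟨⟨h.1.1.congr huw, fun r => ?_⟩, fun i => ih (h.2 i) (dd_eqOn 𝒢.isOpen_dom huw _)⟩
    obtain ⟨C, hC⟩ := h.1.2 r
    exact ⟨C, fun x hx => by rw [huw (𝒢.bdd_subset r hx)]; exact hC x hx⟩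

theorem Sym.congr {W : V → ℝ} {u w : V → F} (h : Sym 𝒢 W u) (huw : Set.EqOn w u 𝒢.dom) :
    Sym 𝒢 W w := fun k => (h k).congr huw

theorem Cls.of_succ {k : ℕ} {W : V → ℝ} {u : V → F} (h : Cls 𝒢 (k + 1) W u) : Cls 𝒢 k W u := by
  induction k generalizing W u with
  | zero => exact h.1
  | succ k ih => exact ⟨h.1, fun i => ih (h.2 i)⟩

theorem Sym.dd {W : V → ℝ} {u : V → F} (h : Sym 𝒢 W u) (i : 𝒢.ι) :
    Sym 𝒢 (fun x => W x * 𝒢.wt i x) (dd (𝒢.dir i) u) := fun k => (h (k + 1)).2 i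

theorem cls_zero (k : ℕ) (W : V → ℝ) : Cls 𝒢 k W (fun _ => (0 : F)) := by
  have hb : ∀ W : V → ℝ, BoundedBy 𝒢 W (fun _ => (0 : F)) := fun W r => ⟨0, fun x _ => by simp⟩
  induction k generalizing W with
  | zero => exact ⟨contDiffOn_const, hb W⟩
  | succ k ih =>
    refine ⟨⟨contDiffOn_const, hb W⟩, fun i => ?_⟩
    rw [dd_const]
    exact ih _

theorem sym_zero (W : V → ℝ) : Sym 𝒢 W (fun _ => (0 : F)) := fun k => cls_zero k W

theorem sym_const {W : V → ℝ} (hW : WLE 𝒢 (fun _ => 1) W) (a : F) : Sym 𝒢 W (fun _ => a) := by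
  have hb : BoundedBy 𝒢 W (fun _ => a) :=
    BoundedBy.mono hW fun r => ⟨‖a‖, fun x _ => by simp⟩
  intro k
  cases k with
  | zero => exact ⟨contDiffOn_const, hb⟩
  | succ k =>
    refine ⟨⟨contDiffOn_const, hb⟩, fun i => ?_⟩
    rw [dd_const]
    exact cls_zero k _

theorem Cls.add {k : ℕ} {W : V → ℝ} {u w : V → F} (hu : Cls 𝒢 k W u) (hw : Cls 𝒢 k W w) :
    Cls 𝒢 k W (fun x => u x + w x) := by
  have hb : ∀ {W : V → ℝ} {u w : V → F}, BoundedBy 𝒢 W u → BoundedBy 𝒢 W w →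
      BoundedBy 𝒢 W (fun x => u x + w x) := fun h1 h2 r => by
    obtain ⟨C, hC⟩ := h1 r
    obtain ⟨D, hD⟩ := h2 r
    exact ⟨C + D, fun x hx => (norm_add_le _ _).trans (by linarith [hC x hx, hD x hx])⟩
  induction k generalizing W u w with
  | zero => exact ⟨hu.1.add hw.1, hb hu.2 hw.2⟩
  | succ k ih =>
    refine ⟨⟨hu.1.1.add hw.1.1, hb hu.1.2 hw.1.2⟩, fun i => ?_⟩
    exact (ih (hu.2 i) (hw.2 i)).congr (dd_add 𝒢.isOpen_dom hu.1.1 hw.1.1 _)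

theorem Sym.add {W : V → ℝ} {u w : V → F} (hu : Sym 𝒢 W u) (hw : Sym 𝒢 W w) :
    Sym 𝒢 W (fun x => u x + w x) := fun k => (hu k).add (hw k)

theorem Cls.sum {κ : Type*} {k : ℕ} {W : V → ℝ} (s : Finset κ) {u : κ → V → F}
    (hu : ∀ j ∈ s, Cls 𝒢 k W (u j)) : Cls 𝒢 k W (fun x => ∑ j ∈ s, u j x) := by
  classical
  induction s using Finset.induction_on with
  | empty => simpa using cls_zero k W
  | insert j s hj ih =>
    simp only [Finset.sum_insert hj]
    exact (hu j (by simp)).add (ih fun l hl => hu l (by simp [hl]))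

theorem Sym.sum {κ : Type*} {W : V → ℝ} (s : Finset κ) {u : κ → V → F}
    (hu : ∀ j ∈ s, Sym 𝒢 W (u j)) : Sym 𝒢 W (fun x => ∑ j ∈ s, u j x) :=
  fun k => Cls.sum s fun j hj => hu j hj k

theorem Cls.clm {F' : Type*} [NormedAddCommGroup F'] [NormedSpace ℝ F'] (L : F →L[ℝ] F')
    {k : ℕ} {W : V → ℝ} {u : V → F} (hu : Cls 𝒢 k W u) : Cls 𝒢 k W (fun x => L (u x)) := by
  have hb : ∀ {W : V → ℝ} {u : V → F}, BoundedBy 𝒢 W u → BoundedBy 𝒢 W (fun x => L (u x)) :=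
    fun h1 r => by
      obtain ⟨C, hC⟩ := h1 r
      refine ⟨‖L‖ * C, fun x hx => (L.le_opNorm _).trans ?_⟩
      rw [mul_assoc]
      exact mul_le_mul_of_nonneg_left (hC x hx) (norm_nonneg _)
  induction k generalizing W u with
  | zero => exact ⟨L.contDiff.comp_contDiffOn hu.1, hb hu.2⟩
  | succ k ih =>
    exact ⟨⟨L.contDiff.comp_contDiffOn hu.1.1, hb hu.1.2⟩, fun i =>
      (ih (hu.2 i)).congr (dd_clm L 𝒢.isOpen_dom hu.1.1 _)⟩

theorem Sym.clm {F' : Type*} [NormedAddCommGroup F'] [NormedSpace ℝ F'] (L : F →L[ℝ] F')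
    {W : V → ℝ} {u : V → F} (hu : Sym 𝒢 W u) : Sym 𝒢 W (fun x => L (u x)) :=
  fun k => (hu k).clm L

theorem Cls.bilin {F₁ F₂ F₃ : Type*} [NormedAddCommGroup F₁] [NormedSpace ℝ F₁]
    [NormedAddCommGroup F₂] [NormedSpace ℝ F₂] [NormedAddCommGroup F₃] [NormedSpace ℝ F₃]
    (L : F₁ →L[ℝ] F₂ →L[ℝ] F₃) {k : ℕ} {W W' : V → ℝ} {u : V → F₁} {w : V → F₂}
    (hu : Cls 𝒢 k W u) (hw : Cls 𝒢 k W' w) :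
    Cls 𝒢 k (fun x => W x * W' x) (fun x => L (u x) (w x)) := by
  have hc : ∀ {u : V → F₁} {w : V → F₂}, ContDiffOn ℝ ∞ u 𝒢.dom → ContDiffOn ℝ ∞ w 𝒢.dom →
      ContDiffOn ℝ ∞ (fun x => L (u x) (w x)) 𝒢.dom := fun h1 h2 =>
    (L.contDiff.comp_contDiffOn h1).clm_apply h2
  have hb : ∀ {W W' : V → ℝ} {u : V → F₁} {w : V → F₂}, BoundedBy 𝒢 W u → BoundedBy 𝒢 W' w →
      BoundedBy 𝒢 (fun x => W x * W' x) (fun x => L (u x) (w x)) := fun h1 h2 r => by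
    obtain ⟨C, hC⟩ := h1 r
    obtain ⟨D, hD⟩ := h2 r
    refine ⟨‖L‖ * (C * D), fun x hx => (L.le_opNorm₂ _ _).trans ?_⟩
    have h0 : 0 ≤ C * _ := (norm_nonneg _).trans (hC x hx)
    calc _ = ‖L‖ * (‖_‖ * ‖_‖) := mul_assoc _ _ _
      _ ≤ ‖L‖ * ((C * _) * (D * _)) := by
        gcongr
        · exact hC x hx
        · exact hD x hx
      _ = _ := by ring
  induction k generalizing W W' u w with
  | zero => exact ⟨hc hu.1 hw.1, hb hu.2 hw.2⟩
  | succ k ih =>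
    refine ⟨⟨hc hu.1.1 hw.1.1, hb hu.1.2 hw.1.2⟩, fun i => ?_⟩
    refine Cls.congr ?_ (dd_bilin L 𝒢.isOpen_dom hu.1.1 hw.1.1 _)
    have h1 := ih (hu.2 i) (Cls.of_succ hw)
    have h2 := ih (Cls.of_succ hu) (hw.2 i)
    have e1 : (fun x => W x * 𝒢.wt i x * W' x) = fun x => W x * W' x * 𝒢.wt i x := by
      ext x; ring
    have e2 : (fun x => W x * (W' x * 𝒢.wt i x)) = fun x => W x * W' x * 𝒢.wt i x := by
      ext x; ring
    rw [e1] at h1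
    rw [e2] at h2
    exact h1.add h2

theorem Cls.smul {𝕜 : Type*} [RCLike 𝕜] [NormedSpace 𝕜 F] [IsScalarTower ℝ 𝕜 F]
    {k : ℕ} {W W' : V → ℝ} {u : V → 𝕜} {w : V → F} (hu : Cls 𝒢 k W u) (hw : Cls 𝒢 k W' w) :
    Cls 𝒢 k (fun x => W x * W' x) (fun x => u x • w x) :=
  hu.bilin (ContinuousLinearMap.lsmul ℝ 𝕜) hw

theorem Sym.smul {𝕜 : Type*} [RCLike 𝕜] [NormedSpace 𝕜 F] [IsScalarTower ℝ 𝕜 F]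
    {W W' : V → ℝ} {u : V → 𝕜} {w : V → F} (hu : Sym 𝒢 W u) (hw : Sym 𝒢 W' w) :
    Sym 𝒢 (fun x => W x * W' x) (fun x => u x • w x) := fun k => (hu k).smul (hw k)

theorem Cls.mul {R : Type*} [NormedRing R] [NormedAlgebra ℝ R] {k : ℕ} {W W' : V → ℝ} {u w : V → R}
    (hu : Cls 𝒢 k W u) (hw : Cls 𝒢 k W' w) :
    Cls 𝒢 k (fun x => W x * W' x) (fun x => u x * w x) :=
  hu.bilin (ContinuousLinearMap.mul ℝ R) hw

theorem Sym.mul {R : Type*} [NormedRing R] [NormedAlgebra ℝ R] {W W' : V → ℝ} {u w : V → R}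
    (hu : Sym 𝒢 W u) (hw : Sym 𝒢 W' w) :
    Sym 𝒢 (fun x => W x * W' x) (fun x => u x * w x) := fun k => (hu k).mul (hw k)

theorem Sym.const_smul {𝕜 : Type*} [RCLike 𝕜] [NormedSpace 𝕜 F] [IsScalarTower ℝ 𝕜 F]
    {W : V → ℝ} {w : V → F} (c : 𝕜) (hw : Sym 𝒢 W w) : Sym 𝒢 W (fun x => c • w x) :=
  hw.clm ((ContinuousLinearMap.lsmul ℝ 𝕜 : 𝕜 →L[ℝ] F →L[ℝ] F) c)

theorem Sym.neg {W : V → ℝ} {u : V → F} (hu : Sym 𝒢 W u) : Sym 𝒢 W (fun x => -u x) := by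
  simpa using hu.const_smul (-1 : ℝ)

theorem Sym.sub {W : V → ℝ} {u w : V → F} (hu : Sym 𝒢 W u) (hw : Sym 𝒢 W w) :
    Sym 𝒢 W (fun x => u x - w x) := by
  simpa [sub_eq_add_neg] using hu.add hw.neg

/-- A function given by a continuous linear functional is a symbol of any weight that dominates it
and whose products with the weights of the directions dominate the constants. -/
theorem sym_of_dd_const {W : V → ℝ} {u : V → F} (hu : ContDiffOn ℝ ∞ u 𝒢.dom)
    (hb : BoundedBy 𝒢 W u) (c : 𝒢.ι → F)
    (hd : ∀ i, Set.EqOn (dd (𝒢.dir i) u) (fun _ => c i) 𝒢.dom)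
    (hc : ∀ i, c i = 0 ∨ WLE 𝒢 (fun _ => 1) (fun x => W x * 𝒢.wt i x)) : Sym 𝒢 W u := by
  intro k
  cases k with
  | zero => exact ⟨hu, hb⟩
  | succ k =>
    refine ⟨⟨hu, hb⟩, fun i => Cls.congr ?_ (hd i)⟩
    rcases hc i with h | h
    · rw [h]; exact cls_zero k _
    · exact sym_const h _ k

/-- The behaviour of the classes under substitution. -/
structure Subst {V' : Type*} [NormedAddCommGroup V'] [NormedSpace ℝ V'] (𝒢' : Grading V')
    (𝒢 : Grading V) (T : V' → V) where
  /-- The coefficients of the transformed directions. -/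
  coef : 𝒢'.ι → 𝒢.ι → V' → ℝ
  /-- The weights of the coefficients. -/
  cwt : 𝒢'.ι → 𝒢.ι → V' → ℝ
  contDiffOn : ContDiffOn ℝ ∞ T 𝒢'.dom
  mapsTo : Set.MapsTo T 𝒢'.dom 𝒢.dom
  bdd : ∀ r, ∃ r', Set.MapsTo T (𝒢'.bdd r) (𝒢.bdd r')
  dd_eq : ∀ i, ∀ x ∈ 𝒢'.dom, dd (𝒢'.dir i) T x = ∑ j, coef i j x • 𝒢.dir j
  sym_coef : ∀ i j, Sym 𝒢' (cwt i j) (coef i j)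
  le : ∀ i j, WLE 𝒢' (fun x => cwt i j x * 𝒢.wt j (T x)) (𝒢'.wt i)

/-- By the chain rule a derivative of u ∘ T is a sum of coefficients times derivatives of u at T.
The field `le` says that the weights gained in this way are dominated by the weight of the original
direction, so induction on k over all weights closes. -/
theorem Subst.cls {V' : Type*} [NormedAddCommGroup V'] [NormedSpace ℝ V'] {𝒢' : Grading V'}
    {T : V' → V} (S : Subst 𝒢' 𝒢 T) {k : ℕ} {W : V → ℝ} (hW : ∀ x, 0 ≤ W x) {u : V → F}
    (hu : Cls 𝒢 k W u) : Cls 𝒢' k (fun x => W (T x)) (fun x => u (T x)) := by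
  have hb : ∀ {W : V → ℝ} {u : V → F}, BoundedBy 𝒢 W u →
      BoundedBy 𝒢' (fun x => W (T x)) (fun x => u (T x)) := fun h r => by
    obtain ⟨r', hr'⟩ := S.bdd r
    obtain ⟨C, hC⟩ := h r'
    exact ⟨C, fun x hx => hC _ (hr' hx)⟩
  induction k generalizing W u with
  | zero => exact ⟨hu.1.comp S.contDiffOn S.mapsTo, hb hu.2⟩
  | succ k ih =>
    refine ⟨⟨hu.1.1.comp S.contDiffOn S.mapsTo, hb hu.1.2⟩, fun i => ?_⟩
    have e : Set.EqOn (dd (𝒢'.dir i) fun x => u (T x))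
        (fun x => ∑ j, S.coef i j x • dd (𝒢.dir j) u (T x)) 𝒢'.dom := fun x hx => by
      rw [dd_comp 𝒢.isOpen_dom 𝒢'.isOpen_dom hu.1.1 S.contDiffOn S.mapsTo _ hx, S.dd_eq i x hx,
        dd_dir_sum]
    refine Cls.congr (Cls.sum _ fun j _ => ?_) e
    have h1 := (S.sym_coef i j k).smul (ih (fun x => mul_nonneg (hW x) (𝒢.wt_nonneg j x)) (hu.2 j))
    refine h1.mono ?_
    have h2 := (WLE.refl (𝒢 := 𝒢') (W := fun x => W (T x)) (fun x => hW _)).mul (S.le i j)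
    convert h2 using 2
    ring

theorem Subst.sym {V' : Type*} [NormedAddCommGroup V'] [NormedSpace ℝ V'] {𝒢' : Grading V'}
    {T : V' → V} (S : Subst 𝒢' 𝒢 T) {W : V → ℝ} (hW : ∀ x, 0 ≤ W x) {u : V → F}
    (hu : Sym 𝒢 W u) : Sym 𝒢' (fun x => W (T x)) (fun x => u (T x)) := fun k => S.cls hW (hu k)

/-! ### Words of derivatives -/

/-- Iterated derivatives along a list of directions. -/
def dw (l : List V) (u : V → F) : V → F := l.foldr dd u

@[simp] theorem dw_nil (u : V → F) : dw [] u = u := rfl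

@[simp] theorem dw_cons (v : V) (l : List V) (u : V → F) : dw (v :: l) u = dd v (dw l u) := rfl

theorem dw_append (l l' : List V) (u : V → F) : dw (l ++ l') u = dw l (dw l' u) := by
  simp [dw, List.foldr_append]

theorem contDiffOn_dw {Ω : Set V} (hΩ : IsOpen Ω) {u : V → F} (hu : ContDiffOn ℝ ∞ u Ω)
    (l : List V) : ContDiffOn ℝ ∞ (dw l u) Ω := by
  induction l with
  | nil => exact hu
  | cons v l ih => exact contDiffOn_dd hΩ ih v

theorem dw_eqOn {Ω : Set V} (hΩ : IsOpen Ω) {u w : V → F} (h : Set.EqOn u w Ω) (l : List V) :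
    Set.EqOn (dw l u) (dw l w) Ω := by
  induction l with
  | nil => exact h
  | cons v l ih => exact dd_eqOn hΩ ih v

theorem dw_perm {Ω : Set V} (hΩ : IsOpen Ω) {u : V → F} (hu : ContDiffOn ℝ ∞ u Ω)
    {l l' : List V} (h : l.Perm l') : Set.EqOn (dw l u) (dw l' u) Ω := by
  induction h with
  | nil => exact fun _ _ => rfl
  | cons v _ ih => exact dd_eqOn hΩ ih v
  | swap v w l => exact dd_comm hΩ (contDiffOn_dw hΩ hu l) _ _
  | trans _ _ h1 h2 => exact h1.trans h2

theorem Sym.dw {W : V → ℝ} {u : V → F} (h : Sym 𝒢 W u) (l : List 𝒢.ι) :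
    Sym 𝒢 (fun x => W x * (l.map fun i => 𝒢.wt i x).prod) (dw (l.map 𝒢.dir) u) := by
  induction l with
  | nil => simpa using h
  | cons i l ih =>
    have := ih.dd i
    simp only [List.map_cons, List.prod_cons, dw_cons]
    convert this using 2
    ring

/-- Converse of `Sym.dw`, for functions such as Borel sums that are estimated word by word. `Cls`
differentiates u itself first, so the new direction is appended at the innermost end of the word. -/
theorem cls_of_words {k : ℕ} {W : V → ℝ} {u : V → F} (hu : ContDiffOn ℝ ∞ u 𝒢.dom)
    (h : ∀ l : List 𝒢.ι, l.length ≤ k →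
      BoundedBy 𝒢 (fun x => W x * (l.map fun i => 𝒢.wt i x).prod) (TwistedCalculus.dw (l.map 𝒢.dir) u)) :
    Cls 𝒢 k W u := by
  induction k generalizing W u with
  | zero => exact ⟨hu, by simpa using h [] (by simp)⟩
  | succ k ih =>
    refine ⟨⟨hu, by simpa using h [] (by simp)⟩, fun i =>
      ih (contDiffOn_dd 𝒢.isOpen_dom hu _) fun l hl => ?_⟩
    have := h (l ++ [i]) (by simpa using hl)
    simp only [List.map_append, List.map_cons, List.map_nil, List.prod_append, List.prod_cons,
      List.prod_nil, mul_one, dw_append, dw_cons, dw_nil] at this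
    convert this using 2
    ring

theorem sym_of_words {W : V → ℝ} {u : V → F} (hu : ContDiffOn ℝ ∞ u 𝒢.dom)
    (h : ∀ l : List 𝒢.ι,
      BoundedBy 𝒢 (fun x => W x * (l.map fun i => 𝒢.wt i x).prod) (TwistedCalculus.dw (l.map 𝒢.dir) u)) :
    Sym 𝒢 W u := fun _ => cls_of_words hu fun l _ => h l

end Classes

/-! ### Oscillatory integrals -/

section Oscillatory

variable {n : ℕ}

/-- `(1 + |y|² + |η|²)^{1/2}`. -/
def jb (p : E n × E n) : ℝ := Real.sqrt (1 + ‖p.1‖ ^ 2 + ‖p.2‖ ^ 2)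

theorem jb_sq (p : E n × E n) : jb p ^ 2 = 1 + ‖p.1‖ ^ 2 + ‖p.2‖ ^ 2 :=
  Real.sq_sqrt (by positivity)

theorem one_le_jb (p : E n × E n) : 1 ≤ jb p := by
  rw [jb, Real.one_le_sqrt]
  nlinarith [sq_nonneg ‖p.1‖, sq_nonneg ‖p.2‖]

theorem jb_pos (p : E n × E n) : 0 < jb p := one_pos.trans_le (one_le_jb p)

theorem norm_fst_le_jb (p : E n × E n) : ‖p.1‖ ≤ jb p :=
  Real.le_sqrt_of_sq_le (by nlinarith [sq_nonneg ‖p.2‖])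

theorem norm_snd_le_jb (p : E n × E n) : ‖p.2‖ ≤ jb p :=
  Real.le_sqrt_of_sq_le (by nlinarith [sq_nonneg ‖p.1‖])

theorem jb_le (p : E n × E n) : jb p ≤ 1 + 2 * ‖p‖ := by
  have h1 := norm_fst_le p
  have h2 := norm_snd_le p
  rw [jb, Real.sqrt_le_left (by positivity)]
  nlinarith [norm_nonneg p, norm_nonneg p.1, norm_nonneg p.2]

/-- The coordinate directions of `ℝⁿ × ℝⁿ`. -/
def pdir (n : ℕ) : Fin n ⊕ Fin n → E n × E n :=
  Sum.elim (fun j => (stdVec n j, 0)) (fun j => (0, stdVec n j))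

/-- The coordinate dual to the direction `pdir n e` with respect to `⟨y, η⟩`, so that
`∂_e ⟨y, η⟩ = dualCoord e (y, η)`. -/
def dualCoord : Fin n ⊕ Fin n → E n × E n →L[ℝ] ℝ :=
  Sum.elim
    (fun j => (EuclideanSpace.proj j).comp (ContinuousLinearMap.snd ℝ (E n) (E n)))
    (fun j => (EuclideanSpace.proj j).comp (ContinuousLinearMap.fst ℝ (E n) (E n)))

theorem sum_dualCoord_sq (p : E n × E n) :
    ∑ e, dualCoord e p * dualCoord e p = ‖p.1‖ ^ 2 + ‖p.2‖ ^ 2 := by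
  simp [dualCoord, EuclideanSpace.norm_sq_eq, ← pow_two, add_comm]

theorem abs_dualCoord_le (e : Fin n ⊕ Fin n) (p : E n × E n) : |dualCoord e p| ≤ jb p := by
  rcases e with j | j
  · exact (PiLp.norm_apply_le p.2 j).trans (norm_snd_le_jb p)
  · exact (PiLp.norm_apply_le p.1 j).trans (norm_fst_le_jb p)

/-- The grading of `ℝⁿ × ℝⁿ` in which all derivatives are neutral. -/
def gradP (n : ℕ) : Grading (E n × E n) where
  dom := Set.univ
  isOpen_dom := isOpen_univ
  ι := Fin n ⊕ Fin n
  dir := pdir n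
  wt := fun _ _ => 1
  wt_nonneg := fun _ _ => zero_le_one
  bdd := fun _ => Set.univ
  bdd_subset := fun _ => Set.subset_univ _

/-! ### Amplitudes on ℝⁿ × ℝⁿ. -/

section Amplitudes

variable {F : Type*} [NormedAddCommGroup F] [NormedSpace ℝ F]

/-- Amplitudes of order `q`. -/
def Amp (q : ℝ) (a : E n × E n → F) : Prop := Sym (gradP n) (fun p => jb p ^ q) a

theorem jb_rpow_le {q q' : ℝ} (h : q ≤ q') (p : E n × E n) : jb p ^ q ≤ jb p ^ q' :=
  Real.rpow_le_rpow_of_exponent_le (one_le_jb p) h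

theorem jb_rpow_nonneg (q : ℝ) (p : E n × E n) : 0 ≤ jb p ^ q :=
  Real.rpow_nonneg (jb_pos p).le _

theorem Amp.contDiff {q : ℝ} {a : E n × E n → F} (ha : Amp q a) : ContDiff ℝ ∞ a :=
  contDiffOn_univ.1 (Sym.contDiffOn ha)

theorem Amp.bound {q : ℝ} {a : E n × E n → F} (ha : Amp q a) : ∃ C, ∀ p, ‖a p‖ ≤ C * jb p ^ q := by
  obtain ⟨C, hC⟩ := Sym.boundedBy ha 0
  exact ⟨C, fun p => hC p trivial⟩

theorem Amp.dd {q : ℝ} {a : E n × E n → F} (ha : Amp q a) (e : Fin n ⊕ Fin n) :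
    Amp q (dd (pdir n e) a) := by
  refine Sym.mono (Sym.dd (𝒢 := gradP n) ha e) (WLE.of_le (fun p => ?_) fun p => ?_)
  · simpa [gradP] using jb_rpow_nonneg q p
  · simp [gradP]

theorem Amp.smul {q q' : ℝ} {c : E n × E n → ℝ} {a : E n × E n → F} (hc : Amp q c)
    (ha : Amp q' a) : Amp (q + q') (fun p => c p • a p) := by
  have := Sym.smul (𝒢 := gradP n) hc ha
  refine Sym.mono this (WLE.of_le (fun p => by have := jb_pos p; positivity) fun p => ?_)
  rw [Real.rpow_add (jb_pos p)]

end Amplitudes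

variable {F : Type*} [NormedAddCommGroup F] [NormedSpace ℂ F]

instance : (MeasureTheory.volume : MeasureTheory.Measure (E n × E n)).IsAddHaarMeasure :=
  inferInstanceAs ((MeasureTheory.volume : MeasureTheory.Measure (E n)).prod
    (MeasureTheory.volume : MeasureTheory.Measure (E n))).IsAddHaarMeasure

/-- The phase factor `e^{-i⟨y,η⟩}`. -/
def phase (p : E n × E n) : ℂ := Complex.exp (-(Complex.I * (inner ℝ p.1 p.2 : ℝ)))

theorem norm_phase (p : E n × E n) : ‖phase p‖ = 1 := by
  rw [phase, ← mul_neg, mul_comm, ← Complex.ofReal_neg, Complex.norm_exp_ofReal_mul_I]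

theorem contDiff_phase : ContDiff ℝ ∞ (phase : E n × E n → ℂ) := by
  have h : ContDiff ℝ ∞ fun p : E n × E n => (inner ℝ p.1 p.2 : ℝ) :=
    contDiff_fst.inner ℝ contDiff_snd
  exact ((contDiff_const.mul (Complex.ofRealCLM.contDiff.comp h)).neg).cexp

theorem dd_phase (e : Fin n ⊕ Fin n) (p : E n × E n) :
    dd (pdir n e) phase p = -(Complex.I * (dualCoord e p : ℝ)) * phase p := by
  have h1 : HasFDerivAt (fun p : E n × E n => (inner ℝ p.1 p.2 : ℝ)) _ p :=
    (hasFDerivAt_fst (p := p)).inner ℝ hasFDerivAt_snd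
  have h2 := (((Complex.ofRealCLM.hasFDerivAt (x := inner ℝ p.1 p.2)).comp p h1).const_mul
    Complex.I).neg.cexp
  have h3 : HasFDerivAt (phase : E n × E n → ℂ) _ p := h2
  rw [dd, h3.fderiv]
  rcases e with j | j
  · simp [pdir, dualCoord, phase, stdVec, EuclideanSpace.inner_single_left]
    ring
  · simp [pdir, dualCoord, phase, stdVec, EuclideanSpace.inner_single_right]
    ring

/-- The oscillatory integral of `a` is `v`, in the sense of regularization by all Schwartz
functions. -/
def HasOsc (a : E n × E n → F) (v : F) : Prop :=
  ∀ χ : 𝓢(E n × E n, ℂ),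
    (∀ ε : ℝ, 0 < ε → MeasureTheory.Integrable fun p => (χ (ε • p) * phase p) • a p) ∧
    Filter.Tendsto (fun ε : ℝ => (((2 * Real.pi) ^ n)⁻¹ : ℝ) • ∫ p,
      (χ (ε • p) * phase p) • a p) (𝓝[>] 0) (𝓝 (χ 0 • v))

theorem HasOsc.add {a b : E n × E n → F} {v w : F} (ha : HasOsc a v) (hb : HasOsc b w) :
    HasOsc (fun p => a p + b p) (v + w) := fun χ => by
  refine ⟨fun ε hε => ?_, ?_⟩
  · simp only [smul_add]
    exact ((ha χ).1 ε hε).add ((hb χ).1 ε hε)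
  · have := (ha χ).2.add (hb χ).2
    rw [← smul_add] at this
    refine this.congr' ?_
    filter_upwards [self_mem_nhdsWithin] with ε hε
    rw [← smul_add, ← MeasureTheory.integral_add ((ha χ).1 ε hε) ((hb χ).1 ε hε)]
    simp only [smul_add]

theorem HasOsc.zero : HasOsc (fun _ : E n × E n => (0 : F)) 0 := fun χ => by
  simp

theorem HasOsc.sum {κ : Type*} (s : Finset κ) {a : κ → E n × E n → F} {v : κ → F}
    (h : ∀ j ∈ s, HasOsc (a j) (v j)) : HasOsc (fun p => ∑ j ∈ s, a j p) (∑ j ∈ s, v j) := by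
  classical
  induction s using Finset.induction_on with
  | empty => simpa using HasOsc.zero
  | insert j s hj ih =>
    simp only [Finset.sum_insert hj]
    exact (h j (by simp)).add (ih fun l hl => h l (by simp [hl]))

theorem HasOsc.clm [CompleteSpace F] {F' : Type*} [NormedAddCommGroup F'] [NormedSpace ℂ F']
    [CompleteSpace F'] (L : F →L[ℂ] F')
    {a : E n × E n → F} {v : F} (ha : HasOsc a v) : HasOsc (fun p => L (a p)) (L v) := fun χ => by
  have e : ∀ ε : ℝ, (fun p => (χ (ε • p) * phase p) • L (a p)) =
      fun p => L ((χ (ε • p) * phase p) • a p) := fun ε => by ext p; rw [L.map_smul]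
  refine ⟨fun ε hε => ?_, ?_⟩
  · rw [e]; exact L.integrable_comp ((ha χ).1 ε hε)
  · have := (L.continuous.tendsto _).comp (ha χ).2
    rw [map_smul] at this
    refine this.congr' ?_
    filter_upwards [self_mem_nhdsWithin] with ε hε
    have h1 : ∫ p, (χ (ε • p) * phase p) • L (a p) = L (∫ p, (χ (ε • p) * phase p) • a p) := by
      rw [e]; exact L.integral_comp_comm ((ha χ).1 ε hε)
    rw [h1, Function.comp, ← L.coe_restrictScalars' (R := ℝ), map_smul]

theorem HasOsc.const_smul [CompleteSpace F] (c : ℂ) {a : E n × E n → F} {v : F}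
    (ha : HasOsc a v) : HasOsc (fun p => c • a p) (c • v) :=
  ha.clm (c • ContinuousLinearMap.id ℂ F)

/-- The tensor product of two cutoffs as a Schwartz function. -/
theorem exists_schwartz_tensor (n : ℕ) : ∃ (χ : 𝓢(E n × E n, ℂ)) (φ : 𝓢(E n, ℂ)), φ 0 = 1 ∧
    ∀ p, χ p = φ p.1 * φ p.2 := by
  let φ : ContDiffBump (0 : E n) := ⟨1, 2, one_pos, one_lt_two⟩
  have h1 : HasCompactSupport fun x : E n => (φ x : ℂ) :=
    φ.hasCompactSupport.comp_left (g := Complex.ofReal) rfl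
  have h2 : ContDiff ℝ ∞ fun x : E n => (φ x : ℂ) := Complex.ofRealCLM.contDiff.comp φ.contDiff
  have h3 : HasCompactSupport fun p : E n × E n => (φ p.1 : ℂ) * (φ p.2 : ℂ) := by
    refine HasCompactSupport.intro (K := tsupport φ ×ˢ tsupport φ)
      (φ.hasCompactSupport.isCompact.prod φ.hasCompactSupport.isCompact) fun p hp => ?_
    by_cases h : p.1 ∈ tsupport φ
    · have : p.2 ∉ tsupport φ := fun h' => hp ⟨h, h'⟩
      simp [image_eq_zero_of_notMem_tsupport this]
    · simp [image_eq_zero_of_notMem_tsupport h]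
  have h4 : ContDiff ℝ ∞ fun p : E n × E n => (φ p.1 : ℂ) * (φ p.2 : ℂ) :=
    (h2.comp contDiff_fst).mul (h2.comp contDiff_snd)
  refine ⟨h3.toSchwartzMap h4, h1.toSchwartzMap h2, ?_, fun p => by simp⟩
  have : φ 0 = 1 := φ.one_of_mem_closedBall (by simp [φ])
  simp [this]

theorem HasOsc.unique {a : E n × E n → F} {v w : F} (hv : HasOsc a v) (hw : HasOsc a w) :
    v = w := by
  obtain ⟨χ, φ, h0, hχ⟩ := exists_schwartz_tensor n
  have : χ 0 = 1 := by rw [hχ]; simp [h0]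
  have h := tendsto_nhds_unique (hv χ).2 (hw χ).2
  simpa [this] using h

theorem integrable_schwartz_smul {q : ℝ} {a : E n × E n → F} (hc : Continuous a)
    (ha : ∃ C, ∀ p, ‖a p‖ ≤ C * jb p ^ q) (χ : 𝓢(E n × E n, ℂ)) {ε : ℝ} (hε : 0 < ε) :
    MeasureTheory.Integrable fun p => (χ (ε • p) * phase p) • a p := by
  obtain ⟨C, hC⟩ := ha
  obtain ⟨k, hk⟩ := exists_nat_ge q
  -- Chosen so that jb p ≤ 1 + 2‖p‖ ≤ c (1 + ‖ε p‖): polynomial growth in p becomes polynomial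
  -- growth in the argument of χ.
  set c := max 1 (2 / ε) with hc'
  have hc1 : 1 ≤ c := le_max_left _ _
  have hintegrable : MeasureTheory.Integrable fun p : E n × E n => (1 + ‖p‖) ^ k * ‖χ p‖ := by
    simp only [add_pow, one_pow, one_mul, Finset.sum_mul]
    refine MeasureTheory.integrable_finsetSum _ fun i _ => ?_
    have := (χ.integrable_pow_mul MeasureTheory.volume (k - i)).const_mul (k.choose i : ℝ)
    refine this.congr (Filter.Eventually.of_forall fun p => ?_)
    simp only; ring
  have hintegrable2 := (hintegrable.comp_smul hε.ne').const_mul (|C| * c ^ k)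
  refine hintegrable2.mono' ?_ (Filter.Eventually.of_forall fun p => ?_)
  · refine Continuous.aestronglyMeasurable ?_
    exact ((χ.continuous.comp (continuous_const_smul ε)).mul contDiff_phase.continuous).smul hc
  · rw [norm_smul, norm_mul, norm_phase, mul_one]
    have h1 : jb p ^ q ≤ (c * (1 + ‖ε • p‖)) ^ k := by
      calc jb p ^ q ≤ jb p ^ (k : ℝ) := jb_rpow_le hk p
        _ = jb p ^ k := Real.rpow_natCast _ _
        _ ≤ _ := by
          refine pow_le_pow_left₀ (jb_pos p).le ((jb_le p).trans ?_) k
          rw [norm_smul, Real.norm_eq_abs, abs_of_pos hε]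
          have h2 : 2 ≤ c * ε := by
            have := le_max_right 1 (2 / ε)
            rw [← hc'] at this
            rwa [div_le_iff₀ hε] at this
          nlinarith [norm_nonneg p]
    calc ‖χ (ε • p)‖ * ‖a p‖ ≤ ‖χ (ε • p)‖ * (|C| * (c * (1 + ‖ε • p‖)) ^ k) := by
          gcongr
          refine (hC p).trans ?_
          exact mul_le_mul (le_abs_self C) h1 (jb_rpow_nonneg q p) (abs_nonneg C)
      _ = _ := by rw [mul_pow]; ring

theorem Amp.integrable {q : ℝ} {a : E n × E n → F} (ha : Amp q a) (χ : 𝓢(E n × E n, ℂ)) {ε : ℝ}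
    (hε : 0 < ε) : MeasureTheory.Integrable fun p => (χ (ε • p) * phase p) • a p :=
  integrable_schwartz_smul ha.contDiff.continuous ha.bound χ hε

theorem amp_dualCoord (e : Fin n ⊕ Fin n) : Amp 1 (fun p : E n × E n => dualCoord e p) := by
  refine sym_of_dd_const (𝒢 := gradP n) (dualCoord e).contDiff.contDiffOn
    (fun r => ⟨1, fun p _ => by simpa using abs_dualCoord_le e p⟩) (fun i => dualCoord e (pdir n i))
    (fun i p _ => by simp [TwistedCalculus.dd, gradP]) (fun i => Or.inr ?_)
  exact WLE.of_le (fun _ => zero_le_one) fun p => by simpa [gradP] using one_le_jb p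

/-- Integration by parts in an oscillatory integral. -/
theorem HasOsc.dualCoord_smul [CompleteSpace F] {q : ℝ} {b : E n × E n → F} {w w' : F}
    (hb : Amp q b) (e : Fin n ⊕ Fin n) (h : HasOsc (dd (pdir n e) b) w) (h' : HasOsc b w') :
    HasOsc (fun p => dualCoord e p • b p) (-Complex.I • w) := fun χ => by
  have hlb : Amp (1 + q) fun p => dualCoord e p • b p := (amp_dualCoord e).smul hb
  refine ⟨fun ε hε => hlb.integrable χ hε, ?_⟩
  -- Differentiating the cutoff gives ε times another Schwartz cutoff, whose value at 0 is
  -- arbitrary. Since `HasOsc` tests against all Schwartz functions and not only those with value 1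
  -- at 0, h' shows that this extra term tends to 0.
  set χ' : 𝓢(E n × E n, ℂ) := LineDeriv.lineDerivOp (pdir n e) χ with hχ'
  have hid : Filter.Tendsto (fun ε : ℝ => ε) (𝓝[>] 0) (𝓝 0) :=
    tendsto_nhdsWithin_of_tendsto_nhds Filter.tendsto_id
  have key := ((h χ).2.add (hid.smul (h' χ').2)).const_smul (-Complex.I)
  rw [zero_smul, add_zero, smul_comm] at key
  refine key.congr' ?_
  filter_upwards [self_mem_nhdsWithin] with ε hε
  have hε : 0 < ε := hε
  have hχd : ∀ p, HasFDerivAt (fun p : E n × E n => χ (ε • p))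
      ((fderiv ℝ χ (ε • p)).comp (ε • ContinuousLinearMap.id ℝ (E n × E n))) p := fun p =>
    (χ.differentiableAt (x := ε • p)).hasFDerivAt.comp p ((hasFDerivAt_id p).const_smul ε)
  have hbd : ∀ p, DifferentiableAt ℝ b p := fun p => hb.contDiff.differentiable (by simp) p
  have hg : ∀ p, fderiv ℝ (fun p => χ (ε • p) • b p) p (pdir n e) =
      χ (ε • p) • dd (pdir n e) b p + ε • (χ' (ε • p) • b p) := fun p => by
    have := (hχd p).smul (hbd p).hasFDerivAt
    have h2 : HasFDerivAt (fun p => χ (ε • p) • b p) _ p := this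
    rw [h2.fderiv]
    simp [hχ', SchwartzMap.lineDerivOp_apply_eq_fderiv, dd, mul_smul]
  have hph : ∀ p, fderiv ℝ (phase : E n × E n → ℂ) p (pdir n e) =
      -(Complex.I * (dualCoord e p : ℝ)) * phase p := dd_phase e
  have i1 := (hb.dd e).integrable χ hε
  have i2 := hb.integrable χ' hε
  have i3 := hb.integrable χ hε
  have i4 := hlb.integrable χ hε
  have e1 : ∀ p, phase p • fderiv ℝ (fun p => χ (ε • p) • b p) p (pdir n e) =
      (χ (ε • p) * phase p) • dd (pdir n e) b p + ε • ((χ' (ε • p) * phase p) • b p) := fun p => by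
    rw [hg, smul_add, smul_smul, smul_comm (phase p) ε, smul_smul]
    rw [mul_comm (phase p), mul_comm (phase p)]
  have e2 : ∀ p, fderiv ℝ (phase : E n × E n → ℂ) p (pdir n e) • (χ (ε • p) • b p) =
      (-Complex.I) • ((χ (ε • p) * phase p) • (dualCoord e p • b p)) := fun p => by
    rw [hph, smul_smul, ← Complex.coe_smul (dualCoord e p), smul_smul, smul_smul]
    congr 1; ring
  have ibp := integral_smul_fderiv_eq_neg_fderiv_smul_of_integrable (μ := MeasureTheory.volume)
    (f := (phase : E n × E n → ℂ)) (g := fun p => χ (ε • p) • b p) (v := pdir n e)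
    (by simp only [e2]; exact i4.smul _)
    (by simp only [e1]; exact i1.add (i2.smul ε))
    (i3.congr (Filter.Eventually.of_forall fun p => by
      simp only [smul_smul, mul_comm (phase p)]))
    (fun p _ => contDiff_phase.differentiable (by simp) p)
    (fun p _ => ((hχd p).differentiableAt).smul (hbd p))
  simp only [e1, e2] at ibp
  rw [MeasureTheory.integral_add i1 (g := fun p => ε • ((χ' (ε • p) * phase p) • b p))
    (i2.smul ε), MeasureTheory.integral_smul,
    MeasureTheory.integral_smul] at ibp
  rw [smul_comm ε, ← smul_add, ibp]
  simp only [neg_smul, neg_neg]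
  rw [smul_comm Complex.I, smul_smul, Complex.I_mul_I, neg_smul, one_smul, smul_neg, neg_neg]

end Oscillatory

/-! ### Lowering the order of amplitudes; existence of oscillatory integrals; Fourier inversion. -/

section Oscillatory

variable {n : ℕ}

/-- `⟨(y,η)⟩⁻²`. -/
def jbInv (p : E n × E n) : ℝ := (1 + ‖p.1‖ ^ 2 + ‖p.2‖ ^ 2)⁻¹

theorem jbInv_eq (p : E n × E n) : jbInv p = jb p ^ (-2 : ℝ) := by
  rw [jbInv, ← jb_sq, Real.rpow_neg (jb_pos p).le]
  norm_cast

/-- The coordinate along the direction `pdir n e`. -/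
def coordP (e : Fin n ⊕ Fin n) : E n × E n →L[ℝ] ℝ := dualCoord e.swap

theorem dd_jbInv (e : Fin n ⊕ Fin n) (p : E n × E n) :
    dd (pdir n e) jbInv p = (-2 : ℝ) • (coordP e p • (jbInv p • jbInv p)) := by
  have h1 : HasFDerivAt (fun p : E n × E n => 1 + ‖p.1‖ ^ 2 + ‖p.2‖ ^ 2) _ p :=
    (((hasFDerivAt_fst (𝕜 := ℝ) (p := p)).norm_sq).const_add 1).add (hasFDerivAt_snd (p := p)).norm_sq
  have h0 : (1 + ‖p.1‖ ^ 2 + ‖p.2‖ ^ 2) ≠ 0 := by positivity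
  have h2 : HasFDerivAt (jbInv : E n × E n → ℝ) _ p := (hasDerivAt_inv h0).comp_hasFDerivAt p h1
  rw [dd, h2.fderiv]
  rcases e with j | j
  · simp [pdir, coordP, dualCoord, jbInv, stdVec, EuclideanSpace.inner_single_right]
    field_simp
  · simp [pdir, coordP, dualCoord, jbInv, stdVec, EuclideanSpace.inner_single_right]
    field_simp

/-- A derivative of ⟨p⟩⁻² is a multiple of a coordinate times ⟨p⟩⁻⁴, of order 1 - 4 ≤ -2, so the
estimate for k derivatives yields the one for k + 1. -/
theorem amp_jbInv : Amp (-2) (jbInv : E n × E n → ℝ) := by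
  have hs : ContDiff ℝ ∞ (jbInv : E n × E n → ℝ) := by
    refine ContDiff.inv ?_ fun p => by positivity
    exact (contDiff_const.add (contDiff_fst.norm_sq ℝ)).add (contDiff_snd.norm_sq ℝ)
  have hb : BoundedBy (gradP n) (fun p => jb p ^ (-2 : ℝ)) (jbInv : E n × E n → ℝ) := fun r =>
    ⟨1, fun p _ => by
      simp only [← jbInv_eq, one_mul]
      rw [Real.norm_of_nonneg]
      unfold jbInv; positivity⟩
  intro k
  induction k with
  | zero => exact ⟨hs.contDiffOn, hb⟩
  | succ k ih =>
    refine ⟨⟨hs.contDiffOn, hb⟩, fun e => Cls.congr ?_ (fun p _ => dd_jbInv e p)⟩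
    have h1 := (sym_const (𝒢 := gradP n) (W := fun _ => 1) (WLE.refl fun _ => zero_le_one)
      (-2 : ℝ) k).smul ((amp_dualCoord (n := n) (Sum.swap e) k).smul (ih.smul ih))
    refine h1.mono (WLE.of_le (fun p => ?_) fun p => ?_)
    · have := jb_pos p; positivity
    · simp only [gradP, one_mul, mul_one]
      rw [← Real.rpow_add (jb_pos p), ← Real.rpow_add (jb_pos p)]
      exact jb_rpow_le (by norm_num) p

/-- `λ_e ⟨(y,η)⟩⁻²`. -/
def ibpCoef (e : Fin n ⊕ Fin n) (p : E n × E n) : ℝ := dualCoord e p • jbInv p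

theorem amp_ibpCoef (e : Fin n ⊕ Fin n) : Amp (-1) (ibpCoef e) := by
  have := (amp_dualCoord e).smul (amp_jbInv (n := n))
  norm_num at this
  exact this

/-- This is 1 = ⟨p⟩⁻²(1 + ∑ λ_e²) with λ_e = `dualCoord e`. In an oscillatory integral the outer
factor λ_e can be exchanged for a derivative, which is neutral; the coefficients that remain have
orders -2 and -1, so one order is gained. -/
theorem ibp_decomposition {F : Type*} [NormedAddCommGroup F] [NormedSpace ℝ F]
    (a : E n × E n → F) (p : E n × E n) :
    jbInv p • a p + ∑ e, dualCoord e p • (ibpCoef e p • a p) = a p := by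
  have : ∀ e, dualCoord e p • (ibpCoef e p • a p) =
      (dualCoord e p * dualCoord e p) • (jbInv p • a p) := fun e => by
    simp only [ibpCoef, smul_smul, smul_eq_mul]; congr 1; ring
  simp_rw [this]
  rw [← Finset.sum_smul, sum_dualCoord_sq, smul_smul, ← add_smul, ← one_add_mul, ← add_assoc,
    jbInv, mul_inv_cancel₀ (by positivity), one_smul]

variable {F : Type*} [NormedAddCommGroup F] [NormedSpace ℂ F]

theorem integrable_jb {q : ℝ} (hq : q < -(2 * n)) :
    MeasureTheory.Integrable fun p : E n × E n => jb p ^ q := by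
  have h : (Module.finrank ℝ (E n × E n) : ℝ) < -q := by
    simp
    linarith
  have := integrable_rpow_neg_one_add_norm_sq (μ := (MeasureTheory.volume :
    MeasureTheory.Measure (E n × E n))) h
  have hcont : Continuous fun p : E n × E n => jb p ^ q := by
    refine Continuous.rpow_const ?_ fun p => Or.inl (jb_pos p).ne'
    unfold jb; fun_prop
  refine this.mono' hcont.aestronglyMeasurable
    (Filter.Eventually.of_forall fun p => ?_)
  rw [Real.norm_of_nonneg (jb_rpow_nonneg q p), neg_neg]
  have h1 : jb p ^ q = (jb p ^ 2) ^ (q / 2) := by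
    rw [← Real.rpow_natCast, ← Real.rpow_mul (jb_pos p).le]; congr 1; push_cast; ring
  rw [h1, jb_sq]
  refine Real.rpow_le_rpow_of_nonpos (by positivity) ?_ ?_
  · rcases max_choice ‖p.1‖ ‖p.2‖ with h | h <;> rw [Prod.norm_def, h] <;>
      nlinarith [sq_nonneg ‖p.1‖, sq_nonneg ‖p.2‖]
  · have : (0 : ℝ) ≤ n := Nat.cast_nonneg n
    linarith

theorem hasOsc_of_integrable [CompleteSpace F] {q : ℝ} (hq : q < -(2 * n)) {a : E n × E n → F}
    (hc : Continuous a) (ha : ∃ C, ∀ p, ‖a p‖ ≤ C * jb p ^ q) :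
    HasOsc a ((((2 * Real.pi) ^ n)⁻¹ : ℝ) • ∫ p, phase p • a p) := fun χ => by
  refine ⟨fun ε hε => integrable_schwartz_smul hc ha χ hε, ?_⟩
  obtain ⟨C, hC⟩ := ha
  obtain ⟨D, hD⟩ : ∃ D, ∀ p, ‖χ p‖ ≤ D := by
    obtain ⟨D, hD⟩ := χ.decay 0 0
    exact ⟨D, fun p => by simpa using hD.2 p⟩
  rw [smul_comm, ← MeasureTheory.integral_smul]
  refine Filter.Tendsto.const_smul ?_ _
  refine MeasureTheory.tendsto_integral_filter_of_dominated_convergence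
    (fun p => |D| * (C * jb p ^ q)) ?_ ?_ (((integrable_jb hq).const_mul C).const_mul |D|) ?_
  · refine Filter.Eventually.of_forall fun ε => Continuous.aestronglyMeasurable ?_
    exact ((χ.continuous.comp (continuous_const_smul ε)).mul contDiff_phase.continuous).smul hc
  · refine Filter.Eventually.of_forall fun ε => Filter.Eventually.of_forall fun p => ?_
    rw [norm_smul, norm_mul, norm_phase, mul_one]
    exact mul_le_mul ((hD _).trans (le_abs_self D)) (hC p) (norm_nonneg _) (abs_nonneg _)
  · refine Filter.Eventually.of_forall fun p => ?_
    rw [smul_smul]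
    refine Filter.Tendsto.smul_const (Filter.Tendsto.mul_const _ ?_) _
    have : Filter.Tendsto (fun ε : ℝ => χ (ε • p)) (𝓝 0) (𝓝 (χ ((0 : ℝ) • p))) :=
      (χ.continuous.comp (continuous_id.smul continuous_const)).tendsto 0
    rw [zero_smul] at this
    exact tendsto_nhdsWithin_of_tendsto_nhds this

/-- Each integration by parts lowers the order by at least one; once it is below -2n, the dimension
with a minus sign, dominated convergence gives the limit. The induction variable N bounds the number
of steps. -/
theorem Amp.exists_hasOsc [CompleteSpace F] {q : ℝ} {a : E n × E n → F} (ha : Amp q a) :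
    ∃ v, HasOsc a v := by
  obtain ⟨N, hN⟩ := exists_nat_gt (q + 2 * n)
  have : ∀ (N : ℕ) (q : ℝ), q + 2 * n < N → ∀ a : E n × E n → F, Amp q a → ∃ v, HasOsc a v := by
    intro N
    induction N with
    | zero =>
      intro q hq a ha
      push_cast at hq
      exact ⟨_, hasOsc_of_integrable (by linarith) ha.contDiff.continuous ha.bound⟩
    | succ N ih =>
      intro q hq a ha
      push_cast at hq
      have h1 := (amp_jbInv (n := n)).smul ha
      have h2 := fun e => (amp_ibpCoef (n := n) e).smul ha
      obtain ⟨v, hv⟩ := ih (-2 + q) (by linarith) _ h1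
      choose w hw using fun e => ih (-1 + q) (by linarith) _ (h2 e)
      choose w' hw' using fun e => ih (-1 + q) (by linarith) _ ((h2 e).dd e)
      have h3 := hv.add (HasOsc.sum Finset.univ fun e _ =>
        HasOsc.dualCoord_smul (h2 e) e (hw' e) (hw e))
      simp only [ibp_decomposition] at h3
      exact ⟨_, h3⟩
  exact this N q hN a ha

open Classical in
/-- The value of an oscillatory integral. -/
def osc (a : E n × E n → F) : F := if h : ∃ v, HasOsc a v then h.choose else 0

theorem HasOsc.osc_eq {a : E n × E n → F} {v : F} (h : HasOsc a v) : osc a = v := by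
  have h' : ∃ v, HasOsc a v := ⟨v, h⟩
  rw [osc, dif_pos h']
  exact h'.choose_spec.unique h

theorem Amp.hasOsc [CompleteSpace F] {q : ℝ} {a : E n × E n → F} (ha : Amp q a) :
    HasOsc a (osc a) := by
  obtain ⟨v, hv⟩ := ha.exists_hasOsc
  rwa [hv.osc_eq]

/-- The operator that lowers the order of an amplitude without changing its oscillatory
integral. -/
def lower {X : Type*} [NormedAddCommGroup X] [NormedSpace ℝ X] (a : X × (E n × E n) → F) :
    X × (E n × E n) → F := fun x =>
  jbInv x.2 • a x + ∑ e, (-Complex.I) • dd (0, pdir n e) (fun x => ibpCoef e x.2 • a x) x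

/-- Fourier inversion. The limit exists for every cutoff, so it can be computed with a tensor
product φ ⊗ φ; then the η-integral is a rescaled Fourier transform of φ, which acts in y as an
approximate identity at 0. -/
theorem HasOsc.const [CompleteSpace F] {q : ℝ} {U : E n → F}
    (hU : Amp q (fun p : E n × E n => U p.1)) :
    HasOsc (fun p : E n × E n => U p.1) (U 0) := by
  obtain ⟨v, hv⟩ := hU.exists_hasOsc
  suffices v = U 0 by rwa [← this]
  obtain ⟨χ, φ, h0, hχ⟩ := exists_schwartz_tensor n
  have hχ0 : χ 0 = 1 := by rw [hχ]; simp [h0]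
  refine tendsto_nhds_unique (f := fun ε : ℝ => (((2 * Real.pi) ^ n)⁻¹ : ℝ) •
    ∫ p, (χ (ε • p) * phase p) • U p.1) (l := 𝓝[>] (0 : ℝ)) (by simpa [hχ0] using (hv χ).2) ?_
  have hUc : Continuous U := by
    have := hU.contDiff.continuous.comp (Continuous.prodMk continuous_id
      (continuous_const (y := (0 : E n))))
    exact this
  set Φ : 𝓢(E n, ℂ) := FourierTransform.fourier φ with hΦ
  have hΦi : ∫ w, Φ w = 1 := by
    have h1 := congrFun (φ.continuous.fourierInv_fourier_eq φ.integrable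
      (by rw [← SchwartzMap.fourier_coe]; exact Φ.integrable)) 0
    rw [Real.fourierInv_eq', h0] at h1
    simpa [← SchwartzMap.fourier_coe, ← hΦ] using h1
  -- Substitution y = 2πε w. The powers of ε and of 2π cancel, φ(ε y) becomes φ(2πε² w) and U(y)
  -- becomes U(2πε w), so only the integrable factor Φ(w) survives as ε → 0.
  have hintegrable : ∀ ε : ℝ, 0 < ε → (((2 * Real.pi) ^ n)⁻¹ : ℝ) • ∫ p, (χ (ε • p) * phase p) • U p.1
      = ∫ w, (φ ((ε * (ε * (2 * Real.pi))) • w) * Φ w) • U ((ε * (2 * Real.pi)) • w) := by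
    intro ε hε
    have hpi := Real.pi_pos
    have h1 : ∫ p, (χ (ε • p) * phase p) • U p.1 =
        ∫ y, ∫ η, (χ (ε • (y, η)) * phase (y, η)) • U y :=
      MeasureTheory.integral_prod _ (hU.integrable χ hε)
    have h2 : ∀ y, ∫ η, (χ (ε • (y, η)) * phase (y, η)) • U y =
        ((ε ^ n)⁻¹ : ℝ) • ((φ (ε • y) * Φ ((2 * Real.pi * ε)⁻¹ • y)) • U y) := fun y => by
      rw [integral_smul_const]
      have h3 : (fun η => χ (ε • (y, η)) * phase (y, η)) = fun η =>
          φ (ε • y) * (fun η' => Complex.exp (-(Complex.I * (inner ℝ (ε⁻¹ • y) η' : ℝ))) * φ η')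
            (ε • η) := by
        ext η
        simp only [hχ, phase, Prod.smul_fst, Prod.smul_snd]
        rw [inner_smul_left, inner_smul_right]
        simp only [conj_trivial]
        rw [← mul_assoc ε⁻¹ ε, inv_mul_cancel₀ hε.ne', one_mul]
        ring
      rw [h3, MeasureTheory.integral_const_mul, MeasureTheory.Measure.integral_comp_smul_of_nonneg
        MeasureTheory.volume (fun η' : E n => Complex.exp (-(Complex.I *
          (inner ℝ (ε⁻¹ • y) η' : ℝ))) * φ η') ε (hR := hε.le), finrank_euclideanSpace_fin,
        ← smul_assoc, mul_smul_comm]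
      congr 3
      rw [hΦ, SchwartzMap.fourier_coe, Real.fourier_eq']
      refine MeasureTheory.integral_congr_ae (Filter.Eventually.of_forall fun η => ?_)
      simp only [smul_eq_mul]
      congr 2
      rw [real_inner_comm, inner_smul_right, inner_smul_right]
      push_cast
      field_simp
    simp_rw [h1, h2]
    rw [MeasureTheory.integral_smul]
    have h4 : (fun y => (φ (ε • y) * Φ ((2 * Real.pi * ε)⁻¹ • y)) • U y) = fun y =>
        (fun w => (φ ((ε * (ε * (2 * Real.pi))) • w) * Φ w) • U ((ε * (2 * Real.pi)) • w))
          ((2 * Real.pi * ε)⁻¹ • y) := by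
      ext y
      simp only [smul_smul]
      have e1 : ε * (ε * (2 * Real.pi)) * (2 * Real.pi * ε)⁻¹ = ε := by field_simp
      have e2 : ε * (2 * Real.pi) * (2 * Real.pi * ε)⁻¹ = 1 := by field_simp
      rw [e1, e2, one_smul]
    rw [h4, MeasureTheory.Measure.integral_comp_smul_of_nonneg MeasureTheory.volume
      (fun w : E n => (φ ((ε * (ε * (2 * Real.pi))) • w) * Φ w) • U ((ε * (2 * Real.pi)) • w))
      (2 * Real.pi * ε)⁻¹ (hR := by positivity),
      finrank_euclideanSpace_fin, smul_smul, smul_smul]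
    have e3 : ((2 * Real.pi) ^ n)⁻¹ * (ε ^ n)⁻¹ * (((2 * Real.pi * ε)⁻¹) ^ n)⁻¹ = 1 := by
      rw [inv_pow, inv_inv, mul_pow (2 * Real.pi) ε n]; field_simp
    rw [← mul_assoc, e3, one_smul]
  obtain ⟨C, hC⟩ := hU.bound
  obtain ⟨k, hk⟩ := exists_nat_ge q
  obtain ⟨D, hD⟩ : ∃ D, ∀ p, ‖φ p‖ ≤ D := by
    obtain ⟨D, hD⟩ := φ.decay 0 0
    exact ⟨D, fun p => by simpa using hD.2 p⟩
  have hlim : Filter.Tendsto (fun ε : ℝ => ∫ w, (φ ((ε * (ε * (2 * Real.pi))) • w) * Φ w) •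
      U ((ε * (2 * Real.pi)) • w)) (𝓝[>] 0) (𝓝 (∫ w, (Φ w) • U 0)) := by
    -- For ε ≤ 1 one has 2πε ≤ 8, hence 1 + 2·8‖w‖ ≤ 20(1 + ‖w‖); this is the source of the constant
    -- 20.
    have hI : MeasureTheory.Integrable fun w : E n =>
        |D| * |C| * 20 ^ k * ((1 + ‖w‖) ^ k * ‖Φ w‖) := by
      refine MeasureTheory.Integrable.const_mul ?_ _
      simp only [add_pow, one_pow, one_mul, Finset.sum_mul]
      refine MeasureTheory.integrable_finsetSum _ fun i _ => ?_
      have := (Φ.integrable_pow_mul MeasureTheory.volume (k - i)).const_mul (k.choose i : ℝ)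
      refine this.congr (Filter.Eventually.of_forall fun p => ?_)
      simp only; ring
    refine MeasureTheory.tendsto_integral_filter_of_dominated_convergence _ ?_ ?_ hI ?_
    · refine Filter.Eventually.of_forall fun ε => Continuous.aestronglyMeasurable ?_
      exact ((φ.continuous.comp (continuous_const_smul _)).mul Φ.continuous).smul
        (hUc.comp (continuous_const_smul _))
    · have hev : ∀ᶠ ε : ℝ in 𝓝[>] 0, ε ∈ Set.Ioc (0 : ℝ) 1 :=
        Ioc_mem_nhdsGT one_pos
      filter_upwards [hev] with ε hε
      refine Filter.Eventually.of_forall fun w => ?_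
      rw [norm_smul, norm_mul]
      have hb : ‖U ((ε * (2 * Real.pi)) • w)‖ ≤ |C| * (20 * (1 + ‖w‖)) ^ k := by
        have h5 := hC ((ε * (2 * Real.pi)) • w, 0)
        refine h5.trans ?_
        refine mul_le_mul (le_abs_self C) ?_ (jb_rpow_nonneg _ _) (abs_nonneg _)
        refine (jb_rpow_le hk _).trans ?_
        rw [Real.rpow_natCast]
        refine pow_le_pow_left₀ (jb_pos _).le ((jb_le _).trans ?_) k
        have h6 : ‖(((ε * (2 * Real.pi)) • w, 0) : E n × E n)‖ = ε * (2 * Real.pi) * ‖w‖ := by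
          rw [Prod.norm_mk, norm_zero, max_eq_left (norm_nonneg _), norm_smul, Real.norm_eq_abs,
            abs_of_nonneg (by have := hε.1; have := Real.pi_pos; positivity)]
        rw [h6]
        have hpi := Real.pi_lt_four
        have hpi0 := Real.pi_pos
        have : ε * (2 * Real.pi) ≤ 8 := by nlinarith [hε.1, hε.2]
        nlinarith [norm_nonneg w]
      calc _ ≤ (|D| * ‖Φ w‖) * (|C| * (20 * (1 + ‖w‖)) ^ k) := by
            refine mul_le_mul ?_ hb (norm_nonneg _) (by positivity)
            exact mul_le_mul_of_nonneg_right ((hD _).trans (le_abs_self D)) (norm_nonneg _)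
        _ = _ := by rw [mul_pow]; ring
    · refine Filter.Eventually.of_forall fun w => ?_
      have hcont : Continuous fun ε : ℝ => (φ ((ε * (ε * (2 * Real.pi))) • w) * Φ w) •
          U ((ε * (2 * Real.pi)) • w) := by
        refine ((φ.continuous.comp ?_).mul continuous_const).smul (hUc.comp ?_) <;> fun_prop
      have := hcont.tendsto 0
      simp only [zero_mul, zero_smul, h0, one_mul] at this
      exact tendsto_nhdsWithin_of_tendsto_nhds this
  rw [integral_smul_const, hΦi, one_smul] at hlim
  refine hlim.congr' ?_
  filter_upwards [self_mem_nhdsWithin] with ε hε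
  exact (hintegrable ε hε).symm

end Oscillatory

/-! ### Oscillatory integrals depending on parameters -/

section Parametric

variable {n : ℕ} {X : Type} [NormedAddCommGroup X] [NormedSpace ℝ X]
  {F : Type*} [NormedAddCommGroup F] [NormedSpace ℂ F]

/-- The grading for amplitudes with parameters. -/
def Grading.amp (n : ℕ) (𝒢 : Grading X) : Grading (X × (E n × E n)) where
  dom := 𝒢.dom ×ˢ Set.univ
  isOpen_dom := 𝒢.isOpen_dom.prod isOpen_univ
  ι := 𝒢.ι ⊕ (Fin n ⊕ Fin n)
  dir := Sum.elim (fun i => (𝒢.dir i, 0)) (fun e => (0, pdir n e))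
  -- The exponent 2 pays for the worst parameter derivative that occurs in the composition, the one
  -- in s: one power of jb for its coefficient η and one for Peetre's inequality. Any finite loss is
  -- harmless, because `lower` recovers it.
  wt := Sum.elim (fun i x => 𝒢.wt i x.1 * jb x.2 ^ (2 : ℝ)) (fun _ _ => 1)
  wt_nonneg := by
    rintro (i | e) x
    · exact mul_nonneg (𝒢.wt_nonneg i _) (jb_rpow_nonneg _ _)
    · exact zero_le_one
  bdd := fun r => 𝒢.bdd r ×ˢ Set.univ
  bdd_subset := fun r => Set.prod_mono (𝒢.bdd_subset r) subset_rfl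

/-- The regularity of a grading that is needed for differentiation under the integral sign. -/
structure Grading.Regular (𝒢 : Grading X) where
  /-- The directions form a basis. -/
  basis : Module.Basis 𝒢.ι ℝ X
  basis_eq : ∀ i, basis i = 𝒢.dir i
  loc : ∀ x ∈ 𝒢.dom, ∃ r, 𝒢.bdd r ∈ 𝓝 x
  wt_cont : ∀ i, ContinuousOn (𝒢.wt i) 𝒢.dom

variable {𝒢 : Grading X}

theorem Grading.Regular.mem_bdd (R : 𝒢.Regular) {x : X} (hx : x ∈ 𝒢.dom) : ∃ r, x ∈ 𝒢.bdd r := by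
  obtain ⟨r, hr⟩ := R.loc x hx
  exact ⟨r, mem_of_mem_nhds hr⟩

variable (𝒢) in
/-- Amplitudes with parameters. -/
def PAmp (W : X → ℝ) (q : ℝ) {F : Type*} [NormedAddCommGroup F] [NormedSpace ℝ F]
    (a : X × (E n × E n) → F) : Prop :=
  Sym (𝒢.amp n) (fun x => W x.1 * jb x.2 ^ q) a

/-- The Kronecker symbol. -/
def kron (κ : Type*) [DecidableEq κ] (i j : κ) : ℝ := if i = j then 1 else 0

/-- Restriction to a fixed parameter. -/
def substFix {x : X} {r : ℕ} (hx : x ∈ 𝒢.bdd r) :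
    Subst (gradP n) (𝒢.amp n) (fun p => (x, p)) where
  coef := fun e j _ => Sum.elim (fun _ => 0)
    (fun e' => kron (Fin n ⊕ Fin n) e' e) j
  cwt := fun _ j _ => Sum.elim (fun _ => 0) (fun _ => 1) j
  contDiffOn := (contDiff_const.prodMk contDiff_id).contDiffOn
  mapsTo := fun p _ => ⟨𝒢.bdd_subset r hx, trivial⟩
  bdd := fun _ => ⟨r, fun p _ => ⟨hx, trivial⟩⟩
  dd_eq := fun e p _ => by
    have : HasFDerivAt (fun p : E n × E n => (x, p)) _ p :=
      (hasFDerivAt_const (𝕜 := ℝ) x p).prodMk (hasFDerivAt_id p)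
    simp only [dd, this.fderiv]
    erw [Fintype.sum_sum_type]
    rcases e with e | e <;> simp [Grading.amp, gradP, kron]
  sym_coef := fun e j => by
    rcases j with i | e'
    · exact sym_zero _
    · exact sym_const (WLE.refl fun _ => zero_le_one) _
  le := fun e j => by
    rcases j with i | e'
    · exact fun r => ⟨1, fun p _ => by simp [gradP]⟩
    · exact fun r => ⟨1, fun p _ => by simp [gradP, Grading.amp]⟩

theorem PAmp.fix {F : Type*} [NormedAddCommGroup F] [NormedSpace ℝ F] {W : X → ℝ}
    (hW : ∀ x, 0 ≤ W x) {q : ℝ} {a : X × (E n × E n) → F}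
    (ha : PAmp 𝒢 W q a) {x : X} {r : ℕ} (hx : x ∈ 𝒢.bdd r) : Amp q (fun p => a (x, p)) := by
  have := (substFix (n := n) hx).sym (fun x => mul_nonneg (hW _) (jb_rpow_nonneg _ _)) ha
  exact Sym.mono this fun _ => ⟨W x, fun p _ => by
    rw [abs_of_nonneg (mul_nonneg (hW _) (jb_rpow_nonneg _ _))]⟩

/-- Projection to the variables of the oscillatory integral. -/
def substSnd (n : ℕ) (𝒢 : Grading X) :
    Subst (𝒢.amp n) (gradP n) (fun x : X × (E n × E n) => x.2) where
  coef := fun j e _ => Sum.elim (fun _ => 0)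
    (fun e' => kron (Fin n ⊕ Fin n) e' e) j
  cwt := fun j _ _ => Sum.elim (fun _ => 0) (fun _ => 1) j
  contDiffOn := contDiff_snd.contDiffOn
  mapsTo := fun _ _ => trivial
  bdd := fun _ => ⟨0, fun _ _ => trivial⟩
  dd_eq := fun j x _ => by
    simp only [dd, hasFDerivAt_snd.fderiv]
    erw [Fintype.sum_sum_type]
    rcases j with i | (e | e) <;> simp [Grading.amp, gradP, kron]
  sym_coef := fun j e => by
    rcases j with i | e'
    · exact sym_zero _
    · exact sym_const (WLE.refl fun _ => zero_le_one) _
  le := fun j e => by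
    rcases j with i | e'
    · exact fun r => ⟨1, fun x _ => by
        have := mul_nonneg (𝒢.wt_nonneg i x.1) (jb_rpow_nonneg 2 x.2)
        simpa [gradP, Grading.amp] using this⟩
    · exact fun r => ⟨1, fun p _ => by simp [gradP, Grading.amp]⟩

theorem Amp.pull {F : Type*} [NormedAddCommGroup F] [NormedSpace ℝ F] {q : ℝ}
    {c : E n × E n → F} (hc : Amp q c) :
    Sym (𝒢.amp n) (fun x => jb x.2 ^ q) (fun x => c x.2) :=
  (substSnd n 𝒢).sym (fun p => jb_rpow_nonneg q p) hc

theorem PAmp.smul_pull {F : Type*} [NormedAddCommGroup F] [NormedSpace ℝ F] {W : X → ℝ}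
    (hW : ∀ x, 0 ≤ W x) {q q' : ℝ} {c : E n × E n → ℝ}
    (hc : Amp q' c) {a : X × (E n × E n) → F} (ha : PAmp 𝒢 W q a) :
    PAmp 𝒢 W (q' + q) (fun x => c x.2 • a x) := by
  have := (Amp.pull (𝒢 := 𝒢) hc).smul ha
  refine Sym.mono this (WLE.of_le (fun x => ?_) fun x => ?_)
  · exact mul_nonneg (jb_rpow_nonneg _ _) (mul_nonneg (hW _) (jb_rpow_nonneg _ _))
  · rw [Real.rpow_add (jb_pos _)]
    exact le_of_eq (by ring)

theorem PAmp.mono {F : Type*} [NormedAddCommGroup F] [NormedSpace ℝ F] {W : X → ℝ}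
    (hW : ∀ x, 0 ≤ W x) {q q' : ℝ} (h : q ≤ q')
    {a : X × (E n × E n) → F} (ha : PAmp 𝒢 W q a) : PAmp 𝒢 W q' a :=
  Sym.mono ha (WLE.of_le (fun _ => mul_nonneg (hW _) (jb_rpow_nonneg _ _))
    fun _ => mul_le_mul_of_nonneg_left (jb_rpow_le h _) (hW _))

theorem PAmp.ddP {F : Type*} [NormedAddCommGroup F] [NormedSpace ℝ F] {W : X → ℝ} {q : ℝ}
    {a : X × (E n × E n) → F} (ha : PAmp 𝒢 W q a) (e : Fin n ⊕ Fin n) :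
    PAmp 𝒢 W q (dd (0, pdir n e) a) := by
  have := Sym.dd (𝒢 := 𝒢.amp n) ha (Sum.inr e)
  simp only [Grading.amp, Sum.elim_inr, mul_one] at this
  exact this

theorem PAmp.ddX {F : Type*} [NormedAddCommGroup F] [NormedSpace ℝ F] {W : X → ℝ} {q : ℝ}
    {a : X × (E n × E n) → F} (ha : PAmp 𝒢 W q a) (i : 𝒢.ι) :
    PAmp 𝒢 (fun x => W x * 𝒢.wt i x) (q + 2) (dd (𝒢.dir i, 0) a) := by
  have := Sym.dd (𝒢 := 𝒢.amp n) ha (Sum.inl i)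
  have e : (fun x : X × (E n × E n) => W x.1 * 𝒢.wt i x.1 * jb x.2 ^ (q + 2)) =
      fun x => W x.1 * jb x.2 ^ q * (𝒢.amp n).wt (Sum.inl i) x := by
    ext x
    simp only [Grading.amp, Sum.elim_inl]
    rw [Real.rpow_add (jb_pos _)]
    ring
  unfold PAmp
  rw [e]
  exact this

theorem pAmp_lower {W : X → ℝ} (hW : ∀ x, 0 ≤ W x) {q : ℝ} {a : X × (E n × E n) → F}
    (ha : PAmp 𝒢 W q a) : PAmp 𝒢 W (q - 1) (lower a) := by
  refine Sym.add ?_ (Sym.sum _ fun e _ => Sym.const_smul (-Complex.I) ?_)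
  · exact PAmp.mono hW (by linarith) (PAmp.smul_pull hW amp_jbInv ha)
  · exact PAmp.mono hW (by linarith) (PAmp.ddP (PAmp.smul_pull hW (amp_ibpCoef e) ha) e)

theorem dd_fix {F : Type*} [NormedAddCommGroup F] [NormedSpace ℝ F] {Ω : Set X} (hΩ : IsOpen Ω)
    {P : Type*} [NormedAddCommGroup P] [NormedSpace ℝ P] {a : X × P → F}
    (ha : ContDiffOn ℝ ∞ a (Ω ×ˢ Set.univ)) {x : X} (hx : x ∈ Ω) (v p : P) :
    dd v (fun p => a (x, p)) p = dd (0, v) a (x, p) := by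
  have hT : HasFDerivAt (fun p : P => (x, p)) _ p :=
    (hasFDerivAt_const (𝕜 := ℝ) x p).prodMk (hasFDerivAt_id p)
  have h := dd_comp (hΩ.prod isOpen_univ) isOpen_univ ha (T := fun p : P => (x, p))
    ((contDiff_const.prodMk contDiff_id).contDiffOn) (fun p _ => ⟨hx, trivial⟩) v (Set.mem_univ p)
  rw [h]
  simp [dd, hT.fderiv]

theorem osc_lower [CompleteSpace F] (R : 𝒢.Regular) {W : X → ℝ} (hW : ∀ x, 0 ≤ W x) {q : ℝ}
    {a : X × (E n × E n) → F} (ha : PAmp 𝒢 W q a) {x : X} (hx : x ∈ 𝒢.dom) :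
    osc (fun p => lower a (x, p)) = osc (fun p => a (x, p)) := by
  obtain ⟨r, hr⟩ := R.mem_bdd hx
  have hax := ha.fix hW hr
  have h1 := (amp_jbInv (n := n)).smul hax
  have h2 := fun e => (amp_ibpCoef (n := n) e).smul hax
  have h3 := h1.hasOsc.add (HasOsc.sum Finset.univ fun e _ =>
    HasOsc.dualCoord_smul (h2 e) e ((h2 e).dd e).hasOsc (h2 e).hasOsc)
  have h4 := h1.hasOsc.add (HasOsc.sum Finset.univ fun e _ =>
    ((h2 e).dd e).hasOsc.const_smul (-Complex.I))
  have h5 := fun p => ibp_decomposition (fun p => a (x, p)) p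
  simp only [h5] at h3
  rw [h3.osc_eq, ← h4.osc_eq]
  congr 1
  ext p
  simp only [lower]
  congr 1
  refine Finset.sum_congr rfl fun e _ => ?_
  have := dd_fix 𝒢.isOpen_dom (Sym.contDiffOn (PAmp.smul_pull hW (amp_ibpCoef e) ha)) hx
    (pdir n e) p
  rw [← this]

/-- The coefficients of `lower` depend on (y,η) only, and partial derivatives commute. -/
theorem dd_lower {W : X → ℝ} (hW : ∀ x, 0 ≤ W x) {q : ℝ}
    {a : X × (E n × E n) → F} (ha : PAmp 𝒢 W q a) (v : X) :
    Set.EqOn (dd (v, 0) (lower a)) (lower (dd (v, 0) a)) (𝒢.amp n).dom := by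
  have hO := (𝒢.amp n).isOpen_dom
  have key : ∀ {q' : ℝ} {c : E n × E n → ℝ}, Amp q' c →
      Set.EqOn (dd (v, 0) fun x : X × (E n × E n) => c x.2 • a x)
        (fun x => c x.2 • dd (v, 0) a x) (𝒢.amp n).dom := fun {q' c} hc x hx => by
    have hcd : ContDiff ℝ ∞ fun x : X × (E n × E n) => c x.2 := hc.contDiff.comp contDiff_snd
    have h := dd_bilin (ContinuousLinearMap.lsmul ℝ ℝ : ℝ →L[ℝ] F →L[ℝ] F) hO hcd.contDiffOn
      (Sym.contDiffOn ha) (v, 0) hx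
    have h0 : dd ((v, 0) : X × (E n × E n)) (fun x : X × (E n × E n) => c x.2) x = 0 := by
      have : HasFDerivAt (fun x : X × (E n × E n) => c x.2) _ x :=
        (hc.contDiff.differentiable (by simp) x.2).hasFDerivAt.comp x hasFDerivAt_snd
      simp [dd, this.fderiv]
    simp only [ContinuousLinearMap.lsmul_apply] at h
    rw [h, h0, zero_smul, zero_add]
  intro x hx
  have s1 := Sym.contDiffOn (PAmp.smul_pull hW (amp_jbInv (n := n)) ha)
  have s2 := fun e => Sym.contDiffOn (PAmp.smul_pull hW (amp_ibpCoef (n := n) e) ha)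
  have s3 := fun e => contDiffOn_dd hO (s2 e) (0, pdir n e)
  have s4 := fun e => (s3 e).const_smul (-Complex.I)
  unfold lower
  rw [dd_add hO s1 (ContDiffOn.sum fun e _ => s4 e) (v, 0) hx]
  beta_reduce
  rw [dd_sum hO _ (fun e _ => s4 e) _ hx, key amp_jbInv hx]
  congr 1
  refine Finset.sum_congr rfl fun e _ => ?_
  have h1 := dd_clm ((ContinuousLinearMap.lsmul ℝ ℂ : ℂ →L[ℝ] F →L[ℝ] F) (-Complex.I)) hO (s3 e)
    (v, 0) hx
  simp only [ContinuousLinearMap.lsmul_apply] at h1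
  refine h1.trans ?_
  rw [dd_comm hO (s2 e) _ _ hx, dd_eqOn hO (key (amp_ibpCoef e)) _ hx]

/-- The third clause is what differentiation under the integral sign needs: the parameter derivative
of the lowered, integrable amplitude has the same oscillatory integral as the parameter derivative
of the original one. -/
theorem lower_iterate {W : X → ℝ} (hW : ∀ x, 0 ≤ W x) {q : ℝ} [CompleteSpace F]
    {a : X × (E n × E n) → F} (ha : PAmp 𝒢 W q a) (R : 𝒢.Regular) (k : ℕ) :
    PAmp 𝒢 W (q - k) (lower^[k] a) ∧
    (∀ x ∈ 𝒢.dom, osc (fun p => lower^[k] a (x, p)) = osc (fun p => a (x, p))) ∧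
    ∀ i, ∀ x ∈ 𝒢.dom, osc (fun p => dd (𝒢.dir i, 0) (lower^[k] a) (x, p)) =
      osc (fun p => dd (𝒢.dir i, 0) a (x, p)) := by
  induction k with
  | zero => simpa using ha
  | succ k ih =>
    obtain ⟨h1, h2, h3⟩ := ih
    simp only [Function.iterate_succ', Function.comp]
    refine ⟨?_, fun x hx => ?_, fun i x hx => ?_⟩
    · have := pAmp_lower hW h1
      push_cast
      rwa [sub_sub] at this
    · rw [osc_lower R hW h1 hx, h2 x hx]
    · rw [← h3 i x hx, ← osc_lower R (fun x => mul_nonneg (hW x) (𝒢.wt_nonneg i x)) (h1.ddX i) hx]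
      congr 1
      ext p
      exact dd_lower hW h1 (𝒢.dir i) ⟨hx, trivial⟩

theorem PAmp.bound {F : Type*} [NormedAddCommGroup F] [NormedSpace ℝ F] {W : X → ℝ} {q : ℝ}
    {a : X × (E n × E n) → F} (ha : PAmp 𝒢 W q a) (r : ℕ) :
    ∃ C, ∀ x ∈ 𝒢.bdd r, ∀ p, ‖a (x, p)‖ ≤ C * (W x * jb p ^ q) := by
  obtain ⟨C, hC⟩ := Sym.boundedBy ha r
  exact ⟨C, fun x hx p => hC (x, p) ⟨hx, trivial⟩⟩

theorem PAmp.continuous_fix {F : Type*} [NormedAddCommGroup F] [NormedSpace ℝ F] {W : X → ℝ}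
    {q : ℝ} {a : X × (E n × E n) → F} (ha : PAmp 𝒢 W q a) {x : X} (hx : x ∈ 𝒢.dom) :
    Continuous fun p => a (x, p) :=
  (Sym.contDiffOn ha).continuousOn.comp_continuous (by fun_prop) fun p => ⟨hx, trivial⟩

theorem PAmp.osc_eq_integral [CompleteSpace F] {W : X → ℝ} {q : ℝ}
    (hq : q < -(2 * n)) {a : X × (E n × E n) → F} (ha : PAmp 𝒢 W q a) (R : 𝒢.Regular) {x : X}
    (hx : x ∈ 𝒢.dom) :
    osc (fun p => a (x, p)) = (((2 * Real.pi) ^ n)⁻¹ : ℝ) • ∫ p, phase p • a (x, p) := by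
  obtain ⟨r, hr⟩ := R.mem_bdd hx
  obtain ⟨C, hC⟩ := ha.bound r
  exact (hasOsc_of_integrable hq (ha.continuous_fix hx) ⟨C * W x, fun p =>
    (hC x hr p).trans (le_of_eq (by ring))⟩).osc_eq

/-- After k steps with q - k < -2n the integral converges absolutely. The weight W does not depend
on (y,η) and factors out, so the bound loses nothing in the parameters, however large q is. -/
theorem PAmp.boundedBy_osc [CompleteSpace F] {W : X → ℝ} (hW : ∀ x, 0 ≤ W x) {q : ℝ}
    {a : X × (E n × E n) → F} (ha : PAmp 𝒢 W q a) (R : 𝒢.Regular) :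
    BoundedBy 𝒢 W (fun x => osc (fun p => a (x, p))) := by
  obtain ⟨k, hk⟩ := exists_nat_gt (q + 2 * n)
  obtain ⟨h1, h2, -⟩ := lower_iterate hW ha R k
  have hq : q - k < -(2 * n) := by linarith
  intro r
  obtain ⟨C, hC⟩ := h1.bound r
  refine ⟨((2 * Real.pi) ^ n)⁻¹ * (C * ∫ p : E n × E n, jb p ^ (q - k)), fun x hx => ?_⟩
  have hxd := 𝒢.bdd_subset r hx
  beta_reduce
  rw [← h2 x hxd, h1.osc_eq_integral hq R hxd, norm_smul, Real.norm_of_nonneg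
    (by have := Real.pi_pos; positivity), mul_assoc]
  gcongr
  have : ∫ p : E n × E n, C * (W x * jb p ^ (q - k)) = C * (∫ p : E n × E n, jb p ^ (q - k)) * W x := by
    rw [MeasureTheory.integral_const_mul, MeasureTheory.integral_const_mul]; ring
  rw [← this]
  refine MeasureTheory.norm_integral_le_of_norm_le (((integrable_jb hq).const_mul _).const_mul _)
    (Filter.Eventually.of_forall fun p => ?_)
  rw [norm_smul, norm_phase, one_mul]
  exact hC x hx p

/-- A locally uniform integrable bound. -/
theorem PAmp.locally_bound {F : Type*} [NormedAddCommGroup F] [NormedSpace ℝ F] {W : X → ℝ}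
    (hW : ∀ x, 0 ≤ W x) (hWc : ContinuousOn W 𝒢.dom)
    {q : ℝ} {a : X × (E n × E n) → F} (ha : PAmp 𝒢 W q a) (R : 𝒢.Regular) {x₀ : X}
    (hx₀ : x₀ ∈ 𝒢.dom) :
    ∃ C, ∀ᶠ x in 𝓝 x₀, x ∈ 𝒢.dom ∧ ∀ p, ‖a (x, p)‖ ≤ C * jb p ^ q := by
  obtain ⟨r, hr⟩ := R.loc x₀ hx₀
  obtain ⟨C, hC⟩ := ha.bound r
  have h1 : ∀ᶠ x in 𝓝 x₀, W x < W x₀ + 1 :=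
    (hWc.continuousAt (𝒢.isOpen_dom.mem_nhds hx₀)).eventually_lt continuousAt_const (by linarith)
  refine ⟨|C| * (W x₀ + 1), ?_⟩
  filter_upwards [hr, h1] with x hx hx1
  refine ⟨𝒢.bdd_subset r hx, fun p => (hC x hx p).trans ?_⟩
  have h2 := jb_rpow_nonneg q p
  calc C * (W x * jb p ^ q) ≤ |C| * (W x * jb p ^ q) :=
        mul_le_mul_of_nonneg_right (le_abs_self C) (mul_nonneg (hW x) h2)
    _ ≤ |C| * ((W x₀ + 1) * jb p ^ q) := by gcongr
    _ = _ := by ring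

theorem PAmp.continuousOn_osc [CompleteSpace F] {W : X → ℝ} (hW : ∀ x, 0 ≤ W x)
    (hWc : ContinuousOn W 𝒢.dom) {q : ℝ}
    {a : X × (E n × E n) → F} (ha : PAmp 𝒢 W q a) (R : 𝒢.Regular) :
    ContinuousOn (fun x => osc (fun p => a (x, p))) 𝒢.dom := by
  obtain ⟨k, hk⟩ := exists_nat_gt (q + 2 * n)
  obtain ⟨h1, h2, -⟩ := lower_iterate hW ha R k
  have hq : q - k < -(2 * n) := by linarith
  have hcont : ContinuousOn (fun x => (((2 * Real.pi) ^ n)⁻¹ : ℝ) •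
      ∫ p, phase p • lower^[k] a (x, p)) 𝒢.dom := by
    intro x₀ hx₀
    refine ContinuousAt.continuousWithinAt (ContinuousAt.const_smul ?_ _)
    obtain ⟨C, hC⟩ := h1.locally_bound hW hWc R hx₀
    refine MeasureTheory.continuousAt_of_dominated (bound := fun p => C * jb p ^ (q - k)) ?_ ?_
      ((integrable_jb hq).const_mul C) ?_
    · filter_upwards [hC] with x hx
      exact (contDiff_phase.continuous.smul (h1.continuous_fix hx.1)).aestronglyMeasurable
    · filter_upwards [hC] with x hx
      refine Filter.Eventually.of_forall fun p => ?_
      rw [norm_smul, norm_phase, one_mul]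
      exact hx.2 p
    · refine Filter.Eventually.of_forall fun p => ContinuousAt.const_smul ?_ _
      have := (Sym.contDiffOn h1).continuousOn.continuousAt
        ((𝒢.amp n).isOpen_dom.mem_nhds (show (x₀, p) ∈ (𝒢.amp n).dom from ⟨hx₀, trivial⟩))
      exact ContinuousAt.comp (f := fun x : X => (x, p)) this (by fun_prop)
  refine hcont.congr fun x hx => ?_
  rw [← h2 x hx, h1.osc_eq_integral hq R hx]

theorem PAmp.hasLineDerivAt_osc [CompleteSpace F] {W : X → ℝ} (hW : ∀ x, 0 ≤ W x)
    (hWc : ContinuousOn W 𝒢.dom) {q : ℝ}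
    {a : X × (E n × E n) → F} (ha : PAmp 𝒢 W q a) (R : 𝒢.Regular) (i : 𝒢.ι) {x₀ : X}
    (hx₀ : x₀ ∈ 𝒢.dom) :
    HasLineDerivAt ℝ (fun x => osc (fun p => a (x, p)))
      (osc (fun p => dd (𝒢.dir i, 0) a (x₀, p))) x₀ (𝒢.dir i) := by
  -- The additional 2 is the order lost by one parameter derivative: the derivative must be
  -- dominated by an integrable function too.
  obtain ⟨k, hk⟩ := exists_nat_gt (q + 2 + 2 * n)
  obtain ⟨h1, h2, h3⟩ := lower_iterate hW ha R k
  have hq : q - k < -(2 * n) := by linarith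
  have hq2 : q - k + 2 < -(2 * n) := by linarith
  have h1' := h1.ddX i
  have hW' : ∀ x, 0 ≤ W x * 𝒢.wt i x := fun x => mul_nonneg (hW x) (𝒢.wt_nonneg i x)
  obtain ⟨C, hC⟩ := h1'.locally_bound hW' (hWc.mul (R.wt_cont i)) R hx₀
  have hline : Filter.Tendsto (fun τ : ℝ => x₀ + τ • 𝒢.dir i) (𝓝 0) (𝓝 x₀) := by
    have : Continuous fun τ : ℝ => x₀ + τ • 𝒢.dir i := by fun_prop
    simpa using this.tendsto 0
  have hs := hline.eventually hC
  obtain ⟨r, hr⟩ := R.mem_bdd hx₀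
  obtain ⟨D, hD⟩ := h1.bound r
  have hcf : ∀ {x}, x ∈ 𝒢.dom → Continuous fun p => phase p • lower^[k] a (x, p) := fun hx =>
    contDiff_phase.continuous.smul (h1.continuous_fix hx)
  have key := hasDerivAt_integral_of_dominated_loc_of_deriv_le (μ := MeasureTheory.volume)
    (F := fun τ p => phase p • lower^[k] a (x₀ + τ • 𝒢.dir i, p))
    (F' := fun τ p => phase p • dd (𝒢.dir i, 0) (lower^[k] a) (x₀ + τ • 𝒢.dir i, p))
    (x₀ := (0 : ℝ)) (bound := fun p => C * jb p ^ (q - k + 2)) hs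
    (hs.mono fun τ hτ => (hcf hτ.1).aestronglyMeasurable)
    (by
      simp only [zero_smul, add_zero]
      refine (((integrable_jb hq).const_mul (W x₀)).const_mul D).mono'
        (hcf hx₀).aestronglyMeasurable (Filter.Eventually.of_forall fun p => ?_)
      rw [norm_smul, norm_phase, one_mul]
      exact hD x₀ hr p)
    (by
      simp only [zero_smul, add_zero]
      exact (contDiff_phase.continuous.smul (h1'.continuous_fix hx₀)).aestronglyMeasurable)
    (Filter.Eventually.of_forall fun p τ hτ => by
      rw [norm_smul, norm_phase, one_mul]
      exact hτ.2 p)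
    ((integrable_jb hq2).const_mul C)
    (Filter.Eventually.of_forall fun p τ hτ => by
      refine HasDerivAt.const_smul (phase p) ?_
      have := hasDerivAt_line (𝒢.amp n).isOpen_dom (Sym.contDiffOn h1) (𝒢.dir i, 0) (x₀, p) τ
        (by simpa [Grading.amp] using hτ.1)
      simpa using this)
  have key2 := key.2.const_smul (((2 * Real.pi) ^ n)⁻¹ : ℝ)
  simp only [zero_smul, add_zero] at key2
  rw [← h1'.osc_eq_integral hq2 R hx₀, h3 i x₀ hx₀] at key2
  refine HasDerivAt.congr_of_eventuallyEq key2 ?_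
  filter_upwards [hs] with τ hτ
  simp only [Pi.smul_apply]
  rw [← h2 _ hτ.1, h1.osc_eq_integral hq R hτ.1]

/-- The family of all oscillatory integrals of parametric amplitudes, with arbitrary continuous
nonnegative weights and arbitrary orders, is closed under the basic directional derivatives and
consists of continuous functions. -/
theorem PAmp.contDiffOn_osc [FiniteDimensional ℝ X] [CompleteSpace F] {W : X → ℝ}
    (hW : ∀ x, 0 ≤ W x) (hWc : ContinuousOn W 𝒢.dom) {q : ℝ} {a : X × (E n × E n) → F}
    (ha : PAmp 𝒢 W q a) (R : 𝒢.Regular) :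
    ContDiffOn ℝ ∞ (fun x => osc (fun p => a (x, p))) 𝒢.dom := by
  refine contDiffOn_of_lineDeriv_family R.basis 𝒢.isOpen_dom
    {u | ∃ (W : X → ℝ) (q : ℝ) (a : X × (E n × E n) → F), (∀ x, 0 ≤ W x) ∧ ContinuousOn W 𝒢.dom ∧
      PAmp 𝒢 W q a ∧ u = fun x => osc (fun p => a (x, p))} ?_ ?_ _ ⟨W, q, a, hW, hWc, ha, rfl⟩
  · rintro u ⟨W, q, a, hW, hWc, ha, rfl⟩
    exact ha.continuousOn_osc hW hWc R
  · rintro u ⟨W, q, a, hW, hWc, ha, rfl⟩ i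
    refine ⟨_, ⟨_, _, _, fun x => mul_nonneg (hW x) (𝒢.wt_nonneg i x), hWc.mul (R.wt_cont i),
      ha.ddX i, rfl⟩, fun x hx => ?_⟩
    rw [R.basis_eq]
    exact ha.hasLineDerivAt_osc hW hWc R i hx

theorem PAmp.dd_osc [FiniteDimensional ℝ X] [CompleteSpace F] {W : X → ℝ}
    (hW : ∀ x, 0 ≤ W x) (hWc : ContinuousOn W 𝒢.dom) {q : ℝ} {a : X × (E n × E n) → F}
    (ha : PAmp 𝒢 W q a) (R : 𝒢.Regular) (i : 𝒢.ι) :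
    Set.EqOn (dd (𝒢.dir i) (fun x => osc (fun p => a (x, p))))
      (fun x => osc (fun p => dd (𝒢.dir i, 0) a (x, p))) 𝒢.dom := fun x hx =>
  ((differentiableAt_of_contDiffOn 𝒢.isOpen_dom
    (ha.contDiffOn_osc hW hWc R) hx).hasFDerivAt.hasLineDerivAt (𝒢.dir i)).unique
    (ha.hasLineDerivAt_osc hW hWc R i hx)

/-- Differentiation passes under the integral and gives an amplitude with parameter weight W·wt and
order q + 2. As W and q are free in the induction, the growth of q does not matter. -/
theorem PAmp.sym_osc [FiniteDimensional ℝ X] [CompleteSpace F] {W : X → ℝ}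
    (hW : ∀ x, 0 ≤ W x) (hWc : ContinuousOn W 𝒢.dom) {q : ℝ} {a : X × (E n × E n) → F}
    (ha : PAmp 𝒢 W q a) (R : 𝒢.Regular) : Sym 𝒢 W (fun x => osc (fun p => a (x, p))) := by
  intro k
  induction k generalizing W q a with
  | zero => exact ⟨ha.contDiffOn_osc hW hWc R, ha.boundedBy_osc hW R⟩
  | succ k ih =>
    refine ⟨⟨ha.contDiffOn_osc hW hWc R, ha.boundedBy_osc hW R⟩, fun i => ?_⟩
    exact (ih (fun x => mul_nonneg (hW x) (𝒢.wt_nonneg i x)) (hWc.mul (R.wt_cont i))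
      (ha.ddX i)).congr (ha.dd_osc hW hWc R i)

end Parametric

/-! ### The gradings of the symbol calculus -/

section Concrete

variable {n : ℕ}

theorem one_le_bracket (ξ : E n) : 1 ≤ bracket ξ := by
  rw [bracket, Real.one_le_sqrt]
  nlinarith [sq_nonneg ‖ξ‖]

theorem bracket_pos (ξ : E n) : 0 < bracket ξ := one_pos.trans_le (one_le_bracket ξ)

theorem bracket_sq (ξ : E n) : bracket ξ ^ 2 = 1 + ‖ξ‖ ^ 2 := Real.sq_sqrt (by positivity)

theorem norm_le_bracket (ξ : E n) : ‖ξ‖ ≤ bracket ξ :=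
  Real.le_sqrt_of_sq_le (by nlinarith)

theorem bracket_rpow_nonneg (M : ℝ) (ξ : E n) : 0 ≤ bracket ξ ^ M :=
  Real.rpow_nonneg (bracket_pos ξ).le M

theorem bracket_rpow_le {M M' : ℝ} (h : M ≤ M') (ξ : E n) : bracket ξ ^ M ≤ bracket ξ ^ M' :=
  Real.rpow_le_rpow_of_exponent_le (one_le_bracket ξ) h

theorem continuous_bracket_rpow (M : ℝ) : Continuous fun ξ : E n => bracket ξ ^ M := by
  refine Continuous.rpow_const ?_ fun p => Or.inl (bracket_pos p).ne'
  unfold bracket; fun_prop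

theorem bracket_add_le (ξ ζ : E n) : bracket (ξ + ζ) ≤ 2 * bracket ξ * bracket ζ := by
  have h0 : 0 ≤ 2 * bracket ξ * bracket ζ := by
    have := bracket_pos ξ; have := bracket_pos ζ; positivity
  rw [bracket, Real.sqrt_le_left h0, mul_pow, mul_pow, bracket_sq, bracket_sq]
  nlinarith [norm_add_le ξ ζ, norm_nonneg (ξ + ζ), norm_nonneg ξ, norm_nonneg ζ,
    sq_nonneg (‖ξ‖ - ‖ζ‖), mul_nonneg (sq_nonneg ‖ξ‖) (sq_nonneg ‖ζ‖)]

theorem bracket_le_of_norm_le {c : ℝ} (hc : 0 ≤ c) {p : E n × E n} {ζ : E n}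
    (h : ‖ζ‖ ≤ c * jb p) : bracket ζ ≤ (1 + c) * jb p := by
  have h1 := one_le_jb p
  rw [bracket, Real.sqrt_le_left (by positivity)]
  nlinarith [norm_nonneg ζ, mul_nonneg hc (zero_le_one.trans h1)]

/-- The Peetre inequality. -/
theorem bracket_add_rpow_le {c : ℝ} (hc : 0 ≤ c) {p : E n × E n} {ζ : E n}
    (h : ‖ζ‖ ≤ c * jb p) (ξ : E n) (M : ℝ) :
    bracket (ξ + ζ) ^ M ≤ (2 * (1 + c)) ^ |M| * (bracket ξ ^ M * jb p ^ |M|) := by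
  have hj := jb_pos p
  have hξ := bracket_pos ξ
  have hξζ := bracket_pos (ξ + ζ)
  have h1 : bracket (ξ + ζ) ≤ 2 * (1 + c) * (bracket ξ * jb p) := by
    refine (bracket_add_le ξ ζ).trans ?_
    nlinarith [mul_le_mul_of_nonneg_left (bracket_le_of_norm_le hc h) hξ.le]
  have h2 : bracket ξ ≤ 2 * (1 + c) * (bracket (ξ + ζ) * jb p) := by
    have h3 := bracket_add_le (ξ + ζ) (-ζ)
    rw [add_neg_cancel_right] at h3
    have h4 : ‖-ζ‖ ≤ c * jb p := by rwa [norm_neg]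
    refine h3.trans ?_
    nlinarith [mul_le_mul_of_nonneg_left (bracket_le_of_norm_le hc h4) hξζ.le]
  rcases le_total 0 M with hM | hM
  · rw [abs_of_nonneg hM, ← Real.mul_rpow hξ.le hj.le, ← Real.mul_rpow (by positivity)
      (by positivity)]
    exact Real.rpow_le_rpow hξζ.le h1 hM
  · rw [abs_of_nonpos hM]
    have h3 := Real.rpow_le_rpow hξ.le h2 (neg_nonneg.2 hM)
    rw [Real.mul_rpow (by positivity) (by positivity), Real.mul_rpow hξζ.le hj.le] at h3
    have h4 : 0 < bracket ξ ^ M := Real.rpow_pos_of_pos hξ _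
    have h5 : 0 < bracket (ξ + ζ) ^ M := Real.rpow_pos_of_pos hξζ _
    have h6 : bracket ξ ^ (-M) * bracket ξ ^ M = 1 := by
      rw [← Real.rpow_add hξ]; simp
    have h7 : bracket (ξ + ζ) ^ (-M) * bracket (ξ + ζ) ^ M = 1 := by
      rw [← Real.rpow_add hξζ]; simp
    calc bracket (ξ + ζ) ^ M = (bracket ξ ^ (-M) * bracket ξ ^ M) * bracket (ξ + ζ) ^ M := by
          rw [h6, one_mul]
      _ ≤ ((2 * (1 + c)) ^ (-M) * (bracket (ξ + ζ) ^ (-M) * jb p ^ (-M)) * bracket ξ ^ M) *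
          bracket (ξ + ζ) ^ M := by gcongr
      _ = (2 * (1 + c)) ^ (-M) * (bracket ξ ^ M * jb p ^ (-M)) *
          (bracket (ξ + ζ) ^ (-M) * bracket (ξ + ζ) ^ M) := by ring
      _ = _ := by rw [h7, mul_one]

/-- The space of the variables `(t, ξ, z)`. -/
abbrev X0 (n : ℕ) : Type := E n × E n × ℂ

/-- The index set of the coordinate directions in `t`, `ξ` and `z`. -/
abbrev I0 (n : ℕ) : Type := Fin n ⊕ (Fin n ⊕ Fin 2)

/-- The coordinate basis of the space of the `(t, ξ, z)`. -/
def basis0 (n : ℕ) : Module.Basis (I0 n) ℝ (X0 n) :=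
  (EuclideanSpace.basisFun (Fin n) ℝ).toBasis.prod
    ((EuclideanSpace.basisFun (Fin n) ℝ).toBasis.prod Complex.basisOneI)

/-- The direction `∂_{t_j}`. -/
def tdir (j : Fin n) : X0 n := (stdVec n j, 0, 0)

/-- The direction `∂_{ξ_j}`. -/
def xdir (j : Fin n) : X0 n := (0, stdVec n j, 0)

/-- The direction of the complex number `c` in the variable `z`. -/
def zdir (c : ℂ) : X0 n := (0, 0, c)

/-- The coordinate directions. -/
def dir0 (n : ℕ) : I0 n → X0 n :=
  Sum.elim tdir (Sum.elim xdir fun k => zdir (![1, Complex.I] k))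

theorem basis0_apply (i : I0 n) : basis0 n i = dir0 n i := by
  rcases i with j | j | k
  · simp [basis0, dir0, tdir, stdVec, Prod.zero_eq_mk]
  · simp [basis0, dir0, xdir, stdVec]
  · simp [basis0, dir0, zdir]

/-- The order that is added by a derivative. -/
def ord0 : I0 n → ℝ := Sum.elim (fun _ => 0) (Sum.elim (fun _ => -1) fun _ => 1)

theorem abs_ord0_le (i : I0 n) : |(ord0 i : ℝ)| ≤ 1 := by
  rcases i with j | j | k <;> simp [ord0]

/-- The points of `Z` of norm at most `r` whose distance to the complement of `Z` is at least
`|z| / r`. -/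
def coneBdd (Z : Set ℂ) (r : ℕ) : Set ℂ := {z | z ∈ Z ∧ ‖z‖ ≤ r ∧ ∀ w, w ∉ Z → ‖z‖ ≤ r * ‖w - z‖}

theorem coneBdd_mono (Z : Set ℂ) {r r' : ℕ} (h : r ≤ r') : coneBdd Z r ⊆ coneBdd Z r' := by
  rintro z ⟨h1, h2, h3⟩
  have h' : (r : ℝ) ≤ r' := by exact_mod_cast h
  exact ⟨h1, h2.trans h', fun w hw => (h3 w hw).trans (by gcongr)⟩

theorem exists_coneBdd_mem_nhds {Z : Set ℂ} (hZ : IsOpen Z) {z : ℂ} (hz : z ∈ Z) :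
    ∃ r, coneBdd Z r ∈ 𝓝 z := by
  obtain ⟨δ, hδ, hb⟩ := Metric.isOpen_iff.1 hZ z hz
  obtain ⟨r, hr⟩ := exists_nat_ge (max (‖z‖ + δ) ((‖z‖ + δ) / (δ / 2)))
  have hr1 := (le_max_left _ _).trans hr
  have hr2 := (le_max_right _ _).trans hr
  rw [div_le_iff₀ (by positivity)] at hr2
  refine ⟨r, Filter.mem_of_superset (Metric.ball_mem_nhds z (half_pos hδ)) fun z' hz' => ?_⟩
  rw [Metric.mem_ball, dist_eq_norm] at hz'
  have hn : ‖z'‖ ≤ ‖z‖ + δ := by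
    have := norm_add_le z (z' - z)
    rw [add_sub_cancel] at this
    linarith
  refine ⟨hb (by rw [Metric.mem_ball, dist_eq_norm]; linarith), hn.trans hr1, fun w hw => ?_⟩
  have h1 : δ ≤ ‖w - z‖ := by
    by_contra h
    exact hw (hb (by rw [Metric.mem_ball, dist_eq_norm]; linarith))
  have h2 : ‖w - z‖ ≤ ‖w - z'‖ + ‖z' - z‖ := by
    have := norm_add_le (w - z') (z' - z)
    rwa [sub_add_sub_cancel] at this
  have h3 : δ / 2 ≤ ‖w - z'‖ := by linarith
  nlinarith [norm_nonneg z', (Nat.cast_nonneg r : (0 : ℝ) ≤ r)]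

/-- The grading of the weakly parametric symbols. -/
def grad0 (n : ℕ) {Z : Set ℂ} (hZ : IsOpen Z) : Grading (X0 n) where
  dom := {x | x.2.2 ∈ Z}
  isOpen_dom := hZ.preimage (continuous_snd.comp continuous_snd)
  ι := I0 n
  dir := dir0 n
  wt := fun i x => bracket x.2.1 ^ (ord0 i : ℝ)
  wt_nonneg := fun _ _ => bracket_rpow_nonneg _ _
  bdd := fun r => {x | x.2.2 ∈ coneBdd Z r}
  bdd_subset := fun _ _ hx => hx.1

/-- The grading `grad0` with an additional variable `s`. -/
def gradS (n : ℕ) {Z : Set ℂ} (hZ : IsOpen Z) : Grading (X0 n × ℝ) where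
  dom := {x | x.1.2.2 ∈ Z}
  isOpen_dom := hZ.preimage ((continuous_snd.comp continuous_snd).comp continuous_fst)
  ι := I0 n ⊕ Unit
  dir := Sum.elim (fun i => (dir0 n i, 0)) fun _ => (0, 1)
  wt := Sum.elim (fun i x => bracket x.1.2.1 ^ (ord0 i : ℝ)) fun _ x => bracket x.1.2.1 ^ (-1 : ℝ)
  wt_nonneg := by rintro (i | _) x <;> exact bracket_rpow_nonneg _ _
  bdd := fun r => {x | x.1.2.2 ∈ coneBdd Z r ∧ |x.2| ≤ r}
  bdd_subset := fun _ _ hx => hx.1.1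

variable {Z : Set ℂ} (hZ : IsOpen Z)

/-- The grading `gradS` is regular. -/
def regularS : (gradS n hZ).Regular where
  basis := (basis0 n).prod (Module.Basis.singleton Unit ℝ)
  basis_eq := by
    rintro (i | u)
    · refine (Module.Basis.prod_apply (basis0 n) (Module.Basis.singleton Unit ℝ) (Sum.inl i)).trans ?_
      simp [gradS, basis0_apply]
    · refine (Module.Basis.prod_apply (basis0 n) (Module.Basis.singleton Unit ℝ) (Sum.inr u)).trans ?_
      simp [gradS]
  loc := by
    rintro ⟨x, s⟩ hx
    obtain ⟨r, hr⟩ := exists_coneBdd_mem_nhds hZ hx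
    obtain ⟨r', hr'⟩ := exists_nat_gt |s|
    refine ⟨max r r', ?_⟩
    have h1 : Continuous fun x : X0 n × ℝ => x.1.2.2 := by fun_prop
    have h2 : Continuous fun x : X0 n × ℝ => |x.2| := by fun_prop
    filter_upwards [h1.continuousAt hr, h2.continuousAt.eventually_lt continuousAt_const hr']
      with y hy1 hy2
    refine ⟨coneBdd_mono Z (le_max_left _ _) hy1, hy2.le.trans ?_⟩
    exact_mod_cast le_max_right r r'
  wt_cont := by
    have h : Continuous fun x : X0 n × ℝ => x.1.2.1 := by fun_prop
    rintro (i | u)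
    · exact ((continuous_bracket_rpow _).comp h).continuousOn
    · exact ((continuous_bracket_rpow _).comp h).continuousOn

theorem sum_smul_stdVec (v : E n) : ∑ k, v k • stdVec n k = v := by
  have := (EuclideanSpace.basisFun (Fin n) ℝ).sum_repr v
  simpa [stdVec] using this

theorem sum_smul_tdir (v : E n) : ∑ k, v k • tdir k = ((v, 0, 0) : X0 n) := by
  refine Prod.ext ?_ (Prod.ext ?_ ?_)
  · simp [tdir, Prod.fst_sum, sum_smul_stdVec]
  · simp [tdir, Prod.snd_sum]
  · simp [tdir, Prod.snd_sum]

theorem sum_smul_xdir (v : E n) : ∑ k, v k • xdir k = ((0, v, 0) : X0 n) := by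
  refine Prod.ext ?_ (Prod.ext ?_ ?_)
  · simp [xdir, Prod.fst_sum]
  · simp [xdir, Prod.fst_sum, Prod.snd_sum, sum_smul_stdVec]
  · simp [xdir, Prod.snd_sum]

/-- The map `(t, ξ, z, s, y, η) ↦ (t, ξ + s η, z)`. -/
def shiftEta (x : (X0 n × ℝ) × (E n × E n)) : X0 n :=
  (x.1.1.1, x.1.1.2.1 + x.1.2 • x.2.2, x.1.1.2.2)

/-- The matrix `B` as a continuous linear map. -/
def matCLM (B : Matrix (Fin n) (Fin n) ℝ) : E n →L[ℝ] E n :=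
  (Matrix.toEuclideanLin B).toContinuousLinearMap

theorem matCLM_apply (B : Matrix (Fin n) (Fin n) ℝ) (x : E n) : matCLM B x = matApply B x := rfl

/-- The map `(t, ξ, z, s, y, η) ↦ (t - y, ξ + B y, z)`. -/
def shiftY (B : Matrix (Fin n) (Fin n) ℝ) (x : (X0 n × ℝ) × (E n × E n)) : X0 n :=
  (x.1.1.1 - x.2.1, x.1.1.2.1 + matCLM B x.2.1, x.1.1.2.2)

theorem contDiff_shiftEta : ContDiff ℝ ∞ (shiftEta : (X0 n × ℝ) × (E n × E n) → X0 n) := by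
  unfold shiftEta; fun_prop

theorem contDiff_shiftY (B : Matrix (Fin n) (Fin n) ℝ) :
    ContDiff ℝ ∞ (shiftY B : (X0 n × ℝ) × (E n × E n) → X0 n) := by
  unfold shiftY; fun_prop

theorem dd_shiftEta (v x : (X0 n × ℝ) × (E n × E n)) :
    dd v shiftEta x = (v.1.1.1, v.1.1.2.1 + (v.1.2 • x.2.2 + x.1.2 • v.2.2), v.1.1.2.2) := by
  have h1 : HasFDerivAt (fun x : (X0 n × ℝ) × (E n × E n) => x.1.1.1) _ x :=
    (((ContinuousLinearMap.fst ℝ _ _).comp (ContinuousLinearMap.fst ℝ _ _)).comp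
      (ContinuousLinearMap.fst ℝ (X0 n × ℝ) (E n × E n))).hasFDerivAt
  have h2 : HasFDerivAt (fun x : (X0 n × ℝ) × (E n × E n) => x.1.1.2.1) _ x :=
    ((((ContinuousLinearMap.fst ℝ _ _).comp (ContinuousLinearMap.snd ℝ _ _)).comp
      (ContinuousLinearMap.fst ℝ _ _)).comp
      (ContinuousLinearMap.fst ℝ (X0 n × ℝ) (E n × E n))).hasFDerivAt
  have h3 : HasFDerivAt (fun x : (X0 n × ℝ) × (E n × E n) => x.1.1.2.2) _ x :=
    ((((ContinuousLinearMap.snd ℝ _ _).comp (ContinuousLinearMap.snd ℝ _ _)).comp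
      (ContinuousLinearMap.fst ℝ _ _)).comp
      (ContinuousLinearMap.fst ℝ (X0 n × ℝ) (E n × E n))).hasFDerivAt
  have h4 : HasFDerivAt (fun x : (X0 n × ℝ) × (E n × E n) => x.1.2) _ x :=
    ((ContinuousLinearMap.snd ℝ _ _).comp
      (ContinuousLinearMap.fst ℝ (X0 n × ℝ) (E n × E n))).hasFDerivAt
  have h5 : HasFDerivAt (fun x : (X0 n × ℝ) × (E n × E n) => x.2.2) _ x :=
    ((ContinuousLinearMap.snd ℝ _ _).comp
      (ContinuousLinearMap.snd ℝ (X0 n × ℝ) (E n × E n))).hasFDerivAt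
  have h : HasFDerivAt (shiftEta : (X0 n × ℝ) × (E n × E n) → X0 n) _ x :=
    h1.prodMk ((h2.add (h4.smul h5)).prodMk h3)
  simp [dd, h.fderiv, add_comm]

theorem dd_shiftY (B : Matrix (Fin n) (Fin n) ℝ) (v x : (X0 n × ℝ) × (E n × E n)) :
    dd v (shiftY B) x = (v.1.1.1 - v.2.1, v.1.1.2.1 + matCLM B v.2.1, v.1.1.2.2) := by
  have h1 : HasFDerivAt (fun x : (X0 n × ℝ) × (E n × E n) => x.1.1.1) _ x :=
    (((ContinuousLinearMap.fst ℝ _ _).comp (ContinuousLinearMap.fst ℝ _ _)).comp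
      (ContinuousLinearMap.fst ℝ (X0 n × ℝ) (E n × E n))).hasFDerivAt
  have h2 : HasFDerivAt (fun x : (X0 n × ℝ) × (E n × E n) => x.1.1.2.1) _ x :=
    ((((ContinuousLinearMap.fst ℝ _ _).comp (ContinuousLinearMap.snd ℝ _ _)).comp
      (ContinuousLinearMap.fst ℝ _ _)).comp
      (ContinuousLinearMap.fst ℝ (X0 n × ℝ) (E n × E n))).hasFDerivAt
  have h3 : HasFDerivAt (fun x : (X0 n × ℝ) × (E n × E n) => x.1.1.2.2) _ x :=
    ((((ContinuousLinearMap.snd ℝ _ _).comp (ContinuousLinearMap.snd ℝ _ _)).comp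
      (ContinuousLinearMap.fst ℝ _ _)).comp
      (ContinuousLinearMap.fst ℝ (X0 n × ℝ) (E n × E n))).hasFDerivAt
  have h5 : HasFDerivAt (fun x : (X0 n × ℝ) × (E n × E n) => x.2.1) _ x :=
    ((ContinuousLinearMap.fst ℝ _ _).comp
      (ContinuousLinearMap.snd ℝ (X0 n × ℝ) (E n × E n))).hasFDerivAt
  have h : HasFDerivAt (shiftY B : (X0 n × ℝ) × (E n × E n) → X0 n) _ x :=
    (h1.sub h5).prodMk ((h2.add ((matCLM B).hasFDerivAt.comp x h5)).prodMk h3)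
  simp [dd, h.fderiv]

theorem norm_smul_snd_le {r : ℕ} {s : ℝ} (hs : |s| ≤ r) (p : E n × E n) :
    ‖s • p.2‖ ≤ (r : ℝ) * jb p := by
  rw [norm_smul, Real.norm_eq_abs]
  exact mul_le_mul hs (norm_snd_le_jb p) (norm_nonneg _) (Nat.cast_nonneg r)

theorem norm_matCLM_le (B : Matrix (Fin n) (Fin n) ℝ) (p : E n × E n) :
    ‖matCLM B p.1‖ ≤ ‖matCLM B‖ * jb p :=
  ((matCLM B).le_opNorm _).trans (mul_le_mul_of_nonneg_left (norm_fst_le_jb p) (norm_nonneg _))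

theorem wle_kron {V : Type*} [NormedAddCommGroup V] [NormedSpace ℝ V] {𝒢 : Grading V}
    {κ : Type*} [DecidableEq κ] (i j : κ) : Sym 𝒢 (fun _ => kron κ i j) (fun _ => kron κ i j) := by
  by_cases h : i = j
  · simpa [kron, h] using sym_const (𝒢 := 𝒢) (WLE.refl fun _ => zero_le_one) (1 : ℝ)
  · simpa [kron, h] using sym_zero (𝒢 := 𝒢) (F := ℝ) (fun _ => 0)

theorem rpow_le_of_ord (i : I0 n) (p : E n × E n) {A C x : ℝ} (hA : 0 ≤ A)
    (hC : 0 ≤ C) (h : x ≤ C * (A * jb p ^ |(ord0 i : ℝ)|)) :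
    x ≤ C * (A * jb p ^ (2 : ℝ)) := by
  refine h.trans ?_
  exact mul_le_mul_of_nonneg_left (mul_le_mul_of_nonneg_left
    (jb_rpow_le ((abs_ord0_le i).trans one_le_two) p) hA) hC

end Concrete

/-! ### The substitutions that form the amplitude of the composition. -/

section Concrete

variable {n : ℕ} {Z : Set ℂ} (hZ : IsOpen Z)

/-- The coefficients of `shiftEta` with respect to the coordinate directions. -/
def etaCoef (i : (I0 n ⊕ Unit) ⊕ (Fin n ⊕ Fin n)) (j : I0 n)
    (x : (X0 n × ℝ) × (E n × E n)) : ℝ :=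
  match i, j with
  | .inl (.inl i), j => kron (I0 n) i j
  | .inl (.inr _), .inr (.inl k) => dualCoord (.inl k) x.2
  | .inr (.inr l), .inr (.inl k) => kron (Fin n) l k * x.1.2
  | _, _ => 0

/-- The weights of the coefficients of `shiftEta`. -/
def etaWt (i : (I0 n ⊕ Unit) ⊕ (Fin n ⊕ Fin n)) (j : I0 n)
    (x : (X0 n × ℝ) × (E n × E n)) : ℝ :=
  match i, j with
  | .inl (.inl i), j => kron (I0 n) i j
  | .inl (.inr _), .inr (.inl _) => jb x.2 ^ (1 : ℝ)
  | .inr (.inr _), .inr (.inl _) => 1 + bracket x.1.1.2.1 * (jb x.2)⁻¹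
  | _, _ => 0

/-- The coefficient s of ∂_η is bounded, but the weight 1 would fail: ∂_s s = 1 has to be dominated
by the weight times ⟨ξ⟩⁻¹⟨p⟩², which is small for large ξ. The additional term ⟨ξ⟩/⟨p⟩ repairs this,
and by Peetre's inequality it is still compensated by the factor ⟨ξ+sη⟩⁻¹ that accompanies s in the
chain rule. -/
theorem sym_scale : Sym ((gradS n hZ).amp n) (fun x => 1 + bracket x.1.1.2.1 * (jb x.2)⁻¹)
    (fun x => x.1.2) := by
  have hpos : ∀ x : (X0 n × ℝ) × (E n × E n), 0 ≤ bracket x.1.1.2.1 * (jb x.2)⁻¹ := fun x => by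
    have := bracket_pos x.1.1.2.1; have := jb_pos x.2; positivity
  refine sym_of_dd_const (by fun_prop) (fun r => ⟨r, fun x hx => ?_⟩)
    (fun i => match i with
      | .inl (.inr _) => 1
      | _ => 0) ?_ ?_
  · have h1 : |x.1.2| ≤ r := hx.1.2
    rw [Real.norm_eq_abs]
    nlinarith [hpos x, (Nat.cast_nonneg r : (0 : ℝ) ≤ r)]
  · intro i x _
    have h4 : HasFDerivAt (fun x : (X0 n × ℝ) × (E n × E n) => x.1.2) _ x :=
      ((ContinuousLinearMap.snd ℝ _ _).comp
        (ContinuousLinearMap.fst ℝ (X0 n × ℝ) (E n × E n))).hasFDerivAt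
    rcases i with (i | u) | e <;> simp [dd, h4.fderiv, Grading.amp, gradS]
  · rintro ((i | u) | e)
    · exact Or.inl rfl
    · refine Or.inr (WLE.of_le (fun _ => zero_le_one) fun x => ?_)
      have hb := bracket_pos x.1.1.2.1
      have hj := one_le_jb x.2
      have e1 : ((gradS n hZ).amp n).wt (Sum.inl (Sum.inr u)) x =
          (bracket x.1.1.2.1)⁻¹ * jb x.2 ^ 2 := by
        simp only [Grading.amp, gradS, Sum.elim_inl, Sum.elim_inr]
        rw [Real.rpow_neg_one]
        norm_cast
      rw [e1]
      have hj0 : 0 < jb x.2 := by linarith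
      have e2 : (1 + bracket x.1.1.2.1 * (jb x.2)⁻¹) * ((bracket x.1.1.2.1)⁻¹ * jb x.2 ^ 2) =
          (bracket x.1.1.2.1)⁻¹ * jb x.2 ^ 2 + jb x.2 := by field_simp
      rw [e2]
      have : 0 ≤ (bracket x.1.1.2.1)⁻¹ * jb x.2 ^ 2 := by positivity
      linarith
    · exact Or.inl rfl

/-- Substitution of `ξ + s η` for `ξ`. -/
def substEta : Subst ((gradS n hZ).amp n) (grad0 n hZ) shiftEta where
  coef := etaCoef
  cwt := etaWt
  contDiffOn := contDiff_shiftEta.contDiffOn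
  mapsTo := fun x hx => hx.1
  bdd := fun r => ⟨r, fun x hx => hx.1.1⟩
  dd_eq := fun i x _ => by
    rw [dd_shiftEta]
    rcases i with (i | u) | (e | e)
    · erw [Finset.sum_eq_single i]
      · simp [etaCoef, kron, Grading.amp, gradS, grad0]
      · intro j _ hj
        simp [etaCoef, kron, hj.symm]
      · exact fun h => absurd (Finset.mem_univ _) h
    · erw [Fintype.sum_sum_type, Fintype.sum_sum_type]
      have := sum_smul_xdir x.2.2
      simp only [grad0, dir0, Sum.elim_inr, Sum.elim_inl, etaCoef, zero_smul,
        Finset.sum_const_zero, zero_add, add_zero]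
      simp only [dualCoord, Sum.elim_inl, ContinuousLinearMap.comp_apply]
      simpa [Grading.amp, gradS] using this.symm
    · erw [Fintype.sum_sum_type, Fintype.sum_sum_type]
      simp [grad0, dir0, etaCoef, Grading.amp, gradS, pdir]
    · erw [Fintype.sum_sum_type, Fintype.sum_sum_type]
      simp [grad0, dir0, etaCoef, Grading.amp, gradS, pdir, kron, xdir]
  sym_coef := fun i j => by
    rcases i with (i | u) | (e | e)
    · exact wle_kron i j
    · rcases j with j | j | j
      · exact sym_zero _
      · exact (amp_dualCoord (Sum.inl j)).pull
      · exact sym_zero _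
    · rcases j with j | j | j <;> exact sym_zero _
    · rcases j with j | j | j
      · exact sym_zero _
      · have := (sym_scale (n := n) hZ).const_smul (kron (Fin n) e j)
        exact this
      · exact sym_zero _
  le := fun i j r => by
    have hz : ∀ (i : (I0 n ⊕ Unit) ⊕ (Fin n ⊕ Fin n)),
        ∃ c : ℝ, ∀ x ∈ ((gradS n hZ).amp n).bdd r,
        |(0 : ℝ) * (grad0 n hZ).wt j (shiftEta x)| ≤ c * ((gradS n hZ).amp n).wt i x := fun i =>
      ⟨0, fun x _ => by simp⟩
    rcases i with (i | u) | (e | e)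
    · by_cases hij : i = j
      · subst hij
        refine ⟨(2 * (1 + (r : ℝ))) ^ |(ord0 i : ℝ)|, fun x hx => ?_⟩
        have h1 := bracket_add_rpow_le (Nat.cast_nonneg r) (norm_smul_snd_le hx.1.2 x.2)
          x.1.1.2.1 (ord0 i)
        have h2 := rpow_le_of_ord i x.2 (bracket_rpow_nonneg _ _) (by positivity) h1
        change |kron (I0 n) i i * bracket (x.1.1.2.1 + x.1.2 • x.2.2) ^ (ord0 i : ℝ)| ≤
          _ * (bracket x.1.1.2.1 ^ (ord0 i : ℝ) * jb x.2 ^ (2 : ℝ))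
        rw [kron, if_pos rfl, one_mul, abs_of_nonneg (bracket_rpow_nonneg _ _)]
        exact h2
      · refine ⟨0, fun x _ => ?_⟩
        simp [etaWt, kron, hij]
    · rcases j with j | j | j
      · exact hz _
      -- Direction ∂_s: the coefficient η contributes one power of jb, and moving ⟨·⟩⁻¹ from ξ + sη
      -- to ξ contributes another.
      · refine ⟨2 * (1 + (r : ℝ)), fun x hx => ?_⟩
        have h1 := bracket_add_rpow_le (Nat.cast_nonneg r) (norm_smul_snd_le hx.1.2 x.2)
          x.1.1.2.1 (-1)
        simp only [abs_neg, abs_one, Real.rpow_one] at h1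
        change |jb x.2 ^ (1 : ℝ) * bracket (x.1.1.2.1 + x.1.2 • x.2.2) ^ (-1 : ℝ)| ≤
          2 * (1 + (r : ℝ)) * (bracket x.1.1.2.1 ^ (-1 : ℝ) * jb x.2 ^ (2 : ℝ))
        rw [abs_of_nonneg (mul_nonneg (jb_rpow_nonneg _ _) (bracket_rpow_nonneg _ _)),
          Real.rpow_one, Real.rpow_two]
        calc jb x.2 * bracket (x.1.1.2.1 + x.1.2 • x.2.2) ^ (-1 : ℝ)
            ≤ jb x.2 * (2 * (1 + (r : ℝ)) * (bracket x.1.1.2.1 ^ (-1 : ℝ) * jb x.2)) :=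
              mul_le_mul_of_nonneg_left h1 (jb_pos _).le
          _ = _ := by ring
      · exact hz _
    · rcases j with j | j | j <;> exact hz _
    · rcases j with j | j | j
      · exact hz _
      -- Direction ∂_η, which has to be neutral: the summand 1 is paid by ⟨ξ+sη⟩⁻¹ ≤ 1, the summand
      -- ⟨ξ⟩/⟨p⟩ by Peetre's inequality.
      · refine ⟨1 + 2 * (1 + (r : ℝ)), fun x hx => ?_⟩
        have h1 := bracket_add_rpow_le (Nat.cast_nonneg r) (norm_smul_snd_le hx.1.2 x.2)
          x.1.1.2.1 (-1)
        simp only [abs_neg, abs_one, Real.rpow_one, Real.rpow_neg_one] at h1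
        have hb := bracket_pos x.1.1.2.1
        have hj := jb_pos x.2
        change |(1 + bracket x.1.1.2.1 * (jb x.2)⁻¹) *
          bracket (x.1.1.2.1 + x.1.2 • x.2.2) ^ (-1 : ℝ)| ≤ (1 + 2 * (1 + (r : ℝ))) * 1
        rw [Real.rpow_neg_one]
        have hb' := one_le_bracket (x.1.1.2.1 + x.1.2 • x.2.2)
        have h3 : (bracket (x.1.1.2.1 + x.1.2 • x.2.2))⁻¹ ≤ 1 := inv_le_one_of_one_le₀ hb'
        rw [abs_of_nonneg (by positivity), add_mul, one_mul, mul_one]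
        refine add_le_add h3 ?_
        calc bracket x.1.1.2.1 * (jb x.2)⁻¹ * (bracket (x.1.1.2.1 + x.1.2 • x.2.2))⁻¹
            ≤ bracket x.1.1.2.1 * (jb x.2)⁻¹ *
              (2 * (1 + (r : ℝ)) * ((bracket x.1.1.2.1)⁻¹ * jb x.2)) := by gcongr
          _ = _ := by field_simp
      · exact hz _

/-- The coefficients of `shiftY B` with respect to the coordinate directions. -/
def yCoef (B : Matrix (Fin n) (Fin n) ℝ) (i : (I0 n ⊕ Unit) ⊕ (Fin n ⊕ Fin n)) (j : I0 n) : ℝ :=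
  match i, j with
  | .inl (.inl i), j => kron (I0 n) i j
  | .inr (.inl l), .inl k => - kron (Fin n) l k
  | .inr (.inl l), .inr (.inl k) => (matCLM B (stdVec n l)) k
  | _, _ => 0

/-- The weights of the coefficients of `shiftY B`. -/
def yWt (i : (I0 n ⊕ Unit) ⊕ (Fin n ⊕ Fin n)) (j : I0 n) : ℝ :=
  match i, j with
  | .inl (.inl i), j => kron (I0 n) i j
  | .inr (.inl _), .inl _ => 1
  | .inr (.inl _), .inr (.inl _) => 1
  | _, _ => 0

/-- Substitution of `t - y` for `t` and of `ξ + B y` for `ξ`. -/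
def substY (B : Matrix (Fin n) (Fin n) ℝ) :
    Subst ((gradS n hZ).amp n) (grad0 n hZ) (shiftY B) where
  coef := fun i j _ => yCoef B i j
  cwt := fun i j _ => yWt i j
  contDiffOn := (contDiff_shiftY B).contDiffOn
  mapsTo := fun x hx => hx.1
  bdd := fun r => ⟨r, fun x hx => hx.1.1⟩
  dd_eq := fun i x _ => by
    rw [dd_shiftY]
    rcases i with (i | u) | (e | e)
    · erw [Finset.sum_eq_single i]
      · simp [yCoef, kron, Grading.amp, gradS, grad0]
      · intro j _ hj
        simp [yCoef, kron, hj.symm]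
      · exact fun h => absurd (Finset.mem_univ _) h
    · erw [Fintype.sum_sum_type, Fintype.sum_sum_type]
      simp [grad0, dir0, yCoef, Grading.amp, gradS]
    · erw [Fintype.sum_sum_type, Fintype.sum_sum_type]
      have := sum_smul_xdir (matCLM B (stdVec n e))
      simp only [grad0, dir0, Sum.elim_inr, Sum.elim_inl, yCoef, zero_smul,
        Finset.sum_const_zero, add_zero]
      rw [this]
      simp [Grading.amp, gradS, pdir, kron, tdir]
    · erw [Fintype.sum_sum_type, Fintype.sum_sum_type]
      simp [grad0, dir0, yCoef, Grading.amp, gradS, pdir]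
  sym_coef := fun i j => by
    rcases i with (i | u) | (e | e)
    · exact wle_kron i j
    · rcases j with j | j | j <;> exact sym_zero _
    · rcases j with j | j | j
      · exact sym_const (WLE.refl fun _ => zero_le_one) _
      · exact sym_const (WLE.refl fun _ => zero_le_one) _
      · exact sym_zero _
    · rcases j with j | j | j <;> exact sym_zero _
  le := fun i j r => by
    have hz : ∀ (i : (I0 n ⊕ Unit) ⊕ (Fin n ⊕ Fin n)),
        ∃ c : ℝ, ∀ x ∈ ((gradS n hZ).amp n).bdd r,
        |(0 : ℝ) * (grad0 n hZ).wt j (shiftY B x)| ≤ c * ((gradS n hZ).amp n).wt i x := fun i =>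
      ⟨0, fun x _ => by simp⟩
    rcases i with (i | u) | (e | e)
    · by_cases hij : i = j
      · subst hij
        refine ⟨(2 * (1 + ‖matCLM B‖)) ^ |(ord0 i : ℝ)|, fun x hx => ?_⟩
        have h1 := bracket_add_rpow_le (norm_nonneg (matCLM B)) (norm_matCLM_le B x.2)
          x.1.1.2.1 (ord0 i)
        have h2 := rpow_le_of_ord i x.2 (bracket_rpow_nonneg _ _) (by positivity) h1
        change |kron (I0 n) i i * bracket (x.1.1.2.1 + matCLM B x.2.1) ^ (ord0 i : ℝ)| ≤
          _ * (bracket x.1.1.2.1 ^ (ord0 i : ℝ) * jb x.2 ^ (2 : ℝ))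
        rw [kron, if_pos rfl, one_mul, abs_of_nonneg (bracket_rpow_nonneg _ _)]
        exact h2
      · refine ⟨0, fun x _ => ?_⟩
        simp [yWt, kron, hij]
    · rcases j with j | j | j <;> exact hz _
    · rcases j with j | j | j
      · refine ⟨1, fun x _ => ?_⟩
        simp [yWt, grad0, ord0, Grading.amp]
      · refine ⟨1, fun x _ => ?_⟩
        change |1 * bracket (x.1.1.2.1 + matCLM B x.2.1) ^ (-1 : ℝ)| ≤ (1 : ℝ) * 1
        rw [Real.rpow_neg_one, one_mul, one_mul]
        rw [abs_of_nonneg (inv_nonneg.2 (bracket_pos _).le)]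
        exact inv_le_one_of_one_le₀ (one_le_bracket _)
      · exact hz _
    · rcases j with j | j | j <;> exact hz _

/-- The coefficients of the restriction to a fixed value of `s`. -/
def sCoef (i : I0 n) (j : I0 n ⊕ Unit) : ℝ :=
  match j with
  | .inl j => kron (I0 n) i j
  | .inr _ => 0

/-- Restriction to a fixed value of `s`. -/
def substS (s : ℝ) : Subst (grad0 n hZ) (gradS n hZ) (fun x => (x, s)) where
  coef := fun i j _ => sCoef i j
  cwt := fun i j _ => sCoef i j
  contDiffOn := (contDiff_id.prodMk contDiff_const).contDiffOn
  mapsTo := fun x hx => hx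
  bdd := fun r => by
    obtain ⟨r', hr'⟩ := exists_nat_ge |s|
    refine ⟨max r r', fun x hx => ⟨coneBdd_mono Z (le_max_left _ _) hx, hr'.trans ?_⟩⟩
    exact_mod_cast le_max_right r r'
  dd_eq := fun i x _ => by
    have : HasFDerivAt (fun x : X0 n => (x, s)) _ x :=
      (hasFDerivAt_id (𝕜 := ℝ) x).prodMk (hasFDerivAt_const s x)
    simp only [dd, this.fderiv]
    erw [Fintype.sum_sum_type, Finset.sum_eq_single i]
    · have : sCoef (n := n) i (Sum.inl i) = 1 := if_pos rfl
      have h0 : sCoef (n := n) i (Sum.inr PUnit.unit) = 0 := rfl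
      simp only [gradS, grad0, this, h0, one_smul, Finset.univ_unique, Finset.sum_singleton,
        PUnit.default_eq_unit, zero_smul, add_zero]
      rfl
    · intro j _ hj
      have : sCoef (n := n) i (Sum.inl j) = 0 := if_neg fun h => hj h.symm
      erw [this, zero_smul]
    · exact fun h => absurd (Finset.mem_univ _) h
  sym_coef := fun i j => by
    rcases j with j | u
    · exact wle_kron (κ := I0 n) i j
    · exact sym_zero _
  le := fun i j r => by
    change I0 n at i
    rcases j with j | u
    · by_cases hij : i = j
      · subst hij
        refine ⟨1, fun x _ => ?_⟩
        change |kron (I0 n) i i * bracket x.2.1 ^ (ord0 i : ℝ)| ≤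
          1 * bracket x.2.1 ^ (ord0 i : ℝ)
        rw [kron, if_pos rfl, one_mul, abs_of_nonneg (bracket_rpow_nonneg _ _)]
      · refine ⟨0, fun x _ => ?_⟩
        simp [sCoef, kron, hij]
    · exact ⟨0, fun x _ => by simp [sCoef]⟩

end Concrete

/-! ### Calculus of orders for symbols in (t, ξ, z). -/

section Orders

variable {n : ℕ} {Z : Set ℂ} (hZ : IsOpen Z) {F : Type*} [NormedAddCommGroup F] [NormedSpace ℝ F]

/-- Symbols of order `M` in the variables `(t, ξ, z)`. -/
def S0 (M : ℝ) (u : X0 n → F) : Prop := Sym (grad0 n hZ) (fun x => bracket x.2.1 ^ M) u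

variable {hZ}

theorem S0.contDiffOn {M : ℝ} {u : X0 n → F} (h : S0 hZ M u) :
    ContDiffOn ℝ ∞ u (grad0 n hZ).dom := Sym.contDiffOn h

theorem S0.mono {M M' : ℝ} (hM : M ≤ M') {u : X0 n → F} (h : S0 hZ M u) : S0 hZ M' u :=
  Sym.mono h (WLE.of_le (fun _ => bracket_rpow_nonneg _ _) fun _ => bracket_rpow_le hM _)

theorem S0.congr {M : ℝ} {u w : X0 n → F} (h : S0 hZ M u) (huw : Set.EqOn w u (grad0 n hZ).dom) :
    S0 hZ M w := Sym.congr h huw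

theorem S0.of_eq {M M' : ℝ} (hM : M = M') {u : X0 n → F} (h : S0 hZ M u) : S0 hZ M' u := hM ▸ h

theorem S0.add {M : ℝ} {u w : X0 n → F} (hu : S0 hZ M u) (hw : S0 hZ M w) :
    S0 hZ M (fun x => u x + w x) := Sym.add hu hw

theorem S0.sub {M : ℝ} {u w : X0 n → F} (hu : S0 hZ M u) (hw : S0 hZ M w) :
    S0 hZ M (fun x => u x - w x) := Sym.sub hu hw

theorem S0.sum {κ : Type*} {M : ℝ} (s : Finset κ) {u : κ → X0 n → F}
    (hu : ∀ j ∈ s, S0 hZ M (u j)) : S0 hZ M (fun x => ∑ j ∈ s, u j x) := Sym.sum s hu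

theorem S0.zero (M : ℝ) : S0 hZ M (fun _ : X0 n => (0 : F)) := sym_zero _

theorem S0.const_smul {𝕜 : Type*} [RCLike 𝕜] [NormedSpace 𝕜 F] [IsScalarTower ℝ 𝕜 F]
    {M : ℝ} {w : X0 n → F} (c : 𝕜) (hw : S0 hZ M w) : S0 hZ M (fun x => c • w x) :=
  Sym.const_smul c hw

theorem S0.const {M : ℝ} (hM : 0 ≤ M) (a : F) : S0 hZ M (fun _ : X0 n => a) :=
  sym_const (WLE.of_le (fun _ => zero_le_one) fun x => by
    simpa using bracket_rpow_le hM x.2.1) a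

theorem S0.of_sym_mul {M M' : ℝ} {u : X0 n → F}
    (h : Sym (grad0 n hZ) (fun x => bracket x.2.1 ^ M * bracket x.2.1 ^ M') u) :
    S0 hZ (M + M') u := by
  have e : (fun x : X0 n => bracket x.2.1 ^ M * bracket x.2.1 ^ M') =
      fun x => bracket x.2.1 ^ (M + M') := by
    ext x; rw [Real.rpow_add (bracket_pos _)]
  rw [e] at h
  exact h

theorem S0.mul {R : Type*} [NormedRing R] [NormedAlgebra ℝ R] {M M' : ℝ} {u w : X0 n → R}
    (hu : S0 hZ M u) (hw : S0 hZ M' w) : S0 hZ (M + M') (fun x => u x * w x) :=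
  S0.of_sym_mul (Sym.mul hu hw)

theorem S0.smul {𝕜 : Type*} [RCLike 𝕜] [NormedSpace 𝕜 F] [IsScalarTower ℝ 𝕜 F]
    {M M' : ℝ} {u : X0 n → 𝕜} {w : X0 n → F} (hu : S0 hZ M u) (hw : S0 hZ M' w) :
    S0 hZ (M + M') (fun x => u x • w x) :=
  S0.of_sym_mul (Sym.smul hu hw)

theorem S0.dd_dir0 {M : ℝ} {u : X0 n → F} (h : S0 hZ M u) (i : I0 n) :
    S0 hZ (M + ord0 i) (dd (dir0 n i) u) :=
  S0.of_sym_mul (Sym.dd h i)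

theorem dd_sum_smul {κ : Type*} (s : Finset κ) (c : κ → ℝ) (v : κ → X0 n) (u : X0 n → F) :
    dd (∑ j ∈ s, c j • v j) u = fun x => ∑ j ∈ s, c j • dd (v j) u x :=
  funext fun x => dd_dir_sum s c v u x

theorem S0.dd_t {M : ℝ} {u : X0 n → F} (h : S0 hZ M u) (v : E n) :
    S0 hZ M (dd ((v, 0, 0) : X0 n) u) := by
  rw [← sum_smul_tdir, dd_sum_smul]
  exact S0.sum _ fun j _ => ((h.dd_dir0 (Sum.inl j)).of_eq (by simp [ord0])).const_smul _

theorem S0.dd_x {M : ℝ} {u : X0 n → F} (h : S0 hZ M u) (v : E n) :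
    S0 hZ (M - 1) (dd ((0, v, 0) : X0 n) u) := by
  rw [← sum_smul_xdir, dd_sum_smul]
  exact S0.sum _ fun j _ => ((h.dd_dir0 (Sum.inr (Sum.inl j))).of_eq
    (by simp [ord0, sub_eq_add_neg])).const_smul _

theorem dd_zdir (u : X0 n → F) (c : ℂ) (x : X0 n) :
    dd (zdir c) u x = c.re • dd (zdir 1) u x + c.im • dd (zdir Complex.I) u x := by
  have : (zdir c : X0 n) = c.re • zdir 1 + c.im • zdir Complex.I := by
    refine Prod.ext ?_ (Prod.ext ?_ ?_)
    · simp [zdir]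
    · simp [zdir]
    · simp [zdir, Complex.re_add_im]
  simp [dd, this]

theorem S0.dd_z {M : ℝ} {u : X0 n → F} (h : S0 hZ M u) (c : ℂ) :
    S0 hZ (M + 1) (dd (zdir c) u) := by
  have : dd (zdir c) u = fun x => c.re • dd (zdir 1) u x + c.im • dd (zdir Complex.I) u x :=
    funext fun x => dd_zdir u c x
  rw [this]
  exact ((h.dd_dir0 (Sum.inr (Sum.inr 0))).const_smul _).add
    ((h.dd_dir0 (Sum.inr (Sum.inr 1))).const_smul _)

theorem S0.bound {M : ℝ} {u : X0 n → F} (h : S0 hZ M u) (r : ℕ) :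
    ∃ C, ∀ x : X0 n, x.2.2 ∈ coneBdd Z r → ‖u x‖ ≤ C * bracket x.2.1 ^ M := Sym.boundedBy h r

end Orders

/-! ### Equivariant symbols that are holomorphic in `z` -/

section Good

variable {n : ℕ} {A : Type*} [CStarAlgebra A] (α : CStarAction n A)
  {Z : Set ℂ} (hZ : IsOpen Z)

/-- The automorphism `α_t` as a continuous linear map. -/
def actL (t : E n) : A →L[ℂ] A :=
  LinearMap.mkContinuous
    { toFun := fun a => α.act t a
      map_add' := map_add _
      map_smul' := map_smul _ } 1 (fun a => by
    simpa using (NonUnitalStarAlgHom.norm_map (α.act t) (EquivLike.injective (α.act t)) a).le)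

theorem actL_apply (t : E n) (a : A) : actL α t a = α.act t a := rfl

theorem norm_act (t : E n) (a : A) : ‖α.act t a‖ = ‖a‖ :=
  NonUnitalStarAlgHom.norm_map (α.act t) (EquivLike.injective (α.act t)) a

/-- Symbols of order `M` in `(t, ξ, z)` that are equivariant in `t` and holomorphic in `z`. -/
structure Good (M : ℝ) (u : X0 n → A) : Prop where
  sym : S0 hZ M u
  hol : ∀ x : X0 n, x.2.2 ∈ Z → dd (zdir Complex.I) u x = Complex.I • dd (zdir 1) u x
  eqv : ∀ (s : E n) (x : X0 n), x.2.2 ∈ Z → u (s + x.1, x.2) = α.act s (u x)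

variable {α hZ}

namespace Good

variable {M M' : ℝ} {u w : X0 n → A}

theorem mono (hM : M ≤ M') (h : Good α hZ M u) : Good α hZ M' u := ⟨h.sym.mono hM, h.hol, h.eqv⟩

theorem of_eq (hM : M = M') (h : Good α hZ M u) : Good α hZ M' u := hM ▸ h

theorem congr (h : Good α hZ M u) (huw : Set.EqOn w u (grad0 n hZ).dom) : Good α hZ M w := by
  refine ⟨h.sym.congr huw, fun x hx => ?_, fun s x hx => ?_⟩
  · rw [dd_eqOn (grad0 n hZ).isOpen_dom huw _ hx, dd_eqOn (grad0 n hZ).isOpen_dom huw _ hx]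
    exact h.hol x hx
  · have hx' : ((s + x.1, x.2) : X0 n) ∈ (grad0 n hZ).dom := hx
    rw [huw hx', huw hx]
    exact h.eqv s x hx

theorem add (hu : Good α hZ M u) (hw : Good α hZ M w) : Good α hZ M (fun x => u x + w x) := by
  refine ⟨hu.sym.add hw.sym, fun x hx => ?_, fun s x hx => ?_⟩
  · have h := fun v => dd_add (grad0 n hZ).isOpen_dom hu.sym.contDiffOn hw.sym.contDiffOn v hx
    simp only at h
    rw [h, h, smul_add, hu.hol x hx, hw.hol x hx]
  · simp only [hu.eqv s x hx, hw.eqv s x hx, map_add]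

theorem const_smul (c : ℂ) (hu : Good α hZ M u) : Good α hZ M (fun x => c • u x) := by
  refine ⟨hu.sym.const_smul c, fun x hx => ?_, fun s x hx => ?_⟩
  · have h := fun v => dd_clm ((ContinuousLinearMap.lsmul ℝ ℂ : ℂ →L[ℝ] A →L[ℝ] A) c)
      (grad0 n hZ).isOpen_dom hu.sym.contDiffOn v hx
    simp only [ContinuousLinearMap.lsmul_apply] at h
    rw [h, h, hu.hol x hx, smul_comm]
  · simp only [hu.eqv s x hx, map_smul]

theorem neg (hu : Good α hZ M u) : Good α hZ M (fun x => -u x) := by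
  simpa using hu.const_smul (-1)

theorem sub (hu : Good α hZ M u) (hw : Good α hZ M w) : Good α hZ M (fun x => u x - w x) := by
  simpa [sub_eq_add_neg] using hu.add hw.neg

variable (α hZ) in
theorem zero (M : ℝ) : Good α hZ M (fun _ => 0) :=
  ⟨S0.zero M, fun x _ => by simp [dd_const], fun s x _ => by simp⟩

theorem sum {κ : Type*} (s : Finset κ) {u : κ → X0 n → A} (hu : ∀ j ∈ s, Good α hZ M (u j)) :
    Good α hZ M (fun x => ∑ j ∈ s, u j x) := by
  classical
  induction s using Finset.induction_on with
  | empty => simpa using zero α hZ M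
  | insert j s hj ih =>
    simp only [Finset.sum_insert hj]
    exact (hu j (by simp)).add (ih fun l hl => hu l (by simp [hl]))

theorem mul (hu : Good α hZ M u) (hw : Good α hZ M' w) :
    Good α hZ (M + M') (fun x => u x * w x) := by
  refine ⟨hu.sym.mul hw.sym, fun x hx => ?_, fun s x hx => ?_⟩
  · have h := fun v => dd_bilin (ContinuousLinearMap.mul ℝ A)
      (grad0 n hZ).isOpen_dom hu.sym.contDiffOn hw.sym.contDiffOn v hx
    simp only [ContinuousLinearMap.mul_apply'] at h
    rw [h, h, hu.hol x hx, hw.hol x hx, smul_add, smul_mul_assoc, mul_smul_comm]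
  · simp only [hu.eqv s x hx, hw.eqv s x hx, map_mul]

/-- Both sides of the equivariance relation are differentiated along v: the automorphism is a
bounded linear map, and a translation in t does not change directions. -/
theorem eqv_dd (hu : Good α hZ M u) (v : X0 n) (s : E n) (x : X0 n) (hx : x.2.2 ∈ Z) :
    dd v u (s + x.1, x.2) = α.act s (dd v u x) := by
  have h1 := dd_clm ((actL α s).restrictScalars ℝ) (grad0 n hZ).isOpen_dom hu.sym.contDiffOn v hx
  simp only [ContinuousLinearMap.coe_restrictScalars', actL_apply] at h1
  rw [← h1]
  have e : ∀ y : X0 n, ((s, 0, 0) : X0 n) + y = (s + y.1, y.2) := fun y => by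
    refine Prod.ext ?_ (Prod.ext ?_ ?_) <;> simp
  have h2 : Set.EqOn (fun y => α.act s (u y)) (fun y => u (((s, 0, 0) : X0 n) + y))
      (grad0 n hZ).dom := fun y hy => by
    simp only [e, hu.eqv s y hy]
  rw [dd_eqOn (grad0 n hZ).isOpen_dom h2 v hx]
  simp only [dd]
  rw [fderiv_comp_add_left, e]

/-- Holomorphy and equivariance pass to any directional derivative, because derivatives commute;
only the order of the derivative has to be supplied. -/
theorem dd_of (hu : Good α hZ M u) {v : X0 n} (hs : S0 hZ M' (dd v u)) :
    Good α hZ M' (dd v u) := by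
  refine ⟨hs, fun x hx => ?_, fun s x hx => hu.eqv_dd v s x hx⟩
  have hΩ := (grad0 n hZ).isOpen_dom
  rw [dd_comm hΩ hu.sym.contDiffOn _ _ hx, dd_eqOn hΩ (w := fun x => Complex.I • dd (zdir 1) u x)
    (fun y hy => hu.hol y hy) v hx, dd_comm hΩ hu.sym.contDiffOn _ v hx]
  have h := dd_clm ((ContinuousLinearMap.lsmul ℝ ℂ : ℂ →L[ℝ] A →L[ℝ] A) Complex.I)
      (grad0 n hZ).isOpen_dom (contDiffOn_dd hΩ hu.sym.contDiffOn (zdir 1)) v hx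
  simpa only [ContinuousLinearMap.lsmul_apply] using h

theorem dd_t (hu : Good α hZ M u) (v : E n) : Good α hZ M (dd ((v, 0, 0) : X0 n) u) :=
  hu.dd_of (hu.sym.dd_t v)

theorem dd_x (hu : Good α hZ M u) (v : E n) : Good α hZ (M - 1) (dd ((0, v, 0) : X0 n) u) :=
  hu.dd_of (hu.sym.dd_x v)

theorem dd_z (hu : Good α hZ M u) (c : ℂ) : Good α hZ (M + 1) (dd (zdir c) u) :=
  hu.dd_of (hu.sym.dd_z c)

end Good

end Good

/-! ### Taylor expansion in the parameter `s` -/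

/-- Induction on N: the derivative of the remainder is the remainder of order N for the shifted
sequence, and the remainder vanishes at 0. The factor 1/N! is given up, since only the order in ξ
counts later. -/
theorem norm_sub_taylor_le {F : Type*} [NormedAddCommGroup F] [NormedSpace ℝ F] (N : ℕ)
    {u : ℕ → ℝ → F} {C : ℝ} (hd : ∀ k, ∀ s ∈ Set.Icc (0 : ℝ) 1, HasDerivAt (u k) (u (k + 1) s) s)
    (hC : ∀ s ∈ Set.Icc (0 : ℝ) 1, ‖u N s‖ ≤ C) :
    ∀ s ∈ Set.Icc (0 : ℝ) 1,
      ‖u 0 s - ∑ k ∈ Finset.range N, (s ^ k / (k.factorial : ℝ)) • u k 0‖ ≤ C := by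
  induction N generalizing u with
  | zero => simpa using hC
  | succ N ih =>
    intro s hs
    have ih' := ih (u := fun k => u (k + 1)) (fun k => hd (k + 1)) hC
    have hpow : ∀ (k : ℕ) (s : ℝ), HasDerivAt (fun s : ℝ => s ^ (k + 1) / ((k + 1).factorial : ℝ))
        (s ^ k / (k.factorial : ℝ)) s := fun k s => by
      refine ((hasDerivAt_pow (k + 1) s).div_const _).congr_deriv ?_
      rw [Nat.factorial_succ]
      push_cast
      have : (k.factorial : ℝ) ≠ 0 := by exact_mod_cast k.factorial_ne_zero
      have : (k : ℝ) + 1 ≠ 0 := by positivity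
      field_simp
    have hsum : ∀ s, ∑ k ∈ Finset.range (N + 1), (s ^ k / (k.factorial : ℝ)) • u k 0 =
        ∑ k ∈ Finset.range N, (s ^ (k + 1) / ((k + 1).factorial : ℝ)) • u (k + 1) 0 + u 0 0 :=
      fun s => by rw [Finset.sum_range_succ']; simp
    have hφ : ∀ s ∈ Set.Icc (0 : ℝ) 1, HasDerivWithinAt
        (fun s => u 0 s - ∑ k ∈ Finset.range (N + 1), (s ^ k / (k.factorial : ℝ)) • u k 0)
        (u 1 s - ∑ k ∈ Finset.range N, (s ^ k / (k.factorial : ℝ)) • u (k + 1) 0)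
        (Set.Icc 0 1) s := fun s hs => by
      simp only [hsum]
      refine ((hd 0 s hs).sub ?_).hasDerivWithinAt
      exact (HasDerivAt.fun_sum fun k _ => (hpow k s).smul_const _).add_const _
    have hb := norm_image_sub_le_of_norm_deriv_le_segment' hφ (C := C)
      (fun s hs => ih' s ⟨hs.1, hs.2.le⟩) s hs
    have h0 : u 0 0 - ∑ k ∈ Finset.range (N + 1), ((0 : ℝ) ^ k / (k.factorial : ℝ)) • u k 0 = 0 := by
      rw [hsum]; simp
    simp only [h0, sub_zero] at hb
    have hC0 : 0 ≤ C := (norm_nonneg _).trans (hC 0 (by simp))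
    exact hb.trans (mul_le_of_le_one_right hC0 hs.2)

section Taylor

variable {n : ℕ} {Z : Set ℂ} {hZ : IsOpen Z} {F : Type*} [NormedAddCommGroup F] [NormedSpace ℝ F]

/-- The direction of the variable `s`. -/
def sdir (n : ℕ) : X0 n × ℝ := (0, 1)

theorem sym_sdir {M : ℝ} {u : X0 n × ℝ → F} (k : ℕ)
    (hu : Sym (gradS n hZ) (fun x => bracket x.1.2.1 ^ M) u) :
    Sym (gradS n hZ) (fun x => bracket x.1.2.1 ^ (M - k)) (dw (List.replicate k (sdir n)) u) := by
  induction k with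
  | zero => simpa using hu
  | succ k ih =>
    have := ih.dd (Sum.inr ())
    rw [List.replicate_succ, dw_cons]
    refine Sym.mono this (WLE.of_le (fun x => ?_) fun x => ?_)
    · exact mul_nonneg (bracket_rpow_nonneg _ _) (bracket_rpow_nonneg _ _)
    · change bracket x.1.2.1 ^ (M - k) * bracket x.1.2.1 ^ (-1 : ℝ) ≤ _
      rw [← Real.rpow_add (bracket_pos _)]
      refine bracket_rpow_le ?_ _
      push_cast; linarith

/-- The remainder of the Taylor expansion in `s`. -/
def taylorRem (N : ℕ) (u : X0 n × ℝ → F) (x : X0 n) : F :=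
  u (x, 1) - ∑ k ∈ Finset.range N,
    ((1 : ℝ) / (k.factorial : ℝ)) • dw (List.replicate k (sdir n)) u (x, 0)

theorem dd_fst_slice {u : X0 n × ℝ → F} (hu : ContDiffOn ℝ ∞ u (gradS n hZ).dom) (v : X0 n)
    (s : ℝ) {x : X0 n} (hx : x ∈ (grad0 n hZ).dom) :
    dd v (fun x => u (x, s)) x = dd (v, 0) u (x, s) := by
  rw [dd_comp (gradS n hZ).isOpen_dom (grad0 n hZ).isOpen_dom hu
    (T := fun x => (x, s)) (contDiff_id.prodMk contDiff_const).contDiffOn (fun _ h => h) v hx]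
  have : HasFDerivAt (fun x : X0 n => (x, s)) _ x :=
    (hasFDerivAt_id (𝕜 := ℝ) x).prodMk (hasFDerivAt_const s x)
  simp [dd, this.fderiv]

/-- The remainder is controlled by the Nth s-derivative on [0,1], and each s-derivative gains one
order. Since coordinate derivatives commute with forming the remainder, estimates of derivatives
reduce to the undifferentiated bound for a differentiated u. -/
theorem s0_taylorRem {N : ℕ} {M : ℝ} {u : X0 n × ℝ → F}
    (hu : Sym (gradS n hZ) (fun x => bracket x.1.2.1 ^ M) u) :
    S0 hZ (M - N) (taylorRem N u) := by
  have hΩ := (gradS n hZ).isOpen_dom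
  have hsm : ∀ {u : X0 n × ℝ → F}, ContDiffOn ℝ ∞ u (gradS n hZ).dom → ∀ s : ℝ,
      ContDiffOn ℝ ∞ (fun x => u (x, s)) (grad0 n hZ).dom := fun hu s =>
    hu.comp (contDiff_id.prodMk contDiff_const).contDiffOn fun _ h => h
  have hsmooth : ∀ {u : X0 n × ℝ → F}, ContDiffOn ℝ ∞ u (gradS n hZ).dom →
      ContDiffOn ℝ ∞ (taylorRem N u) (grad0 n hZ).dom := fun hu =>
    (hsm hu 1).sub (ContDiffOn.sum fun k _ =>
      (hsm (contDiffOn_dw hΩ hu _) 0).const_smul _)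
  intro k
  induction k generalizing M u with
  | zero => exact ⟨hsmooth hu.contDiffOn, taylorRem_bound hu⟩
  | succ k ih =>
    refine ⟨⟨hsmooth hu.contDiffOn, taylorRem_bound hu⟩, fun i => ?_⟩
    have h1 : Sym (gradS n hZ) (fun x => bracket x.1.2.1 ^ (M + ord0 i : ℝ))
        (dd (dir0 n i, 0) u) := by
      have := hu.dd (Sum.inl i)
      refine Sym.mono this (WLE.of_le (fun x => ?_) fun x => ?_)
      · exact mul_nonneg (bracket_rpow_nonneg _ _) (bracket_rpow_nonneg _ _)
      · rw [Real.rpow_add (bracket_pos _)]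
        exact le_rfl
    refine ((ih h1).congr fun x hx => ?_).mono (WLE.of_le (fun _ => bracket_rpow_nonneg _ _)
      fun x => ?_)
    · have e1 : dd (dir0 n i) (taylorRem N u) x = dd (dir0 n i) (fun x => u (x, 1)) x -
          ∑ k ∈ Finset.range N, ((1 : ℝ) / (k.factorial : ℝ)) •
            dd (dir0 n i) (fun x => dw (List.replicate k (sdir n)) u (x, 0)) x := by
        have hd1 := (differentiableAt_of_contDiffOn (grad0 n hZ).isOpen_dom
          (hsm hu.contDiffOn 1) hx).hasFDerivAt
        have hd2 := fun k => (differentiableAt_of_contDiffOn (grad0 n hZ).isOpen_dom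
          (hsm (contDiffOn_dw hΩ hu.contDiffOn (List.replicate k (sdir n))) 0) hx).hasFDerivAt
        have h := hd1.sub (HasFDerivAt.fun_sum fun k (_ : k ∈ Finset.range N) =>
          (hd2 k).const_smul ((1 : ℝ) / (k.factorial : ℝ)))
        have h' : HasFDerivAt (taylorRem N u) _ x := h
        simp [dd, h'.fderiv]
      refine e1.trans ?_
      rw [dd_fst_slice hu.contDiffOn _ _ hx, taylorRem]
      congr 1
      refine Finset.sum_congr rfl fun k _ => ?_
      rw [dd_fst_slice (contDiffOn_dw hΩ hu.contDiffOn _) _ _ hx]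
      congr 1
      have hp := dw_perm hΩ hu.contDiffOn (l := (dir0 n i, (0 : ℝ)) :: List.replicate k (sdir n))
        (l' := List.replicate k (sdir n) ++ [(dir0 n i, (0 : ℝ))])
        (List.perm_append_singleton _ _).symm
      have := hp (show ((x, (0 : ℝ)) : X0 n × ℝ) ∈ (gradS n hZ).dom from hx)
      rw [dw_append] at this
      exact this
    · change _ ≤ bracket x.2.1 ^ (M - N) * bracket x.2.1 ^ (ord0 i : ℝ)
      rw [← Real.rpow_add (bracket_pos _)]
      exact bracket_rpow_le (by linarith) _
where
  taylorRem_bound {M : ℝ} {u : X0 n × ℝ → F}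
      (hu : Sym (gradS n hZ) (fun x => bracket x.1.2.1 ^ M) u) :
      BoundedBy (grad0 n hZ) (fun x => bracket x.2.1 ^ (M - N)) (taylorRem N u) := fun r => by
    have hΩ := (gradS n hZ).isOpen_dom
    obtain ⟨C, hC⟩ := (sym_sdir N hu).boundedBy (max r 1)
    refine ⟨C, fun x hx => ?_⟩
    have h := norm_sub_taylor_le N (u := fun k s => dw (List.replicate k (sdir n)) u (x, s))
      (C := C * bracket x.2.1 ^ (M - N)) (fun k s _ => ?_) (fun s hs => ?_) 1 (by simp)
    · simpa [taylorRem] using h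
    · have hl := hasDerivAt_line hΩ (contDiffOn_dw hΩ hu.contDiffOn (List.replicate k (sdir n)))
        (sdir n) (x, 0) s (by
          have : x.2.2 ∈ Z := (grad0 n hZ).bdd_subset r hx
          simpa [gradS, sdir] using this)
      simpa [sdir, List.replicate_succ] using hl
    · refine hC (x, s) ⟨coneBdd_mono Z (le_max_left _ _) hx, ?_⟩
      rw [abs_of_nonneg hs.1]
      exact hs.2.trans (by exact_mod_cast le_max_right r 1)

end Taylor

/-! ### Multi-indices -/

section MultiIndex

variable {n : ℕ}

theorem len_add (σ τ : Fin n → ℕ) : len (σ + τ) = len σ + len τ := by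
  simp [len, Finset.sum_add_distrib]

theorem len_single (j : Fin n) : len (Pi.single j 1 : Fin n → ℕ) = 1 := by
  simp [len]

theorem mem_piAntidiag_univ {k : ℕ} {σ : Fin n → ℕ} :
    σ ∈ Finset.piAntidiag (Finset.univ : Finset (Fin n)) k ↔ len σ = k := by
  simp [Finset.mem_piAntidiag, len]

theorem multiFactorial_add_single (σ : Fin n → ℕ) (j : Fin n) :
    multiFactorial (σ + Pi.single j 1) = (σ j + 1) * multiFactorial σ := by
  have h : ∀ i, ((σ + Pi.single j 1 : Fin n → ℕ) i).factorial =
      (if i = j then σ j + 1 else 1) * (σ i).factorial := fun i => by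
    by_cases hij : i = j
    · subst hij; simp [Nat.factorial_succ]
    · simp [hij]
  rw [multiFactorial, Finset.prod_congr rfl fun i _ => h i, Finset.prod_mul_distrib]
  simp [multiFactorial]

theorem multiFactorial_ne_zero (σ : Fin n → ℕ) : (multiFactorial σ : ℂ) ≠ 0 := by
  rw [multiFactorial, Nat.cast_ne_zero, Finset.prod_ne_zero_iff]
  exact fun i _ => Nat.factorial_ne_zero _

theorem sub_single_add (σ : Fin n → ℕ) {j : Fin n} (h : σ j ≠ 0) :
    σ - Pi.single j 1 + Pi.single j 1 = σ := by
  ext i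
  by_cases hij : i = j
  · subst hij; simp; omega
  · simp [hij]

theorem multi_induction {p : (Fin n → ℕ) → Prop} (h0 : p 0)
    (hs : ∀ σ j, p σ → p (σ + Pi.single j 1)) (σ : Fin n → ℕ) : p σ := by
  obtain ⟨k, hk⟩ : ∃ k, len σ = k := ⟨_, rfl⟩
  induction k generalizing σ with
  | zero =>
    have : σ = 0 := by
      ext i
      have := (Finset.sum_eq_zero_iff (s := Finset.univ) (f := σ)).1 hk i (Finset.mem_univ i)
      simpa using this
    rwa [this]
  | succ k ih =>
    obtain ⟨j, hj⟩ : ∃ j, σ j ≠ 0 := by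
      by_contra! h
      simp [len, h] at hk
    have e := sub_single_add σ hj
    have hl : len (σ - Pi.single j 1) = k := by
      have := congrArg len e
      rw [len_add, len_single, hk] at this
      omega
    rw [← e]
    exact hs _ j (ih _ hl)

variable {F : Type*} [AddCommGroup F] [Module ℂ F]

/-- The pairs (σ, j) correspond to τ = σ + e_j with τ_j ≠ 0, where 1/σ! = τ_j/τ!, and ∑ τ_j = k + 1.
This is the bookkeeping behind k!·∑ 1/σ! in the iterated s-derivative. -/
theorem sum_piAntidiag_succ (k : ℕ) (c : (Fin n → ℕ) → F) :
    ∑ σ ∈ Finset.piAntidiag (Finset.univ : Finset (Fin n)) k, ∑ j,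
      (multiFactorial σ : ℂ)⁻¹ • c (σ + Pi.single j 1) =
    ((k : ℂ) + 1) • ∑ τ ∈ Finset.piAntidiag (Finset.univ : Finset (Fin n)) (k + 1),
      (multiFactorial τ : ℂ)⁻¹ • c τ := by
  have h1 : ∀ τ ∈ Finset.piAntidiag (Finset.univ : Finset (Fin n)) (k + 1),
      ((k : ℂ) + 1) • (multiFactorial τ : ℂ)⁻¹ • c τ =
      ∑ j, ((τ j : ℂ) * (multiFactorial τ : ℂ)⁻¹) • c τ := fun τ hτ => by
    have h : (∑ j, (τ j : ℂ)) = k + 1 := by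
      have := mem_piAntidiag_univ.1 hτ
      rw [len] at this
      exact_mod_cast this
    rw [← Finset.sum_smul, ← Finset.sum_mul, h, smul_smul]
  rw [Finset.smul_sum, Finset.sum_congr rfl h1, Finset.sum_comm, Finset.sum_comm (t := Finset.univ)]
  refine Finset.sum_congr rfl fun j _ => ?_
  rw [← Finset.sum_filter_add_sum_filter_not (Finset.piAntidiag _ (k + 1)) (fun τ => τ j ≠ 0),
    Finset.sum_eq_zero (s := Finset.filter (fun τ : Fin n → ℕ => ¬ τ j ≠ 0) _), add_zero]
  · refine Finset.sum_nbij' (fun σ => σ + Pi.single j 1) (fun τ => τ - Pi.single j 1) ?_ ?_ ?_ ?_ ?_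
    · intro σ hσ
      rw [Finset.mem_filter, mem_piAntidiag_univ, len_add, len_single, mem_piAntidiag_univ.1 hσ]
      simp
    · intro τ hτ
      rw [Finset.mem_filter, mem_piAntidiag_univ] at hτ
      rw [mem_piAntidiag_univ]
      have := congrArg len (sub_single_add τ hτ.2)
      rw [len_add, len_single, hτ.1] at this
      omega
    · intro σ _
      ext i; simp
    · intro τ hτ
      exact sub_single_add τ (Finset.mem_filter.1 hτ).2
    · intro σ _
      rw [multiFactorial_add_single]
      congr 1
      have := multiFactorial_ne_zero σ
      have h' : (σ j : ℂ) + 1 ≠ 0 := Nat.cast_add_one_ne_zero _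
      simp
      field_simp
  · intro τ hτ
    have : τ j = 0 := by simpa using (Finset.mem_filter.1 hτ).2
    simp [this]

theorem multiChoose_eq_zero {σ γ : Fin n → ℕ} (h : ¬ γ ≤ σ) : multiChoose σ γ = 0 := by
  rw [Pi.le_def, not_forall] at h
  obtain ⟨i, hi⟩ := h
  exact Finset.prod_eq_zero (Finset.mem_univ i) (Nat.choose_eq_zero_of_lt (not_le.1 hi))

theorem multiChoose_add_single (σ γ : Fin n → ℕ) (j : Fin n) :
    multiChoose (σ + Pi.single j 1) γ =
      multiChoose σ γ + if γ j = 0 then 0 else multiChoose σ (γ - Pi.single j 1) := by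
  have h : ∀ τ γ : Fin n → ℕ, multiChoose τ γ = (τ j).choose (γ j) *
      ∏ i ∈ Finset.univ.erase j, (τ i).choose (γ i) := fun τ γ =>
    (Finset.mul_prod_erase _ _ (Finset.mem_univ j)).symm
  have e1 : ∏ i ∈ Finset.univ.erase j, ((σ + Pi.single j 1 : Fin n → ℕ) i).choose (γ i) =
      ∏ i ∈ Finset.univ.erase j, (σ i).choose (γ i) :=
    Finset.prod_congr rfl fun i hi => by simp [Finset.ne_of_mem_erase hi]
  have e2 : ∏ i ∈ Finset.univ.erase j, (σ i).choose ((γ - Pi.single j 1 : Fin n → ℕ) i) =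
      ∏ i ∈ Finset.univ.erase j, (σ i).choose (γ i) :=
    Finset.prod_congr rfl fun i hi => by simp [Finset.ne_of_mem_erase hi]
  rw [h, h σ γ, h σ (γ - Pi.single j 1), e1, e2]
  by_cases h0 : γ j = 0
  · simp [h0]
  · obtain ⟨g, hg⟩ := Nat.exists_eq_succ_of_ne_zero h0
    simp [hg, Nat.choose_succ_succ]
    ring

/-- Pascal's rule in the jth slot: the inductive step of the binomial theorem for two commuting
families of operators. -/
theorem sum_Iic_add_single (c : (Fin n → ℕ) → (Fin n → ℕ) → F) (σ : Fin n → ℕ) (j : Fin n) :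
    ∑ γ ∈ Finset.Iic (σ + Pi.single j 1),
      (multiChoose (σ + Pi.single j 1) γ : ℂ) • c (σ + Pi.single j 1 - γ) γ =
    ∑ γ ∈ Finset.Iic σ, (multiChoose σ γ : ℂ) • c (σ - γ + Pi.single j 1) γ +
      ∑ γ ∈ Finset.Iic σ, (multiChoose σ γ : ℂ) • c (σ - γ) (γ + Pi.single j 1) := by
  have hle : σ ≤ σ + Pi.single j 1 := le_self_add
  have h1 : ∀ γ, (multiChoose (σ + Pi.single j 1) γ : ℂ) • c (σ + Pi.single j 1 - γ) γ =
      (multiChoose σ γ : ℂ) • c (σ + Pi.single j 1 - γ) γ +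
      (if γ j = 0 then 0 else (multiChoose σ (γ - Pi.single j 1) : ℂ) •
        c (σ + Pi.single j 1 - γ) γ) := fun γ => by
    rw [multiChoose_add_single]
    split_ifs <;> simp [add_smul]
  simp only [h1, Finset.sum_add_distrib]
  congr 1
  · symm
    refine Finset.sum_subset_zero_on_sdiff (Finset.Iic_subset_Iic.2 hle) ?_ ?_
    · intro γ hγ
      rw [Finset.mem_sdiff, Finset.mem_Iic, Finset.mem_Iic] at hγ
      rw [multiChoose_eq_zero hγ.2, Nat.cast_zero, zero_smul]
    · intro γ hγ
      rw [tsub_add_eq_add_tsub (Finset.mem_Iic.1 hγ)]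
  · rw [← Finset.sum_filter_add_sum_filter_not (Finset.Iic (σ + Pi.single j 1)) (fun γ => γ j = 0),
      Finset.sum_eq_zero (s := Finset.filter (fun γ : Fin n → ℕ => γ j = 0) _), zero_add]
    · symm
      refine Finset.sum_nbij' (fun γ => γ + Pi.single j 1) (fun γ => γ - Pi.single j 1) ?_ ?_ ?_ ?_ ?_
      · intro γ hγ
        rw [Finset.mem_filter, Finset.mem_Iic]
        exact ⟨add_le_add_left (Finset.mem_Iic.1 hγ) _, by simp⟩
      · intro γ hγ
        rw [Finset.mem_filter, Finset.mem_Iic] at hγ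
        rw [Finset.mem_Iic]
        exact tsub_le_iff_right.2 hγ.1
      · intro γ _
        ext i; simp
      · intro γ hγ
        exact sub_single_add γ (Finset.mem_filter.1 hγ).2
      · intro γ _
        rw [if_neg (by simp)]
        congr 2
        · congr 1; ext i; simp
        · rw [add_tsub_add_eq_tsub_right]
    · intro γ hγ
      rw [if_pos (Finset.mem_filter.1 hγ).2]

end MultiIndex

/-! ### Derivatives with multi-indices -/

section MultiDerivatives

variable {n : ℕ} {V F : Type*} [NormedAddCommGroup V] [NormedSpace ℝ V]
  [NormedAddCommGroup F] [NormedSpace ℝ F]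

/-- The list of the directions of a derivative with multi-index `σ`. -/
def mdList {X : Type*} (v : Fin n → X) (σ : Fin n → ℕ) : List X :=
  (List.finRange n).flatMap fun j => List.replicate (σ j) (v j)

theorem coe_mdList {X : Type*} (v : Fin n → X) (σ : Fin n → ℕ) :
    (mdList v σ : Multiset X) = ∑ j, σ j • ({v j} : Multiset X) := by
  rw [mdList, ← Multiset.coe_bind]
  rw [Multiset.bind, Multiset.join]
  simp only [Multiset.map_coe, Multiset.sum_coe, Fin.sum_univ_def, Multiset.nsmul_singleton]
  rfl

theorem length_mdList {X : Type*} (v : Fin n → X) (σ : Fin n → ℕ) : (mdList v σ).length = len σ := by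
  rw [← Multiset.coe_card, coe_mdList]
  simp [len]

theorem mdList_map {X Y : Type*} (φ : X → Y) (v : Fin n → X) (σ : Fin n → ℕ) :
    (mdList v σ).map φ = mdList (fun j => φ (v j)) σ := by
  simp [mdList, List.map_flatMap]

/-- The derivative `∂_{v₁}^{σ₁} ⋯ ∂_{vₙ}^{σₙ} u`. -/
def md (v : Fin n → V) (σ : Fin n → ℕ) (u : V → F) : V → F := dw (mdList v σ) u

theorem md_zero (v : Fin n → V) (u : V → F) : md v 0 u = u := by
  have : mdList v 0 = [] := by simp [mdList]
  rw [md, this, dw_nil]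

theorem dw_replicate (k : ℕ) (v : V) (u : V → F) : dw (List.replicate k v) u = (dd v)^[k] u := by
  induction k with
  | zero => rfl
  | succ k ih => rw [List.replicate_succ, dw_cons, ih, Function.iterate_succ_apply']

theorem multiDeriv_eq_md {A : Type*} [CStarAlgebra A] (v : Fin n → E n) (σ : Fin n → ℕ)
    (u : E n → A) : multiDeriv v σ u = md v σ u := by
  rw [multiDeriv, md, mdList]
  induction List.finRange n with
  | nil => rfl
  | cons j l ih =>
    rw [List.foldr_cons, ih, List.flatMap_cons, dw_append, dw_replicate]
    rfl

theorem dw_eqOn_of_coe_eq {Ω : Set V} (hΩ : IsOpen Ω) {u : V → F} (hu : ContDiffOn ℝ ∞ u Ω)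
    {l l' : List V} (h : (l : Multiset V) = l') :
    Set.EqOn (dw l u) (dw l' u) Ω := dw_perm hΩ hu (Multiset.coe_eq_coe.1 h)

theorem md_add_single {Ω : Set V} (hΩ : IsOpen Ω) {u : V → F} (hu : ContDiffOn ℝ ∞ u Ω)
    (v : Fin n → V) (σ : Fin n → ℕ) (j : Fin n) :
    Set.EqOn (md v (σ + Pi.single j 1) u) (dd (v j) (md v σ u)) Ω := by
  have h := dw_eqOn_of_coe_eq hΩ hu (l := mdList v (σ + Pi.single j 1))
    (l' := v j :: mdList v σ) (by
    rw [← Multiset.cons_coe, coe_mdList, coe_mdList, ← Multiset.singleton_add]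
    simp only [Pi.add_apply, add_smul, Finset.sum_add_distrib]
    rw [add_comm]
    congr 1
    rw [Finset.sum_eq_single j]
    · simp
    · intro i _ hi; simp [hi]
    · simp)
  exact h

theorem dd_md_md {Ω : Set V} (hΩ : IsOpen Ω) {u : V → F} (hu : ContDiffOn ℝ ∞ u Ω)
    (v w : Fin n → V) (σ τ : Fin n → ℕ) (j : Fin n) :
    Set.EqOn (dd (w j) (md v σ (md w τ u))) (md v σ (md w (τ + Pi.single j 1) u)) Ω := by
  have h := dw_eqOn_of_coe_eq hΩ hu (l := w j :: (mdList v σ ++ mdList w τ))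
    (l' := mdList v σ ++ (w j :: mdList w τ))
    (by
      rw [Multiset.coe_eq_coe]
      exact List.perm_middle.symm)
  refine Set.EqOn.trans ?_ (h.trans ?_)
  · rw [dw_cons, dw_append]; exact fun _ _ => rfl
  · rw [dw_append]
    exact dw_eqOn hΩ (md_add_single hΩ hu w τ j).symm _

theorem dw_add {Ω : Set V} (hΩ : IsOpen Ω) {u : V → F} (hu : ContDiffOn ℝ ∞ u Ω)
    {w : V → F} (hw : ContDiffOn ℝ ∞ w Ω) (l : List V) :
    Set.EqOn (dw l fun x => u x + w x) (fun x => dw l u x + dw l w x) Ω := by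
  induction l with
  | nil => exact fun _ _ => rfl
  | cons v l ih =>
    exact (dd_eqOn hΩ ih v).trans (dd_add hΩ (contDiffOn_dw hΩ hu l) (contDiffOn_dw hΩ hw l) v)

theorem dw_clm {Ω : Set V} (hΩ : IsOpen Ω) {u : V → F} (hu : ContDiffOn ℝ ∞ u Ω)
    {F' : Type*} [NormedAddCommGroup F'] [NormedSpace ℝ F'] (L : F →L[ℝ] F')
    (l : List V) : Set.EqOn (dw l fun x => L (u x)) (fun x => L (dw l u x)) Ω := by
  induction l with
  | nil => exact fun _ _ => rfl
  | cons v l ih => exact (dd_eqOn hΩ ih v).trans (dd_clm L hΩ (contDiffOn_dw hΩ hu l) v)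

theorem dw_sub {Ω : Set V} (hΩ : IsOpen Ω) {u : V → F} (hu : ContDiffOn ℝ ∞ u Ω)
    {w : V → F} (hw : ContDiffOn ℝ ∞ w Ω) (l : List V) :
    Set.EqOn (dw l fun x => u x - w x) (fun x => dw l u x - dw l w x) Ω := by
  have h := dw_clm hΩ hw (-ContinuousLinearMap.id ℝ F) l
  have h2 := dw_add hΩ hu (w := fun x => -w x) hw.neg l
  intro x hx
  have e1 := h2 hx
  have e2 := h hx
  simp only [neg_apply, ContinuousLinearMap.id_apply] at e2
  simp only [sub_eq_add_neg]
  rw [e1]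
  simp only [e2]

theorem dw_sum {κ : Type*} {Ω : Set V} (hΩ : IsOpen Ω) (s : Finset κ) {u : κ → V → F}
    (hu : ∀ j ∈ s, ContDiffOn ℝ ∞ (u j) Ω) (l : List V) :
    Set.EqOn (dw l fun x => ∑ j ∈ s, u j x) (fun x => ∑ j ∈ s, dw l (u j) x) Ω := by
  induction l with
  | nil => exact fun _ _ => rfl
  | cons v l ih =>
    exact (dd_eqOn hΩ ih v).trans (dd_sum hΩ s (fun j hj => contDiffOn_dw hΩ (hu j hj) l) v)

end MultiDerivatives

/-! ### The composition as an oscillatory integral with parameters -/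

section Composition

variable {n : ℕ} {A : Type*} [CStarAlgebra A] {α : CStarAction n A} {Z : Set ℂ} {hZ : IsOpen Z}
  (B : Matrix (Fin n) (Fin n) ℝ)

/-- The amplitude `f(t, ξ + s η, z) G(t - y, ξ + B y, z)`. -/
def compAmp (f G : X0 n → A) (x : (X0 n × ℝ) × (E n × E n)) : A :=
  f (shiftEta x) * G (shiftY B x)

/-- The oscillatory integral of `f(t, ξ + s η, z) G(t - y, ξ + B y, z)`. -/
def comp (f G : X0 n → A) (x : X0 n × ℝ) : A := osc fun p => compAmp B f G (x, p)

/-- The direction of `∂_{y_j}` of `G(t - y, ξ + B y, z)`. -/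
def bdir (j : Fin n) : X0 n := (-stdVec n j, matCLM B (stdVec n j), 0)

/-- Peetre's inequality, used for both factors, moves the weights at ξ + sη and ξ + By to ξ; the
price is the growth |m| + |M| in (y,η), which is irrelevant for the oscillatory integral. -/
theorem pAmp_compAmp {m M : ℝ} {f G : X0 n → A} (hf : S0 hZ m f) (hG : S0 hZ M G) :
    PAmp (gradS n hZ) (fun x => bracket x.1.2.1 ^ (m + M)) (|m| + |M|) (compAmp B f G) := by
  have h1 := (substEta hZ).sym (fun _ => bracket_rpow_nonneg _ _) hf
  have h2 := (substY hZ B).sym (fun _ => bracket_rpow_nonneg _ _) hG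
  refine (h1.mul h2).mono fun r =>
    ⟨(2 * (1 + (r : ℝ))) ^ |m| * (2 * (1 + ‖matCLM B‖)) ^ |M|, fun x hx => ?_⟩
  have e1 := bracket_add_rpow_le (Nat.cast_nonneg r) (norm_smul_snd_le hx.1.2 x.2) x.1.1.2.1 m
  have e2 := bracket_add_rpow_le (norm_nonneg (matCLM B)) (norm_matCLM_le B x.2) x.1.1.2.1 M
  rw [abs_of_nonneg (mul_nonneg (bracket_rpow_nonneg _ _) (bracket_rpow_nonneg _ _))]
  simp only
  rw [Real.rpow_add (bracket_pos _), Real.rpow_add (jb_pos _)]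
  refine (mul_le_mul e1 e2 (bracket_rpow_nonneg _ _)
    ((bracket_rpow_nonneg _ _).trans e1)).trans (le_of_eq ?_)
  ring

theorem sym_comp {m M : ℝ} {f G : X0 n → A} (hf : S0 hZ m f) (hG : S0 hZ M G) :
    Sym (gradS n hZ) (fun x => bracket x.1.2.1 ^ (m + M)) (comp B f G) :=
  (pAmp_compAmp B hf hG).sym_osc (fun _ => bracket_rpow_nonneg _ _)
    ((continuous_bracket_rpow _).comp (by fun_prop)).continuousOn (regularS hZ)

variable {B}

theorem amp_compAmp {m M : ℝ} {f G : X0 n → A} (hf : S0 hZ m f) (hG : S0 hZ M G)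
    {x : X0 n × ℝ} (hx : x ∈ (gradS n hZ).dom) :
    Amp (|m| + |M|) (fun p => compAmp B f G (x, p)) := by
  obtain ⟨r, hr⟩ := (regularS hZ).mem_bdd hx
  exact (pAmp_compAmp B hf hG).fix (fun _ => bracket_rpow_nonneg _ _) hr

theorem comp_congr {f f' G G' : X0 n → A} (hf : Set.EqOn f f' (grad0 n hZ).dom)
    (hG : Set.EqOn G G' (grad0 n hZ).dom) :
    Set.EqOn (comp B f G) (comp B f' G') (gradS n hZ).dom := fun x hx => by
  simp only [comp]
  congr 1
  ext p
  have h1 : shiftEta (x, p) ∈ (grad0 n hZ).dom := hx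
  have h2 : shiftY B (x, p) ∈ (grad0 n hZ).dom := hx
  simp only [compAmp, hf h1, hG h2]

/-- At s = 0 the amplitude does not depend on η, so Fourier inversion evaluates it at y = 0; the
left factor is then constant and comes out of the integral. -/
theorem comp_zero {M : ℝ} {f G : X0 n → A} (hG : S0 hZ M G) {x : X0 n}
    (hx : x ∈ (grad0 n hZ).dom) : comp B f G (x, 0) = f x * G x := by
  have h1 : Amp (|0| + |M|) (fun p => compAmp B (fun _ => 1) G ((x, (0 : ℝ)), p)) :=
    amp_compAmp (S0.const le_rfl 1) hG hx
  have h2 := HasOsc.const (U := fun y => G (x.1 - y, x.2.1 + matCLM B y, x.2.2)) (q := |0| + |M|)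
    (by simpa only [compAmp, one_mul, shiftY] using h1)
  have h3 := h2.clm (ContinuousLinearMap.mul ℂ A (f x))
  simp only [sub_zero, map_zero, add_zero, ContinuousLinearMap.mul_apply'] at h3
  rw [← h3.osc_eq, comp]
  congr 1
  ext p
  simp [compAmp, shiftEta, shiftY]

theorem dd_compAmp {m M : ℝ} {f G : X0 n → A} (hf : S0 hZ m f) (hG : S0 hZ M G)
    (v : (X0 n × ℝ) × (E n × E n)) {x : (X0 n × ℝ) × (E n × E n)} (hx : x.1.1.2.2 ∈ Z) :
    dd v (compAmp B f G) x = dd (dd v shiftEta x) f (shiftEta x) * G (shiftY B x) +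
      f (shiftEta x) * dd (dd v (shiftY B) x) G (shiftY B x) := by
  have hΩ := ((gradS n hZ).amp n).isOpen_dom
  have hx' : x ∈ ((gradS n hZ).amp n).dom := ⟨hx, trivial⟩
  have m1 : Set.MapsTo shiftEta ((gradS n hZ).amp n).dom (grad0 n hZ).dom := fun x hx => hx.1
  have m2 : Set.MapsTo (shiftY B) ((gradS n hZ).amp n).dom (grad0 n hZ).dom := fun x hx => hx.1
  have c1 : ContDiffOn ℝ ∞ (fun x => f (shiftEta x)) ((gradS n hZ).amp n).dom :=
    hf.contDiffOn.comp contDiff_shiftEta.contDiffOn m1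
  have c2 : ContDiffOn ℝ ∞ (fun x => G (shiftY B x)) ((gradS n hZ).amp n).dom :=
    hG.contDiffOn.comp (contDiff_shiftY B).contDiffOn m2
  have h := dd_bilin (ContinuousLinearMap.mul ℝ A) hΩ c1 c2 v hx'
  simp only [ContinuousLinearMap.mul_apply'] at h
  rw [dd_comp (grad0 n hZ).isOpen_dom hΩ hf.contDiffOn contDiff_shiftEta.contDiffOn m1 v hx',
    dd_comp (grad0 n hZ).isOpen_dom hΩ hG.contDiffOn (contDiff_shiftY B).contDiffOn m2 v hx'] at h
  exact h

theorem dd_bdir (G : X0 n → A) (j : Fin n) : dd (bdir B j) G = fun x =>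
    (-1 : ℝ) • dd ((stdVec n j, 0, 0) : X0 n) G x +
      dd ((0, matCLM B (stdVec n j), 0) : X0 n) G x := by
  have : bdir B j = (-1 : ℝ) • ((stdVec n j, 0, 0) : X0 n) + (0, matCLM B (stdVec n j), 0) := by
    refine Prod.ext ?_ (Prod.ext ?_ ?_) <;> simp [bdir]
  ext x
  simp only [dd, this, map_add, map_smul]

theorem S0.dd_bdir {M : ℝ} {G : X0 n → A} (hG : S0 hZ M G) (j : Fin n) :
    S0 hZ M (dd (bdir B j) G) := by
  rw [TwistedCalculus.dd_bdir]
  exact ((hG.dd_t _).const_smul _).add ((hG.dd_x _).mono (by linarith))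

/-- Differentiation in s brings out ∑ η_j ∂_{ξ_j} f. Integration by parts in y replaces η_j by
-i∂_{y_j}, which meets only G(t-y, ξ+By, z), because f(t, ξ+sη, z) is independent of y; on G it acts
along `bdir`. The left factor has lost one order and the right one has not gained any. -/
theorem dd_sdir_comp {m M : ℝ} {f G : X0 n → A} (hf : S0 hZ m f) (hG : S0 hZ M G) :
    Set.EqOn (dd (sdir n) (comp B f G))
      (fun x => -Complex.I • ∑ j, comp B (dd (xdir j) f) (dd (bdir B j) G) x)
      (gradS n hZ).dom := fun x hx => by
  have h1 := (pAmp_compAmp B hf hG).dd_osc (fun _ => bracket_rpow_nonneg _ _)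
    ((continuous_bracket_rpow _).comp (by fun_prop)).continuousOn (regularS hZ) (Sum.inr ()) hx
  refine h1.trans ?_
  have hfj : ∀ j, S0 hZ (m - 1) (dd (xdir j) f) := fun j => hf.dd_x _
  have hGj : ∀ j, S0 hZ M (dd (bdir B j) G) := fun j => hG.dd_bdir j
  have h2 : ∀ j, HasOsc (fun p => dualCoord (Sum.inl j) p • compAmp B (dd (xdir j) f) G (x, p))
      (-Complex.I • comp B (dd (xdir j) f) (dd (bdir B j) G) x) := fun j => by
    refine HasOsc.dualCoord_smul (amp_compAmp (hfj j) hG hx) (Sum.inl j) ?_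
      (amp_compAmp (hfj j) hG hx).hasOsc
    have h3 := (amp_compAmp (B := B) (hfj j) (hGj j) hx).hasOsc
    refine (congrArg (fun a => HasOsc a _) (funext fun p => ?_)).mpr h3
    rw [dd_fix (gradS n hZ).isOpen_dom (pAmp_compAmp B (hfj j) hG).contDiffOn hx,
      dd_compAmp (x := (x, p)) (hfj j) hG _ hx, dd_shiftEta, dd_shiftY]
    have e0 : dd (0 : X0 n) (dd (xdir j) f) (shiftEta (x, p)) = 0 := by simp [dd]
    have e1 : dd ((0, 0, 0) : X0 n) (dd (xdir j) f) (shiftEta (x, p)) = 0 := e0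
    simp [pdir, compAmp, e1, bdir]
  have h4 := HasOsc.sum Finset.univ fun j _ => h2 j
  rw [← Finset.smul_sum] at h4
  refine Eq.trans ?_ h4.osc_eq
  simp only
  congr 1
  ext p
  have h5 := dd_compAmp (B := B) hf hG ((sdir n, 0) : (X0 n × ℝ) × (E n × E n)) (x := (x, p)) hx
  refine h5.trans ?_
  rw [dd_shiftEta, dd_shiftY]
  have e0 : dd ((0, 0, 0) : X0 n) G (shiftY B (x, p)) = 0 := by
    change dd (0 : X0 n) G _ = 0
    simp [dd]
  have e1 : dd ((0, p.2, 0) : X0 n) f (shiftEta (x, p)) =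
      ∑ j, p.2 j • dd (xdir j) f (shiftEta (x, p)) := by
    rw [← sum_smul_xdir, dd_dir_sum]
  simp only [sdir, Prod.fst_zero, Prod.snd_zero, one_smul, smul_zero, add_zero, zero_add, map_zero,
    sub_zero, e0, mul_zero, e1, Finset.sum_mul, compAmp, smul_mul_assoc]
  rfl

theorem contDiffOn_comp {m M : ℝ} {f G : X0 n → A} (hf : S0 hZ m f) (hG : S0 hZ M G) :
    ContDiffOn ℝ ∞ (comp B f G) (gradS n hZ).dom := (sym_comp B hf hG).contDiffOn

/-- Holomorphy is checked under the oscillatory integral, where the product rule gives the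
Cauchy–Riemann equation of the amplitude. Equivariance holds since α_s is a bounded multiplicative
map and commutes with oscillatory integrals. -/
theorem Good.comp_one {m M : ℝ} {f G : X0 n → A} (hf : Good α hZ m f) (hG : Good α hZ M G) :
    Good α hZ (m + M) (fun x => comp B f G (x, 1)) := by
  have hs := (substS hZ 1).sym (W := fun x : X0 n × ℝ => bracket x.1.2.1 ^ (m + M))
    (fun _ => bracket_rpow_nonneg _ _) (sym_comp B hf.sym hG.sym)
  refine ⟨hs, fun x hx => ?_, fun s x hx => ?_⟩
  · have hxS : ((x, (1 : ℝ)) : X0 n × ℝ) ∈ (gradS n hZ).dom := hx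
    have hc := contDiffOn_comp (B := B) hf.sym hG.sym
    rw [dd_fst_slice hc _ _ hx, dd_fst_slice hc _ _ hx]
    have h1 := fun i => (pAmp_compAmp B hf.sym hG.sym).dd_osc (fun _ => bracket_rpow_nonneg _ _)
      ((continuous_bracket_rpow _).comp (by fun_prop)).continuousOn (regularS hZ) (Sum.inl i) hxS
    have hI := h1 (Sum.inr (Sum.inr 1))
    have h0 := h1 (Sum.inr (Sum.inr 0))
    have key : ∀ p, dd (((zdir Complex.I, 0), 0) : (X0 n × ℝ) × (E n × E n)) (compAmp B f G)
        ((x, 1), p) = Complex.I • dd (((zdir 1, 0), 0) : (X0 n × ℝ) × (E n × E n))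
          (compAmp B f G) ((x, 1), p) := fun p => by
      have e1 : ∀ c : ℂ, dd (((zdir c, 0), 0) : (X0 n × ℝ) × (E n × E n)) shiftEta ((x, 1), p) =
          zdir c := fun c => by
        rw [dd_shiftEta]; simp [zdir]
      have e2 : ∀ c : ℂ, dd (((zdir c, 0), 0) : (X0 n × ℝ) × (E n × E n)) (shiftY B) ((x, 1), p) =
          zdir c := fun c => by
        rw [dd_shiftY]; simp [zdir]
      rw [dd_compAmp hf.sym hG.sym _ hx, dd_compAmp hf.sym hG.sym _ hx, e1, e1, e2, e2,
        hf.hol (shiftEta ((x, 1), p)) hx, hG.hol (shiftY B ((x, 1), p)) hx, smul_add, smul_mul_assoc, mul_smul_comm]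
    refine hI.trans (Eq.trans ?_ (congrArg (fun a => Complex.I • a) h0.symm))
    obtain ⟨r, hr⟩ := (regularS hZ).mem_bdd hxS
    have hA := ((pAmp_compAmp B hf.sym hG.sym).ddX (Sum.inr (Sum.inr 0) |> Sum.inl)).fix
      (fun x => mul_nonneg (bracket_rpow_nonneg _ _) ((gradS n hZ).wt_nonneg _ _)) hr
    exact (congrArg osc (funext key)).trans (hA.hasOsc.const_smul Complex.I).osc_eq
  · have h := (amp_compAmp (B := B) hf.sym hG.sym
      (show ((x, (1 : ℝ)) : X0 n × ℝ) ∈ (gradS n hZ).dom from hx)).hasOsc.clm (actL α s)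
    refine Eq.trans ?_ h.osc_eq
    simp only [comp]
    congr 1
    ext p
    simp only [compAmp, actL_apply, map_mul]
    have h1 := hf.eqv s (shiftEta ((x, 1), p)) hx
    have h2 := hG.eqv s (shiftY B ((x, 1), p)) hx
    rw [← h1, ← h2]
    simp [shiftEta, shiftY, add_sub_assoc]

end Composition

/-! ### Asymptotic expansion of the composition product. -/

section Expansion

variable {n : ℕ} {A : Type*} [CStarAlgebra A] {α : CStarAction n A} {Z : Set ℂ} {hZ : IsOpen Z}
  {B : Matrix (Fin n) (Fin n) ℝ}

/-- The direction of `∂_{B,ξ_j}`. -/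
def Bdir (B : Matrix (Fin n) (Fin n) ℝ) (j : Fin n) : X0 n := (0, matCLM B (stdVec n j), 0)

theorem Good.dw_t {M : ℝ} {u : X0 n → A} (hu : Good α hZ M u) (l : List (E n)) :
    Good α hZ M (dw (l.map fun v => ((v, 0, 0) : X0 n)) u) := by
  induction l with
  | nil => exact hu
  | cons v l ih => exact ih.dd_t v

theorem Good.dw_x {M : ℝ} {u : X0 n → A} (hu : Good α hZ M u) (l : List (E n)) :
    Good α hZ (M - l.length) (dw (l.map fun v => ((0, v, 0) : X0 n)) u) := by
  induction l with
  | nil => simpa using hu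
  | cons v l ih => exact (ih.dd_x v).of_eq (by push_cast [List.length_cons]; ring)

theorem Good.md_tdir {M : ℝ} {u : X0 n → A} (hu : Good α hZ M u) (σ : Fin n → ℕ) :
    Good α hZ M (md tdir σ u) := by
  have := hu.dw_t (mdList (stdVec n) σ)
  rwa [mdList_map] at this

theorem Good.md_xdir {M : ℝ} {u : X0 n → A} (hu : Good α hZ M u) (σ : Fin n → ℕ) :
    Good α hZ (M - len σ) (md xdir σ u) := by
  have := hu.dw_x (mdList (stdVec n) σ)
  rwa [mdList_map, length_mdList] at this

theorem Good.md_Bdir {M : ℝ} {u : X0 n → A} (hu : Good α hZ M u) (σ : Fin n → ℕ) :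
    Good α hZ (M - len σ) (md (Bdir B) σ u) := by
  have := hu.dw_x (mdList (fun j => matCLM B (stdVec n j)) σ)
  rwa [mdList_map, length_mdList] at this

theorem Good.dd_bdir {M : ℝ} {u : X0 n → A} (hu : Good α hZ M u) (j : Fin n) :
    Good α hZ M (dd (bdir B j) u) := hu.dd_of (hu.sym.dd_bdir j)

theorem Good.md_bdir {M : ℝ} {u : X0 n → A} (hu : Good α hZ M u) (σ : Fin n → ℕ) :
    Good α hZ M (md (bdir B) σ u) := by
  rw [md, mdList]
  have : ∀ l : List (Fin n), Good α hZ M (dw (l.map (bdir B)) u) := fun l => by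
    induction l with
    | nil => exact hu
    | cons j l ih => exact ih.dd_bdir j
  have h := this ((List.finRange n).flatMap fun j => List.replicate (σ j) j)
  simpa only [List.map_flatMap, List.map_replicate] using h

/-- Iteration of `dd_sdir_comp`; `sum_piAntidiag_succ` collects the ordered words of derivatives
into multi-indices with the factor k!/σ!. -/
theorem dw_sdir_comp {m M : ℝ} {f G : X0 n → A} (hf : Good α hZ m f) (hG : Good α hZ M G) (k : ℕ) :
    Set.EqOn (dw (List.replicate k (sdir n)) (comp B f G))
      (fun x => ((-Complex.I) ^ k * (k.factorial : ℂ)) •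
        ∑ σ ∈ Finset.piAntidiag (Finset.univ : Finset (Fin n)) k,
          (multiFactorial σ : ℂ)⁻¹ • comp B (md xdir σ f) (md (bdir B) σ G) x)
      (gradS n hZ).dom := by
  have hΩ := (gradS n hZ).isOpen_dom
  have hΩ0 := (grad0 n hZ).isOpen_dom
  induction k with
  | zero =>
    intro x _
    have : Finset.piAntidiag (Finset.univ : Finset (Fin n)) 0 = {0} := by simp
    simp [this, md_zero, multiFactorial]
  | succ k ih =>
    rw [List.replicate_succ, dw_cons]
    refine (dd_eqOn hΩ ih (sdir n)).trans fun x hx => ?_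
    have hc : ∀ σ, ContDiffOn ℝ ∞ (comp B (md xdir σ f) (md (bdir B) σ G)) (gradS n hZ).dom :=
      fun σ => contDiffOn_comp (hf.md_xdir σ).sym (hG.md_bdir σ).sym
    have hcs : ∀ σ, ContDiffOn ℝ ∞ (fun x => (multiFactorial σ : ℂ)⁻¹ •
        comp B (md xdir σ f) (md (bdir B) σ G) x) (gradS n hZ).dom :=
      fun σ => (hc σ).const_smul _
    have e1 : ∀ (c : ℂ) {w : X0 n × ℝ → A}, ContDiffOn ℝ ∞ w (gradS n hZ).dom →
        dd (sdir n) (fun x => c • w x) x = c • dd (sdir n) w x := fun c w hw =>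
      dd_clm ((ContinuousLinearMap.lsmul ℝ ℂ : ℂ →L[ℝ] A →L[ℝ] A) c) hΩ hw _ hx
    have e2 : ∀ σ, dd (sdir n) (comp B (md xdir σ f) (md (bdir B) σ G)) x =
        -Complex.I • ∑ j, comp B (md xdir (σ + Pi.single j 1) f)
          (md (bdir B) (σ + Pi.single j 1) G) x := fun σ => by
      refine (dd_sdir_comp (hf.md_xdir σ).sym (hG.md_bdir σ).sym hx).trans ?_
      simp only
      congr 1
      refine Finset.sum_congr rfl fun j _ => ?_
      exact comp_congr (hZ := hZ) (md_add_single hΩ0 hf.sym.contDiffOn _ σ j).symm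
        (md_add_single hΩ0 hG.sym.contDiffOn _ σ j).symm hx
    rw [e1 _ (ContDiffOn.sum fun σ _ => hcs σ), dd_sum hΩ _ (fun σ _ => hcs σ) _ hx]
    simp only [e1 _ (hc _), e2]
    have e3 := sum_piAntidiag_succ k fun σ => comp B (md xdir σ f) (md (bdir B) σ G) x
    simp only [← Finset.smul_sum] at e3
    simp only [smul_comm _ (-Complex.I), ← Finset.smul_sum]
    rw [e3, smul_smul, smul_smul, Nat.factorial_succ, pow_succ]
    congr 1
    push_cast
    ring

/-- The term of order `k` of the expansion of the composition. -/
def compTerm (B : Matrix (Fin n) (Fin n) ℝ) (k : ℕ) (f G : X0 n → A) (x : X0 n) : A :=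
  ∑ σ ∈ Finset.piAntidiag (Finset.univ : Finset (Fin n)) k,
    ((-Complex.I) ^ len σ / (multiFactorial σ : ℂ)) • (md xdir σ f x * md (bdir B) σ G x)

/-- Taylor's formula in s from s = 0 to s = 1: the k! of the s-derivative cancels the one in
Taylor's formula, and at s = 0 each `comp` is a pointwise product. -/
theorem s0_comp_sub_compTerm {m M : ℝ} {f G : X0 n → A} (hf : Good α hZ m f)
    (hG : Good α hZ M G) (N : ℕ) :
    S0 hZ (m + M - N) (fun x => comp B f G (x, 1) - ∑ k ∈ Finset.range N, compTerm B k f G x) := by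
  refine (s0_taylorRem (N := N) (sym_comp B hf.sym hG.sym)).congr fun x hx => ?_
  simp only [taylorRem]
  congr 1
  refine Finset.sum_congr rfl fun k _ => ?_
  rw [dw_sdir_comp hf hG k (show ((x, (0 : ℝ)) : X0 n × ℝ) ∈ (gradS n hZ).dom from hx), compTerm]
  simp only [comp_zero (hG.md_bdir _).sym hx, Finset.smul_sum]
  refine Finset.sum_congr rfl fun σ hσ => ?_
  rw [mem_piAntidiag_univ.1 hσ, ← Complex.coe_smul, smul_smul, smul_smul]
  congr 1
  have : (k.factorial : ℂ) ≠ 0 := by exact_mod_cast k.factorial_ne_zero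
  push_cast
  field_simp

/-- The jth direction is -∂_{t_j} + ∂_{B,j}, and the two families commute, so this is the binomial
theorem. It is the origin of the twisted derivatives in the statement, the t-derivatives turning
into powers of δ. -/
theorem md_bdir_eq {M : ℝ} {G : X0 n → A} (hG : Good α hZ M G) (σ : Fin n → ℕ) :
    Set.EqOn (md (bdir B) σ G) (fun x => ∑ γ ∈ Finset.Iic σ, (multiChoose σ γ : ℂ) •
      ((-1 : ℂ) ^ len (σ - γ) • md tdir (σ - γ) (md (Bdir B) γ G) x)) (grad0 n hZ).dom := by
  have hΩ := (grad0 n hZ).isOpen_dom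
  have hc : ∀ σ γ, ContDiffOn ℝ ∞ (md tdir σ (md (Bdir B) γ G)) (grad0 n hZ).dom := fun σ γ =>
    ((hG.md_Bdir γ).md_tdir σ).sym.contDiffOn
  induction σ using multi_induction with
  | h0 =>
    intro x _
    have : Finset.Iic (0 : Fin n → ℕ) = {0} := by ext; simp
    simp [this, md_zero, multiChoose, len]
  | hs σ j ih =>
    refine (md_add_single hΩ hG.sym.contDiffOn (bdir B) σ j).trans
      ((dd_eqOn hΩ ih _).trans fun x hx => ?_)
    have e1 : ∀ (c : ℂ) {w : X0 n → A}, ContDiffOn ℝ ∞ w (grad0 n hZ).dom →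
        dd (bdir B j) (fun x => c • w x) x = c • dd (bdir B j) w x := fun c w hw =>
      dd_clm ((ContinuousLinearMap.lsmul ℝ ℂ : ℂ →L[ℝ] A →L[ℝ] A) c) hΩ hw _ hx
    have e2 : ∀ γ, dd (bdir B j) (md tdir (σ - γ) (md (Bdir B) γ G)) x =
        (-1 : ℂ) • md tdir (σ - γ + Pi.single j 1) (md (Bdir B) γ G) x +
          md tdir (σ - γ) (md (Bdir B) (γ + Pi.single j 1) G) x := fun γ => by
      rw [TwistedCalculus.dd_bdir]
      have h1 := dd_md_md hΩ hG.sym.contDiffOn tdir (Bdir B) (σ - γ) γ j hx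
      have h2 := md_add_single hΩ (hG.md_Bdir (B := B) γ).sym.contDiffOn tdir (σ - γ) j hx
      simp only [tdir, Bdir] at h1 h2 ⊢
      rw [h1, h2]
      simp
    have hcs : ∀ γ, ContDiffOn ℝ ∞ (fun x => (-1 : ℂ) ^ len (σ - γ) •
        md tdir (σ - γ) (md (Bdir B) γ G) x) (grad0 n hZ).dom := fun γ => (hc _ _).const_smul _
    rw [dd_sum hΩ _ (fun γ _ => (hcs γ).const_smul _) _ hx]
    simp only [e1 _ (hcs _), e1 _ (hc _ _), e2]
    rw [sum_Iic_add_single (fun τ γ => (-1 : ℂ) ^ len τ • md tdir τ (md (Bdir B) γ G) x) σ j,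
      ← Finset.sum_add_distrib]
    refine Finset.sum_congr rfl fun γ _ => ?_
    rw [len_add, len_single, pow_succ, ← smul_add, smul_add, smul_smul]

/-- The part of order `l` of `∂_x^σ|_{x=0} α_{-x}(G(ξ + B x))`. -/
def tw (B : Matrix (Fin n) (Fin n) ℝ) (σ : Fin n → ℕ) (P : ℕ → X0 n → A) (l : ℕ) (x : X0 n) : A :=
  ∑ γ ∈ (Finset.Iic σ).filter (fun γ => len γ ≤ l), (multiChoose σ γ : ℂ) •
    ((-1 : ℂ) ^ len (σ - γ) • md tdir (σ - γ) (md (Bdir B) γ (P (l - len γ))) x)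

theorem Good.tw {M : ℝ} {P : ℕ → X0 n → A} {l : ℕ} (hP : ∀ i ≤ l, Good α hZ (M - i) (P i))
    (σ : Fin n → ℕ) : Good α hZ (M - l) (tw B σ P l) := by
  refine Good.sum _ fun γ hγ => ((Good.of_eq ?_ (((hP _ (Nat.sub_le _ _)).md_Bdir γ).md_tdir
    (σ - γ))).const_smul _).const_smul _
  rw [Nat.cast_sub (Finset.mem_filter.1 hγ).2]
  ring

theorem sum_range_filter_le (L a : ℕ) {F : Type*} [AddCommMonoid F] (c : ℕ → F) :
    ∑ l ∈ Finset.range L, (if a ≤ l then c (l - a) else 0) = ∑ i ∈ Finset.range (L - a), c i := by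
  rcases le_total a L with h | h
  · obtain ⟨d, rfl⟩ := Nat.exists_eq_add_of_le h
    rw [Finset.sum_range_add, Finset.sum_eq_zero, zero_add, Nat.add_sub_cancel_left]
    · simp
    · intro l hl
      rw [if_neg (by simpa using hl)]
  · rw [Nat.sub_eq_zero_of_le h, Finset.sum_range_zero]
    refine Finset.sum_eq_zero fun l hl => if_neg ?_
    have := Finset.mem_range.1 hl
    omega

theorem dw_sub_sum {V F κ : Type*} [NormedAddCommGroup V] [NormedSpace ℝ V]
    [NormedAddCommGroup F] [NormedSpace ℝ F] {Ω : Set V} (hΩ : IsOpen Ω) {u : V → F}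
    (hu : ContDiffOn ℝ ∞ u Ω) {s : Finset κ} {w : κ → V → F}
    (hw : ∀ j ∈ s, ContDiffOn ℝ ∞ (w j) Ω) (l : List V) :
    Set.EqOn (dw l fun x => u x - ∑ j ∈ s, w j x) (fun x => dw l u x - ∑ j ∈ s, dw l (w j) x) Ω :=
  fun x hx => by
  rw [dw_sub hΩ hu (ContDiffOn.sum hw) _ hx]
  simp only [dw_sum hΩ s hw _ hx]

/-- Since ∂_B^γ lowers the order by |γ|, the part P_i enters at order i + |γ|; a truncation at order
L therefore uses the parts with i < L - |γ| in the term indexed by γ. -/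
theorem s0_md_bdir_sub_tw {M : ℝ} {G : X0 n → A} {P : ℕ → X0 n → A} (hG : Good α hZ M G)
    (hP : ∀ i : ℕ, Good α hZ (M - i) (P i))
    (hr : ∀ N : ℕ, Good α hZ (M - N) (fun x => G x - ∑ i ∈ Finset.range N, P i x))
    (σ : Fin n → ℕ) (L : ℕ) :
    S0 hZ (M - L) (fun x => md (bdir B) σ G x - ∑ l ∈ Finset.range L, tw B σ P l x) := by
  have hΩ := (grad0 n hZ).isOpen_dom
  have key : ∀ γ ∈ Finset.Iic σ, S0 hZ (M - L) (fun x => (multiChoose σ γ : ℂ) •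
      ((-1 : ℂ) ^ len (σ - γ) • md tdir (σ - γ) (md (Bdir B) γ
        fun x => G x - ∑ i ∈ Finset.range (L - len γ), P i x) x)) := fun γ _ => by
    refine S0.const_smul _ (S0.const_smul _ (S0.mono ?_
      (((hr (L - len γ)).md_Bdir γ).md_tdir (σ - γ)).sym))
    -- If |γ| exceeds L, the truncated difference is 0 and no part is subtracted; then ∂_B^γ G alone
    -- already has order at most M - L.
    rcases le_total (len γ) L with h | h
    · rw [Nat.cast_sub h]; linarith
    · rw [Nat.sub_eq_zero_of_le h, Nat.cast_zero]
      have : (L : ℝ) ≤ len γ := by exact_mod_cast h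
      linarith
  refine (S0.sum _ key).congr fun x hx => ?_
  simp only
  rw [md_bdir_eq hG σ hx]
  simp only [tw, Finset.sum_filter]
  rw [Finset.sum_comm, ← Finset.sum_sub_distrib]
  refine Finset.sum_congr rfl fun γ _ => ?_
  rw [sum_range_filter_le L (len γ) fun i => (multiChoose σ γ : ℂ) •
    ((-1 : ℂ) ^ len (σ - γ) • md tdir (σ - γ) (md (Bdir B) γ (P i)) x)]
  rw [← Finset.smul_sum, ← Finset.smul_sum, ← smul_sub, ← smul_sub]
  congr 2
  have hPc := fun i (_ : i ∈ Finset.range (L - len γ)) => (hP i).sym.contDiffOn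
  have hPc' := fun i (_ : i ∈ Finset.range (L - len γ)) => ((hP i).md_Bdir (B := B) γ).sym.contDiffOn
  have h2 := (dw_eqOn hΩ (dw_sub_sum hΩ hG.sym.contDiffOn hPc (mdList (Bdir B) γ))
    (mdList tdir (σ - γ)) hx).trans
    (dw_sub_sum hΩ (hG.md_Bdir γ).sym.contDiffOn hPc' (mdList tdir (σ - γ)) hx)
  exact h2.symm

end Expansion

/-! ### The composition sorted by total order. -/

section Total

variable {n : ℕ} {A : Type*} [CStarAlgebra A] {α : CStarAction n A} {Z : Set ℂ} {hZ : IsOpen Z}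
  {B : Matrix (Fin n) (Fin n) ℝ}

/-- The terms with `k` derivatives, the part `p a` of the left factor and the twisted part of order
`l` of the right factor. -/
def tripleTerm (B : Matrix (Fin n) (Fin n) ℝ) (p P : ℕ → X0 n → A) (k a l : ℕ) (x : X0 n) : A :=
  ∑ σ ∈ Finset.piAntidiag (Finset.univ : Finset (Fin n)) k,
    ((-Complex.I) ^ len σ / (multiFactorial σ : ℂ)) • (md xdir σ (p a) x * tw B σ P l x)

/-- The part of order `j` of the composition without the contributions of the part `P j`. -/
def lowerTerm (B : Matrix (Fin n) (Fin n) ℝ) (p P : ℕ → X0 n → A) (j : ℕ) (x : X0 n) : A :=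
  ∑ l ∈ Finset.range j, ∑ q ∈ Finset.HasAntidiagonal.antidiagonal (j - l),
    tripleTerm B p P q.2 q.1 l x

theorem tw_zero (P : ℕ → X0 n → A) (l : ℕ) : tw B 0 P l = P l := by
  ext x
  have h1 : Finset.Iic (0 : Fin n → ℕ) = {0} := by ext; simp
  have h2 : (({0} : Finset (Fin n → ℕ)).filter fun γ => len γ ≤ l) = {0} := by
    ext γ
    simp only [Finset.mem_filter, Finset.mem_singleton, and_iff_left_iff_imp]
    rintro rfl
    simp [len]
  rw [tw, h1, h2, Finset.sum_singleton]
  simp [md_zero, multiChoose, len]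

theorem tripleTerm_zero (p P : ℕ → X0 n → A) (a l : ℕ) (x : X0 n) :
    tripleTerm B p P 0 a l x = p a x * P l x := by
  have : Finset.piAntidiag (Finset.univ : Finset (Fin n)) 0 = {0} := by simp
  simp [tripleTerm, this, md_zero, tw_zero, multiFactorial, len]

/-- Both sides run over all (k, a, l) with k + a + l < N, once by total degree and once by iterated
truncation. -/
theorem sum_triple_reindex {F : Type*} [AddCommMonoid F] (N : ℕ) (Y : ℕ → ℕ → ℕ → F) :
    ∑ j ∈ Finset.range N, ∑ l ∈ Finset.range (j + 1),
      ∑ q ∈ Finset.HasAntidiagonal.antidiagonal (j - l), Y q.2 q.1 l =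
    ∑ k ∈ Finset.range N, ∑ a ∈ Finset.range (N - k), ∑ l ∈ Finset.range (N - k - a), Y k a l := by
  rw [Finset.sum_range_diag_flip N fun l d =>
    ∑ q ∈ Finset.HasAntidiagonal.antidiagonal d, Y q.2 q.1 l]
  have h1 : ∀ l d, ∑ q ∈ Finset.HasAntidiagonal.antidiagonal d, Y q.2 q.1 l =
      ∑ k ∈ Finset.range (d + 1), Y k (d - k) l := fun l d => by
    rw [← Finset.Nat.sum_antidiagonal_eq_sum_range_succ (fun k a => Y k a l),
      ← Finset.Nat.sum_antidiagonal_swap]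
    rfl
  have h2 : ∀ l K, ∑ d ∈ Finset.range K, ∑ k ∈ Finset.range (d + 1), Y k (d - k) l =
      ∑ k ∈ Finset.range K, ∑ a ∈ Finset.range (K - k), Y k a l := fun l K =>
    Finset.sum_range_diag_flip K fun k a => Y k a l
  simp only [h1, h2]
  rw [Finset.sum_comm' (s' := fun k => Finset.range (N - k)) (t' := Finset.range N)
    (fun l k => by simp only [Finset.mem_range]; omega)]
  refine Finset.sum_congr rfl fun k _ => ?_
  exact Finset.sum_comm' (fun l a => by simp only [Finset.mem_range]; omega)

/-- The only term of total order j that involves the twisted part of order j is the one with k = a =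
0, which is the plain product p₀P_j. -/
theorem sum_lowerTerm (p P : ℕ → X0 n → A) (N : ℕ) (x : X0 n) :
    ∑ j ∈ Finset.range N, (lowerTerm B p P j x + p 0 x * P j x) =
    ∑ k ∈ Finset.range N, ∑ a ∈ Finset.range (N - k), ∑ l ∈ Finset.range (N - k - a),
      tripleTerm B p P k a l x := by
  rw [← sum_triple_reindex N fun k a l => tripleTerm B p P k a l x]
  refine Finset.sum_congr rfl fun j _ => ?_
  rw [Finset.sum_range_succ, lowerTerm]
  simp [tripleTerm_zero]

theorem Good.tripleTerm {m M : ℝ} {p P : ℕ → X0 n → A} {a l : ℕ}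
    (hp : Good α hZ (m - a) (p a)) (hP : ∀ i ≤ l, Good α hZ (M - i) (P i)) (k : ℕ) :
    Good α hZ (m + M - (k + a + l)) (tripleTerm B p P k a l) := by
  refine Good.sum _ fun σ hσ => (Good.of_eq ?_ ((hp.md_xdir σ).mul (Good.tw hP σ))).const_smul _
  rw [mem_piAntidiag_univ.1 hσ]
  ring

theorem Good.lowerTerm {m M : ℝ} {p P : ℕ → X0 n → A} {j : ℕ}
    (hp : ∀ a : ℕ, Good α hZ (m - a) (p a)) (hP : ∀ i < j, Good α hZ (M - (i : ℕ)) (P i)) :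
    Good α hZ (m + M - j) (lowerTerm B p P j) := by
  refine Good.sum _ fun l hl => Good.sum _ fun q hq => Good.of_eq ?_
    (Good.tripleTerm (hp q.1) (fun i hi => hP i (hi.trans_lt (Finset.mem_range.1 hl))) q.2)
  have h1 := Finset.HasAntidiagonal.mem_antidiagonal.1 hq
  have h2 := Finset.mem_range.1 hl
  have h3 : (q.2 : ℝ) + q.1 + l = j := by
    have : q.2 + q.1 + l = j := by omega
    exact_mod_cast this
  rw [h3]

/-- For each σ of length k the product of the derivatives is truncated in two stages: the left
factor at N - k, then, against its part p_a, the right factor at N - k - a. Each error then has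
order m + M - N, since ∂_ξ^σ contributes -k and p_a contributes -a. -/
theorem s0_comp_sub_lowerTerm {m M : ℝ} {f G : X0 n → A} {p P : ℕ → X0 n → A}
    (hf : Good α hZ m f) (hp : ∀ a : ℕ, Good α hZ (m - a) (p a))
    (hfr : ∀ N : ℕ, Good α hZ (m - N) (fun x => f x - ∑ a ∈ Finset.range N, p a x))
    (hG : Good α hZ M G) (hP : ∀ i : ℕ, Good α hZ (M - i) (P i))
    (hGr : ∀ N : ℕ, Good α hZ (M - N) (fun x => G x - ∑ i ∈ Finset.range N, P i x)) (N : ℕ) :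
    S0 hZ (m + M - N) (fun x => comp B f G (x, 1) -
      ∑ j ∈ Finset.range N, (lowerTerm B p P j x + p 0 x * P j x)) := by
  have hΩ := (grad0 n hZ).isOpen_dom
  have key : ∀ k ∈ Finset.range N, ∀ σ ∈ Finset.piAntidiag (Finset.univ : Finset (Fin n)) k,
      S0 hZ (m + M - N) (fun x => md xdir σ f x * md (bdir B) σ G x -
        ∑ a ∈ Finset.range (N - k), ∑ l ∈ Finset.range (N - k - a),
          md xdir σ (p a) x * tw B σ P l x) := fun k hk σ hσ => by
    have hk' : k ≤ N := (Finset.mem_range.1 hk).le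
    have h1 : S0 hZ (m + M - N) fun x =>
        md xdir σ (fun x => f x - ∑ a ∈ Finset.range (N - k), p a x) x * md (bdir B) σ G x := by
      refine S0.of_eq ?_ (((hfr (N - k)).md_xdir σ).mul (hG.md_bdir σ)).sym
      rw [mem_piAntidiag_univ.1 hσ, Nat.cast_sub hk']
      ring
    have h2 : S0 hZ (m + M - N) fun x => ∑ a ∈ Finset.range (N - k), md xdir σ (p a) x *
        (md (bdir B) σ G x - ∑ l ∈ Finset.range (N - k - a), tw B σ P l x) := by
      refine S0.sum _ fun a ha => S0.of_eq ?_
        (((hp a).md_xdir σ).sym.mul (s0_md_bdir_sub_tw hG hP hGr σ (N - k - a)))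
      have ha' : a ≤ N - k := (Finset.mem_range.1 ha).le
      rw [mem_piAntidiag_univ.1 hσ, Nat.cast_sub ha', Nat.cast_sub hk']
      ring
    refine (h1.add h2).congr fun x hx => ?_
    simp only
    have e := dw_sub_sum hΩ hf.sym.contDiffOn
      (fun a (_ : a ∈ Finset.range (N - k)) => (hp a).sym.contDiffOn) (mdList xdir σ) hx
    simp only [md, e, mul_sub, sub_mul, Finset.sum_sub_distrib, Finset.mul_sum, Finset.sum_mul]
    abel
  have h3 : S0 hZ (m + M - N) (fun x => ∑ k ∈ Finset.range N,
      ∑ σ ∈ Finset.piAntidiag (Finset.univ : Finset (Fin n)) k,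
        ((-Complex.I) ^ len σ / (multiFactorial σ : ℂ)) •
        (md xdir σ f x * md (bdir B) σ G x -
        ∑ a ∈ Finset.range (N - k), ∑ l ∈ Finset.range (N - k - a),
          md xdir σ (p a) x * tw B σ P l x)) :=
    S0.sum _ fun k hk => S0.sum _ fun σ hσ => (key k hk σ hσ).const_smul _
  refine ((s0_comp_sub_compTerm (B := B) hf hG N).add h3).congr fun x _ => ?_
  simp only
  rw [sum_lowerTerm]
  have e : ∀ k, ∑ a ∈ Finset.range (N - k), ∑ l ∈ Finset.range (N - k - a),
      tripleTerm B p P k a l x = ∑ σ ∈ Finset.piAntidiag (Finset.univ : Finset (Fin n)) k,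
        ((-Complex.I) ^ len σ / (multiFactorial σ : ℂ)) •
          ∑ a ∈ Finset.range (N - k), ∑ l ∈ Finset.range (N - k - a),
            md xdir σ (p a) x * tw B σ P l x := fun k => by
    simp only [tripleTerm, Finset.smul_sum]
    exact (Finset.sum_congr rfl fun a _ => Finset.sum_comm).trans Finset.sum_comm
  simp only [e, compTerm, smul_sub, Finset.sum_sub_distrib]
  abel

end Total

/-! ### The recursion for the homogeneous parts -/

section Recursion

variable {n : ℕ} {A : Type*} [CStarAlgebra A] {α : CStarAction n A} {Z : Set ℂ} {hZ : IsOpen Z}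
  {B : Matrix (Fin n) (Fin n) ℝ}

theorem tw_congr {P P' : ℕ → X0 n → A} {l : ℕ} (h : ∀ i ≤ l, P i = P' i) (σ : Fin n → ℕ) :
    tw B σ P l = tw B σ P' l := by
  ext x
  exact Finset.sum_congr rfl fun γ _ => by rw [h _ (Nat.sub_le _ _)]

theorem lowerTerm_congr {p P P' : ℕ → X0 n → A} {j : ℕ} (h : ∀ i < j, P i = P' i) :
    lowerTerm B p P j = lowerTerm B p P' j := by
  ext x
  refine Finset.sum_congr rfl fun l hl => Finset.sum_congr rfl fun q _ =>
    Finset.sum_congr rfl fun σ _ => ?_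
  rw [tw_congr fun i hi => h i (hi.trans_lt (Finset.mem_range.1 hl))]

/-- The sequence with first term `u₀` and `u_j = - Q T_j(u₀, …, u_{j-1})`. -/
def parts (B : Matrix (Fin n) (Fin n) ℝ) (p : ℕ → X0 n → A) (Q u₀ : X0 n → A) : ℕ → X0 n → A
  | 0 => u₀
  | j + 1 => fun x =>
    -(Q x * lowerTerm B p (fun i => if _ : i < j + 1 then parts B p Q u₀ i else 0) (j + 1) x)

theorem parts_zero (p : ℕ → X0 n → A) (Q u₀ : X0 n → A) : parts B p Q u₀ 0 = u₀ := by
  rw [parts]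

/-- The guard in the definition serves well-founded recursion only; it disappears because the lower
term of order j reads no part of index j or above. -/
theorem parts_eq (p : ℕ → X0 n → A) (Q u₀ : X0 n → A) {j : ℕ} (hj : 1 ≤ j) :
    parts B p Q u₀ j = fun x => -(Q x * lowerTerm B p (parts B p Q u₀) j x) := by
  obtain ⟨j, rfl⟩ := Nat.exists_eq_add_of_le' hj
  rw [parts, lowerTerm_congr (P' := parts B p Q u₀) fun i hi => by simp [hi]]

theorem Good.parts {m M : ℝ} {p : ℕ → X0 n → A} {Q u₀ : X0 n → A}
    (hp : ∀ a : ℕ, Good α hZ (m - a) (p a)) (hQ : Good α hZ (-m) Q) (hu : Good α hZ M u₀) (j : ℕ) :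
    Good α hZ (M - j) (parts B p Q u₀ j) := by
  induction j using Nat.strong_induction_on with
  | _ j ih =>
    rcases Nat.eq_zero_or_pos j with rfl | hj
    · simpa [parts_zero] using hu
    · rw [parts_eq p Q u₀ hj]
      exact (Good.of_eq (by ring) (hQ.mul (Good.lowerTerm hp ih))).neg

/-! ### Multiplication by functions of `z` -/

theorem dd_smul_of_snd_snd {c : ℂ → ℂ} (hc : ContDiffOn ℝ ∞ c Z) {u : X0 n → A}
    (hu : ContDiffOn ℝ ∞ u (grad0 n hZ).dom) {v : X0 n} (hv : v.2.2 = 0) :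
    Set.EqOn (dd v fun x => c x.2.2 • u x) (fun x => c x.2.2 • dd v u x) (grad0 n hZ).dom :=
  fun x hx => by
  have hΩ := (grad0 n hZ).isOpen_dom
  have hm : Set.MapsTo (fun x : X0 n => x.2.2) (grad0 n hZ).dom Z := fun x hx => hx
  have hT : ContDiffOn ℝ ∞ (fun x : X0 n => x.2.2) (grad0 n hZ).dom := by fun_prop
  have h := dd_bilin (ContinuousLinearMap.lsmul ℝ ℂ : ℂ →L[ℝ] A →L[ℝ] A) hΩ
    (hc.comp hT hm) hu v hx
  simp only [Function.comp_def, ContinuousLinearMap.lsmul_apply] at h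
  rw [h, dd_comp hZ hΩ hc hT hm v hx]
  have e : dd v (fun x : X0 n => x.2.2) x = 0 := by
    have h4 : HasFDerivAt (fun x : X0 n => x.2.2) _ x :=
      ((ContinuousLinearMap.snd ℝ _ _).comp (ContinuousLinearMap.snd ℝ (E n) (E n × ℂ))).hasFDerivAt
    simp [dd, h4.fderiv, hv]
  rw [e]
  simp [dd]

theorem dw_smul_of_snd_snd {c : ℂ → ℂ} (hc : ContDiffOn ℝ ∞ c Z) {u : X0 n → A}
    (hu : ContDiffOn ℝ ∞ u (grad0 n hZ).dom) {l : List (X0 n)} (hl : ∀ v ∈ l, v.2.2 = 0) :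
    Set.EqOn (dw l fun x => c x.2.2 • u x) (fun x => c x.2.2 • dw l u x) (grad0 n hZ).dom := by
  induction l with
  | nil => exact fun _ _ => rfl
  | cons v l ih =>
    exact (dd_eqOn (grad0 n hZ).isOpen_dom (ih fun v hv => hl v (by simp [hv])) v).trans
      (dd_smul_of_snd_snd hc (contDiffOn_dw (grad0 n hZ).isOpen_dom hu l) (hl v (by simp)))

theorem mem_mdList {X : Type*} {v : Fin n → X} {σ : Fin n → ℕ} {w : X} (h : w ∈ mdList v σ) :
    ∃ j, w = v j := by
  rw [mdList, List.mem_flatMap] at h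
  obtain ⟨j, _, hj⟩ := h
  exact ⟨j, List.eq_of_mem_replicate hj⟩

/-- Only t- and ξ-derivatives occur, so a function of z is a constant for every operation involved,
and the expression is linear in P. -/
theorem lowerTerm_smul {c : ℂ → ℂ} (hc : ContDiffOn ℝ ∞ c Z) {p P P' : ℕ → X0 n → A} {j : ℕ}
    (hP : ∀ i < j, ContDiffOn ℝ ∞ (P i) (grad0 n hZ).dom)
    (h : ∀ i < j, Set.EqOn (P' i) (fun x => c x.2.2 • P i x) (grad0 n hZ).dom) :
    Set.EqOn (lowerTerm B p P' j) (fun x => c x.2.2 • lowerTerm B p P j x) (grad0 n hZ).dom :=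
  fun x hx => by
  have hΩ := (grad0 n hZ).isOpen_dom
  simp only [lowerTerm, tripleTerm, Finset.smul_sum]
  refine Finset.sum_congr rfl fun l hl => Finset.sum_congr rfl fun q _ =>
    Finset.sum_congr rfl fun σ _ => ?_
  rw [smul_comm (c x.2.2), ← mul_smul_comm (c x.2.2)]
  congr 2
  simp only [tw, Finset.smul_sum]
  refine Finset.sum_congr rfl fun γ _ => ?_
  rw [smul_comm (c x.2.2), smul_comm (c x.2.2)]
  congr 2
  have hi : l - len γ < j := (Nat.sub_le _ _).trans_lt (Finset.mem_range.1 hl)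
  have e1 := dw_smul_of_snd_snd hc (hP _ hi) (l := mdList (Bdir B) γ) fun v hv => by
    obtain ⟨k, rfl⟩ := mem_mdList hv
    rfl
  have e2 := dw_smul_of_snd_snd hc (contDiffOn_dw hΩ (hP _ hi) (mdList (Bdir B) γ))
    (l := mdList tdir (σ - γ)) fun v hv => by
      obtain ⟨k, rfl⟩ := mem_mdList hv
      rfl
  exact ((dw_eqOn hΩ ((dw_eqOn hΩ (h _ hi) _).trans e1) _).trans e2) hx

/-- The recursion is linear in its starting term. The factor c will be z^{-m}, which is unbounded as
z → 0, so the order of z^{-m}u_j cannot be read off from that of u_j; it is obtained by restarting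
the recursion from z^{-m}u₀. -/
theorem parts_smul {m M : ℝ} {c : ℂ → ℂ} (hc : ContDiffOn ℝ ∞ c Z) {p : ℕ → X0 n → A}
    {Q u₀ w₀ : X0 n → A} (hp : ∀ a : ℕ, Good α hZ (m - a) (p a)) (hQ : Good α hZ (-m) Q)
    (hu : Good α hZ M u₀)
    (h0 : Set.EqOn w₀ (fun x => c x.2.2 • u₀ x) (grad0 n hZ).dom) (j : ℕ) :
    Set.EqOn (parts B p Q w₀ j) (fun x => c x.2.2 • parts B p Q u₀ j x) (grad0 n hZ).dom := by
  induction j using Nat.strong_induction_on with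
  | _ j ih =>
    rcases Nat.eq_zero_or_pos j with rfl | hj
    · simpa [parts_zero] using h0
    · rw [parts_eq p Q u₀ hj, parts_eq p Q w₀ hj]
      intro x hx
      simp only
      rw [lowerTerm_smul hc (P := parts B p Q u₀)
        (fun i _ => (Good.parts hp hQ hu i).sym.contDiffOn) ih hx, mul_smul_comm, smul_neg]

/-! ### Homogeneity -/

/-- The dilation `(t, ξ, z) ↦ (t, r ξ, z / r)`. -/
def dil (r : ℝ) : X0 n →L[ℝ] X0 n :=
  (ContinuousLinearMap.fst ℝ _ _).prod
    ((r • (ContinuousLinearMap.fst ℝ _ _).comp (ContinuousLinearMap.snd ℝ (E n) (E n × ℂ))).prod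
      (r⁻¹ • (ContinuousLinearMap.snd ℝ _ _).comp (ContinuousLinearMap.snd ℝ (E n) (E n × ℂ))))

theorem dil_apply (r : ℝ) (x : X0 n) : dil r x = (x.1, r • x.2.1, r⁻¹ • x.2.2) := rfl

variable (Z) in
/-- Homogeneity of degree `d` for `|ξ| > 1`. -/
def Hom (d : ℝ) (u : X0 n → A) : Prop :=
  ∀ r : ℝ, 1 ≤ r → ∀ x : X0 n, x.2.2 ∈ Z → 1 < ‖x.2.1‖ → u (dil r x) = (r ^ d) • u x

theorem Hom.of_eq {d d' : ℝ} {u : X0 n → A} (h : d = d') (hu : Hom Z d u) : Hom Z d' u := h ▸ hu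

theorem Hom.sum {κ : Type*} {d : ℝ} (s : Finset κ) {u : κ → X0 n → A}
    (hu : ∀ j ∈ s, Hom Z d (u j)) : Hom Z d (fun x => ∑ j ∈ s, u j x) := fun r hr x hx h1 => by
  rw [Finset.smul_sum]
  exact Finset.sum_congr rfl fun j hj => hu j hj r hr x hx h1

theorem Hom.const_smul {d : ℝ} {u : X0 n → A} (c : ℂ) (hu : Hom Z d u) :
    Hom Z d (fun x => c • u x) := fun r hr x hx h1 => by
  simp only [hu r hr x hx h1, smul_comm c]

theorem Hom.mul {d d' : ℝ} {u w : X0 n → A} (hu : Hom Z d u) (hw : Hom Z d' w) :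
    Hom Z (d + d') (fun x => u x * w x) := fun r hr x hx h1 => by
  simp only [hu r hr x hx h1, hw r hr x hx h1]
  rw [smul_mul_smul_comm, Real.rpow_add (by linarith)]

theorem Hom.neg {d : ℝ} {u : X0 n → A} (hu : Hom Z d u) : Hom Z d (fun x => -u x) := by
  simpa using hu.const_smul (-1)

/-- Differentiate u ∘ dil r = r^d u. The identity has to hold on an open set for this, which is why
homogeneity is formulated with |ξ| > 1 and extended to |ξ| = 1 only at the end. -/
theorem Hom.dd_dil (hconic : ∀ r : ℝ, 1 ≤ r → ∀ z ∈ Z, r⁻¹ • z ∈ Z) {d : ℝ} {u : X0 n → A}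
    (hu : Hom Z d u) (hc : ContDiffOn ℝ ∞ u (grad0 n hZ).dom) (v : X0 n) {r : ℝ} (hr : 1 ≤ r)
    {x : X0 n} (hx : x.2.2 ∈ Z) (h1 : 1 < ‖x.2.1‖) :
    dd (dil r v) u (dil r x) = (r ^ d) • dd v u x := by
  have hΩ := (grad0 n hZ).isOpen_dom
  have hx' : dil r x ∈ (grad0 n hZ).dom := hconic r hr _ hx
  have e1 := (differentiableAt_of_contDiffOn hΩ hc hx').hasFDerivAt.comp x (dil r).hasFDerivAt
  have e2 := (differentiableAt_of_contDiffOn hΩ hc hx).hasFDerivAt.const_smul (r ^ d)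
  have hev : (u ∘ dil r) =ᶠ[𝓝 x] (r ^ d • u) := by
    have o1 : {y : X0 n | 1 < ‖y.2.1‖} ∈ 𝓝 x :=
      (isOpen_lt continuous_const (by fun_prop)).mem_nhds h1
    filter_upwards [hΩ.mem_nhds hx, o1] with y hy1 hy2
    exact hu r hr y hy1 hy2
  have e3 := (e2.congr_of_eventuallyEq hev).unique e1
  have := congrArg (fun L => L v) e3
  simpa [dd] using this.symm

theorem Hom.dd_t (hconic : ∀ r : ℝ, 1 ≤ r → ∀ z ∈ Z, r⁻¹ • z ∈ Z) {d : ℝ} {u : X0 n → A}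
    (hu : Hom Z d u) (hc : ContDiffOn ℝ ∞ u (grad0 n hZ).dom) (v : E n) :
    Hom Z d (dd ((v, 0, 0) : X0 n) u) := fun r hr x hx h1 => by
  have := hu.dd_dil hconic hc (v, 0, 0) hr hx h1
  rwa [dil_apply r (v, 0, 0), smul_zero, smul_zero] at this

theorem Hom.dd_x (hconic : ∀ r : ℝ, 1 ≤ r → ∀ z ∈ Z, r⁻¹ • z ∈ Z) {d : ℝ} {u : X0 n → A}
    (hu : Hom Z d u) (hc : ContDiffOn ℝ ∞ u (grad0 n hZ).dom) (v : E n) :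
    Hom Z (d - 1) (dd ((0, v, 0) : X0 n) u) := fun r hr x hx h1 => by
  have hr0 : 0 < r := by linarith
  have h := hu.dd_dil hconic hc (0, v, 0) hr hx h1
  have e : dil r ((0, v, 0) : X0 n) = r • ((0, v, 0) : X0 n) := by
    simp [dil_apply]
  rw [e] at h
  have e2 : dd (r • ((0, v, 0) : X0 n)) u (dil r x) = r • dd ((0, v, 0) : X0 n) u (dil r x) := by
    simp only [dd, map_smul]
  rw [e2] at h
  rw [Real.rpow_sub hr0, Real.rpow_one, div_eq_inv_mul, mul_smul, ← h, smul_smul,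
    inv_mul_cancel₀ hr0.ne', one_smul]

theorem Hom.dw_t (hconic : ∀ r : ℝ, 1 ≤ r → ∀ z ∈ Z, r⁻¹ • z ∈ Z) {d : ℝ} {u : X0 n → A}
    (hu : Hom Z d u) (hc : ContDiffOn ℝ ∞ u (grad0 n hZ).dom) (l : List (E n)) :
    Hom Z d (dw (l.map fun v => ((v, 0, 0) : X0 n)) u) := by
  induction l with
  | nil => exact hu
  | cons v l ih => exact ih.dd_t hconic (contDiffOn_dw (grad0 n hZ).isOpen_dom hc _) v

theorem Hom.dw_x (hconic : ∀ r : ℝ, 1 ≤ r → ∀ z ∈ Z, r⁻¹ • z ∈ Z) {d : ℝ} {u : X0 n → A}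
    (hu : Hom Z d u) (hc : ContDiffOn ℝ ∞ u (grad0 n hZ).dom) (l : List (E n)) :
    Hom Z (d - l.length) (dw (l.map fun v => ((0, v, 0) : X0 n)) u) := by
  induction l with
  | nil => simpa using hu
  | cons v l ih =>
    exact (ih.dd_x hconic (contDiffOn_dw (grad0 n hZ).isOpen_dom hc _) v).of_eq
      (by push_cast [List.length_cons]; ring)

theorem Hom.lowerTerm (hconic : ∀ r : ℝ, 1 ≤ r → ∀ z ∈ Z, r⁻¹ • z ∈ Z) {m M : ℝ}
    {p P : ℕ → X0 n → A} {j : ℕ}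
    (hp : ∀ a : ℕ, Hom Z (m - a) (p a)) (hpc : ∀ a, ContDiffOn ℝ ∞ (p a) (grad0 n hZ).dom)
    (hP : ∀ i < j, Hom Z (M - (i : ℕ)) (P i))
    (hPc : ∀ i < j, ContDiffOn ℝ ∞ (P i) (grad0 n hZ).dom) :
    Hom Z (m + M - j) (lowerTerm B p P j) := by
  refine Hom.sum _ fun l hl => Hom.sum _ fun q hq => Hom.sum _ fun σ hσ => Hom.const_smul _ ?_
  have hl' := Finset.mem_range.1 hl
  have h1 := Finset.HasAntidiagonal.mem_antidiagonal.1 hq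
  have h3 : (q.2 : ℝ) + q.1 + l = j := by
    have : q.2 + q.1 + l = j := by omega
    exact_mod_cast this
  have hx := (hp q.1).dw_x hconic (hpc q.1) (mdList (stdVec n) σ)
  rw [mdList_map, length_mdList, mem_piAntidiag_univ.1 hσ] at hx
  refine Hom.of_eq (d := m - q.1 - q.2 + (M - l)) (by rw [← h3]; ring) (hx.mul ?_)
  refine Hom.sum _ fun γ hγ => (Hom.const_smul _ (Hom.const_smul _ ?_))
  have hi : l - len γ < j := (Nat.sub_le _ _).trans_lt hl'
  have hb := (hP _ hi).dw_x hconic (hPc _ hi) (mdList (fun j => matCLM B (stdVec n j)) γ)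
  have ht := hb.dw_t hconic (contDiffOn_dw (grad0 n hZ).isOpen_dom (hPc _ hi) _)
    (mdList (stdVec n) (σ - γ))
  rw [mdList_map, mdList_map, length_mdList] at ht
  refine Hom.of_eq ?_ ht
  rw [Nat.cast_sub (Finset.mem_filter.1 hγ).2]
  ring

theorem Hom.parts (hconic : ∀ r : ℝ, 1 ≤ r → ∀ z ∈ Z, r⁻¹ • z ∈ Z) {m M : ℝ} {p : ℕ → X0 n → A}
    {Q u₀ : X0 n → A} (hp : ∀ a : ℕ, Hom Z (m - a) (p a))
    (hpc : ∀ a, ContDiffOn ℝ ∞ (p a) (grad0 n hZ).dom) (hQ : Hom Z (-m) Q) (hu : Hom Z M u₀)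
    (hc : ∀ j, ContDiffOn ℝ ∞ (parts B p Q u₀ j) (grad0 n hZ).dom) (j : ℕ) :
    Hom Z (M - j) (parts B p Q u₀ j) := by
  induction j using Nat.strong_induction_on with
  | _ j ih =>
    rcases Nat.eq_zero_or_pos j with rfl | hj
    · simpa [parts_zero] using hu
    · rw [parts_eq p Q u₀ hj]
      exact (Hom.of_eq (by ring) (hQ.mul (Hom.lowerTerm hconic hp hpc ih fun i _ => hc i))).neg

/-- Homogeneity extends to `|ξ| = 1`. -/
theorem Hom.of_le (hconic : ∀ r : ℝ, 1 ≤ r → ∀ z ∈ Z, r⁻¹ • z ∈ Z) {d : ℝ} {u : X0 n → A}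
    (hu : Hom Z d u) (hc : ContinuousOn u (grad0 n hZ).dom) {r : ℝ} (hr : 1 ≤ r) {x : X0 n}
    (hx : x.2.2 ∈ Z) (h1 : 1 ≤ ‖x.2.1‖) : u (dil r x) = (r ^ d) • u x := by
  have hΩ := (grad0 n hZ).isOpen_dom
  -- Approach the point along its ray in ξ: (1+ε)ξ has norm greater than 1 for ε > 0.
  have hγ : Continuous fun ε : ℝ => ((x.1, (1 + ε) • x.2.1, x.2.2) : X0 n) := by fun_prop
  have hx0 : ((x.1, (1 + (0 : ℝ)) • x.2.1, x.2.2) : X0 n) = x := by simp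
  have c1 : Filter.Tendsto (fun ε : ℝ => u (dil r (x.1, (1 + ε) • x.2.1, x.2.2))) (𝓝[>] 0)
      (𝓝 (u (dil r x))) := by
    have ht : Filter.Tendsto (fun ε : ℝ => dil r ((x.1, (1 + ε) • x.2.1, x.2.2) : X0 n)) (𝓝 0)
        (𝓝 (dil r x)) := by
      have := ((dil r).continuous.comp hγ).tendsto 0
      simpa [Function.comp_def] using this
    exact ((hc.continuousAt (hΩ.mem_nhds (hconic r hr _ hx))).tendsto.comp ht).mono_left
      nhdsWithin_le_nhds
  have c2 : Filter.Tendsto (fun ε : ℝ => (r ^ d) • u (x.1, (1 + ε) • x.2.1, x.2.2)) (𝓝[>] 0)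
      (𝓝 ((r ^ d) • u x)) := by
    have ht : Filter.Tendsto (fun ε : ℝ => ((x.1, (1 + ε) • x.2.1, x.2.2) : X0 n)) (𝓝 0)
        (𝓝 x) := by
      have := hγ.tendsto 0
      simpa using this
    exact (((hc.continuousAt (hΩ.mem_nhds hx)).tendsto.comp ht).const_smul (r ^ d)).mono_left
      nhdsWithin_le_nhds
  refine tendsto_nhds_unique (c1.congr' ?_) c2
  filter_upwards [self_mem_nhdsWithin] with ε hε
  refine hu r hr _ hx ?_
  have hε' : (0 : ℝ) < ε := hε
  simp only
  rw [norm_smul, Real.norm_of_nonneg (by linarith)]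
  nlinarith

end Recursion

/-! ### From equivariant symbols to symbols -/

section Affine

variable {V V' F : Type*} [NormedAddCommGroup V] [NormedSpace ℝ V]
  [NormedAddCommGroup V'] [NormedSpace ℝ V'] [NormedAddCommGroup F] [NormedSpace ℝ F]

theorem dw_affine {Ω : Set V} (hΩ : IsOpen Ω) {u : V → F} (hu : ContDiffOn ℝ ∞ u Ω)
    (L : V' →L[ℝ] V) (x₀ : V) (h : ∀ y, x₀ + L y ∈ Ω) (l : List V') :
    dw l (fun y => u (x₀ + L y)) = fun y => dw (l.map L) u (x₀ + L y) := by
  induction l with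
  | nil => rfl
  | cons v l ih =>
    rw [dw_cons, ih, List.map_cons, dw_cons]
    ext y
    have hT : HasFDerivAt (fun y => x₀ + L y) L y := L.hasFDerivAt.const_add x₀
    have h1 := (differentiableAt_of_contDiffOn hΩ (contDiffOn_dw hΩ hu (l.map L)) (h y)).hasFDerivAt
    have h2 : HasFDerivAt (fun y => dw (l.map L) u (x₀ + L y)) _ y := h1.comp y hT
    simp [dd, h2.fderiv]

theorem md_affine {n : ℕ} {Ω : Set V} (hΩ : IsOpen Ω) {u : V → F} (hu : ContDiffOn ℝ ∞ u Ω)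
    (L : V' →L[ℝ] V) (x₀ : V) (h : ∀ y, x₀ + L y ∈ Ω) (v : Fin n → V') (σ : Fin n → ℕ) :
    md v σ (fun y => u (x₀ + L y)) = fun y => md (fun j => L (v j)) σ u (x₀ + L y) := by
  rw [md, dw_affine hΩ hu L x₀ h, mdList_map]
  rfl

end Affine

/-! ### Restriction of equivariant symbols to t = 0. -/

section FromGood

variable {n : ℕ} {A : Type*} [CStarAlgebra A] {α : CStarAction n A} {Z : Set ℂ} {hZ : IsOpen Z}

/-- The inclusion of the variable `t`. -/
def inT (n : ℕ) : E n →L[ℝ] X0 n := ContinuousLinearMap.inl ℝ (E n) (E n × ℂ)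

/-- The inclusion of the variable `ξ`. -/
def inX (n : ℕ) : E n →L[ℝ] X0 n :=
  (ContinuousLinearMap.inr ℝ (E n) (E n × ℂ)).comp (ContinuousLinearMap.inl ℝ (E n) ℂ)

theorem md_slice_t {u : X0 n → A} (hu : ContDiffOn ℝ ∞ u (grad0 n hZ).dom) (ξ : E n) {z : ℂ}
    (hz : z ∈ Z) (σ : Fin n → ℕ) :
    md (stdVec n) σ (fun t => u (t, ξ, z)) = fun t => md tdir σ u (t, ξ, z) := by
  have e : ∀ t : E n, ((0, ξ, z) : X0 n) + inT n t = (t, ξ, z) := fun t => by simp [inT]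
  have h := md_affine (grad0 n hZ).isOpen_dom hu (inT n) (0, ξ, z)
    (fun y => by rw [e]; exact hz) (stdVec n) σ
  simp only [e] at h
  exact h

theorem md_slice_x {u : X0 n → A} (hu : ContDiffOn ℝ ∞ u (grad0 n hZ).dom) (t : E n) {z : ℂ}
    (hz : z ∈ Z) (v : Fin n → E n) (σ : Fin n → ℕ) :
    md v σ (fun ξ => u (t, ξ, z)) = fun ξ => md (fun j => ((0, v j, 0) : X0 n)) σ u (t, ξ, z) := by
  have e : ∀ ξ : E n, ((t, 0, z) : X0 n) + inX n ξ = (t, ξ, z) := fun t => by simp [inX]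
  have h := md_affine (grad0 n hZ).isOpen_dom hu (inX n) (t, 0, z)
    (fun y => by rw [e]; exact hz) v σ
  simp only [e] at h
  exact h

theorem Good.act_eq {M : ℝ} {u : X0 n → A} (hu : Good α hZ M u) (t ξ : E n) {z : ℂ} (hz : z ∈ Z) :
    α.act t (u (0, ξ, z)) = u (t, ξ, z) := by
  have := hu.eqv t (0, ξ, z) hz
  simpa using this.symm

theorem Good.mem_smoothElements {M : ℝ} {u : X0 n → A} (hu : Good α hZ M u) (ξ : E n) {z : ℂ}
    (hz : z ∈ Z) : u (0, ξ, z) ∈ smoothElements α := by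
  rw [smoothElements, Set.mem_ofPred_eq]
  simp only [hu.act_eq _ ξ hz]
  refine hu.sym.contDiffOn.comp_contDiff (f := fun t : E n => ((t, ξ, z) : X0 n)) (by fun_prop)
    fun t => hz

/-- By equivariance the orbit of u(0,ξ,z) is t ↦ u(t,ξ,z), so the derivatives of the action are
partial derivatives of u. -/
theorem Good.delta_eq {M : ℝ} {u : X0 n → A} (hu : Good α hZ M u) (β : Fin n → ℕ) (ξ : E n) {z : ℂ}
    (hz : z ∈ Z) :
    delta α β (u (0, ξ, z)) = (Complex.I ^ len β)⁻¹ • md tdir β u (0, ξ, z) := by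
  rw [delta, pderiv, multiDeriv_eq_md]
  simp only [hu.act_eq _ ξ hz]
  rw [md_slice_t hu.sym.contDiffOn ξ hz]

theorem Good.multiDeriv_eq {M : ℝ} {u : X0 n → A} (hu : Good α hZ M u) (v : Fin n → E n)
    (γ : Fin n → ℕ) (ξ : E n) {z : ℂ} (hz : z ∈ Z) :
    multiDeriv v γ (fun ξ => u (0, ξ, z)) ξ =
      md (fun j => ((0, v j, 0) : X0 n)) γ u (0, ξ, z) := by
  rw [multiDeriv_eq_md, md_slice_x hu.sym.contDiffOn 0 hz]

theorem norm_I_pow_inv_smul (k : ℕ) (a : A) : ‖(Complex.I ^ k)⁻¹ • a‖ = ‖a‖ := by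
  rw [norm_smul]
  simp

theorem Good.delta_pderiv_eq {M : ℝ} {u : X0 n → A} (hu : Good α hZ M u) (β γ : Fin n → ℕ)
    (ξ : E n) {z : ℂ} (hz : z ∈ Z) :
    delta α β (pderiv γ (fun ξ => u (0, ξ, z)) ξ) =
      (Complex.I ^ len β)⁻¹ • md tdir β (md xdir γ u) (0, ξ, z) := by
  rw [pderiv, hu.multiDeriv_eq _ _ _ hz]
  exact (hu.md_xdir γ).delta_eq β ξ hz

theorem Good.bound_pderiv {M : ℝ} {u : X0 n → A} (hu : Good α hZ M u) (β γ : Fin n → ℕ) (r : ℕ) :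
    ∃ C : ℝ, ∀ z ∈ coneBdd Z r, ∀ ξ,
      ‖delta α β (pderiv γ (fun ξ => u (0, ξ, z)) ξ)‖ ≤ C * bracket ξ ^ (M - len γ) := by
  obtain ⟨C, hC⟩ := ((hu.md_xdir γ).md_tdir β).sym.bound r
  refine ⟨C, fun z hz ξ => ?_⟩
  rw [hu.delta_pderiv_eq β γ ξ hz.1, norm_I_pow_inv_smul]
  exact hC (0, ξ, z) hz

theorem Good.isSymbol {M : ℝ} {u : X0 n → A} (hu : Good α hZ M u) {z : ℂ} (hz : z ∈ Z) :
    IsSymbol α M (fun ξ => u (0, ξ, z)) := by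
  refine ⟨⟨fun ξ => hu.mem_smoothElements ξ hz, fun γ => ?_⟩, fun β γ => ?_⟩
  · simp only [hu.delta_eq γ _ hz]
    exact ((hu.md_tdir γ).sym.contDiffOn.comp_contDiff (f := fun ξ : E n => ((0, ξ, z) : X0 n))
      (by fun_prop) fun t => hz).const_smul _
  · obtain ⟨r, hr⟩ := exists_coneBdd_mem_nhds hZ hz
    obtain ⟨C, hC⟩ := hu.bound_pderiv β γ r
    exact ⟨C, hC z (mem_of_mem_nhds hr)⟩

/-- Real differentiability together with the Cauchy–Riemann equation makes the real differential in
z complex linear. -/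
theorem Good.hasDerivAt {M : ℝ} {u : X0 n → A} (hu : Good α hZ M u) (t ξ : E n) {z : ℂ}
    (hz : z ∈ Z) : HasDerivAt (fun w : ℂ => u (t, ξ, w)) (dd (zdir 1) u (t, ξ, z)) z := by
  have h1 := (differentiableAt_of_contDiffOn (grad0 n hZ).isOpen_dom hu.sym.contDiffOn
    (x := (t, ξ, z)) hz).hasFDerivAt
  have h2 : HasFDerivAt (fun w : ℂ => ((t, ξ, w) : X0 n)) (((0 : ℂ →L[ℝ] E n).prod
      ((0 : ℂ →L[ℝ] E n).prod (ContinuousLinearMap.id ℝ ℂ)))) z :=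
    (hasFDerivAt_const t z).prodMk ((hasFDerivAt_const ξ z).prodMk (hasFDerivAt_id z))
  have h3 := h1.comp z h2
  have h4 : HasFDerivAt (fun w : ℂ => u (t, ξ, w))
      (ContinuousLinearMap.toSpanSingleton ℂ (dd (zdir 1) u (t, ξ, z))) z := by
    refine hasFDerivAt_of_restrictScalars ℝ h3 ?_
    ext c
    have e := dd_zdir u c (t, ξ, z)
    rw [hu.hol _ hz] at e
    have e2 : c.re • dd (zdir 1) u (t, ξ, z) + c.im • Complex.I • dd (zdir 1) u (t, ξ, z) =
        c • dd (zdir 1) u (t, ξ, z) := by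
      conv_rhs => rw [← Complex.re_add_im c, add_smul, mul_smul, Complex.coe_smul, Complex.coe_smul]
    rw [e2] at e
    simpa [dd, zdir] using e.symm
  simpa using h4.hasDerivAt

/-- Iterated complex derivatives in `z`. -/
theorem Good.iterate_dd_z {M : ℝ} {u : X0 n → A} (hu : Good α hZ M u) (j : ℕ) :
    Good α hZ (M + j) ((dd (zdir 1))^[j] u) := by
  induction j with
  | zero => simpa using hu
  | succ j ih =>
    rw [Function.iterate_succ_apply']
    exact (ih.dd_z 1).of_eq (by push_cast; ring)

theorem Good.iteratedDeriv_eq {M : ℝ} {u : X0 n → A} (hu : Good α hZ M u) (j : ℕ) (t ξ : E n) :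
    Set.EqOn (iteratedDeriv j fun w : ℂ => u (t, ξ, w))
      (fun w => (dd (zdir 1))^[j] u (t, ξ, w)) Z := by
  induction j with
  | zero => exact fun _ _ => by simp
  | succ j ih =>
    intro z hz
    rw [iteratedDeriv_succ, (Filter.eventuallyEq_of_mem (hZ.mem_nhds hz) ih).deriv_eq,
      ((hu.iterate_dd_z j).hasDerivAt t ξ hz).deriv, Function.iterate_succ_apply']

theorem delta_smul {a : A} (ha : a ∈ smoothElements α) (c : ℂ) (β : Fin n → ℕ) :
    delta α β (c • a) = c • delta α β a := by
  rw [delta, delta, smul_comm c]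
  congr 1
  simp only [pderiv, multiDeriv_eq_md, map_smul]
  have h := dw_clm isOpen_univ (ContDiff.contDiffOn ha)
    ((ContinuousLinearMap.lsmul ℝ ℂ : ℂ →L[ℝ] A →L[ℝ] A) c) (mdList (stdVec n) β)
    (Set.mem_univ (0 : E n))
  exact h

theorem iteratedDeriv_eqOn {F : Type*} [NormedAddCommGroup F] [NormedSpace ℂ F] {Z : Set ℂ}
    (hZ : IsOpen Z) {u w : ℂ → F} (h : Set.EqOn u w Z) (j : ℕ) :
    Set.EqOn (iteratedDeriv j u) (iteratedDeriv j w) Z := fun _ hz =>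
  (Filter.eventuallyEq_of_mem (hZ.mem_nhds hz) h).iteratedDeriv_eq j

/-- An equivariant symbol gives rise to a weakly parametric symbol. -/
theorem Good.isWeakSymbol {Γ : Set ℂ} (h0 : (0 : ℂ) ∉ Γ) (hΓ : ∀ z, z ∈ Z ↔ z⁻¹ ∈ Γ)
    (hcone : ∀ a b : ℝ, closedSector a b ⊆ Γ → ∃ r, ∀ z : ℂ, z⁻¹ ∈ closedSector a b → ‖z‖ ≤ 1 →
      z ∈ coneBdd Z r) {M : ℝ} {d : ℤ} {u : X0 n → A} (hu : Good α hZ M u) {F : E n → ℂ → A}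
    (hF : ∀ ξ, ∀ z ∈ Z, z ^ d • F ξ z⁻¹ = u (0, ξ, z)) : IsWeakSymbol α Γ M d F := by
  have hinv : ∀ μ ∈ Γ, μ⁻¹ ∈ Z := fun μ hμ => (hΓ _).2 (by simpa using hμ)
  have hne : ∀ μ ∈ Γ, μ ≠ 0 := fun μ hμ h => h0 (h ▸ hμ)
  have hFe : ∀ ξ, ∀ μ ∈ Γ, F ξ μ = μ ^ d • u (0, ξ, μ⁻¹) := fun ξ μ hμ => by
    rw [← hF ξ _ (hinv μ hμ), inv_inv, smul_smul, ← mul_zpow, mul_inv_cancel₀ (hne μ hμ), one_zpow,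
      one_smul]
  have hδ : ∀ γ ξ, ∀ μ ∈ Γ, delta α γ (F ξ μ) =
      μ ^ d • (Complex.I ^ len γ)⁻¹ • md tdir γ u (0, ξ, μ⁻¹) := fun γ ξ μ hμ => by
    rw [hFe ξ μ hμ, delta_smul (hu.mem_smoothElements ξ (hinv μ hμ)), hu.delta_eq γ ξ (hinv μ hμ)]
  have hz : ∀ j, ∀ z ∈ Z, zDeriv d j F z = fun ξ => (dd (zdir 1))^[j] u (0, ξ, z) :=
    fun j z hz => by
      ext ξ
      rw [zDeriv, iteratedDeriv_eqOn hZ (w := fun w => u (0, ξ, w)) (fun w hw => hF ξ w hw) j hz,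
        hu.iteratedDeriv_eq j 0 ξ hz]
  -- Openness of Γ is recovered from that of Z by inversion away from 0; it is needed to replace F
  -- by its expression in u near a given μ.
  have hopen : IsOpen Γ := by
    have : Γ = {μ : ℂ | μ ≠ 0} ∩ (fun μ => μ⁻¹) ⁻¹' Z := by
      ext μ
      exact ⟨fun h => ⟨hne μ h, hinv μ h⟩, fun h => by simpa using (hΓ _).1 h.2⟩
    rw [this]
    exact ContinuousOn.isOpen_inter_preimage (fun μ hμ => (continuousAt_inv₀ hμ).continuousWithinAt)
      isOpen_ne hZ
  refine ⟨⟨fun ξ μ hμ => ?_, fun γ => ⟨?_, fun ξ μ hμ => ?_⟩⟩, fun j z hzΓ => ?_,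
    fun j β γ a b hab => ?_⟩
  · rw [hFe ξ μ hμ]
    have := hu.mem_smoothElements ξ (hinv μ hμ)
    rw [smoothElements, Set.mem_ofPred_eq] at this ⊢
    simp only [map_smul]
    exact this.const_smul _
  · have hi : ContDiffOn ℝ ∞ (fun p : E n × ℂ => p.2⁻¹) (Set.univ ×ˢ Γ) := fun p hp =>
      ((contDiffAt_inv ℝ (hne p.2 hp.2)).comp p contDiffAt_snd).contDiffWithinAt
    have hzp : ContDiffOn ℝ ∞ (fun p : E n × ℂ => p.2 ^ d) (Set.univ ×ˢ Γ) := by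
      cases d with
      | ofNat k => simpa using (contDiff_snd.pow k).contDiffOn
      | negSucc k =>
        simp only [zpow_negSucc, ← inv_pow]
        exact hi.pow (k + 1)
    have hmd : ContDiffOn ℝ ∞ (fun p : E n × ℂ => md tdir γ u (0, p.1, p.2⁻¹)) (Set.univ ×ˢ Γ) :=
      (hu.md_tdir γ).sym.contDiffOn.comp (g := md tdir γ u)
        (f := fun p : E n × ℂ => ((0, p.1, p.2⁻¹) : X0 n))
        (contDiffOn_const.prodMk (contDiff_fst.contDiffOn.prodMk hi)) fun p hp => hinv _ hp.2
    exact (hzp.smul (hmd.const_smul _)).congr fun p hp => hδ γ p.1 p.2 hp.2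
  · have h1 : HasDerivAt (fun μ : ℂ => md tdir γ u (0, ξ, μ⁻¹)) _ μ :=
      ((hu.md_tdir γ).hasDerivAt 0 ξ (hinv μ hμ)).scomp μ (hasDerivAt_inv (hne μ hμ))
    have h2 : DifferentiableAt ℂ (fun μ : ℂ => μ ^ d) μ :=
      differentiableAt_zpow.2 (Or.inl (hne μ hμ))
    have h3 := h2.smul (h1.differentiableAt.const_smul (Complex.I ^ len γ)⁻¹)
    refine (h3.congr_of_eventuallyEq ?_).differentiableWithinAt
    filter_upwards [hopen.mem_nhds hμ] with ν hν
    exact hδ γ ξ ν hν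
  · rw [hz j z ((hΓ z).2 hzΓ)]
    exact (hu.iterate_dd_z j).isSymbol ((hΓ z).2 hzΓ)
  · obtain ⟨r, hr⟩ := hcone a b hab
    obtain ⟨C, hC⟩ := (hu.iterate_dd_z j).bound_pderiv β γ r
    refine ⟨C, fun z hz1 hz2 ξ => ?_⟩
    rw [hz j z ((hΓ z).2 (hab hz1))]
    exact hC z (hr z hz1 hz2) ξ

end FromGood

/-! ### Sectors -/

section Sectors

/-- The sector is the image of an open horizontal strip under exp, which is an open map; injectivity
plays no role. -/
theorem isOpen_openSector (a b : ℝ) : IsOpen (openSector a b) := by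
  have : openSector a b = Complex.exp '' {w : ℂ | w.im ∈ Set.Ioo a b} := by
    ext μ
    constructor
    · rintro ⟨r, θ, hr, hθ, rfl⟩
      refine ⟨Real.log r + θ * Complex.I, by simpa using hθ, ?_⟩
      rw [Complex.exp_add, ← Complex.ofReal_exp, Real.exp_log hr]
    · rintro ⟨w, hw, rfl⟩
      refine ⟨Real.exp w.re, w.im, Real.exp_pos _, hw, ?_⟩
      rw [Complex.ofReal_exp, ← Complex.exp_add, Complex.re_add_im]
  rw [this]
  exact Complex.isOpenMap_exp _ (isOpen_Ioo.preimage Complex.continuous_im)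

theorem zero_notMem_openSector (a b : ℝ) : (0 : ℂ) ∉ openSector a b := by
  rintro ⟨r, θ, hr, _, h⟩
  have h' := h.symm
  rw [mul_eq_zero] at h'
  rcases h' with h' | h'
  · exact hr.ne' (by exact_mod_cast h')
  · exact Complex.exp_ne_zero _ h'

theorem inv_mem_openSector {a b : ℝ} {z : ℂ} : z⁻¹ ∈ openSector a b ↔ z ∈ openSector (-b) (-a) := by
  have key : ∀ {a b : ℝ} {z : ℂ}, z ∈ openSector a b → z⁻¹ ∈ openSector (-b) (-a) := by
    rintro a b z ⟨r, θ, hr, hθ, rfl⟩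
    refine ⟨r⁻¹, -θ, inv_pos.2 hr, ⟨neg_lt_neg hθ.2, neg_lt_neg hθ.1⟩, ?_⟩
    rw [mul_inv, ← Complex.exp_neg]
    push_cast
    rw [neg_mul]
  refine ⟨fun h => ?_, fun h => ?_⟩
  · simpa using key h
  · simpa using key h

theorem smul_mem_openSector {a b : ℝ} {z : ℂ} (hz : z ∈ openSector a b) {r : ℝ} (hr : 0 < r) :
    r • z ∈ openSector a b := by
  obtain ⟨ρ, θ, hρ, hθ, rfl⟩ := hz
  exact ⟨r * ρ, θ, mul_pos hr hρ, hθ, by rw [Complex.real_smul]; push_cast; ring⟩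

/-- The directions of the inverted closed sector form a compact arc inside the open cone, hence stay
at a distance δ from its complement. Scaling makes the distance of z to the complement at least
δ|z|, so any r ≥ max(1, 1/δ) serves. -/
theorem exists_coneBdd_of_closedSector {a b a' b' : ℝ} (h : closedSector a' b' ⊆ openSector a b) :
    ∃ r, ∀ z : ℂ, z⁻¹ ∈ closedSector a' b' → ‖z‖ ≤ 1 → z ∈ coneBdd (openSector (-b) (-a)) r := by
  set K : Set ℂ := (fun θ : ℝ => Complex.exp (-(θ * Complex.I))) '' Set.Icc a' b' with hK
  have hKc : IsCompact K := isCompact_Icc.image (by fun_prop)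
  have hKZ : K ⊆ openSector (-b) (-a) := by
    rintro _ ⟨θ, hθ, rfl⟩
    refine inv_mem_openSector.1 (h ⟨1, θ, one_pos, hθ, ?_⟩)
    rw [← Complex.exp_neg]
    simp
  obtain ⟨δ, hδ, hδK⟩ := hKc.exists_thickening_subset_open (isOpen_openSector (-b) (-a)) hKZ
  obtain ⟨r, hr⟩ := exists_nat_ge (max 1 δ⁻¹)
  refine ⟨r, fun z hz hz1 => ⟨inv_mem_openSector.1 (h hz),
    hz1.trans ((le_max_left _ _).trans hr), fun w hw => ?_⟩⟩
  obtain ⟨ρ, θ, hρ, hθ, hzi⟩ := hz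
  have hzeq : z = ρ⁻¹ • Complex.exp (-(θ * Complex.I)) := by
    rw [← inv_inv z, hzi, mul_inv, Complex.exp_neg, Complex.real_smul]
    push_cast
    rfl
  have hnz : ‖z‖ = ρ⁻¹ := by
    rw [hzeq, norm_smul, ← neg_mul, ← Complex.ofReal_neg, Complex.norm_exp_ofReal_mul_I, mul_one,
      Real.norm_of_nonneg (inv_nonneg.2 hρ.le)]
  have hw' : ρ • w ∉ openSector (-b) (-a) := fun hw' => hw (by
    have := smul_mem_openSector hw' (inv_pos.2 hρ)
    rwa [smul_smul, inv_mul_cancel₀ hρ.ne', one_smul] at this)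
  have hd : δ ≤ ‖ρ • w - Complex.exp (-(θ * Complex.I))‖ := by
    by_contra hlt
    refine hw' (hδK ?_)
    rw [Metric.mem_thickening_iff]
    exact ⟨_, ⟨θ, hθ, rfl⟩, by rw [dist_eq_norm]; exact not_le.1 hlt⟩
  have e : ρ • w - Complex.exp (-(θ * Complex.I)) = ρ • (w - z) := by
    rw [smul_sub, hzeq, smul_smul, mul_inv_cancel₀ hρ.ne', one_smul]
  rw [e, norm_smul, Real.norm_of_nonneg hρ.le] at hd
  rw [hnz]
  have h1 : δ⁻¹ ≤ r := (le_max_right _ _).trans hr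
  have h2 : ρ⁻¹ * δ ≤ ‖w - z‖ := by
    rw [inv_mul_le_iff₀ hρ]; exact hd
  calc ρ⁻¹ = δ⁻¹ * (ρ⁻¹ * δ) := by field_simp
    _ ≤ r * ‖w - z‖ := mul_le_mul h1 h2 (by positivity) (Nat.cast_nonneg r)

end Sectors

/-! ### From symbols to equivariant symbols -/

section Generator

variable {n : ℕ} {A : Type*} [CStarAlgebra A] (α : CStarAction n A)

/-- Point-norm continuity becomes joint continuity because the automorphisms are isometries. -/
theorem continuous_act_uncurry {X : Type*} [TopologicalSpace X] {φ : X → E n} {ψ : X → A}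
    (hφ : Continuous φ) (hψ : Continuous ψ) : Continuous fun x => α.act (φ x) (ψ x) := by
  rw [continuous_iff_continuousAt]
  intro x₀
  have h1 : Filter.Tendsto (fun x => α.act (φ x) (ψ x₀)) (𝓝 x₀) (𝓝 (α.act (φ x₀) (ψ x₀))) :=
    (((α.continuous_act (ψ x₀)).comp hφ).tendsto x₀)
  have h2 : Filter.Tendsto (fun x => α.act (φ x) (ψ x) - α.act (φ x) (ψ x₀)) (𝓝 x₀) (𝓝 0) := by
    rw [tendsto_zero_iff_norm_tendsto_zero]
    have e : ∀ x, ‖α.act (φ x) (ψ x) - α.act (φ x) (ψ x₀)‖ = ‖ψ x - ψ x₀‖ := fun x => by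
      rw [← map_sub, norm_act]
    simp only [e]
    have := (hψ.sub (continuous_const (y := ψ x₀))).norm.tendsto x₀
    simpa using this
  have := h2.add h1
  simpa [ContinuousAt] using this

/-- The operators `y ↦ ∫₀ˢ α_{σ v} y dσ`. -/
def integralAct (v : E n) (s : ℝ) : A →L[ℝ] A :=
  LinearMap.mkContinuous
    { toFun := fun y => ∫ σ in (0 : ℝ)..s, α.act (σ • v) y
      map_add' := fun x y => by
        simp only [map_add]
        exact intervalIntegral.integral_add
          ((continuous_act_uncurry α (by fun_prop) continuous_const).intervalIntegrable _ _)
          ((continuous_act_uncurry α (by fun_prop) continuous_const).intervalIntegrable _ _)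
      map_smul' := fun c y => by
        simp only [RingHom.id_apply]
        rw [← intervalIntegral.integral_smul]
        congr 1
        ext σ
        exact map_smul ((actL α (σ • v)).restrictScalars ℝ) c y } |s| (fun y => by
    have := intervalIntegral.norm_integral_le_of_norm_le_const (a := 0) (b := s) (C := ‖y‖)
      (f := fun σ => α.act (σ • v) y) fun σ _ => (norm_act α _ _).le
    simpa [mul_comm] using this)

theorem integralAct_apply (v : E n) (s : ℝ) (y : A) :
    integralAct α v s y = ∫ σ in (0 : ℝ)..s, α.act (σ • v) y := rfl

/-- `y` is the derivative of `x` in the direction `v`. -/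
def Gen (v : E n) (x y : A) : Prop := ∀ s : ℝ, α.act (s • v) x - x = integralAct α v s y

variable {α}

theorem Gen.hasDerivAt {v : E n} {x y : A} (h : Gen α v x y) (t : E n) :
    HasDerivAt (fun s : ℝ => α.act (t + s • v) x) (α.act t y) 0 := by
  have hc : Continuous fun σ : ℝ => α.act (σ • v) y :=
    continuous_act_uncurry α (by fun_prop) continuous_const
  have h1 := (hc.integral_hasStrictDerivAt 0 0).hasDerivAt
  simp only [zero_smul, α.act_zero] at h1
  have h2 : HasDerivAt (fun s : ℝ => α.act (s • v) x) y 0 := by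
    have e : (fun s : ℝ => α.act (s • v) x) = fun s => (∫ σ in (0 : ℝ)..s, α.act (σ • v) y) + x := by
      ext s
      rw [← integralAct_apply, ← h s, sub_add_cancel]
    rw [e]
    exact h1.add_const x
  have h3 := ((actL α t).restrictScalars ℝ).hasFDerivAt.comp_hasDerivAt (0 : ℝ) h2
  refine h3.congr_of_eventuallyEq (Filter.Eventually.of_forall fun s => ?_)
  simp [α.act_add, actL_apply]

theorem Gen.of_hasDerivAt {v : E n} {x y : A}
    (h : ∀ s : ℝ, HasDerivAt (fun s : ℝ => α.act (s • v) x) (α.act (s • v) y) s) : Gen α v x y := by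
  intro s
  have hc : Continuous fun σ : ℝ => α.act (σ • v) y :=
    continuous_act_uncurry α (by fun_prop) continuous_const
  rw [integralAct_apply, intervalIntegral.integral_eq_sub_of_hasDerivAt (fun σ _ => h σ)
    (hc.intervalIntegrable _ _), zero_smul, α.act_zero]

/-- In its integrated form the relation equates a bounded operator applied to φ(ξ) with a bounded
operator applied to ψ(ξ), so it can be differentiated in ξ. In this way t- and ξ-derivatives of
α_t(F(ξ)) are interchanged before joint smoothness is known. -/
theorem Gen.dd {v : E n} {φ ψ : E n → A} (hφ : ContDiff ℝ ∞ φ) (hψ : ContDiff ℝ ∞ ψ)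
    (h : ∀ ξ, Gen α v (φ ξ) (ψ ξ)) (w ξ : E n) : Gen α v (dd w φ ξ) (dd w ψ ξ) := by
  intro s
  have e : (fun ξ => ((actL α (s • v)).restrictScalars ℝ - ContinuousLinearMap.id ℝ A) (φ ξ)) =
      fun ξ => integralAct α v s (ψ ξ) := by
    ext ξ
    simpa [actL_apply] using h ξ s
  have h1 := dd_clm ((actL α (s • v)).restrictScalars ℝ - ContinuousLinearMap.id ℝ A)
    isOpen_univ hφ.contDiffOn w (Set.mem_univ ξ)
  have h2 := dd_clm (integralAct α v s) isOpen_univ hψ.contDiffOn w (Set.mem_univ ξ)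
  rw [e] at h1
  have h3 := h1.symm.trans h2
  simpa [actL_apply] using h3

theorem contDiff_dw {V F : Type*} [NormedAddCommGroup V] [NormedSpace ℝ V] [NormedAddCommGroup F]
    [NormedSpace ℝ F] {u : V → F} (hu : ContDiff ℝ ∞ u) (l : List V) : ContDiff ℝ ∞ (dw l u) :=
  contDiffOn_univ.1 (contDiffOn_dw isOpen_univ hu.contDiffOn l)

theorem Gen.dw {v : E n} {φ ψ : E n → A} (hφ : ContDiff ℝ ∞ φ) (hψ : ContDiff ℝ ∞ ψ)
    (h : ∀ ξ, Gen α v (φ ξ) (ψ ξ)) (l : List (E n)) (ξ : E n) :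
    Gen α v (dw l φ ξ) (dw l ψ ξ) := by
  induction l generalizing ξ with
  | nil => exact h ξ
  | cons w l ih => exact Gen.dd (contDiff_dw hφ l) (contDiff_dw hψ l) ih w ξ

/-- `∂_t^γ|_{t=0} α_t(a)`. -/
def tder (α : CStarAction n A) (γ : Fin n → ℕ) (a : A) : A :=
  md (stdVec n) γ (fun t => α.act t a) 0

theorem delta_eq_tder (γ : Fin n → ℕ) (a : A) :
    delta α γ a = (Complex.I ^ len γ)⁻¹ • tder α γ a := by
  rw [delta, pderiv, multiDeriv_eq_md, tder]

theorem dw_act {a : A} (ha : a ∈ smoothElements α) (l : List (E n)) (t : E n) :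
    dw l (fun t => α.act t a) t = α.act t (dw l (fun t => α.act t a) 0) := by
  have h1 := dw_affine (V' := E n) isOpen_univ (ContDiff.contDiffOn ha)
    (ContinuousLinearMap.id ℝ (E n)) t (fun _ => Set.mem_univ _) l
  have h2 := dw_clm isOpen_univ (ContDiff.contDiffOn ha) ((actL α t).restrictScalars ℝ) l
    (Set.mem_univ (0 : E n))
  have e := congrFun h1 0
  simp only [ContinuousLinearMap.coe_id', id_eq, α.act_add, add_zero, List.map_id] at e
  simp only [ContinuousLinearMap.coe_restrictScalars', actL_apply] at h2
  rw [← h2, e]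

theorem gen_tder {a : A} (ha : a ∈ smoothElements α) (γ : Fin n → ℕ) (j : Fin n) :
    Gen α (stdVec n j) (tder α γ a) (tder α (γ + Pi.single j 1) a) := by
  refine Gen.of_hasDerivAt fun s => ?_
  have hc : ContDiff ℝ ∞ fun t => α.act t a := ha
  have h1 := hasDerivAt_line isOpen_univ (contDiff_dw hc (mdList (stdVec n) γ)).contDiffOn
    (stdVec n j) 0 s (Set.mem_univ _)
  have h2 := md_add_single isOpen_univ hc.contDiffOn (stdVec n) γ j (Set.mem_univ (s • stdVec n j))
  simp only [zero_add] at h1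
  rw [md] at h2
  rw [md] at h2
  rw [← h2, dw_act ha] at h1
  refine h1.congr_of_eventuallyEq (Filter.Eventually.of_forall fun σ => ?_)
  exact (dw_act ha _ _).symm

end Generator

/-! ### Joint smoothness and estimates for α_t(F(ξ)). -/

section Lift

variable {n : ℕ} {A : Type*} [CStarAlgebra A] {α : CStarAction n A} {Z : Set ℂ} {hZ : IsOpen Z}

/-- The function `α_t(F(ξ))` of `(t, ξ, z)`. -/
def lift (α : CStarAction n A) (F : E n → A) (x : X0 n) : A := α.act x.1 (F x.2.1)

theorem SmoothMap.contDiff_tder {F : E n → A} (hF : SmoothMap α F) (γ : Fin n → ℕ) :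
    ContDiff ℝ ∞ fun ξ => tder α γ (F ξ) := by
  have h := (hF.2 γ).const_smul (Complex.I ^ len γ)
  have : Complex.I ^ len γ ≠ 0 := pow_ne_zero _ Complex.I_ne_zero
  simpa only [delta_eq_tder, smul_smul, mul_inv_cancel₀ this, one_smul] using h

/-- The derivatives of `lift α F`. -/
def liftDer (α : CStarAction n A) (F : E n → A) (l : List (E n)) (γ : Fin n → ℕ) : X0 n → A :=
  lift α (dw l fun ξ => tder α γ (F ξ))

theorem hasLineDerivAt_liftDer_t {F : E n → A} (hF : SmoothMap α F) (l : List (E n))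
    (γ : Fin n → ℕ) (j : Fin n) (x : X0 n) :
    HasLineDerivAt ℝ (liftDer α F l γ) (liftDer α F l (γ + Pi.single j 1) x) x (tdir j) := by
  have h := Gen.dw (hF.contDiff_tder γ) (hF.contDiff_tder (γ + Pi.single j 1))
    (fun ξ => gen_tder (hF.1 ξ) γ j) l x.2.1
  have h2 := h.hasDerivAt x.1
  rw [HasLineDerivAt]
  simpa [liftDer, lift, tdir] using h2

theorem hasLineDerivAt_liftDer_x {F : E n → A} (hF : SmoothMap α F) (l : List (E n))
    (γ : Fin n → ℕ) (v : E n) (x : X0 n) :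
    HasLineDerivAt ℝ (liftDer α F l γ) (liftDer α F (v :: l) γ x) x (0, v, 0) := by
  have h1 := hasDerivAt_line isOpen_univ (contDiff_dw (hF.contDiff_tder γ) l).contDiffOn v x.2.1 0
    (Set.mem_univ _)
  have h2 := ((actL α x.1).restrictScalars ℝ).hasFDerivAt.comp_hasDerivAt (0 : ℝ) h1
  rw [HasLineDerivAt]
  simpa [liftDer, lift, actL_apply, Function.comp_def] using h2

theorem hasLineDerivAt_liftDer_z (F : E n → A) (l : List (E n))
    (γ : Fin n → ℕ) (c : ℂ) (x : X0 n) :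
    HasLineDerivAt ℝ (liftDer α F l γ) 0 x (zdir c) := by
  rw [HasLineDerivAt]
  simpa [liftDer, lift, zdir] using hasDerivAt_const (0 : ℝ) (liftDer α F l γ x)

theorem continuous_liftDer {F : E n → A} (hF : SmoothMap α F) (l : List (E n)) (γ : Fin n → ℕ) :
    Continuous (liftDer α F l γ) :=
  continuous_act_uncurry α continuous_fst
    ((contDiff_dw (hF.contDiff_tder γ) l).continuous.comp (by fun_prop))

/-- The functions α_t(∂_ξ^l ∂_t^γ F), together with 0 for the z-direction, are continuous and closed
under the coordinate derivatives. -/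
theorem contDiff_liftDer {F : E n → A} (hF : SmoothMap α F) (l : List (E n)) (γ : Fin n → ℕ) :
    ContDiff ℝ ∞ (liftDer α F l γ) := by
  have h := contDiffOn_of_lineDeriv_family (basis0 n) isOpen_univ
    ({u | ∃ l γ, u = liftDer α F l γ} ∪ {0}) ?_ ?_ (liftDer α F l γ) (Or.inl ⟨l, γ, rfl⟩)
  · exact contDiffOn_univ.1 h
  · rintro u (⟨l, γ, rfl⟩ | rfl)
    · exact (continuous_liftDer hF l γ).continuousOn
    · exact continuousOn_const
  · rintro u (⟨l, γ, rfl⟩ | rfl) i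
    · rw [basis0_apply]
      rcases i with j | j | k
      · exact ⟨_, Or.inl ⟨l, γ + Pi.single j 1, rfl⟩, fun x _ => hasLineDerivAt_liftDer_t hF l γ j x⟩
      · exact ⟨_, Or.inl ⟨stdVec n j :: l, γ, rfl⟩, fun x _ =>
          hasLineDerivAt_liftDer_x hF l γ (stdVec n j) x⟩
      · exact ⟨0, Or.inr rfl, fun x _ => hasLineDerivAt_liftDer_z F l γ _ x⟩
    · refine ⟨0, Or.inr rfl, fun x _ => ?_⟩
      rw [HasLineDerivAt]
      exact hasDerivAt_const _ _

theorem dd_eq_of_hasLineDerivAt {V F : Type*} [NormedAddCommGroup V] [NormedSpace ℝ V]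
    [NormedAddCommGroup F] [NormedSpace ℝ F] {u : V → F} (hu : ContDiff ℝ ∞ u) {x v : V} {u' : F}
    (h : HasLineDerivAt ℝ u u' x v) : dd v u x = u' :=
  (((hu.differentiable (by simp)) x).hasFDerivAt.hasLineDerivAt v).unique h

theorem dd_liftDer_t {F : E n → A} (hF : SmoothMap α F) (l : List (E n)) (γ : Fin n → ℕ)
    (j : Fin n) : dd (tdir j) (liftDer α F l γ) = liftDer α F l (γ + Pi.single j 1) :=
  funext fun x => dd_eq_of_hasLineDerivAt (contDiff_liftDer hF l γ) (hasLineDerivAt_liftDer_t hF l γ j x)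

theorem dd_liftDer_x {F : E n → A} (hF : SmoothMap α F) (l : List (E n)) (γ : Fin n → ℕ)
    (v : E n) : dd ((0, v, 0) : X0 n) (liftDer α F l γ) = liftDer α F (v :: l) γ :=
  funext fun x => dd_eq_of_hasLineDerivAt (contDiff_liftDer hF l γ) (hasLineDerivAt_liftDer_x hF l γ v x)

theorem dd_liftDer_z {F : E n → A} (hF : SmoothMap α F) (l : List (E n)) (γ : Fin n → ℕ)
    (c : ℂ) : dd (zdir c) (liftDer α F l γ) = fun _ => 0 :=
  funext fun x => dd_eq_of_hasLineDerivAt (contDiff_liftDer hF l γ) (hasLineDerivAt_liftDer_z F l γ c x)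

theorem liftDer_nil_zero (F : E n → A) : liftDer α F [] 0 = lift α F := by
  ext x
  simp [liftDer, lift, tder, md_zero, α.act_zero]

/-- The multi-index that counts the occurrences of each index in a list. -/
def countIdx (w : List (Fin n)) : Fin n → ℕ := fun j => w.count j

theorem perm_mdList {X : Type*} (v : Fin n → X) (w : List (Fin n)) :
    (w.map v).Perm (mdList v (countIdx w)) := by
  have h : w.Perm (mdList id (countIdx w)) := by
    rw [← Multiset.coe_eq_coe, coe_mdList]
    ext j
    rw [Multiset.count_sum', Finset.sum_eq_single j]
    · simp [countIdx]
    · intro i _ hi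
      simp [hi.symm]
    · simp
  have := h.map v
  rwa [mdList_map] at this

theorem len_countIdx (w : List (Fin n)) : len (countIdx w) = w.length := by
  rw [← length_mdList (id : Fin n → Fin n), ← (perm_mdList id w).length_eq]
  simp

/-- The automorphism α_t is isometric, so t drops out of the estimate. The word of ξ-derivatives is
sorted into a multi-index, and δ^γ differs from the derivative of the action only by a power of i.
-/
theorem IsSymbol.bound_liftDer {M : ℝ} {F : E n → A} (hF : IsSymbol α M F) (w : List (Fin n))
    (γ : Fin n → ℕ) : ∃ C : ℝ, ∀ x : X0 n,
      ‖liftDer α F (w.map (stdVec n)) γ x‖ ≤ C * bracket x.2.1 ^ (M - w.length) := by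
  obtain ⟨C, hC⟩ := hF.2 γ (countIdx w)
  refine ⟨C, fun x => ?_⟩
  have h := hC x.2.1
  rw [len_countIdx] at h
  rw [liftDer, lift, norm_act]
  refine le_trans (le_of_eq ?_) h
  have hsm := hF.1
  have e0 : dw (w.map (stdVec n)) F = pderiv (countIdx w) F := by
    have hF0 : ContDiff ℝ ∞ F := by
      have := hsm.contDiff_tder 0
      simpa [tder, md_zero, α.act_zero] using this
    rw [pderiv, multiDeriv_eq_md]
    ext ξ
    exact dw_perm isOpen_univ hF0.contDiffOn (perm_mdList (stdVec n) w) (Set.mem_univ ξ)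
  rw [← e0]
  have e1 : (fun t => α.act t (dw (w.map (stdVec n)) F x.2.1)) =
      fun t => liftDer α F (w.map (stdVec n)) 0 (t, x.2.1, 0) := by
    ext t
    simp [liftDer, lift, tder, md_zero, α.act_zero]
  have e2 : ∀ γ, md tdir γ (liftDer α F (w.map (stdVec n)) 0) =
      liftDer α F (w.map (stdVec n)) γ := fun γ => by
    clear h hC
    induction γ using multi_induction with
    | h0 => exact md_zero _ _
    | hs σ j ih =>
      ext y
      rw [md_add_single isOpen_univ (contDiff_liftDer hsm _ 0).contDiffOn tdir σ j
        (Set.mem_univ y), ih, dd_liftDer_t hsm]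
  rw [delta_eq_tder, norm_I_pow_inv_smul, tder, e1,
    md_slice_t (hZ := isOpen_univ) (contDiff_liftDer hsm _ 0).contDiffOn x.2.1 (Set.mem_univ 0), e2]
  simp [liftDer, lift, α.act_zero]

theorem IsSymbol.cls_liftDer {M : ℝ} {F : E n → A} (hF : IsSymbol α M F) (k : ℕ)
    (w : List (Fin n)) (γ : Fin n → ℕ) :
    Cls (grad0 n hZ) k (fun x => bracket x.2.1 ^ (M - w.length))
      (liftDer α F (w.map (stdVec n)) γ) := by
  have hc : ∀ (w : List (Fin n)) (γ : Fin n → ℕ),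
      ContDiffOn ℝ ∞ (liftDer α F (w.map (stdVec n)) γ) (grad0 n hZ).dom := fun w γ =>
    (contDiff_liftDer hF.1 _ γ).contDiffOn
  have hb : ∀ (w : List (Fin n)) (γ : Fin n → ℕ), BoundedBy (grad0 n hZ)
      (fun x => bracket x.2.1 ^ (M - w.length)) (liftDer α F (w.map (stdVec n)) γ) :=
    fun w γ r => by
      obtain ⟨C, hC⟩ := hF.bound_liftDer w γ
      exact ⟨C, fun x _ => hC x⟩
  induction k generalizing w γ with
  | zero => exact ⟨hc w γ, hb w γ⟩
  | succ k ih =>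
    refine ⟨⟨hc w γ, hb w γ⟩, fun i => ?_⟩
    rcases i with j | j | c
    · have e : dd ((grad0 n hZ).dir (Sum.inl j)) (liftDer α F (w.map (stdVec n)) γ) =
          liftDer α F (w.map (stdVec n)) (γ + Pi.single j 1) := dd_liftDer_t hF.1 _ γ j
      rw [e]
      refine (ih w _).mono (WLE.of_le (fun _ => bracket_rpow_nonneg _ _) fun x => ?_)
      simp [grad0, ord0]
    · have e : dd ((grad0 n hZ).dir (Sum.inr (Sum.inl j))) (liftDer α F (w.map (stdVec n)) γ) =
          liftDer α F ((j :: w).map (stdVec n)) γ := dd_liftDer_x hF.1 _ γ _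
      rw [e]
      refine (ih (j :: w) _).mono (WLE.of_le (fun _ => bracket_rpow_nonneg _ _) fun x => ?_)
      change _ ≤ bracket x.2.1 ^ (M - w.length) * bracket x.2.1 ^ (-1 : ℝ)
      rw [← Real.rpow_add (bracket_pos _)]
      exact bracket_rpow_le (by push_cast [List.length_cons]; linarith) _
    · have e : dd ((grad0 n hZ).dir (Sum.inr (Sum.inr c))) (liftDer α F (w.map (stdVec n)) γ) =
          fun _ => 0 := dd_liftDer_z hF.1 _ γ _
      rw [e]
      exact cls_zero _ _

/-- A symbol gives rise to an equivariant symbol. -/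
theorem IsSymbol.good {M : ℝ} {F : E n → A} (hF : IsSymbol α M F) : Good α hZ M (lift α F) := by
  refine ⟨fun k => ?_, fun x _ => ?_, fun s x _ => ?_⟩
  · have := hF.cls_liftDer (hZ := hZ) k [] 0
    simpa [liftDer_nil_zero] using this
  · rw [← liftDer_nil_zero, dd_liftDer_z hF.1, dd_liftDer_z hF.1, smul_zero]
  · simp [lift, α.act_add]

end Lift

/-! ### Cutoffs in `ξ` -/

section Diagonal

variable {V V' F : Type*} [NormedAddCommGroup V] [NormedSpace ℝ V] [NormedAddCommGroup V']
  [NormedSpace ℝ V'] [NormedAddCommGroup F] [NormedSpace ℝ F] {𝒢 : Grading V} {𝒢' : Grading V'}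

/-- The classes under a substitution that maps directions to multiples of directions. -/
theorem Cls.comp_diag {T : V' → V} (hT : ContDiffOn ℝ ∞ T 𝒢'.dom) (hm : Set.MapsTo T 𝒢'.dom 𝒢.dom)
    (hb : ∀ r, ∃ r', Set.MapsTo T (𝒢'.bdd r) (𝒢.bdd r')) (e : 𝒢'.ι → 𝒢.ι) (c : 𝒢'.ι → ℝ)
    (hd : ∀ i, ∀ x ∈ 𝒢'.dom, dd (𝒢'.dir i) T x = c i • 𝒢.dir (e i))
    (hw : ∀ i, WLE 𝒢' (fun x => 𝒢.wt (e i) (T x)) (𝒢'.wt i))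
    {k : ℕ} {W : V → ℝ} {W' : V' → ℝ} (hW : WLE 𝒢' (fun x => W (T x)) W') {u : V → F}
    (hu : Cls 𝒢 k W u) : Cls 𝒢' k W' (fun x => u (T x)) := by
  have hbd : ∀ {W : V → ℝ} {W' : V' → ℝ} {u : V → F}, WLE 𝒢' (fun x => W (T x)) W' →
      BoundedBy 𝒢 W u → BoundedBy 𝒢' W' (fun x => u (T x)) := fun hW h =>
    BoundedBy.mono hW fun r => by
      obtain ⟨r', hr'⟩ := hb r
      obtain ⟨C, hC⟩ := h r'
      exact ⟨C, fun x hx => hC _ (hr' hx)⟩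
  induction k generalizing W W' u with
  | zero => exact ⟨hu.1.comp hT hm, hbd hW hu.2⟩
  | succ k ih =>
    refine ⟨⟨hu.1.1.comp hT hm, hbd hW hu.1.2⟩, fun i => ?_⟩
    have he : Set.EqOn (dd (𝒢'.dir i) fun x => u (T x))
        (fun x => ((ContinuousLinearMap.lsmul ℝ ℝ : ℝ →L[ℝ] F →L[ℝ] F) (c i))
          (dd (𝒢.dir (e i)) u (T x))) 𝒢'.dom := fun x hx => by
      rw [dd_comp 𝒢.isOpen_dom 𝒢'.isOpen_dom hu.1.1 hT hm _ hx, hd i x hx]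
      simp [dd]
    exact Cls.congr (Cls.clm _ (ih (hW.mul (hw i)) (hu.2 (e i)))) he

end Diagonal

section Cutoff

variable {n : ℕ} {Z : Set ℂ} (hZ : IsOpen Z)

/-- The grading `grad0` with an additional parameter `ε ∈ [0, 1]`. -/
def gradE (n : ℕ) {Z : Set ℂ} (hZ : IsOpen Z) : Grading (X0 n × ℝ) where
  dom := {x | x.1.2.2 ∈ Z}
  isOpen_dom := hZ.preimage ((continuous_snd.comp continuous_snd).comp continuous_fst)
  ι := I0 n
  dir := fun i => (dir0 n i, 0)
  wt := fun i x => bracket x.1.2.1 ^ (ord0 i : ℝ)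
  wt_nonneg := fun _ _ => bracket_rpow_nonneg _ _
  bdd := fun r => {x | x.1.2.2 ∈ coneBdd Z r ∧ 0 ≤ x.2 ∧ x.2 ≤ 1}
  bdd_subset := fun _ _ hx => hx.1.1

variable {F : Type*} [NormedAddCommGroup F] [NormedSpace ℝ F] {hZ}

theorem S0.gradE {M : ℝ} {u : X0 n → F} (hu : S0 hZ M u) :
    Sym (gradE n hZ) (fun x => bracket x.1.2.1 ^ M) (fun x => u x.1) := fun k => by
  refine Cls.comp_diag (𝒢 := grad0 n hZ) (𝒢' := TwistedCalculus.gradE n hZ) contDiff_fst.contDiffOn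
    (fun x hx => hx) (fun r => ⟨r, fun x hx => hx.1⟩) id (fun _ => 1) (fun i x _ => ?_) (fun i => ?_)
    (WLE.refl fun _ => bracket_rpow_nonneg _ _) (hu k)
  · rw [one_smul, dd, fderiv_fst]
    rfl
  · exact WLE.refl fun _ => bracket_rpow_nonneg _ _

theorem S0.of_gradE {M : ℝ} {u : X0 n × ℝ → F}
    (hu : Sym (TwistedCalculus.gradE n hZ) (fun x => bracket x.1.2.1 ^ M) u) {ε : ℝ} (h0 : 0 ≤ ε)
    (h1 : ε ≤ 1) : S0 hZ M (fun x => u (x, ε)) := fun k => by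
  refine Cls.comp_diag (𝒢' := grad0 n hZ) (𝒢 := TwistedCalculus.gradE n hZ)
    (T := fun x => (x, ε)) (by fun_prop)
    (fun x hx => hx) (fun r => ⟨r, fun x hx => ⟨hx, h0, h1⟩⟩) id (fun _ => 1) (fun i x _ => ?_)
    (fun i => ?_) (WLE.refl fun _ => bracket_rpow_nonneg _ _) (hu k)
  · have : HasFDerivAt (fun x : X0 n => (x, ε)) _ x :=
      (hasFDerivAt_id (𝕜 := ℝ) x).prodMk (hasFDerivAt_const ε x)
    rw [one_smul, dd, this.fderiv]
    rfl
  · exact WLE.refl fun _ => bracket_rpow_nonneg _ _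

/-- Dilation of the variable `ξ`. -/
theorem S0.dilate {M : ℝ} {u : X0 n → F} (hu : S0 hZ M u) :
    S0 hZ M (fun x => u (x.1, (2 : ℝ) • x.2.1, x.2.2)) := fun k => by
  have hle : ∀ (s : ℝ) (ξ : E n), bracket ((2 : ℝ) • ξ) ^ s ≤ 2 ^ |s| * bracket ξ ^ s := fun s ξ => by
    have hξ := bracket_pos ξ
    have h1 : bracket ((2 : ℝ) • ξ) ≤ 2 * bracket ξ := by
      rw [bracket, Real.sqrt_le_left (by positivity), mul_pow, bracket_sq, norm_smul]
      norm_num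
      nlinarith [sq_nonneg ‖ξ‖]
    have h2 : bracket ξ ≤ bracket ((2 : ℝ) • ξ) := by
      refine Real.sqrt_le_sqrt ?_
      rw [norm_smul]
      norm_num
      nlinarith [sq_nonneg ‖ξ‖]
    rcases le_total 0 s with hs | hs
    · rw [abs_of_nonneg hs, ← Real.mul_rpow zero_le_two hξ.le]
      exact Real.rpow_le_rpow (bracket_pos _).le h1 hs
    · refine (Real.rpow_le_rpow_of_nonpos hξ h2 hs).trans ?_
      exact le_mul_of_one_le_left (Real.rpow_nonneg hξ.le _)
        (Real.one_le_rpow one_le_two (abs_nonneg s))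
  have hT : ContDiff ℝ ∞ (fun x : X0 n => ((x.1, (2 : ℝ) • x.2.1, x.2.2) : X0 n)) := by fun_prop
  refine Cls.comp_diag (𝒢' := grad0 n hZ) (𝒢 := grad0 n hZ) hT.contDiffOn
    (fun x hx => hx) (fun r => ⟨r, fun x hx => hx⟩) id
    (Sum.elim (fun _ => 1) (Sum.elim (fun _ => 2) fun _ => 1)) (fun i x _ => ?_)
    (fun i r => ⟨2 ^ |(ord0 i : ℝ)|, fun x _ => ?_⟩)
    (fun r => ⟨2 ^ |M|, fun x _ => ?_⟩) (hu k)
  · have h1 : HasLineDerivAt ℝ (fun x : X0 n => ((x.1, (2 : ℝ) • x.2.1, x.2.2) : X0 n))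
        ((dir0 n i).1, (2 : ℝ) • (dir0 n i).2.1, (dir0 n i).2.2) x (dir0 n i) := by
      let L : X0 n →L[ℝ] X0 n := (ContinuousLinearMap.fst ℝ _ _).prod
        (((2 : ℝ) • (ContinuousLinearMap.fst ℝ _ _).comp (ContinuousLinearMap.snd ℝ _ _)).prod
          ((ContinuousLinearMap.snd ℝ _ _).comp (ContinuousLinearMap.snd ℝ _ _)))
      exact (L.hasFDerivAt (x := x)).hasLineDerivAt (dir0 n i)
    refine (dd_eq_of_hasLineDerivAt hT h1).trans ?_
    rcases i with j | j | l <;> simp [grad0, dir0, tdir, xdir, zdir]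
  · rw [abs_of_nonneg ((grad0 n hZ).wt_nonneg _ _)]
    exact hle _ _
  · rw [abs_of_nonneg (bracket_rpow_nonneg _ _)]
    exact hle _ _

theorem dd_cutoff {h : E n → ℝ} (hh : ContDiff ℝ ∞ h) (p : ℕ) (v : X0 n) :
    dd ((v, 0) : X0 n × ℝ) (fun x : X0 n × ℝ => x.2 ^ p * h (x.2 • x.1.2.1)) =
      fun x => x.2 ^ (p + 1) * dd v.2.1 h (x.2 • x.1.2.1) := by
  ext x
  refine dd_eq_of_hasLineDerivAt ?_ ?_
  · exact (contDiff_snd.pow p).mul (hh.comp (by fun_prop))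
  · have h1 : HasDerivAt (fun τ : ℝ => x.2 • x.1.2.1 + τ • x.2 • v.2.1) (x.2 • v.2.1) 0 := by
      simpa using ((hasDerivAt_id (0 : ℝ)).smul_const (x.2 • v.2.1)).const_add (x.2 • x.1.2.1)
    have h2 := ((hh.differentiable (by simp)) (x.2 • x.1.2.1 + (0 : ℝ) • x.2 • v.2.1)).hasFDerivAt.comp_hasDerivAt
      (0 : ℝ) h1
    have h3 := h2.const_mul (x.2 ^ p)
    rw [HasLineDerivAt]
    refine (h3.congr_deriv ?_).congr_of_eventuallyEq (Filter.Eventually.of_forall fun τ => ?_)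
    · simp [dd, pow_succ, mul_assoc]
    · simp [smul_comm τ x.2]

/-- A ξ-derivative brings out a factor ε, and on the support of h(εξ) one has ε⟨ξ⟩ ≤ 1 + |R|; hence
ε^p is bounded by a multiple of ⟨ξ⟩^{-p} uniformly in ε ∈ [0,1]. The exponent p and h are free in
the induction to absorb these factors. -/
theorem cls_cutoff (k p : ℕ) {h : E n → ℝ} (hh : ContDiff ℝ ∞ h) (hc : HasCompactSupport h) :
    Cls (gradE n hZ) k (fun x => bracket x.1.2.1 ^ (-(p : ℝ)))
      (fun x => x.2 ^ p * h (x.2 • x.1.2.1)) := by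
  have hcd : ∀ (p : ℕ) {h : E n → ℝ}, ContDiff ℝ ∞ h →
      ContDiffOn ℝ ∞ (fun x : X0 n × ℝ => x.2 ^ p * h (x.2 • x.1.2.1)) (gradE n hZ).dom :=
    fun p h hh => ((contDiff_snd.pow p).mul (hh.comp (by fun_prop))).contDiffOn
  have hb : ∀ (p : ℕ) {h : E n → ℝ}, ContDiff ℝ ∞ h → HasCompactSupport h →
      BoundedBy (gradE n hZ) (fun x => bracket x.1.2.1 ^ (-(p : ℝ)))
        (fun x => x.2 ^ p * h (x.2 • x.1.2.1)) := fun p h hh hc r => by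
    obtain ⟨C, hC⟩ := hc.exists_bound_of_continuous hh.continuous
    obtain ⟨R, hR⟩ := hc.isBounded.exists_norm_le
    refine ⟨C * (1 + |R|) ^ p, ?_⟩
    rintro ⟨x, ε⟩ ⟨_, h0, h1⟩
    simp only at h0 h1
    have hC0 : 0 ≤ C := (norm_nonneg _).trans (hC 0)
    have hB := bracket_pos x.2.1
    by_cases hz : h (ε • x.2.1) = 0
    · simp only [hz, mul_zero, norm_zero]
      have := bracket_rpow_nonneg (-(p : ℝ)) x.2.1
      positivity
    · have h2 := hR _ (subset_tsupport _ (Function.mem_support.2 hz))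
      rw [norm_smul, Real.norm_of_nonneg h0] at h2
      have h3 : ε * bracket x.2.1 ≤ 1 + |R| := by
        refine (sq_le_sq₀ (by positivity) (by positivity)).1 ?_
        rw [mul_pow, bracket_sq]
        nlinarith [mul_nonneg h0 (norm_nonneg x.2.1), le_abs_self R, abs_nonneg R]
      change ‖ε ^ p * h (ε • x.2.1)‖ ≤ C * (1 + |R|) ^ p * bracket x.2.1 ^ (-(p : ℝ))
      rw [norm_mul, norm_pow, Real.norm_of_nonneg h0, Real.rpow_neg hB.le, Real.rpow_natCast]
      rw [← div_eq_mul_inv, le_div_iff₀ (by positivity)]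
      calc ε ^ p * ‖h (ε • x.2.1)‖ * bracket x.2.1 ^ p
          = ‖h (ε • x.2.1)‖ * (ε * bracket x.2.1) ^ p := by rw [mul_pow]; ring
        _ ≤ C * (1 + |R|) ^ p := by
          gcongr
          exact hC _
  induction k generalizing p h with
  | zero => exact ⟨hcd p hh, hb p hh hc⟩
  | succ k ih =>
    refine ⟨⟨hcd p hh, hb p hh hc⟩, fun i => ?_⟩
    have e : dd ((gradE n hZ).dir i) (fun x : X0 n × ℝ => x.2 ^ p * h (x.2 • x.1.2.1)) = _ :=
      dd_cutoff hh p (dir0 n i)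
    rw [e]
    have hz : (dir0 n i).2.1 = 0 → Cls (gradE n hZ) k
        (fun x => bracket x.1.2.1 ^ (-(p : ℝ)) * (gradE n hZ).wt i x)
        (fun x => x.2 ^ (p + 1) * dd (dir0 n i).2.1 h (x.2 • x.1.2.1)) := fun h0 => by
      rw [h0]
      simpa [dd] using cls_zero (𝒢 := gradE n hZ) (F := ℝ) k _
    rcases i with j | j | l
    · exact hz rfl
    · have hh' : ContDiff ℝ ∞ (dd (stdVec n j) h) := contDiff_dw hh [stdVec n j]
      have hc' : HasCompactSupport (dd (stdVec n j) h) := hc.fderiv_apply (𝕜 := ℝ) _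
      refine (ih (p + 1) hh' hc').mono (WLE.of_le (fun _ => bracket_rpow_nonneg _ _) fun x => ?_)
      change _ ≤ bracket x.1.2.1 ^ (-(p : ℝ)) * bracket x.1.2.1 ^ (-1 : ℝ)
      rw [← Real.rpow_add (bracket_pos _)]
      exact bracket_rpow_le (by push_cast; linarith) _
    · exact hz rfl

theorem sym_cutoff {h : E n → ℝ} (hh : ContDiff ℝ ∞ h) (hc : HasCompactSupport h) :
    Sym (gradE n hZ) (fun x => bracket x.1.2.1 ^ (0 : ℝ)) (fun x => h (x.2 • x.1.2.1)) := fun k => by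
  simpa using cls_cutoff (hZ := hZ) k 0 hh hc

theorem s0_cutoff {h : E n → ℝ} (hh : ContDiff ℝ ∞ h) (hc : HasCompactSupport h) {ε : ℝ}
    (h0 : 0 ≤ ε) (h1 : ε ≤ 1) : S0 hZ 0 (fun x => h (ε • x.2.1)) :=
  S0.of_gradE (sym_cutoff hh hc) h0 h1

theorem dw_eq_zero_of_vanish (hZ : IsOpen Z) {u : X0 n → F} {R : ℝ}
    (hR : ∀ x : X0 n, x.2.2 ∈ Z → R ≤ ‖x.2.1‖ → u x = 0) (l : List (X0 n)) {x : X0 n}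
    (hx : x.2.2 ∈ Z) (hx' : R < ‖x.2.1‖) : dw l u x = 0 := by
  have hΩ : IsOpen ((grad0 n hZ).dom ∩ {x : X0 n | R < ‖x.2.1‖}) :=
    (grad0 n hZ).isOpen_dom.inter (isOpen_lt continuous_const (by fun_prop))
  have h := dw_eqOn hΩ (u := u) (w := fun _ => 0) (fun y hy => hR y hy.1 (le_of_lt hy.2)) l ⟨hx, hx'⟩
  rw [h]
  clear h
  induction l generalizing x with
  | nil => rfl
  | cons v l ih =>
    have e : dw l (fun _ : X0 n => (0 : F)) = fun _ => 0 := by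
      clear ih
      induction l with
      | nil => rfl
      | cons v l ih => rw [dw_cons, ih, dd_const]
    rw [dw_cons, e, dd_const]

/-- Symbols with bounded support in `ξ` are of every order. -/
theorem S0.of_vanish {M : ℝ} {u : X0 n → F} (hu : S0 hZ M u) {R : ℝ}
    (hR : ∀ x : X0 n, x.2.2 ∈ Z → R ≤ ‖x.2.1‖ → u x = 0) (M' : ℝ) : S0 hZ M' u := by
  refine sym_of_words hu.contDiffOn fun l r => ?_
  obtain ⟨C, hC⟩ := (Sym.dw hu l).boundedBy r
  set K := (1 + |R|) ^ |M - M'| with hK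
  refine ⟨|C| * K, fun x hx => ?_⟩
  have hprod : 0 ≤ (l.map fun i => (grad0 n hZ).wt i x).prod :=
    List.prod_nonneg fun a ha => by
      obtain ⟨i, _, rfl⟩ := List.mem_map.1 ha
      exact (grad0 n hZ).wt_nonneg i x
  have hB := bracket_rpow_nonneg M x.2.1
  have hB' := bracket_rpow_nonneg M' x.2.1
  have hK0 : 0 ≤ K := by positivity
  by_cases hξ : R < ‖x.2.1‖
  · rw [dw_eq_zero_of_vanish hZ hR _ hx.1 hξ, norm_zero]
    positivity
  · have h1 : bracket x.2.1 ≤ 1 + |R| := by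
      rw [bracket, Real.sqrt_le_left (by positivity)]
      have := (not_lt.1 hξ).trans (le_abs_self R)
      nlinarith [norm_nonneg x.2.1]
    have h2 : bracket x.2.1 ^ M ≤ K * bracket x.2.1 ^ M' := by
      have : bracket x.2.1 ^ M = bracket x.2.1 ^ (M - M') * bracket x.2.1 ^ M' := by
        rw [← Real.rpow_add (bracket_pos _), sub_add_cancel]
      rw [this]
      refine mul_le_mul_of_nonneg_right ?_ hB'
      refine (bracket_rpow_le (le_abs_self _) _).trans ?_
      exact Real.rpow_le_rpow (bracket_pos _).le h1 (abs_nonneg _)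
    calc _ ≤ C * (bracket x.2.1 ^ M * (l.map fun i => (grad0 n hZ).wt i x).prod) := hC x hx
      _ ≤ |C| * (bracket x.2.1 ^ M * (l.map fun i => (grad0 n hZ).wt i x).prod) := by
        gcongr; exact le_abs_self C
      _ ≤ |C| * (K * bracket x.2.1 ^ M' * (l.map fun i => (grad0 n hZ).wt i x).prod) := by gcongr
      _ = _ := by ring

variable {A : Type*} [CStarAlgebra A] {α : CStarAction n A}

theorem Good.of_vanish {M : ℝ} {u : X0 n → A} (hu : Good α hZ M u) {R : ℝ}
    (hR : ∀ x : X0 n, x.2.2 ∈ Z → R ≤ ‖x.2.1‖ → u x = 0) (M' : ℝ) : Good α hZ M' u :=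
  ⟨hu.sym.of_vanish hR M', hu.hol, hu.eqv⟩

theorem Good.smul_fun {M M' : ℝ} {φ : E n → ℝ} (hφ : S0 hZ M' (fun x => φ x.2.1)) {u : X0 n → A}
    (hu : Good α hZ M u) : Good α hZ (M' + M) (fun x => φ x.2.1 • u x) := by
  refine ⟨hφ.smul hu.sym, fun x hx => ?_, fun s x hx => ?_⟩
  · have h := fun v => dd_bilin (ContinuousLinearMap.lsmul ℝ ℝ : ℝ →L[ℝ] A →L[ℝ] A)
      (grad0 n hZ).isOpen_dom hφ.contDiffOn hu.sym.contDiffOn v hx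
    simp only [ContinuousLinearMap.lsmul_apply] at h
    have h0 : ∀ c, dd (zdir c) (fun x : X0 n => φ x.2.1) x = 0 := fun c => by
      have h1 := ((differentiableAt_of_contDiffOn (grad0 n hZ).isOpen_dom hφ.contDiffOn
        hx).hasFDerivAt.hasLineDerivAt (zdir c))
      refine h1.unique ?_
      rw [HasLineDerivAt]
      simpa [zdir] using hasDerivAt_const (0 : ℝ) (φ x.2.1)
    rw [h, h, h0, h0, hu.hol x hx, zero_smul, zero_add, zero_add, smul_comm]
  · simp only [hu.eqv s x hx]
    exact (map_smul ((actL α s).restrictScalars ℝ) (φ x.2.1) (u x)).symm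

theorem Good.dilate {M : ℝ} {F : E n → A} (hF : Good α hZ M (lift α F)) :
    Good α hZ M (lift α fun ξ => F ((2 : ℝ) • ξ)) := by
  refine ⟨hF.sym.dilate, fun x hx => ?_, fun s x hx => ?_⟩
  · have hc := hF.sym.dilate.contDiffOn
    have h0 : ∀ c, dd (zdir c) (lift α fun ξ : E n => F ((2 : ℝ) • ξ)) x = 0 := fun c => by
      have h1 := ((differentiableAt_of_contDiffOn (grad0 n hZ).isOpen_dom hc
        hx).hasFDerivAt.hasLineDerivAt (zdir c))
      refine h1.unique ?_
      rw [HasLineDerivAt]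
      simpa [zdir, lift] using hasDerivAt_const (0 : ℝ) (lift α (fun ξ : E n => F ((2 : ℝ) • ξ)) x)
    rw [h0, h0, smul_zero]
  · simp [lift, α.act_add]

end Cutoff

/-! ### The inverse of the principal part -/

section Resolvent

variable {n : ℕ} {A : Type*} [CStarAlgebra A] {α : CStarAction n A} {Z : Set ℂ} {hZ : IsOpen Z}

/-- `z^k (z^m p - 1)⁻¹`. -/
def res (m : ℕ) (p : X0 n → A) (k : ℕ) (x : X0 n) : A :=
  x.2.2 ^ k • Ring.inverse (x.2.2 ^ m • p x - 1)

variable {m : ℕ} {p : X0 n → A}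

theorem contDiffOn_res (hp : ContDiffOn ℝ ∞ p (grad0 n hZ).dom)
    (hq : ∀ x : X0 n, x.2.2 ∈ Z → IsUnit (x.2.2 ^ m • p x - 1)) (k : ℕ) :
    ContDiffOn ℝ ∞ (res m p k) (grad0 n hZ).dom := by
  have hz : ∀ k, ContDiffOn ℝ ∞ (fun x : X0 n => x.2.2 ^ k) (grad0 n hZ).dom := fun k => by fun_prop
  refine (hz k).smul fun x hx => ?_
  obtain ⟨q, h⟩ := hq x hx
  have h1 : ContDiffAt ℝ ∞ (Ring.inverse : A → A) (x.2.2 ^ m • p x - 1) := by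
    rw [← h]
    exact contDiffAt_ringInverse ℝ q
  exact h1.comp_contDiffWithinAt x (((hz m).smul hp).sub contDiffOn_const x hx)

/-- From ∂R = -R ∂(z^m p) R, with the powers of z redistributed so that every factor is again some
`res` of index at most m when k ≤ m. The truncated index k - 1 at k = 0 is harmless, as its
coefficient is k. -/
theorem dd_res (hp : ContDiffOn ℝ ∞ p (grad0 n hZ).dom)
    (hq : ∀ x : X0 n, x.2.2 ∈ Z → IsUnit (x.2.2 ^ m • p x - 1)) (k : ℕ) (v : X0 n) {x : X0 n}
    (hx : x.2.2 ∈ Z) :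
    dd v (res m p k) x = v.2.2 • ((k : ℂ) • res m p (k - 1) x -
      (m : ℂ) • (res m p k x * p x * res m p (m - 1) x)) - res m p k x * dd v p x * res m p m x := by
  have hd := (differentiableAt_of_contDiffOn (grad0 n hZ).isOpen_dom (contDiffOn_res hp hq k)
    hx).hasFDerivAt.hasLineDerivAt v
  refine hd.unique ?_
  rw [HasLineDerivAt]
  have hl : HasDerivAt (fun τ : ℝ => x.2.2 + τ • v.2.2) v.2.2 0 := by
    simpa using ((hasDerivAt_id (0 : ℝ)).smul_const v.2.2).const_add x.2.2
  have hz : ∀ k : ℕ, HasDerivAt (fun τ : ℝ => (x.2.2 + τ • v.2.2) ^ k)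
      ((k : ℂ) * x.2.2 ^ (k - 1) * v.2.2) 0 := fun k => by
    simpa using hl.fun_pow k
  have hp' : HasDerivAt (fun τ : ℝ => p (x + τ • v)) (dd v p x) 0 := by
    have := hasDerivAt_line (grad0 n hZ).isOpen_dom hp v x 0 (by rw [zero_smul, add_zero]; exact hx)
    simpa using this
  have hq' := ((hz m).smul hp').sub_const (1 : A)
  obtain ⟨q, h⟩ := hq x hx
  have e0 : (x.2.2 + (0 : ℝ) • v.2.2) ^ m • p (x + (0 : ℝ) • v) - 1 = q := by simp [h]
  have hi : HasFDerivAt (Ring.inverse : A → A)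
      (-ContinuousLinearMap.mulLeftRight ℝ A ((q⁻¹ : Aˣ) : A) ((q⁻¹ : Aˣ) : A))
      ((x.2.2 + (0 : ℝ) • v.2.2) ^ m • p (x + (0 : ℝ) • v) - 1) := by
    rw [e0]
    exact hasFDerivAt_ringInverse (𝕜 := ℝ) q
  have hc := (hz k).smul (hi.comp_hasDerivAt (0 : ℝ) hq')
  refine (hc.congr_deriv ?_).congr_of_eventuallyEq (Filter.Eventually.of_forall fun τ => ?_)
  · have hqi : Ring.inverse (x.2.2 ^ m • p x - 1) = ((q⁻¹ : Aˣ) : A) := by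
      rw [← h, Ring.inverse_unit]
    simp only [Function.comp_apply, Pi.smul_apply', zero_smul, add_zero, res, hqi, neg_apply,
      ContinuousLinearMap.mulLeftRight_apply, mul_add, add_mul, smul_mul_assoc, mul_smul_comm,
      smul_sub, smul_neg, smul_add, smul_smul]
    have e1 : x.2.2 ^ k * ((m : ℂ) * x.2.2 ^ (m - 1) * v.2.2) =
      v.2.2 * ((m : ℂ) * (x.2.2 ^ (m - 1) * x.2.2 ^ k)) := by ring
    have e2 : (k : ℂ) * x.2.2 ^ (k - 1) * v.2.2 = v.2.2 * ((k : ℂ) * x.2.2 ^ (k - 1)) := by ring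
    rw [e1, e2, mul_comm (x.2.2 ^ k) (x.2.2 ^ m)]
    abel
  · rfl

/-- Induction on the number of derivatives, simultaneously for all k ≤ m. In each term of `dd_res`
the orders add up to -k - 1 for a ξ-derivative, -k for a t-derivative and -k + 1 for a z-derivative.
-/
theorem cls_res (hm : 0 < m) (hp : S0 hZ m p)
    (hq : ∀ x : X0 n, x.2.2 ∈ Z → IsUnit (x.2.2 ^ m • p x - 1))
    (hb : ∀ k ≤ m, BoundedBy (grad0 n hZ) (fun x => bracket x.2.1 ^ (-(k : ℝ))) (res m p k))
    (l k : ℕ) (hk : k ≤ m) :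
    Cls (grad0 n hZ) l (fun x => bracket x.2.1 ^ (-(k : ℝ))) (res m p k) := by
  induction l generalizing k with
  | zero => exact ⟨contDiffOn_res hp.contDiffOn hq k, hb k hk⟩
  | succ l ih =>
    refine ⟨⟨contDiffOn_res hp.contDiffOn hq k, hb k hk⟩, fun i => ?_⟩
    refine Cls.congr ?_ fun x hx => dd_res hp.contDiffOn hq k (dir0 n i) hx
    have hW : ∀ {s : ℝ} {W : X0 n → ℝ} {u : X0 n → A},
        Cls (grad0 n hZ) l W u → (W = fun x => bracket x.2.1 ^ s) → s = -k + ord0 i →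
        Cls (grad0 n hZ) l (fun x => bracket x.2.1 ^ (-(k : ℝ)) * (grad0 n hZ).wt i x) u := by
      rintro s W u hu rfl rfl
      refine hu.mono (WLE.of_le (fun _ => bracket_rpow_nonneg _ _) fun x => ?_)
      rw [Real.rpow_add (bracket_pos _)]
      rfl
    have hsub : ∀ {W : X0 n → ℝ} {u w : X0 n → A}, Cls (grad0 n hZ) l W u →
        Cls (grad0 n hZ) l W w → Cls (grad0 n hZ) l W (fun x => u x - w x) := fun h1 h2 => by
      simpa [sub_eq_add_neg] using
        h1.add (h2.clm ((ContinuousLinearMap.lsmul ℝ ℝ : ℝ →L[ℝ] A →L[ℝ] A) (-1)))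
    have hsm : ∀ (c : ℂ) {W : X0 n → ℝ} {u : X0 n → A}, Cls (grad0 n hZ) l W u →
        Cls (grad0 n hZ) l W (fun x => c • u x) := fun c _ _ h =>
      h.clm ((ContinuousLinearMap.lsmul ℝ ℂ : ℂ →L[ℝ] A →L[ℝ] A) c)
    have h3 := hW (((ih k hk).mul (hp.dd_dir0 i l)).mul (ih m le_rfl)) (s := -k + ord0 i)
      (by ext x; rw [← Real.rpow_add (bracket_pos _), ← Real.rpow_add (bracket_pos _)]; ring_nf) rfl
    refine hsub ?_ h3
    by_cases hc : (dir0 n i).2.2 = 0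
    · simp only [hc, zero_smul]
      exact cls_zero _ _
    · have hi : (ord0 i : ℝ) = 1 := by
        rcases i with j | j | j
        · simp [dir0, tdir] at hc
        · simp [dir0, xdir] at hc
        · rfl
      refine hsm _ (hsub ?_ (hsm _ ?_))
      · rcases Nat.eq_zero_or_pos k with rfl | hk0
        · simp only [Nat.cast_zero, zero_smul]
          exact cls_zero _ _
        · refine hW (hsm _ (ih (k - 1) (by omega))) rfl ?_
          rw [hi, Nat.cast_sub hk0]
          push_cast
          ring
      · refine hW (((ih k hk).mul (hp l)).mul (ih (m - 1) (by omega))) (s := -k + ord0 i) ?_ rfl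
        ext x
        rw [← Real.rpow_add (bracket_pos _), ← Real.rpow_add (bracket_pos _), hi, Nat.cast_sub hm]
        push_cast
        ring_nf

theorem act_inverse (s : E n) {a : A} (ha : IsUnit a) :
    α.act s (Ring.inverse a) = Ring.inverse (α.act s a) := by
  obtain ⟨q, rfl⟩ := ha
  have h : α.act s (q : A) = ((Units.map (α.act s : A →* A)) q : Aˣ) := rfl
  rw [h, Ring.inverse_unit, Ring.inverse_unit]
  rfl

theorem Good.res (hm : 0 < m) (hp : Good α hZ m p)
    (hq : ∀ x : X0 n, x.2.2 ∈ Z → IsUnit (x.2.2 ^ m • p x - 1))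
    (hb : ∀ k ≤ m, BoundedBy (grad0 n hZ) (fun x => bracket x.2.1 ^ (-(k : ℝ))) (res m p k))
    {k : ℕ} (hk : k ≤ m) : Good α hZ (-k) (res m p k) := by
  refine ⟨fun l => cls_res hm hp.sym hq hb l k hk, fun x hx => ?_, fun s x hx => ?_⟩
  · rw [dd_res hp.sym.contDiffOn hq k _ hx, dd_res hp.sym.contDiffOn hq k _ hx, hp.hol x hx]
    simp only [zdir, one_smul, smul_sub, mul_smul_comm, smul_mul_assoc]
  · simp only [TwistedCalculus.res, hp.eqv s x hx, map_smul, act_inverse s (hq x hx), map_sub,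
      map_one]

end Resolvent

/-! ### Uniform bounds for the resolvent of the principal part. -/

section Bound

variable {A : Type*} [CStarAlgebra A]

theorem exists_bound_inverse {X : Type*} [TopologicalSpace X] {K : Set X} (hK : IsCompact K)
    {Φ : X → A} (hΦ : ContinuousOn Φ K) (hu : ∀ x ∈ K, IsUnit (Φ x)) :
    ∃ C, ∀ x ∈ K, ‖Ring.inverse (Φ x)‖ ≤ C := by
  refine hK.exists_bound_of_continuousOn (fun x hx => ?_)
  obtain ⟨q, h⟩ := hu x hx
  have h1 : ContinuousAt (Ring.inverse : A → A) (Φ x) := by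
    rw [← h]
    exact NormedRing.inverse_continuousAt q
  exact h1.comp_continuousWithinAt (hΦ x hx)

theorem isUnit_smul {c : ℂ} (hc : c ≠ 0) {a : A} (ha : IsUnit a) : IsUnit (c • a) := by
  have := (IsUnit.mk0 c hc).map (algebraMap ℂ A)
  rw [Algebra.smul_def]
  exact this.mul ha

theorem inverse_smul {c : ℂ} (hc : c ≠ 0) {a : A} (ha : IsUnit a) :
    Ring.inverse (c • a) = c⁻¹ • Ring.inverse a := by
  obtain ⟨q, rfl⟩ := ha
  have h : c • (q : A) = ((Units.mk0 c hc • q : Aˣ) : A) := rfl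
  rw [h, Ring.inverse_unit, Ring.inverse_unit]
  rfl

variable {n : ℕ} {Z : Set ℂ} {m : ℕ} {F : E n → A}

/-- Unit vectors at distance at least `1 / r` from the complement of `Z`. -/
def dirBdd (Z : Set ℂ) (r : ℕ) : Set ℂ := {κ | ‖κ‖ = 1 ∧ ∀ w, w ∉ Z → 1 ≤ r * ‖w - κ‖}

theorem isCompact_dirBdd (Z : Set ℂ) (r : ℕ) : IsCompact (dirBdd Z r) := by
  refine (isCompact_sphere (0 : ℂ) 1).of_isClosed_subset ?_ fun κ hκ => by simpa using hκ.1
  have : dirBdd Z r = {κ | ‖κ‖ = 1} ∩ ⋂ w ∈ Zᶜ, {κ : ℂ | 1 ≤ r * ‖w - κ‖} := by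
    ext κ; simp [dirBdd]
  rw [this]
  refine (isClosed_eq (by fun_prop) (by fun_prop)).inter (isClosed_biInter fun w _ =>
    isClosed_le (by fun_prop) (by fun_prop))

theorem dirBdd_subset (Z : Set ℂ) (r : ℕ) : dirBdd Z r ⊆ Z := fun κ hκ => by
  by_contra h
  have := hκ.2 κ h
  norm_num at this

theorem inv_norm_smul_mem_dirBdd (hcone : ∀ z ∈ Z, ∀ s : ℝ, 0 < s → s • z ∈ Z) (h0 : (0 : ℂ) ∉ Z)
    {r : ℕ} {z : ℂ} (hz : z ∈ coneBdd Z r) : ‖z‖⁻¹ • z ∈ dirBdd Z r := by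
  have hz0 : z ≠ 0 := fun h => h0 (h ▸ hz.1)
  have hn : 0 < ‖z‖ := norm_pos_iff.2 hz0
  refine ⟨by rw [norm_smul, norm_inv, norm_norm, inv_mul_cancel₀ hn.ne'], fun w hw => ?_⟩
  have hw' : ‖z‖ • w ∉ Z := fun h => hw (by
    have := hcone _ h _ (inv_pos.2 hn)
    rwa [smul_smul, inv_mul_cancel₀ hn.ne', one_smul] at this)
  have h1 := hz.2.2 _ hw'
  have h2 : ‖z‖ • w - z = ‖z‖ • (w - ‖z‖⁻¹ • z) := by
    rw [smul_sub, smul_smul, mul_inv_cancel₀ hn.ne', one_smul]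
  rw [h2, norm_smul, norm_norm] at h1
  have h3 : ‖z‖ * 1 ≤ ‖z‖ * (r * ‖w - ‖z‖⁻¹ • z‖) := by linarith
  exact le_of_mul_le_mul_left h3 hn

/-- For s > 0 this is (sz)^m (a - (sz)^{-m}), and sz stays in the cone; for s = 0 the element is -1.
-/
theorem isUnit_sub_one (hcone : ∀ z ∈ Z, ∀ s : ℝ, 0 < s → s • z ∈ Z) (h0 : (0 : ℂ) ∉ Z)
    (hm : 0 < m) {a : A} (ha : ∀ z ∈ Z, IsUnit (a - algebraMap ℂ A (z⁻¹ ^ m))) {z : ℂ}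
    (hz : z ∈ Z) {s : ℝ} (hs : 0 ≤ s) : IsUnit ((s • z) ^ m • a - 1) := by
  rcases hs.eq_or_lt with rfl | hs
  · rw [zero_smul, zero_pow hm.ne', zero_smul, zero_sub]
    exact isUnit_one.neg
  · have hw := hcone z hz s hs
    have hw0 : s • z ≠ 0 := fun h => h0 (h ▸ hw)
    have h := isUnit_smul (pow_ne_zero m hw0) (ha _ hw)
    rwa [smul_sub, Algebra.algebraMap_eq_smul_one, smul_smul, ← mul_pow, mul_inv_cancel₀ hw0,
      one_pow, one_smul] at h

/-- The same family seen from the other end, with s the inverse of the radial variable. The endpoint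
s = 0 is where invertibility of a itself, that is, ellipticity, enters. -/
theorem isUnit_smul_sub (hcone : ∀ z ∈ Z, ∀ s : ℝ, 0 < s → s • z ∈ Z) (h0 : (0 : ℂ) ∉ Z)
    (hm : 0 < m) {a : A} (ha0 : IsUnit a)
    (ha : ∀ z ∈ Z, IsUnit (a - algebraMap ℂ A (z⁻¹ ^ m))) {z : ℂ}
    (hz : z ∈ Z) {s : ℝ} (hs : 0 ≤ s) : IsUnit (z ^ m • a - ((s : ℂ) ^ m) • 1) := by
  rcases hs.eq_or_lt with rfl | hs
  · rw [Complex.ofReal_zero, zero_pow hm.ne', zero_smul, sub_zero]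
    exact isUnit_smul (pow_ne_zero m fun h => h0 (h ▸ hz)) ha0
  · have h1 := isUnit_sub_one hcone h0 hm ha hz (inv_nonneg.2 hs.le)
    have hs' : (s : ℂ) ≠ 0 := by exact_mod_cast hs.ne'
    have h2 := isUnit_smul (pow_ne_zero m hs') h1
    rwa [smul_sub, smul_smul, ← mul_pow, Complex.real_smul, Complex.ofReal_inv, ← mul_assoc,
      mul_inv_cancel₀ hs', one_mul] at h2

/-- With σ = s|z| and κ = z/|z| in the compact set `dirBdd`, the half-line σ ≥ 0 is compactified:
for σ ≤ 1 the element (σκ)^m F(θ) - 1 is continuous and invertible on a compact set; for σ ≥ 1 the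
factor σ^m is taken out, and κ^m F(θ) - σ^{-m} with σ^{-1} ∈ [0,1] is treated in the same way. The
factor σ^{k-m} left in the second case is at most 1. -/
theorem exists_bound_resolvent (hcone : ∀ z ∈ Z, ∀ s : ℝ, 0 < s → s • z ∈ Z) (h0 : (0 : ℂ) ∉ Z)
    (hm : 0 < m) (hF : Continuous F) (hF0 : ∀ θ, ‖θ‖ = 1 → IsUnit (F θ))
    (hFm : ∀ θ, ‖θ‖ = 1 → ∀ z ∈ Z, IsUnit (F θ - algebraMap ℂ A (z⁻¹ ^ m))) (r : ℕ) :
    ∃ C, 0 ≤ C ∧ ∀ z ∈ coneBdd Z r, ∀ θ, ‖θ‖ = 1 → ∀ s : ℝ, 0 ≤ s → ∀ k ≤ m,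
      (s * ‖z‖) ^ k * ‖Ring.inverse ((s • z) ^ m • F θ - 1)‖ ≤ C := by
  have hK : IsCompact ((Set.Icc (0 : ℝ) 1) ×ˢ (Metric.sphere (0 : E n) 1) ×ˢ dirBdd Z r) :=
    isCompact_Icc.prod ((isCompact_sphere _ _).prod (isCompact_dirBdd Z r))
  obtain ⟨C₁, hC₁⟩ := exists_bound_inverse hK
    (Φ := fun q : ℝ × E n × ℂ => (q.1 • q.2.2) ^ m • F q.2.1 - 1)
    (by have : Continuous fun q : ℝ × E n × ℂ => F q.2.1 := hF.comp (by fun_prop)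
        exact Continuous.continuousOn (by fun_prop))
    (fun q hq => isUnit_sub_one hcone h0 hm (hFm _ (by simpa using hq.2.1))
      (dirBdd_subset Z r hq.2.2) hq.1.1)
  obtain ⟨C₂, hC₂⟩ := exists_bound_inverse hK
    (Φ := fun q : ℝ × E n × ℂ => q.2.2 ^ m • F q.2.1 - ((q.1 : ℂ) ^ m) • 1)
    (by have : Continuous fun q : ℝ × E n × ℂ => F q.2.1 := hF.comp (by fun_prop)
        exact Continuous.continuousOn (by fun_prop))
    (fun q hq => isUnit_smul_sub hcone h0 hm (hF0 _ (by simpa using hq.2.1))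
      (hFm _ (by simpa using hq.2.1)) (dirBdd_subset Z r hq.2.2) hq.1.1)
  refine ⟨max 0 (max C₁ C₂), le_max_left _ _, fun z hz θ hθ s hs k hk => ?_⟩
  have hz0 : z ≠ 0 := fun h => h0 (h ▸ hz.1)
  have hn : 0 < ‖z‖ := norm_pos_iff.2 hz0
  have hκ := inv_norm_smul_mem_dirBdd hcone h0 hz
  set κ := ‖z‖⁻¹ • z with hκd
  set σ := s * ‖z‖ with hσ
  have hσ0 : 0 ≤ σ := mul_nonneg hs hn.le
  have e : s • z = σ • κ := by
    rw [hσ, hκd, smul_smul, mul_assoc, mul_inv_cancel₀ hn.ne', mul_one]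
  have hθ' : θ ∈ Metric.sphere (0 : E n) 1 := by simpa using hθ
  rw [e]
  rcases le_total σ 1 with h1 | h1
  · have := hC₁ (σ, θ, κ) ⟨⟨hσ0, h1⟩, hθ', hκ⟩
    calc σ ^ k * ‖Ring.inverse ((σ • κ) ^ m • F θ - 1)‖
        ≤ 1 * ‖Ring.inverse ((σ • κ) ^ m • F θ - 1)‖ := by
          gcongr
          exact pow_le_one₀ hσ0 h1
      _ ≤ _ := by
        rw [one_mul]
        exact this.trans ((le_max_left _ _).trans (le_max_right _ _))
  · have hσp : 0 < σ := one_pos.trans_le h1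
    have h2 := hC₂ (σ⁻¹, θ, κ) ⟨⟨inv_nonneg.2 hσ0, inv_le_one_of_one_le₀ h1⟩, hθ', hκ⟩
    have hu := isUnit_smul_sub hcone h0 hm (hF0 _ hθ) (hFm _ hθ) (dirBdd_subset Z r hκ)
      (inv_nonneg.2 hσ0)
    have hσc : (σ : ℂ) ≠ 0 := by exact_mod_cast hσp.ne'
    have e2 : (σ • κ) ^ m • F θ - 1 = ((σ : ℂ) ^ m) • (κ ^ m • F θ - (((σ⁻¹ : ℝ) : ℂ) ^ m) • 1) := by
      rw [smul_sub, smul_smul _ _ (F θ), smul_smul _ _ (1 : A), ← mul_pow, ← mul_pow,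
        Complex.ofReal_inv, mul_inv_cancel₀ hσc, one_pow, one_smul, Complex.real_smul]
    rw [e2, inverse_smul (pow_ne_zero m hσc) hu, norm_smul, norm_inv, norm_pow, Complex.norm_real,
      Real.norm_of_nonneg hσ0, ← mul_assoc]
    calc σ ^ k * (σ ^ m)⁻¹ * _ ≤ 1 * C₂ := by
          refine mul_le_mul ?_ h2 (norm_nonneg _) zero_le_one
          rw [← div_eq_mul_inv, div_le_one (by positivity)]
          exact pow_le_pow_right₀ h1 hk
      _ ≤ _ := by
        rw [one_mul]
        exact (le_max_right _ _).trans (le_max_right _ _)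

end Bound

/-! ### The principal part, modified near the origin. -/

section Principal

variable {n : ℕ} {A : Type*} [CStarAlgebra A] {α : CStarAction n A} {Z : Set ℂ} {hZ : IsOpen Z}

/-- A smooth cutoff that is `1` for `|ξ| ≤ 1/2` and vanishes for `|ξ| ≥ 1`. -/
def innerBump (n : ℕ) : ContDiffBump (0 : E n) := ⟨1 / 2, 1, by norm_num, by norm_num⟩

/-- The function that agrees with `F` for `|ξ| ≥ 1`, where `F` is homogeneous of degree `m`, and
is a nonnegative multiple of the homogeneous extension of `F` for all `ξ`. -/
def principal (m : ℕ) (F : E n → A) (ξ : E n) : A :=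
  (1 - innerBump n ξ) • ((2 : ℝ) ^ m)⁻¹ • F ((2 : ℝ) • ξ)

variable {m : ℕ} {F : E n → A}

theorem principal_eq (hF : IsHomogeneous m F) {ξ : E n} (hξ : 1 ≤ ‖ξ‖) : principal m F ξ = F ξ := by
  have h1 : innerBump n ξ = 0 := (innerBump n).zero_of_le_dist (by rw [dist_zero_right]; exact hξ)
  rw [principal, h1, sub_zero, one_smul, hF 2 one_le_two ξ hξ, smul_smul, Real.rpow_natCast,
    inv_mul_cancel₀ (by positivity), one_smul]

/-- Outside the ball of radius 1/2 the function 2^{-m}F(2ξ) is the homogeneous extension of F, and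
the cutoff multiplies it by a nonnegative number. Being a nonnegative multiple of F(θ) is what keeps
the modified principal part invertible after subtraction of μ^m, for every ξ. -/
theorem principal_polar (hF : IsHomogeneous m F) (hm : 0 < m) (ξ : E n) : principal m F ξ = 0 ∨
    ∃ s : ℝ, 0 ≤ s ∧ ∃ θ : E n, ‖θ‖ = 1 ∧ principal m F ξ = ((s : ℂ) ^ m) • F θ := by
  rcases le_or_gt ‖ξ‖ (1 / 2) with h | h
  · left
    have h1 : innerBump n ξ = 1 := (innerBump n).one_of_mem_closedBall
      (by rw [mem_closedBall_zero_iff]; exact h)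
    rw [principal, h1, sub_self, zero_smul]
  · right
    have hn : 0 < ‖ξ‖ := by linarith
    have hc : 0 ≤ 1 - innerBump n ξ := sub_nonneg.2 (innerBump n).le_one
    have hθ : ‖‖ξ‖⁻¹ • ξ‖ = 1 := by rw [norm_smul, norm_inv, norm_norm, inv_mul_cancel₀ hn.ne']
    -- The mth root of the cutoff value is absorbed into the radius; homogeneity is then applied
    -- with the factor 2‖ξ‖ ≥ 1.
    refine ⟨(1 - innerBump n ξ) ^ ((m : ℝ)⁻¹) * ‖ξ‖, by positivity, ‖ξ‖⁻¹ • ξ, hθ, ?_⟩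
    have h3 := hF (2 * ‖ξ‖) (by linarith) (‖ξ‖⁻¹ • ξ) hθ.ge
    rw [smul_smul, mul_assoc, mul_inv_cancel₀ hn.ne', mul_one, Real.rpow_natCast] at h3
    have h4 : ∀ (c : ℝ) (a : A), ((c : ℂ)) • a = c • a := fun c a => by
      rw [← Complex.coe_smul]
    rw [principal, h3, ← Complex.ofReal_pow, h4, smul_smul, smul_smul, mul_pow, mul_pow,
      Real.rpow_inv_natCast_pow hc hm.ne']
    congr 1
    field_simp

theorem good_principal (hF : Good α hZ m (lift α F)) : Good α hZ m (lift α (principal m F)) := by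
  have hc : S0 hZ 0 (fun x : X0 n => (1 : ℝ) - innerBump n x.2.1) := by
    have := s0_cutoff (hZ := hZ) (innerBump n).contDiff (innerBump n).hasCompactSupport
      zero_le_one le_rfl
    simp only [one_smul] at this
    exact (S0.const le_rfl (1 : ℝ)).sub this
  have h := ((hF.dilate.const_smul (((2 : ℝ) ^ m)⁻¹ : ℝ)).smul_fun
    (φ := fun ξ => 1 - innerBump n ξ) hc).of_eq (zero_add _)
  refine h.congr fun x _ => ?_
  have h2 : ∀ (c : ℝ) (a : A), α.act x.1 (c • a) = c • α.act x.1 a := fun c a =>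
    map_smul ((actL α x.1).restrictScalars ℝ) c a
  simp only [lift, principal, h2, Complex.coe_smul]

theorem good_sub_principal (hF : Good α hZ m (lift α F)) (hF' : IsHomogeneous m F) (M : ℝ) :
    Good α hZ M (fun x => lift α F x - lift α (principal m F) x) :=
  (hF.sub (good_principal hF)).of_vanish (R := 1) (fun x _ hx => by
    simp only [lift, principal_eq hF' hx, sub_self]) M

theorem isUnit_principal (hcone : ∀ z ∈ Z, ∀ s : ℝ, 0 < s → s • z ∈ Z) (h0 : (0 : ℂ) ∉ Z)
    (hm : 0 < m) (hF : IsHomogeneous m F)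
    (hFm : ∀ θ, ‖θ‖ = 1 → ∀ z ∈ Z, IsUnit (F θ - algebraMap ℂ A (z⁻¹ ^ m))) (ξ : E n) {z : ℂ}
    (hz : z ∈ Z) : IsUnit (z ^ m • principal m F ξ - 1) := by
  rcases principal_polar hF hm ξ with h | ⟨s, hs, θ, hθ, h⟩
  · rw [h, smul_zero, zero_sub]
    exact isUnit_one.neg
  · have := isUnit_sub_one hcone h0 hm (hFm θ hθ) hz hs
    rwa [h, smul_smul, ← mul_pow, mul_comm z, ← Complex.real_smul]

theorem isUnit_lift_principal (hcone : ∀ z ∈ Z, ∀ s : ℝ, 0 < s → s • z ∈ Z) (h0 : (0 : ℂ) ∉ Z)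
    (hm : 0 < m) (hF : IsHomogeneous m F)
    (hFm : ∀ θ, ‖θ‖ = 1 → ∀ z ∈ Z, IsUnit (F θ - algebraMap ℂ A (z⁻¹ ^ m))) (x : X0 n)
    (hx : x.2.2 ∈ Z) : IsUnit (x.2.2 ^ m • lift α (principal m F) x - 1) := by
  have := (isUnit_principal hcone h0 hm hF hFm x.2.1 hx).map (α.act x.1)
  simpa [lift] using this

theorem bracket_le_two_mul {ξ : E n} (h : 1 ≤ ‖ξ‖) : bracket ξ ≤ 2 * ‖ξ‖ := by
  rw [bracket, Real.sqrt_le_left (by positivity)]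
  nlinarith

theorem bracket_le_two {ξ : E n} (h : ‖ξ‖ ≤ 1) : bracket ξ ≤ 2 := by
  rw [bracket, Real.sqrt_le_left (by positivity)]
  nlinarith [norm_nonneg ξ]

/-- For |ξ| ≤ 1 the inverse is bounded and |z| ≤ r bounds z^k; for |ξ| ≥ 1 the bound on (|ξ||z|)^k R
supplies the decay |ξ|^{-k}. -/
theorem boundedBy_res_principal (hcone : ∀ z ∈ Z, ∀ s : ℝ, 0 < s → s • z ∈ Z) (h0 : (0 : ℂ) ∉ Z)
    (hm : 0 < m) (hFc : Continuous F) (hF : IsHomogeneous m F)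
    (hF0 : ∀ θ, ‖θ‖ = 1 → IsUnit (F θ))
    (hFm : ∀ θ, ‖θ‖ = 1 → ∀ z ∈ Z, IsUnit (F θ - algebraMap ℂ A (z⁻¹ ^ m))) (k : ℕ) (hk : k ≤ m) :
    BoundedBy (grad0 n hZ) (fun x => bracket x.2.1 ^ (-(k : ℝ)))
      (res m (lift α (principal m F)) k) := by
  intro r
  obtain ⟨C, hC0, hC⟩ := exists_bound_resolvent hcone h0 hm hFc hF0 hFm r
  -- The summand ‖1‖ covers the points where the modified principal part is 0 and the inverse is -1;
  -- the factor 2 compares ⟨ξ⟩ with max(1, |ξ|).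
  refine ⟨(C + ‖(1 : A)‖) * (2 * (r + 1)) ^ k, fun x hx => ?_⟩
  have hB := bracket_pos x.2.1
  have hN : ‖res m (lift α (principal m F)) k x‖ =
      ‖x.2.2‖ ^ k * ‖Ring.inverse (x.2.2 ^ m • principal m F x.2.1 - 1)‖ := by
    have e : x.2.2 ^ m • lift α (principal m F) x - 1 =
        α.act x.1 (x.2.2 ^ m • principal m F x.2.1 - 1) := by simp [lift]
    rw [res, norm_smul, norm_pow, e,
      ← act_inverse x.1 (isUnit_principal hcone h0 hm hF hFm x.2.1 hx.1), norm_act]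
  change _ ≤ (C + ‖(1 : A)‖) * (2 * (r + 1)) ^ k * bracket x.2.1 ^ (-(k : ℝ))
  rw [hN, Real.rpow_neg hB.le, Real.rpow_natCast, ← div_eq_mul_inv, le_div_iff₀ (by positivity)]
  have hpol := principal_polar hF hm x.2.1
  rcases le_total ‖x.2.1‖ 1 with hξ | hξ
  · have h1 : ‖Ring.inverse (x.2.2 ^ m • principal m F x.2.1 - 1)‖ ≤ C + ‖(1 : A)‖ := by
      rcases hpol with h | ⟨s, hs, θ, hθ, h⟩
      · have e : Ring.inverse (-1 : A) = -1 := by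
          have := Ring.inverse_unit (-1 : Aˣ)
          simpa using this
        rw [h, smul_zero, zero_sub, e, norm_neg]
        linarith
      · have := hC x.2.2 hx θ hθ s hs 0 (Nat.zero_le _)
        rw [pow_zero, one_mul, Complex.real_smul, mul_pow, mul_comm, ← smul_smul, ← h] at this
        linarith [norm_nonneg (1 : A)]
    calc _ ≤ ((r : ℝ) + 1) ^ k * (C + ‖(1 : A)‖) * 2 ^ k := by
          gcongr
          · exact hx.2.1.trans (by linarith)
          · exact bracket_le_two hξ
      _ = _ := by rw [mul_pow]; ring
  · have h1 : (‖x.2.1‖ * ‖x.2.2‖) ^ k * ‖Ring.inverse (x.2.2 ^ m • principal m F x.2.1 - 1)‖ ≤ C := by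
      rw [principal_eq hF hξ]
      have hn : 0 < ‖x.2.1‖ := by linarith
      have hθ : ‖‖x.2.1‖⁻¹ • x.2.1‖ = 1 := by
        rw [norm_smul, norm_inv, norm_norm, inv_mul_cancel₀ hn.ne']
      have h3 := hF ‖x.2.1‖ hξ (‖x.2.1‖⁻¹ • x.2.1) hθ.ge
      rw [smul_smul, mul_inv_cancel₀ hn.ne', one_smul, Real.rpow_natCast] at h3
      have := hC x.2.2 hx _ hθ _ hn.le k hk
      rw [Complex.real_smul, mul_pow (‖x.2.1‖ : ℂ), mul_comm ((‖x.2.1‖ : ℂ) ^ m), ← smul_smul,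
        ← Complex.ofReal_pow, Complex.coe_smul, ← h3] at this
      exact this
    calc _ ≤ ‖x.2.2‖ ^ k * ‖Ring.inverse (x.2.2 ^ m • principal m F x.2.1 - 1)‖ *
          (2 * ‖x.2.1‖) ^ k := by
          gcongr
          exact bracket_le_two_mul hξ
      _ = (‖x.2.1‖ * ‖x.2.2‖) ^ k * ‖Ring.inverse (x.2.2 ^ m • principal m F x.2.1 - 1)‖ * 2 ^ k := by
        rw [mul_pow, mul_pow]; ring
      _ ≤ (C + ‖(1 : A)‖) * 2 ^ k := by
        gcongr
        linarith [norm_nonneg (1 : A)]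
      _ ≤ _ := by
        gcongr
        have : (0 : ℝ) ≤ r := Nat.cast_nonneg r
        linarith

theorem good_res_principal (hcone : ∀ z ∈ Z, ∀ s : ℝ, 0 < s → s • z ∈ Z) (h0 : (0 : ℂ) ∉ Z)
    (hm : 0 < m) (hFc : Continuous F) (hFg : Good α hZ m (lift α F)) (hF : IsHomogeneous m F)
    (hF0 : ∀ θ, ‖θ‖ = 1 → IsUnit (F θ))
    (hFm : ∀ θ, ‖θ‖ = 1 → ∀ z ∈ Z, IsUnit (F θ - algebraMap ℂ A (z⁻¹ ^ m))) {k : ℕ} (hk : k ≤ m) :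
    Good α hZ (-k) (res m (lift α (principal m F)) k) :=
  Good.res hm (good_principal hFg) (isUnit_lift_principal hcone h0 hm hF hFm)
    (boundedBy_res_principal hcone h0 hm hFc hF hF0 hFm) hk

end Principal

/-! ### Asymptotic summation -/

section Borel

variable {n : ℕ} {Z : Set ℂ} {hZ : IsOpen Z}

/-- A smooth cutoff that is `1` for `|ξ| ≤ 1` and vanishes for `|ξ| ≥ 2`. -/
def outerBump (n : ℕ) : ContDiffBump (0 : E n) := ⟨1, 2, by norm_num, by norm_num⟩

/-- The excision function that vanishes for `|ξ| ≤ 1 / ε` and is `1` for `|ξ| ≥ 2 / ε`. -/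
def excision (ε : ℝ) (ξ : E n) : ℝ := 1 - outerBump n (ε • ξ)

theorem excision_eq_zero {ε : ℝ} (hε : 0 ≤ ε) {ξ : E n} (h : ε * ‖ξ‖ ≤ 1) : excision ε ξ = 0 := by
  rw [excision, (outerBump n).one_of_mem_closedBall, sub_self]
  rw [mem_closedBall_zero_iff, norm_smul, Real.norm_of_nonneg hε]
  exact h

theorem excision_eq_one {ε : ℝ} (hε : 0 ≤ ε) {ξ : E n} (h : 2 ≤ ε * ‖ξ‖) : excision ε ξ = 1 := by
  rw [excision, (outerBump n).zero_of_le_dist, sub_zero]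
  rw [dist_zero_right, norm_smul, Real.norm_of_nonneg hε]
  exact h

variable {F : Type*} [NormedAddCommGroup F] [NormedSpace ℝ F]

theorem sym_excision_smul {M : ℝ} {u : X0 n → F} (hu : S0 hZ M u) :
    Sym (gradE n hZ) (fun x => bracket x.1.2.1 ^ M)
      (fun x => excision x.2 x.1.2.1 • u x.1) := by
  have h1 : Sym (gradE n hZ) (fun x => bracket x.1.2.1 ^ (0 : ℝ))
      (fun x => (1 : ℝ) - outerBump n (x.2 • x.1.2.1)) :=
    (sym_const (WLE.of_le (fun _ => zero_le_one) fun x => by simp) 1).sub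
      (sym_cutoff (outerBump n).contDiff (outerBump n).hasCompactSupport)
  have h2 := h1.smul hu.gradE
  simpa [excision] using h2

theorem s0_excision {ε : ℝ} (h0 : 0 ≤ ε) (h1 : ε ≤ 1) :
    S0 hZ 0 (fun x : X0 n => excision ε x.2.1) :=
  (S0.const le_rfl (1 : ℝ)).sub
    (s0_cutoff (outerBump n).contDiff (outerBump n).hasCompactSupport h0 h1)

theorem dw_slice {w : X0 n × ℝ → F} (hw : ContDiffOn ℝ ∞ w (gradE n hZ).dom) (ε : ℝ)
    (l : List (X0 n)) : Set.EqOn (dw l fun x => w (x, ε))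
      (fun x => dw (l.map fun v => ((v, 0) : X0 n × ℝ)) w (x, ε)) (grad0 n hZ).dom := by
  induction l with
  | nil => exact fun _ _ => rfl
  | cons v l ih =>
    intro x hx
    have hT : HasFDerivAt (fun x : X0 n => (x, ε)) _ x :=
      (hasFDerivAt_id (𝕜 := ℝ) x).prodMk (hasFDerivAt_const ε x)
    rw [dw_cons, dd_eqOn (grad0 n hZ).isOpen_dom ih v hx,
      dd_comp (T := fun x : X0 n => (x, ε)) (gradE n hZ).isOpen_dom (grad0 n hZ).isOpen_dom
        (contDiffOn_dw (gradE n hZ).isOpen_dom hw _) (by fun_prop) (fun y hy => hy) v hx]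
    simp only [List.map_cons, dw_cons]
    congr 1
    rw [dd, hT.fderiv]
    rfl

theorem prod_wt_nonneg (l : List (I0 n)) (x : X0 n) :
    0 ≤ (l.map fun i => (grad0 n hZ).wt i x).prod :=
  List.prod_nonneg fun a ha => by
    obtain ⟨i, _, rfl⟩ := List.mem_map.1 ha
    exact (grad0 n hZ).wt_nonneg i x

/-- The excision of a symbol gains a factor `ε` at the expense of one order. -/
theorem exists_bound_excision {M : ℝ} {u : X0 n → F} (hu : S0 hZ M u) (l : List (I0 n)) (r : ℕ) :
    ∃ C, 0 ≤ C ∧ ∀ ε : ℝ, 0 < ε → ε ≤ 1 → ∀ x : X0 n, x.2.2 ∈ coneBdd Z r →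
      ‖dw (l.map (dir0 n)) (fun x => excision ε x.2.1 • u x) x‖ ≤
        C * ε * (bracket x.2.1 ^ (M + 1) * (l.map fun i => (grad0 n hZ).wt i x).prod) := by
  have hs := sym_excision_smul hu
  obtain ⟨C, hC⟩ := (hs.dw l).boundedBy r
  refine ⟨|C|, abs_nonneg C, fun ε h0 h1 x hx => ?_⟩
  have hp := prod_wt_nonneg (hZ := hZ) l x
  have hB := bracket_pos x.2.1
  rcases lt_or_ge (ε * ‖x.2.1‖) 1 with h | h
  · have hΩ : IsOpen ((grad0 n hZ).dom ∩ {x : X0 n | ε * ‖x.2.1‖ < 1}) :=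
      (grad0 n hZ).isOpen_dom.inter (isOpen_lt (by fun_prop) continuous_const)
    have hz := dw_eqOn hΩ (u := fun x => excision ε x.2.1 • u x) (w := fun _ => (0 : F))
      (fun y hy => by simp [excision_eq_zero h0.le (le_of_lt hy.2)]) (l.map (dir0 n)) ⟨hx.1, h⟩
    have hz' : dw (l.map (dir0 n)) (fun _ : X0 n => (0 : F)) x = 0 :=
      dw_eq_zero_of_vanish hZ (R := -1) (fun _ _ _ => rfl) _ hx.1
        (by linarith [norm_nonneg x.2.1])
    rw [hz, hz', norm_zero]
    have := bracket_rpow_nonneg (M + 1) x.2.1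
    positivity
  · have e := dw_slice hs.contDiffOn ε (l.map (dir0 n)) (x := x) hx.1
    simp only [List.map_map] at e
    rw [e]
    have hb := hC (x, ε) ⟨hx, h0.le, h1⟩
    -- Off the region where the excision vanishes identically, a factor ε⟨ξ⟩ ≥ 1 can be inserted: ε
    -- is gained and one order is spent.
    have hε : 1 ≤ ε * bracket x.2.1 := h.trans (by gcongr; exact norm_le_bracket _)
    refine hb.trans ?_
    calc C * (bracket x.2.1 ^ M * (l.map fun i => (grad0 n hZ).wt i x).prod)
        ≤ |C| * (bracket x.2.1 ^ M * (l.map fun i => (grad0 n hZ).wt i x).prod) := by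
          gcongr; exact le_abs_self C
      _ ≤ |C| * ((bracket x.2.1 ^ M * (ε * bracket x.2.1)) *
          (l.map fun i => (grad0 n hZ).wt i x).prod) := by
          gcongr
          exact le_mul_of_one_le_right (bracket_rpow_nonneg _ _) hε
      _ = _ := by
          rw [Real.rpow_add hB, Real.rpow_one]
          ring

/-- For fixed N there are only finitely many series, words of length at most N and sets of index at
most N, so one small ε serves all these estimates. -/
theorem exists_excision_parameter {κ : Type*} [Finite κ] {M : κ → ℝ} {u : κ → X0 n → F}
    (hu : ∀ i, S0 hZ (M i) (u i)) (N : ℕ) {δ : ℝ} (hδ : 0 < δ) :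
    ∃ ε : ℝ, 0 < ε ∧ ε ≤ δ ∧ ∀ i, ∀ l : List (I0 n), l.length ≤ N → ∀ r ≤ N, ∀ x : X0 n,
      x.2.2 ∈ coneBdd Z r → ‖dw (l.map (dir0 n)) (fun x => excision ε x.2.1 • u i x) x‖ ≤
        δ * (bracket x.2.1 ^ (M i + 1) * (l.map fun i => (grad0 n hZ).wt i x).prod) := by
  have h1 : ∀ i, ∀ l : List (I0 n), ∀ r, ∀ᶠ ε : ℝ in 𝓝[>] 0, ∀ x : X0 n,
      x.2.2 ∈ coneBdd Z r → ‖dw (l.map (dir0 n)) (fun x => excision ε x.2.1 • u i x) x‖ ≤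
        δ * (bracket x.2.1 ^ (M i + 1) * (l.map fun i => (grad0 n hZ).wt i x).prod) :=
    fun i l r => by
      obtain ⟨C, hC0, hC⟩ := exists_bound_excision (hu i) l r
      have hd : 0 < min 1 (δ / (C + 1)) := by positivity
      filter_upwards [Ioo_mem_nhdsGT hd] with ε hε x hx
      have he1 : ε ≤ 1 := hε.2.le.trans (min_le_left _ _)
      have he2 : ε ≤ δ / (C + 1) := hε.2.le.trans (min_le_right _ _)
      rw [le_div_iff₀ (by positivity)] at he2
      refine (hC ε hε.1 he1 x hx).trans (mul_le_mul_of_nonneg_right ?_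
        (mul_nonneg (bracket_rpow_nonneg _ _) (prod_wt_nonneg l x)))
      nlinarith [hε.1]
  have h2 : ∀ᶠ ε : ℝ in 𝓝[>] 0, ∀ i, ∀ l ∈ {l : List (I0 n) | l.length ≤ N}, ∀ r ∈ Set.Iic N,
      ∀ x : X0 n, x.2.2 ∈ coneBdd Z r →
        ‖dw (l.map (dir0 n)) (fun x => excision ε x.2.1 • u i x) x‖ ≤
        δ * (bracket x.2.1 ^ (M i + 1) * (l.map fun i => (grad0 n hZ).wt i x).prod) := by
    refine Filter.eventually_all.2 fun i => ?_
    refine (Filter.eventually_all_finite (List.finite_length_le (I0 n) N)).2 fun l _ => ?_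
    exact (Filter.eventually_all_finite (Set.finite_Iic N)).2 fun r _ => h1 i l r
  obtain ⟨ε, hε, hε'⟩ := (h2.and (Ioo_mem_nhdsGT hδ)).exists
  exact ⟨ε, hε'.1, hε'.2.le, hε⟩

variable {A : Type*} [CStarAlgebra A] {α : CStarAction n A}

/-- The sum `∑ⱼ χ(ε_j ξ) v_j` with excision functions `χ`. -/
def borelSum (ε : ℕ → ℝ) (v : ℕ → X0 n → A) (x : X0 n) : A :=
  ∑' j, excision (ε j) x.2.1 • v j x

theorem borelSum_smul (ε : ℕ → ℝ) (v : ℕ → X0 n → A) (c : ℂ) (x : X0 n) :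
    borelSum ε (fun j y => c • v j y) x = c • borelSum ε v x := by
  rw [borelSum, borelSum, ← tsum_const_smul'']
  simp only [smul_comm c]

/-- Since ε_j ≤ 2^{-j}, the jth excision vanishes for |ξ| ≤ 2^j and the sum is locally finite;
smoothness, holomorphy and equivariance are thus those of finite sums. -/
theorem borelSum_eq {ε : ℕ → ℝ} (hε0 : ∀ j, 0 < ε j) (hε : ∀ j, ε j ≤ (1 / 2) ^ j)
    (v : ℕ → X0 n → A) {J : ℕ} {x : X0 n} (hx : ‖x.2.1‖ < 2 ^ J) :
    borelSum ε v x = ∑ j ∈ Finset.range J, excision (ε j) x.2.1 • v j x := by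
  refine tsum_eq_sum fun j hj => ?_
  have hj' : J ≤ j := by simpa using hj
  rw [excision_eq_zero (hε0 j).le, zero_smul]
  calc ε j * ‖x.2.1‖ ≤ (1 / 2) ^ j * 2 ^ J := by
        gcongr
        exact hε j
    _ ≤ (1 / 2) ^ j * 2 ^ j := by
        gcongr
        norm_num
    _ = 1 := by rw [← mul_pow]; norm_num

theorem good_excision_sub {M : ℝ} {v : X0 n → A} (hv : Good α hZ M v) {ε : ℝ} (h0 : 0 < ε)
    (h1 : ε ≤ 1) (M' : ℝ) : Good α hZ M' (fun x => excision ε x.2.1 • v x - v x) :=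
  (((hv.smul_fun (s0_excision h0.le h1)).of_eq (zero_add M)).sub hv).of_vanish (R := 2 / ε)
    (fun x _ hx => by
      rw [div_le_iff₀ h0, mul_comm] at hx
      rw [excision_eq_one h0.le hx, one_smul, sub_self]) M'

/-- The truncated remainders of an asymptotic sum. -/
theorem good_truncation {M : ℝ} {v : ℕ → X0 n → A} (hv : ∀ j : ℕ, Good α hZ (M - j) (v j))
    {ε : ℕ → ℝ} (hε0 : ∀ j, 0 < ε j) (hε1 : ∀ j, ε j ≤ 1) {N J : ℕ} (hNJ : N ≤ J) :
    Good α hZ (M - N) (fun x => ∑ j ∈ Finset.range J, excision (ε j) x.2.1 • v j x -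
      ∑ j ∈ Finset.range N, v j x) := by
  have h1 : Good α hZ (M - N) (fun x => ∑ j ∈ Finset.range J,
      (excision (ε j) x.2.1 • v j x - v j x)) :=
    Good.sum _ fun j _ => good_excision_sub (hv j) (hε0 j) (hε1 j) _
  have h2 : Good α hZ (M - N) (fun x => ∑ j ∈ Finset.Ico N J, v j x) :=
    Good.sum _ fun j hj => (hv j).mono (by
      have : (N : ℝ) ≤ j := by exact_mod_cast (Finset.mem_Ico.1 hj).1
      linarith)
  refine (h1.add h2).congr fun x _ => ?_
  simp only [Finset.sum_sub_distrib, Finset.sum_Ico_eq_sub (fun j => v j x) hNJ]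
  abel

/-- Locally the remainder is a finite truncation, controlled by `good_truncation`, plus a tail of
excised terms, which the bounds in hb sum geometrically, independently of where the finite sum is
cut off. -/
theorem good_borelSum_sub {M : ℝ} {v : ℕ → X0 n → A} (hv : ∀ j : ℕ, Good α hZ (M - j) (v j))
    {ε : ℕ → ℝ} (hε0 : ∀ j, 0 < ε j) (hε : ∀ j, ε j ≤ (1 / 2) ^ j)
    (hb : ∀ j : ℕ, ∀ l : List (I0 n), l.length ≤ j → ∀ r ≤ j, ∀ x : X0 n,
      x.2.2 ∈ coneBdd Z r → ‖dw (l.map (dir0 n)) (fun x => excision (ε j) x.2.1 • v j x) x‖ ≤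
        (1 / 2) ^ j * (bracket x.2.1 ^ (M - j + 1) * (l.map fun i => (grad0 n hZ).wt i x).prod))
    (N : ℕ) :
    Good α hZ (M - N) (fun x => borelSum ε v x - ∑ j ∈ Finset.range N, v j x) := by
  have hε1 : ∀ j, ε j ≤ 1 := fun j => (hε j).trans (pow_le_one₀ (by norm_num) (by norm_num))
  have hΩ : ∀ J : ℕ, IsOpen ((grad0 n hZ).dom ∩ {x : X0 n | ‖x.2.1‖ < 2 ^ J}) := fun J =>
    (grad0 n hZ).isOpen_dom.inter (isOpen_lt (by fun_prop) continuous_const)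
  have hloc : ∀ (x : X0 n) (K : ℕ), ∃ J, K ≤ J ∧ ‖x.2.1‖ < 2 ^ J := fun x K => by
    obtain ⟨J, hJ⟩ := pow_unbounded_of_one_lt ‖x.2.1‖ (one_lt_two (α := ℝ))
    exact ⟨max K J, le_max_left _ _, hJ.trans_le (pow_le_pow_right₀ one_le_two (le_max_right _ _))⟩
  set R : X0 n → A := fun x => borelSum ε v x - ∑ j ∈ Finset.range N, v j x with hR
  set T : ℕ → X0 n → A := fun J x => ∑ j ∈ Finset.range J, excision (ε j) x.2.1 • v j x -
      ∑ j ∈ Finset.range N, v j x with hT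
  have hTg : ∀ J, N ≤ J → Good α hZ (M - N) (T J) := fun J h => good_truncation hv hε0 hε1 h
  have hRT : ∀ J, Set.EqOn R (T J) ((grad0 n hZ).dom ∩ {x : X0 n | ‖x.2.1‖ < 2 ^ J}) :=
    fun J x hx => by
      simp only [hR, hT]
      rw [borelSum_eq hε0 hε v hx.2]
  refine ⟨sym_of_words ?_ ?_, fun x hx => ?_, fun s x hx => ?_⟩
  · intro x hx
    obtain ⟨J, hJ, hxJ⟩ := hloc x N
    have h1 : ContDiffAt ℝ ∞ (T J) x :=
      (hTg J hJ).sym.contDiffOn.contDiffAt ((grad0 n hZ).isOpen_dom.mem_nhds hx)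
    refine (h1.congr_of_eventuallyEq ?_).contDiffWithinAt
    exact Filter.eventuallyEq_of_mem ((hΩ J).mem_nhds ⟨hx, hxJ⟩) (hRT J)
  · intro l r
    change List (I0 n) at l
    -- From index K on, the bounds in hb apply to this word and this set, and M - j + 1 ≤ M - N, the
    -- excision having cost one order. The 2 in the final constant is the sum of the geometric
    -- series.
    set K := max (N + 1) (max l.length r) with hK
    have hNK : N + 1 ≤ K := le_max_left _ _
    have hlK : l.length ≤ K := (le_max_left _ _).trans (le_max_right _ _)
    have hrK : r ≤ K := (le_max_right _ _).trans (le_max_right _ _)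
    obtain ⟨C, hC⟩ := (Sym.dw (hTg K (by omega)).sym l).boundedBy r
    refine ⟨C + 2, fun x hx => ?_⟩
    obtain ⟨J, hJ, hxJ⟩ := hloc x K
    have hp := prod_wt_nonneg (hZ := hZ) l x
    have hB := bracket_rpow_nonneg (M - N) x.2.1
    have hsm : ∀ j, ContDiffOn ℝ ∞ (fun x : X0 n => excision (ε j) x.2.1 • v j x)
        (grad0 n hZ).dom := fun j =>
      ((hv j).smul_fun (s0_excision (hε0 j).le (hε1 j))).sym.contDiffOn
    have e1 : Set.EqOn R (fun x => T K x + ∑ j ∈ Finset.Ico K J, excision (ε j) x.2.1 • v j x)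
        ((grad0 n hZ).dom ∩ {x : X0 n | ‖x.2.1‖ < 2 ^ J}) := fun y hy => by
      rw [hRT J hy]
      simp only [hT, Finset.sum_Ico_eq_sub (fun j => excision (ε j) y.2.1 • v j y) hJ]
      abel
    have e2 := dw_eqOn (hΩ J) e1 (l.map (dir0 n)) ⟨hx.1, hxJ⟩
    have e3 := dw_add (grad0 n hZ).isOpen_dom (hTg K (by omega)).sym.contDiffOn
      (ContDiffOn.sum (s := Finset.Ico K J) fun j _ => hsm j) (l.map (dir0 n)) (x := x) hx.1
    have e4 := dw_sum (grad0 n hZ).isOpen_dom (Finset.Ico K J) (fun j _ => hsm j)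
      (l.map (dir0 n)) (x := x) hx.1
    have e5 := e2.trans (e3.trans (congrArg (dw (l.map (dir0 n)) (T K) x + ·) e4))
    change ‖dw (l.map (dir0 n)) R x‖ ≤ (C + 2) *
      (bracket x.2.1 ^ (M - N) * (l.map fun i => (grad0 n hZ).wt i x).prod)
    rw [e5, add_mul]
    have b1 : ‖dw (l.map (dir0 n)) (T K) x‖ ≤
        C * (bracket x.2.1 ^ (M - N) * (l.map fun i => (grad0 n hZ).wt i x).prod) := hC x hx
    have b2 : ‖∑ j ∈ Finset.Ico K J,
        dw (l.map (dir0 n)) (fun x => excision (ε j) x.2.1 • v j x) x‖ ≤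
        2 * (bracket x.2.1 ^ (M - N) * (l.map fun i => (grad0 n hZ).wt i x).prod) := by
      calc _ ≤ ∑ j ∈ Finset.Ico K J, (1 / 2 : ℝ) ^ j *
            (bracket x.2.1 ^ (M - N) * (l.map fun i => (grad0 n hZ).wt i x).prod) := by
            refine (norm_sum_le _ _).trans (Finset.sum_le_sum fun j hj => ?_)
            have hKj := (Finset.mem_Ico.1 hj).1
            refine (hb j l (hlK.trans hKj) r (hrK.trans hKj) x hx).trans ?_
            refine mul_le_mul_of_nonneg_left (mul_le_mul_of_nonneg_right
              (bracket_rpow_le ?_ _) hp) (by positivity)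
            have : ((N + 1 : ℕ) : ℝ) ≤ j := by exact_mod_cast hNK.trans hKj
            push_cast at this
            linarith
        _ ≤ ∑ j ∈ Finset.range J, (1 / 2 : ℝ) ^ j *
            (bracket x.2.1 ^ (M - N) * (l.map fun i => (grad0 n hZ).wt i x).prod) := by
            refine Finset.sum_le_sum_of_subset_of_nonneg (fun j hj => ?_) fun _ _ _ => by positivity
            exact Finset.mem_range.2 (Finset.mem_Ico.1 hj).2
        _ ≤ _ := by
            rw [← Finset.sum_mul]
            gcongr
            exact sum_geometric_two_le J
    exact (norm_add_le _ _).trans (add_le_add b1 b2)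
  · obtain ⟨J, hJ, hxJ⟩ := hloc x N
    have h := fun w => dd_eqOn (hΩ J) (hRT J) w (x := x) ⟨hx, hxJ⟩
    rw [h, h]
    exact (hTg J hJ).hol x hx
  · obtain ⟨J, hJ, hxJ⟩ := hloc x N
    rw [hRT J (x := x) ⟨hx, hxJ⟩, hRT J (x := (s + x.1, x.2)) ⟨hx, hxJ⟩]
    exact (hTg J hJ).eqv s x hx

/-- Finitely many asymptotic series can be summed with the same excision functions. -/
theorem exists_borelSum {κ : Type*} [Finite κ] {M : κ → ℝ} {v : κ → ℕ → X0 n → A}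
    (hv : ∀ i, ∀ j : ℕ, Good α hZ (M i - j) (v i j)) : ∃ ε : ℕ → ℝ, ∀ i, ∀ N : ℕ,
      Good α hZ (M i - N) (fun x => borelSum ε (v i) x - ∑ j ∈ Finset.range N, v i j x) := by
  choose ε h0 h1 h2 using fun j : ℕ => exists_excision_parameter (hZ := hZ)
    (fun i => (hv i j).sym) j (δ := (1 / 2) ^ j) (by positivity)
  exact ⟨ε, fun i N => good_borelSum_sub (hv i) h0 h1 (fun j => h2 j i) N⟩

end Borel

/-! ### The parametrix -/

section Parametrix

variable {n : ℕ} {A : Type*} [CStarAlgebra A] {α : CStarAction n A} {Z : Set ℂ} {hZ : IsOpen Z}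
  {B : Matrix (Fin n) (Fin n) ℝ} {m : ℕ} {f : E n → A} {fh : ℕ → E n → A}

theorem lift_sub_sum (f : E n → A) (fh : ℕ → E n → A) (N : ℕ) :
    lift α (fun ξ => f ξ - ∑ j ∈ Finset.range N, fh j ξ) =
      fun x => lift α f x - ∑ j ∈ Finset.range N, lift α (fh j) x := by
  ext x
  simp [lift]

theorem IsPolyhomogeneous.good_sub_sum {s : ℝ} (hf : IsPolyhomogeneous α s f fh) (N : ℕ) :
    Good α hZ (s - N) (fun x => lift α f x - ∑ j ∈ Finset.range N, lift α (fh j) x) := by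
  rw [← lift_sub_sum]
  exact (hf.2.2 N).good

/-- The definition asks only smoothness and homogeneity of the parts; their symbol estimates follow
because each part is a difference of consecutive remainders. -/
theorem IsPolyhomogeneous.good_part {s : ℝ} (hf : IsPolyhomogeneous α s f fh) (j : ℕ) :
    Good α hZ (s - j) (lift α (fh j)) := by
  have h1 := hf.good_sub_sum (hZ := hZ) j
  have h2 := (hf.good_sub_sum (hZ := hZ) (j + 1)).mono (M' := s - j) (by push_cast; linarith)
  refine (h1.sub h2).congr fun x _ => ?_
  simp only [Finset.sum_range_succ]
  abel

/-- The factor `z^{-m}`. -/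
def negPow (m : ℕ) (z : ℂ) : ℂ := (z ^ m)⁻¹

theorem contDiffOn_negPow (h0 : (0 : ℂ) ∉ Z) (m : ℕ) : ContDiffOn ℝ ∞ (negPow m) Z :=
  ContDiffOn.inv (contDiff_id.pow m).contDiffOn fun _ hz => pow_ne_zero m fun h => h0 (h ▸ hz)

theorem res_zero_eq (h0 : (0 : ℂ) ∉ Z) (p : X0 n → A) :
    Set.EqOn (res m p 0) (fun x => negPow m x.2.2 • res m p m x) (grad0 n hZ).dom := fun x hx => by
  have hz : x.2.2 ≠ 0 := fun h => h0 (h ▸ hx)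
  simp only [res, negPow]
  rw [smul_smul, inv_mul_cancel₀ (pow_ne_zero m hz), one_smul, pow_zero, one_smul]

theorem sub_negPow_mul_res (h0 : (0 : ℂ) ∉ Z) {p : X0 n → A} {x : X0 n} (hx : x.2.2 ∈ Z)
    (hq : IsUnit (x.2.2 ^ m • p x - 1)) :
    (p x - negPow m x.2.2 • 1) * res m p m x = 1 ∧
      res m p m x * (p x - negPow m x.2.2 • 1) = 1 := by
  have hz : x.2.2 ≠ 0 := fun h => h0 (h ▸ hx)
  have e : p x - negPow m x.2.2 • 1 = negPow m x.2.2 • (x.2.2 ^ m • p x - 1) := by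
    rw [smul_sub, smul_smul, negPow, inv_mul_cancel₀ (pow_ne_zero m hz), one_smul]
  rw [e, res, smul_mul_smul_comm, smul_mul_smul_comm, Ring.mul_inverse_cancel _ hq,
    Ring.inverse_mul_cancel _ hq, negPow, inv_mul_cancel₀ (pow_ne_zero m hz),
    mul_inv_cancel₀ (pow_ne_zero m hz), one_smul]
  exact ⟨rfl, rfl⟩

theorem hom_lift {d : ℝ} {F : E n → A} (hF : IsHomogeneous d F) : Hom Z d (lift α F) :=
  fun r hr x _ h1 => by
    rw [dil_apply]
    simp only [lift]
    rw [hF r hr _ h1.le]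
    exact map_smul ((actL α x.1).restrictScalars ℝ) _ _

theorem hom_res_principal {F : E n → A} (hF : IsHomogeneous m F) :
    Hom Z (-m) (res m (lift α (principal m F)) m) := fun r hr x _ h1 => by
  have hr0 : 0 < r := by linarith
  have hrc : (r : ℂ) ≠ 0 := by exact_mod_cast hr0.ne'
  have hle : 1 ≤ ‖r • x.2.1‖ := by
    rw [norm_smul, Real.norm_of_nonneg hr0.le]
    nlinarith
  have e : lift α (principal m F) (dil r x) = ((r : ℂ) ^ m) • lift α (principal m F) x := by
    rw [dil_apply]
    simp only [lift]
    rw [principal_eq hF hle, principal_eq hF h1.le, hF r hr _ h1.le, Real.rpow_natCast,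
      ← Complex.coe_smul, Complex.ofReal_pow, map_smul]
  have e2 : (dil r x).2.2 = (r : ℂ)⁻¹ * x.2.2 := by
    rw [dil_apply]
    simp
  have e3 : ((r ^ (-(m : ℝ)) : ℝ) : ℂ) = ((r : ℂ)⁻¹) ^ m := by
    rw [Real.rpow_neg hr0.le, Real.rpow_natCast]
    push_cast
    rw [inv_pow]
  rw [res, res, e, e2, ← Complex.coe_smul, e3, smul_smul, smul_smul, mul_pow]
  congr 3
  rw [mul_right_comm, ← mul_pow, inv_mul_cancel₀ hrc, one_pow, one_mul]

/-- The parametrix of an elliptic symbol with its homogeneous parts. -/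
structure IsParametrix (α : CStarAction n A) (hZ : IsOpen Z) (B : Matrix (Fin n) (Fin n) ℝ) (m : ℕ)
    (fh : ℕ → E n → A) (g : X0 n → A) (u : ℕ → X0 n → A) : Prop where
  part : ∀ j : ℕ, Good α hZ (-m - j) (u j)
  part_smul : ∀ j : ℕ, Good α hZ (0 - j) (fun x => negPow m x.2.2 • u j x)
  part_smul_smul : ∀ j : ℕ, Good α hZ (m - 1 - j)
    (fun x => negPow m x.2.2 • negPow m x.2.2 • u (j + 1) x)
  rem : ∀ N : ℕ, Good α hZ (-m - N) (fun x => g x - ∑ j ∈ Finset.range N, u j x)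
  rem_smul : ∀ N : ℕ, Good α hZ (0 - N)
    (fun x => negPow m x.2.2 • (g x - ∑ j ∈ Finset.range N, u j x))
  rem_smul_smul : ∀ N : ℕ, Good α hZ (m - 1 - N) (fun x => negPow m x.2.2 • negPow m x.2.2 •
    (g x - u 0 x - ∑ j ∈ Finset.range N, u (j + 1) x))
  hom : ∀ j : ℕ, Hom Z (-m - j) (u j)
  inv : ∀ x : X0 n, x.2.2 ∈ Z →
    (lift α (principal m (fh 0)) x - negPow m x.2.2 • 1) * u 0 x = 1 ∧
      u 0 x * (lift α (principal m (fh 0)) x - negPow m x.2.2 • 1) = 1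
  recursion : ∀ j, 1 ≤ j → ∀ x : X0 n,
    u j x = -(u 0 x * lowerTerm B (fun a => lift α (fh a)) u j x)

/-- The three scales of the statement, weighted by 1, z^{-m} and z^{-2m}, are run in parallel: each
sequence is constructed with its own order from `res` of index m or 0, and only afterwards
identified with a multiple of u_j. -/
theorem exists_isParametrix (hcone : ∀ z ∈ Z, ∀ s : ℝ, 0 < s → s • z ∈ Z) (h0 : (0 : ℂ) ∉ Z)
    (hm : 0 < m) (hf : IsPolyhomogeneous α m f fh)
    (hF0 : ∀ θ, ‖θ‖ = 1 → IsUnit (fh 0 θ))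
    (hFm : ∀ θ, ‖θ‖ = 1 → ∀ z ∈ Z, IsUnit (fh 0 θ - algebraMap ℂ A (z⁻¹ ^ m))) :
    ∃ g u, IsParametrix α hZ B m fh g u := by
  have hF : IsHomogeneous m (fh 0) := by simpa using (hf.2.1 0).2
  have hFc : Continuous (fh 0) := by
    have := ((hf.2.1 0).1.contDiff_tder 0).continuous
    simpa [tder, md_zero, α.act_zero] using this
  have hp : ∀ a : ℕ, Good α hZ (m - a) (lift α (fh a)) := hf.good_part
  have hFg : Good α hZ m (lift α (fh 0)) := by simpa using hp 0
  set p : ℕ → X0 n → A := fun a => lift α (fh a) with hpd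
  set Q : ℕ → X0 n → A := res m (lift α (principal m (fh 0))) with hQd
  have hQ : ∀ k ≤ m, Good α hZ (-k) (Q k) := fun k hk =>
    good_res_principal hcone h0 hm hFc hFg hF hF0 hFm hk
  have hQm := hQ m le_rfl
  have hQ0 : Good α hZ 0 (Q 0) := (hQ 0 (Nat.zero_le m)).of_eq (by simp)
  set u := parts B p (Q m) (Q m) with hu
  -- The innermost factor z^m R is replaced by R, so that G_j = z^{-m}u_j has order -j.
  set G := parts B p (Q m) (Q 0) with hG
  -- The outermost factor is replaced as well. For j ≥ 1 the recursion supplies two distinct factors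
  -- z^m R, whence z^{-2m}u_j has order m - j; u₀ has only one such factor, which is why g - g_{-m}
  -- is treated separately.
  set H : ℕ → X0 n → A := fun j x => -(Q 0 x * lowerTerm B p G (j + 1) x) with hH
  have gu : ∀ j : ℕ, Good α hZ (-m - j) (u j) := Good.parts hp hQm hQm
  have gG : ∀ j : ℕ, Good α hZ (0 - j) (G j) := Good.parts hp hQm hQ0
  have gH : ∀ j : ℕ, Good α hZ (m - 1 - j) (H j) := fun j =>
    (hQ0.mul (Good.lowerTerm (B := B) (M := 0) hp fun i _ => gG i)).neg.of_eq (by push_cast; ring)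
  have hc := contDiffOn_negPow h0 m
  have eQ : Set.EqOn (Q 0) (fun x => negPow m x.2.2 • Q m x) (grad0 n hZ).dom := res_zero_eq h0 _
  have eG : ∀ j, Set.EqOn (G j) (fun x => negPow m x.2.2 • u j x) (grad0 n hZ).dom :=
    parts_smul hc hp hQm hQm eQ
  have eH : ∀ j, Set.EqOn (H j) (fun x => negPow m x.2.2 • negPow m x.2.2 • u (j + 1) x)
      (grad0 n hZ).dom := fun j x hx => by
    have h1 := lowerTerm_smul (B := B) (p := p) hc (j := j + 1) (fun i _ => (gu i).sym.contDiffOn)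
      (fun i _ => eG i) hx
    have h2 : u (j + 1) x = -(Q m x * lowerTerm B p u (j + 1) x) :=
      congrFun (parts_eq p (Q m) (Q m) (Nat.le_add_left 1 j)) x
    simp only [hH]
    rw [h1, eQ hx, h2]
    simp only [smul_mul_smul_comm, smul_smul, smul_neg]
  -- One choice of excision functions for all three series: they do not depend on z, so the three
  -- Borel sums are again multiples of one another.
  have hv : ∀ i : Fin 3, ∀ j : ℕ, Good α hZ ((![-m - 1, -1, m - 1] : Fin 3 → ℝ) i - j)
      ((![fun j => u (j + 1), fun j => G (j + 1), H] : Fin 3 → ℕ → X0 n → A) i j) := fun i j => by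
    fin_cases i
    · exact (gu (j + 1)).of_eq (by simp; ring)
    · exact (gG (j + 1)).of_eq (by simp; ring)
    · exact gH j
  obtain ⟨ε, hε⟩ := exists_borelSum hv
  have r0 : ∀ N : ℕ, Good α hZ (-m - 1 - N) (fun x => borelSum ε (fun j => u (j + 1)) x -
    ∑ j ∈ Finset.range N, u (j + 1) x) := hε 0
  have r1 : ∀ N : ℕ, Good α hZ (-1 - N) (fun x => borelSum ε (fun j => G (j + 1)) x -
    ∑ j ∈ Finset.range N, G (j + 1) x) := hε 1
  have r2 : ∀ N : ℕ, Good α hZ (m - 1 - N) (fun x => borelSum ε H x -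
    ∑ j ∈ Finset.range N, H j x) := hε 2
  clear hε hv
  have s1 : ∀ x ∈ (grad0 n hZ).dom, borelSum ε (fun j => G (j + 1)) x =
      negPow m x.2.2 • borelSum ε (fun j => u (j + 1)) x := fun x hx => by
    rw [← borelSum_smul]
    simp only [borelSum]
    exact tsum_congr fun j => by rw [eG (j + 1) hx]
  have s2 : ∀ x ∈ (grad0 n hZ).dom, borelSum ε H x =
      negPow m x.2.2 • negPow m x.2.2 • borelSum ε (fun j => u (j + 1)) x := fun x hx => by
    rw [← borelSum_smul, ← borelSum_smul]
    simp only [borelSum]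
    exact tsum_congr fun j => by rw [eH j hx]
  -- The leading part is added without excision, so that g - u₀ is exactly the Borel sum of the rest
  -- and inherits the z^{-2m} expansion.
  refine ⟨fun x => u 0 x + borelSum ε (fun j => u (j + 1)) x, u, gu,
    fun j => (gG j).congr (eG j).symm, fun j => (gH j).congr (eH j).symm, fun N => ?_, fun N => ?_,
    fun N => ?_, fun j => ?_, fun x hx => ?_, fun j hj x => ?_⟩
  · cases N with
    | zero =>
      have h1 := (gu 0).add ((r0 0).mono (M' := -m - ((0 : ℕ) : ℝ)) (by simp))
      simpa using h1
    | succ N =>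
      refine ((r0 N).of_eq (by push_cast; ring)).congr fun x _ => ?_
      simp only [Finset.sum_range_succ' _ N]
      abel
  · cases N with
    | zero =>
      have h1 := (gG 0).add ((r1 0).mono (M' := 0 - ((0 : ℕ) : ℝ)) (by simp))
      refine h1.congr fun x hx => ?_
      simp [s1 x hx, eG 0 hx]
    | succ N =>
      refine ((r1 N).of_eq (by push_cast; ring)).congr fun x hx => ?_
      simp only [Finset.sum_range_succ' _ N, s1 x hx, eG _ hx, ← Finset.smul_sum, ← smul_sub]
      congr 1
      abel
  · refine (r2 N).congr fun x hx => ?_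
    simp only [s2 x hx, eH _ hx, ← Finset.smul_sum, ← smul_sub]
    congr 2
    abel
  · have hconic : ∀ r : ℝ, 1 ≤ r → ∀ z ∈ Z, r⁻¹ • z ∈ Z := fun r hr z hz =>
      hcone z hz _ (inv_pos.2 (by linarith))
    exact Hom.parts hconic (fun a => hom_lift (hf.2.1 a).2) (fun a => (hp a).sym.contDiffOn)
      (hom_res_principal hF) (hom_res_principal hF) (fun j => (gu j).sym.contDiffOn) j
  · rw [hu, parts_zero]
    exact sub_negPow_mul_res h0 hx (isUnit_lift_principal hcone h0 hm hF hFm x hx)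
  · have h1 : u 0 = Q m := parts_zero p (Q m) (Q m)
    rw [h1]
    exact congrFun (parts_eq p (Q m) (Q m) hj) x

theorem IsParametrix.good {g : X0 n → A} {u : ℕ → X0 n → A} (h : IsParametrix α hZ B m fh g u) :
    Good α hZ (-m) g := by simpa using h.rem 0

theorem IsParametrix.good_smul {g : X0 n → A} {u : ℕ → X0 n → A}
    (h : IsParametrix α hZ B m fh g u) : Good α hZ 0 (fun x => negPow m x.2.2 • g x) := by
  simpa using h.rem_smul 0

/-- Multiplying the recursion by the inverse of u₀ shows that the terms of order j cancel. -/
theorem IsParametrix.mul_part {g : X0 n → A} {u : ℕ → X0 n → A}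
    (h : IsParametrix α hZ B m fh g u) {j : ℕ} (hj : 1 ≤ j) {x : X0 n} (hx : x.2.2 ∈ Z) :
    lift α (principal m (fh 0)) x * u j x - negPow m x.2.2 • u j x =
      -lowerTerm B (fun a => lift α (fh a)) u j x := by
  have h1 : lift α (principal m (fh 0)) x * u j x - negPow m x.2.2 • u j x =
      (lift α (principal m (fh 0)) x - negPow m x.2.2 • 1) * u j x := by
    rw [sub_mul, smul_mul_assoc, one_mul]
  rw [h1, h.recursion j hj, mul_neg, ← mul_assoc, (h.inv x hx).1, one_mul]

theorem IsParametrix.mul_part_zero {g : X0 n → A} {u : ℕ → X0 n → A}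
    (h : IsParametrix α hZ B m fh g u) {x : X0 n} (hx : x.2.2 ∈ Z) :
    lift α (principal m (fh 0)) x * u 0 x - negPow m x.2.2 • u 0 x = 1 := by
  rw [← (h.inv x hx).1, sub_mul, smul_mul_assoc, one_mul]

/-- The remainder of the composition with the parametrix is of order `-∞`. -/
theorem IsParametrix.good_comp (h0 : (0 : ℂ) ∉ Z) {g : X0 n → A} {u : ℕ → X0 n → A}
    (h : IsParametrix α hZ B m fh g u) (hf : IsPolyhomogeneous α m f fh) (M : ℝ) :
    Good α hZ M (fun x => comp B (lift α f) (fun x => negPow m x.2.2 • g x) (x, 1) -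
      negPow m x.2.2 • negPow m x.2.2 • g x - negPow m x.2.2 • 1) := by
  have hfg : Good α hZ m (lift α f) := hf.1.good
  have hF : IsHomogeneous m (fh 0) := by simpa using (hf.2.1 0).2
  have hp : ∀ a : ℕ, Good α hZ (m - a) (lift α (fh a)) := hf.good_part
  have hFg : Good α hZ m (lift α (fh 0)) := by simpa using hp 0
  have hP := good_principal (hZ := hZ) hFg
  set p : ℕ → X0 n → A := fun a => lift α (fh a) with hpd
  set P := lift α (principal m (fh 0)) with hPd
  set G : ℕ → X0 n → A := fun j x => negPow m x.2.2 • u j x with hG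
  set w : X0 n → A := fun x => comp B (lift α f) (fun x => negPow m x.2.2 • g x) (x, 1) -
      negPow m x.2.2 • negPow m x.2.2 • g x - negPow m x.2.2 • 1 with hw
  have hG0 : Good α hZ 0 (G 0) := by simpa using h.part_smul 0
  have e0 : ∀ x : X0 n, x.2.2 ∈ Z →
      P x * G 0 x = negPow m x.2.2 • negPow m x.2.2 • u 0 x + negPow m x.2.2 • 1 := fun x hx => by
    have := congrArg (fun a => negPow m x.2.2 • a) (h.mul_part_zero hx)
    simp only [smul_sub] at this
    rw [sub_eq_iff_eq_add] at this
    simp only [hG, mul_smul_comm]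
    rw [this, add_comm]
  -- The terms z^{-2m}g and z^{-m}·1 need not satisfy symbol estimates as z → 0. They are regrouped
  -- as PG₀, which equals z^{-2m}u₀ + z^{-m}, plus z^{-2m}(g - u₀). This crude order supplies
  -- holomorphy and equivariance of w; the order is improved afterwards.
  have hwg : Good α hZ m w := by
    have h1 : Good α hZ m (fun x => comp B (lift α f) (fun x => negPow m x.2.2 • g x) (x, 1)) :=
      (Good.comp_one hfg h.good_smul).of_eq (by simp)
    have h2 : Good α hZ m (fun x => P x * G 0 x) := (hP.mul hG0).of_eq (by simp)
    have h3 := (h.rem_smul_smul 0).mono (M' := m) (by simp)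
    refine ((h1.sub h2).sub h3).congr fun x hx => ?_
    simp only [hw, e0 x hx, Finset.range_zero, Finset.sum_empty, sub_zero, smul_sub]
    abel
  refine ⟨?_, hwg.hol, hwg.eqv⟩
  suffices hN : ∀ N : ℕ, S0 hZ (m - (N + 1 : ℕ)) w by
    obtain ⟨N, hN'⟩ := exists_nat_ge (m - M)
    exact (hN N).mono (by push_cast; linarith)
  intro N
  have hGr : ∀ N : ℕ, Good α hZ (0 - N) (fun x => negPow m x.2.2 • g x -
      ∑ i ∈ Finset.range N, G i x) := fun N => by
    simpa only [hG, smul_sub, Finset.smul_sum] using h.rem_smul N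
  have h1 := s0_comp_sub_lowerTerm (B := B) hfg hp hf.good_sub_sum h.good_smul h.part_smul hGr (N + 1)
  -- The expansion contains f_m itself, while the inverse belongs to its modification. The
  -- difference vanishes for |ξ| ≥ 1 and so has every order; the order is chosen to compensate the
  -- -j of G_j.
  have h2 : S0 hZ (m - (N + 1 : ℕ)) (fun x => ∑ j ∈ Finset.range (N + 1), (p 0 x - P x) * G j x) := by
    refine S0.sum _ fun j _ => ?_
    have := (good_sub_principal hFg hF (m - (N + 1 : ℕ) + j)).sym.mul (h.part_smul j).sym
    exact this.of_eq (by ring)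
  have h3 := (h.rem_smul_smul N).sym
  refine ((((h1.of_eq (by ring)).add h2).sub (h3.of_eq (by push_cast; ring)))).congr fun x hx => ?_
  have e1 : ∀ j, lowerTerm B p G (j + 1) x =
      -(P x * G (j + 1) x - negPow m x.2.2 • G (j + 1) x) := fun j => by
    have hl := lowerTerm_smul (B := B) (p := p) (contDiffOn_negPow h0 m) (j := j + 1)
      (fun i _ => (h.part i).sym.contDiffOn) (fun i _ => fun y _ => rfl) hx (P' := G)
    rw [hl]
    have := h.mul_part (Nat.le_add_left 1 j) hx
    simp only [hG, mul_smul_comm, ← smul_sub]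
    rw [this, smul_neg, neg_neg]
  have e2 : lowerTerm B p G 0 x = 0 := by simp [lowerTerm]
  simp only [hw]
  -- The term j = 0 gives z^{-2m}u₀ + z^{-m}; the terms j ≥ 1 give z^{-2m}u_j by the recursion. What
  -- is left beside (p₀ - P)G_j is z^{-m} plus z^{-2m} times a partial sum of g.
  have e3 : ∑ j ∈ Finset.range (N + 1), (lowerTerm B p G j x + p 0 x * G j x) =
      ∑ j ∈ Finset.range (N + 1), (p 0 x - P x) * G j x + negPow m x.2.2 • negPow m x.2.2 • u 0 x +
        negPow m x.2.2 • 1 + negPow m x.2.2 • negPow m x.2.2 • ∑ j ∈ Finset.range N, u (j + 1) x := by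
    rw [Finset.sum_range_succ', Finset.sum_range_succ' _ N, e2, zero_add, sub_mul, e0 x hx,
      Finset.smul_sum, Finset.smul_sum]
    have e4 : ∑ k ∈ Finset.range N, (lowerTerm B p G (k + 1) x + p 0 x * G (k + 1) x) =
        ∑ k ∈ Finset.range N, (p 0 x - P x) * G (k + 1) x +
          ∑ k ∈ Finset.range N, negPow m x.2.2 • negPow m x.2.2 • u (k + 1) x := by
      rw [← Finset.sum_add_distrib]
      refine Finset.sum_congr rfl fun k _ => ?_
      rw [e1, sub_mul]
      simp only [hG]
      abel
    rw [e4]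
    abel
  rw [e3]
  simp only [smul_sub]
  abel

theorem comp_smul {m M : ℝ} {f G : X0 n → A} (hf : S0 hZ m f) (hG : S0 hZ M G) (c : ℂ → ℂ) {x : X0 n}
    (hx : x.2.2 ∈ Z) :
    comp B f (fun x => c x.2.2 • G x) (x, 1) = c x.2.2 • comp B f G (x, 1) := by
  have h := (amp_compAmp (B := B) hf hG
    (show ((x, (1 : ℝ)) : X0 n × ℝ) ∈ (gradS n hZ).dom from hx)).hasOsc.const_smul (c x.2.2)
  refine Eq.trans ?_ h.osc_eq
  simp only [comp]
  congr 1
  ext p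
  simp [compAmp, shiftY]

theorem HasOsc.hasOscIntegral {a : E n → E n → A} {v : A}
    (h : HasOsc (fun p : E n × E n => a p.1 p.2) v) : HasOscIntegral a v := fun χ hχ => by
  have := h χ
  rw [hχ, one_smul] at this
  exact this

/-- The composition of a constant with G is the case s = 0 with left factor 1; this handles the term
-μ^m of f - μ^m. -/
theorem hasOsc_shift {M : ℝ} {G : X0 n → A} (hG : S0 hZ M G) {x : X0 n} (hx : x.2.2 ∈ Z) :
    HasOsc (fun p : E n × E n => G (x.1 - p.1, x.2.1 + matCLM B p.1, x.2.2)) (G x) := by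
  have h1 := (amp_compAmp (B := B) (S0.const le_rfl (1 : A)) hG
    (show ((x, (0 : ℝ)) : X0 n × ℝ) ∈ (gradS n hZ).dom from hx)).hasOsc
  have h2 := comp_zero (B := B) (f := fun _ => 1) hG (x := x) hx
  rw [comp, one_mul] at h2
  rw [h2] at h1
  simpa only [compAmp, one_mul, shiftY] using h1

/-- The composition of `f - c` with an equivariant symbol. -/
theorem isComposition_sub {s M : ℝ} (hf : Good α hZ s (lift α f)) {g : X0 n → A} (hg : Good α hZ M g)
    (c : ℂ) {z : ℂ} (hz : z ∈ Z) :
    IsComposition α B (fun ξ => f ξ - algebraMap ℂ A c) (fun ξ => g (0, ξ, z))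
      (fun ξ => comp B (lift α f) g ((0, ξ, z), 1) - c • g (0, ξ, z)) := fun ξ => by
  have h1 := (amp_compAmp (B := B) hf.sym hg.sym
    (show (((0, ξ, z), (1 : ℝ)) : X0 n × ℝ) ∈ (gradS n hZ).dom from hz)).hasOsc
  have h2 := (hasOsc_shift (B := B) hg.sym (x := (0, ξ, z)) hz).const_smul (-c)
  have h3 := h1.add h2
  refine HasOsc.hasOscIntegral ?_
  simp only
  rw [sub_eq_add_neg (comp B (lift α f) g ((0, ξ, z), 1)), ← neg_smul]
  refine (congrArg (fun a => HasOsc a _) (funext fun p => ?_)).mpr h3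
  rw [hg.act_eq _ _ hz, ← matCLM_apply, Algebra.algebraMap_eq_smul_one, sub_mul, smul_mul_assoc,
    one_mul]
  simp [compAmp, shiftEta, shiftY, lift, α.act_zero, sub_eq_add_neg, add_comm]

end Parametrix

/-! ### Translation of the parametrix into the terms of the statement. -/

section Translation

variable {n : ℕ} {A : Type*} [CStarAlgebra A] {α : CStarAction n A} {Z : Set ℂ} {hZ : IsOpen Z}
  {B : Matrix (Fin n) (Fin n) ℝ} {m : ℕ} {fh : ℕ → E n → A}

/-- The signs agree because δ^τ carries i^{-|τ|}, and (-i)^{|τ|} i^{-|τ|} = (-1)^{|τ|} is the sign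
of the derivatives of α_{-x}. -/
theorem tw_eq_twistedPart {M : ℝ} {P : ℕ → X0 n → A} (hP : ∀ i : ℕ, Good α hZ (M - i) (P i))
    (σ : Fin n → ℕ) (l : ℕ) (ξ : E n) {z : ℂ} (hz : z ∈ Z) :
    tw B σ P l (0, ξ, z) = twistedPart α B σ (fun i ζ => P i (0, ζ, z)) l ξ := by
  rw [tw, twistedPart]
  refine Finset.sum_congr rfl fun γ _ => ?_
  have h1 : pderivB B γ (fun ζ => P (l - len γ) (0, ζ, z)) ξ =
      md (Bdir B) γ (P (l - len γ)) (0, ξ, z) :=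
    (hP (l - len γ)).multiDeriv_eq (fun j => matApply B (stdVec n j)) γ ξ hz
  rw [h1, ((hP (l - len γ)).md_Bdir γ).delta_eq (σ - γ) ξ hz, smul_smul, smul_smul]
  congr 1
  rw [mul_assoc, ← inv_pow, ← mul_pow, neg_mul, mul_inv_cancel₀ Complex.I_ne_zero]

theorem md_xdir_lift {s : ℝ} {F : E n → A} (hF : Good α hZ s (lift α F)) (σ : Fin n → ℕ) (ξ : E n)
    {z : ℂ} (hz : z ∈ Z) : md xdir σ (lift α F) (0, ξ, z) = pderiv σ F ξ := by
  have h := hF.multiDeriv_eq (stdVec n) σ ξ hz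
  simp only [lift, α.act_zero] at h
  exact h.symm

theorem IsParametrix.part_eq {g : X0 n → A} {u : ℕ → X0 n → A} (h : IsParametrix α hZ B m fh g u)
    (hp : ∀ a : ℕ, Good α hZ (m - a) (lift α (fh a))) {j : ℕ} (hj : 1 ≤ j) (ξ : E n) {z : ℂ}
    (hz : z ∈ Z) :
    u j (0, ξ, z) = -∑ l ∈ Finset.range j, ∑ q ∈ Finset.HasAntidiagonal.antidiagonal (j - l),
      ∑ σ ∈ Finset.piAntidiag (Finset.univ : Finset (Fin n)) q.2,
        ((-Complex.I) ^ len σ / (multiFactorial σ : ℂ)) •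
          (u 0 (0, ξ, z) * pderiv σ (fh q.1) ξ *
            twistedPart α B σ (fun i ζ => u i (0, ζ, z)) l ξ) := by
  rw [h.recursion j hj, lowerTerm]
  simp only [Finset.mul_sum, tripleTerm, mul_smul_comm, tw_eq_twistedPart h.part _ _ _ hz,
    md_xdir_lift (hp _) _ _ hz, mul_assoc]

theorem IsParametrix.isWeakHomogeneous {Γ : Set ℂ} (hΓ : ∀ z, z ∈ Z ↔ z⁻¹ ∈ Γ)
    (hcone : ∀ z ∈ Z, ∀ s : ℝ, 0 < s → s • z ∈ Z)
    {g : X0 n → A} {u : ℕ → X0 n → A} (h : IsParametrix α hZ B m fh g u) (j : ℕ) :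
    IsWeakHomogeneous Γ (-m - j) (fun ξ μ => u j (0, ξ, μ⁻¹)) := fun t ht ξ hξ μ hμ => by
  have hz : μ⁻¹ ∈ Z := (hΓ _).2 (by simpa using hμ)
  have h1 := (h.hom j).of_le (fun r hr z hz => hcone z hz _ (inv_pos.2 (by linarith)))
    (h.part j).sym.contDiffOn.continuousOn ht (x := (0, ξ, μ⁻¹)) hz hξ
  rw [← h1, dil_apply]
  simp [mul_comm]

theorem InvertibleInSmooth.isUnit {a : A} (h : InvertibleInSmooth α a) : IsUnit a := by
  obtain ⟨b, -, h1, h2⟩ := h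
  exact ⟨⟨a, b, h1, h2⟩, rfl⟩

end Translation

end TwistedCalculus

end

/-! ### Proof of the theorem. -/

theorem mainTheorem3 {n : ℕ} {A : Type*} [CStarAlgebra A] (α : CStarAction n A)
    (B : Matrix (Fin n) (Fin n) ℝ) (hB : B.transpose = -B)
    (a b : ℝ) (hab : a < b) (hab' : b ≤ a + 2 * Real.pi)
    (m : ℕ) (hm : 0 < m) (f : E n → A) (fh : ℕ → E n → A)
    (hf : IsPolyhomogeneous α m f fh)
    (hell : IsEllipticWithParameter α (openSector a b) m (fh 0)) :
    ∃ (g : E n → ℂ → A) (gh : ℕ → E n → ℂ → A),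
      IsWeaklyPolyhomogeneous α (openSector a b) (-m) 0 g gh ∧
      IsWeaklyPolyhomogeneous α (openSector a b) (-m) (-m) g gh ∧
      HasWeakExpansion α (openSector a b) (-m) 0 g gh ∧
      HasWeakExpansion α (openSector a b) 0 (-m) g gh ∧
      HasWeakExpansion α (openSector a b) (-m - 1) 0
        (fun ξ μ => g ξ μ - gh 0 ξ μ) (fun j => gh (j + 1)) ∧
      HasWeakExpansion α (openSector a b) (m - 1) (-2 * m)
        (fun ξ μ => g ξ μ - gh 0 ξ μ) (fun j => gh (j + 1)) ∧
      (∀ ξ : E n, 1 ≤ ‖ξ‖ → ∀ μ ∈ openSector a b,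
        (fh 0 ξ - algebraMap ℂ A (μ ^ m)) * gh 0 ξ μ = 1 ∧
        gh 0 ξ μ * (fh 0 ξ - algebraMap ℂ A (μ ^ m)) = 1) ∧
      (∀ j : ℕ, 1 ≤ j → ∀ ξ : E n, ∀ μ ∈ openSector a b,
        gh j ξ μ = -∑ l ∈ Finset.range j, ∑ q ∈ Finset.HasAntidiagonal.antidiagonal (j - l),
          ∑ σ ∈ Finset.piAntidiag (Finset.univ : Finset (Fin n)) q.2,
            ((-Complex.I) ^ len σ / (multiFactorial σ : ℂ)) •
              (gh 0 ξ μ * pderiv σ (fh q.1) ξ *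
                twistedPart α B σ (fun i ζ => gh i ζ μ) l ξ)) ∧
      ∃ h : E n → ℂ → A,
        (∀ μ ∈ openSector a b,
          IsComposition α B (fun ξ => f ξ - algebraMap ℂ A (μ ^ m)) (fun ξ => g ξ μ)
            (fun ξ => h ξ μ)) ∧
        ∀ M : ℝ, IsWeakSymbol α (openSector a b) M (-m) (fun ξ μ => h ξ μ - 1) := by
  have hZ := isOpen_openSector (-b) (-a)
  have hΓ : ∀ z, z ∈ openSector (-b) (-a) ↔ z⁻¹ ∈ openSector a b := fun z => inv_mem_openSector.symm
  have h0 := zero_notMem_openSector (-b) (-a)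
  have hcone : ∀ z ∈ openSector (-b) (-a), ∀ s : ℝ, 0 < s → s • z ∈ openSector (-b) (-a) :=
    fun z hz s hs => smul_mem_openSector hz hs
  obtain ⟨g, u, h⟩ := exists_isParametrix (hZ := hZ) (B := B) hcone h0 hm hf
    (fun θ hθ => (hell.1 θ hθ).isUnit) (fun θ hθ z hz => (hell.2 θ hθ _ ((hΓ z).1 hz)).isUnit)
  -- Every membership in the statement reduces to an identity at t = 0 between z^d F(ξ, 1/z) and a
  -- function already known to be `Good`.
  have weak : ∀ {M : ℝ} {d : ℤ} {v : X0 n → A} {F : E n → ℂ → A}, Good α hZ M v →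
      (∀ ξ, ∀ z ∈ openSector (-b) (-a), z ^ d • F ξ z⁻¹ = v (0, ξ, z)) →
      IsWeakSymbol α (openSector a b) M d F := fun hv hF =>
    hv.isWeakSymbol (zero_notMem_openSector a b) hΓ (fun _ _ => exists_coneBdd_of_closedSector) hF
  have z0 : ∀ (z : ℂ) (c : A), z ^ (0 : ℤ) • c = c := fun z c => by simp
  have z1 : ∀ (z : ℂ) (c : A), z ^ (-(m : ℤ)) • c = negPow m z • c := fun z c => by
    rw [zpow_neg, zpow_natCast, negPow]
  have z2 : ∀ (z : ℂ) (c : A), z ^ (-2 * (m : ℤ)) • c = negPow m z • negPow m z • c := fun z c => by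
    have : z ^ (-2 * (m : ℤ)) = (z ^ (2 * m))⁻¹ := by
      rw [neg_mul, zpow_neg]
      norm_cast
    rw [this, smul_smul, negPow, two_mul, pow_add, mul_inv]
  have hinv : ∀ μ ∈ openSector a b, μ⁻¹ ∈ openSector (-b) (-a) := fun μ hμ =>
    (hΓ _).2 (by simpa using hμ)
  set G : E n → ℂ → A := fun ξ μ => g (0, ξ, μ⁻¹) with hG
  set U : ℕ → E n → ℂ → A := fun j ξ μ => u j (0, ξ, μ⁻¹) with hU
  have x1 : HasWeakExpansion α (openSector a b) (-m) 0 G U :=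
    ⟨weak h.good fun ξ z _ => by simp [hG], fun j => weak (h.part j) fun ξ z _ => by simp [hU],
      fun N => weak (h.rem N) fun ξ z _ => by simp [hG, hU]⟩
  have x2 : HasWeakExpansion α (openSector a b) 0 (-m) G U :=
    ⟨weak h.good_smul fun ξ z _ => by simp only [hG, z1, inv_inv],
      fun j => weak (h.part_smul j) fun ξ z _ => by simp only [hU, z1, inv_inv],
      fun N => weak (h.rem_smul N) fun ξ z _ => by simp only [hG, hU, z1, inv_inv]⟩
  have hhom : ∀ j : ℕ, IsWeakHomogeneous (openSector a b) (-m - j) (U j) :=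
    h.isWeakHomogeneous hΓ hcone
  refine ⟨G, U, ⟨by simpa using x1, hhom⟩, ⟨by simpa using x2, hhom⟩, x1, x2, ⟨?_, ?_, ?_⟩,
    ⟨?_, ?_, ?_⟩, fun ξ hξ μ hμ => ?_, fun j hj ξ μ hμ => ?_,
    fun ξ μ => comp B (lift α f) g ((0, ξ, μ⁻¹), 1) - μ ^ m • G ξ μ, fun μ hμ => ?_, fun M => ?_⟩
  · exact weak ((h.rem 1).of_eq (by simp)) fun ξ z _ => by simp [hG, hU]
  · exact fun j => weak ((h.part (j + 1)).of_eq (by push_cast; ring)) fun ξ z _ => by simp [hU]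
  -- For g - g_{-m} the index is shifted by one: its N-term remainder is the (N+1)-term remainder of
  -- g.
  · refine fun N => weak ((h.rem (N + 1)).of_eq (by push_cast; ring)) fun ξ z _ => ?_
    simp only [hG, hU, z0, inv_inv, Finset.sum_range_succ' _ N]
    abel
  · exact weak ((h.rem_smul_smul 0).of_eq (by simp)) fun ξ z _ => by
      simp only [hG, hU, z2, inv_inv, Finset.range_zero, Finset.sum_empty, sub_zero]
  · exact fun j => weak (h.part_smul_smul j) fun ξ z _ => by simp only [hU, z2, inv_inv]
  · exact fun N => weak (h.rem_smul_smul N) fun ξ z _ => by simp only [hG, hU, z2, inv_inv]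
  · have h1 := h.inv (0, ξ, μ⁻¹) (hinv μ hμ)
    have hF : IsHomogeneous m (fh 0) := by simpa using (hf.2.1 0).2
    simpa [lift, α.act_zero, principal_eq hF hξ, negPow, Algebra.algebraMap_eq_smul_one] using h1
  · exact h.part_eq hf.good_part hj ξ (hinv μ hμ)
  · exact isComposition_sub hf.1.good h.good (μ ^ m) (hinv μ hμ)
  -- Here d = -m: the factor z^{-m} moves inside the right factor of the composition, which gives
  -- the form treated by `good_comp`.
  · refine weak (h.good_comp h0 hf M) fun ξ z hz => ?_
    have h2 := comp_smul (B := B) hf.1.good.sym h.good.sym (negPow m) (x := (0, ξ, z)) hz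
    simp only [hG, z1, inv_inv, h2, smul_sub, inv_pow]
    rfl
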